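/- **Setting.** For a measurable function $\hat\phi:\mathbb R\to\mathbb R$ and $a\ge 0$ let $I_a=\int_0^\infty \hat\phi(r)^2 r^a\,dr$. Write $W_l(v)=(1+|v|^2)^{l/2}$, $\|f\|_{L^2_l}=\|W_lf\|_{L^2(\mathbb R^3)}$, $\|f\|_{H^N_l}=\sum_{|\alpha|\le N}\|\partial^\alpha f\|_{L^2_l}$ (weak derivatives), $H^N=H^N_0$. For $0<\varepsilon\le 1$ define $$Q_1(g,h)(v)=\int_{\mathbb R^3}\int_{\sigma\in\mathbb S^2,\ (v-v_*)\cdot\sigma\ge 0} \varepsilon^{-4}|v-v_*|\,\hat\phi^2\!\left(\varepsilon^{-1}|v-v_*|\sin\tfrac{\theta}{2}\right)\big(g(v_*')h(v')-g(v_*)h(v)\big)\,d\sigma\,dv_*,$$ where $\theta\in[0,\pi/2]$ is the angle between $v-v_*$ and $\sigma$, $v'=\frac{v+v_*}{2}+\frac{|v-v_*|}{2}\sigma$ and $v'_*=\frac{v+v_*}{2}-\frac{|v-v_*|}{2}\sigma$. The Landau operator is $$Q_L(g,h)(v)=\nabla\cdot\int_{\mathbb R^3}a(v-v_*)\{g(v_*)\nabla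 h(v)-\nabla g(v_*)h(v)\}\,dv_*,\qquad a_{ij}(z)=2\pi I_3|z|^{-1}\Big(\delta_{ij}-\frac{z_iz_j}{|z|^2}\Big),$$ with the divergence taken in the sense of distributions. **Lemma.** For every $l\ge 0$ there is a constant $C_l>0$, depending only on $l$, such that for all $\vartheta\in(0,1]$, all $\varepsilon\in(0,1]$, all $\hat\phi$ with $I_0+I_3+I_{3+\vartheta}<\infty$, and all real-valued $g\in H^3_{l+5}$, $h\in H^3_{l+3}$: the integral defining $Q_1(g,h)(v)$ converges absolutely for almost every $v$; the integral in the definition of $Q_L(g,h)$ converges absolutely for almost every $v$, and it and its distributional divergence $Q_L(g,h)$ are locally integrable functions; and $$\|Q_1(g,h)-Q_L(g,h)\|_{L^2_l}\le C_l\,\varepsilon^{\vartheta} I_{3+\vartheta}\left(\|g\|_{H^3_{l+5}}\|h\|_{H^3}+\|g\|_{H^3_2}\|h\|_{H^3_{l+3}}\right).$$ -/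

import Mathlib

open MeasureTheory Set
open scoped ContDiff ENNReal

noncomputable section

/-- The velocity space `ℝ³` with its Euclidean norm. -/
abbrev Vel : Type := EuclideanSpace ℝ (Fin 3)

/-! ### Weighted Sobolev spaces -/

/-- The weight `W_l(v) = (1 + |v|²)^{l/2}`. -/
def weightW (l : ℝ) (v : Vel) : ℝ := (1 + ‖v‖ ^ 2) ^ (l / 2)

/-- The weighted norm `‖f‖_{L²_l} = ‖W_l f‖_{L²}`. -/
def normL2 (l : ℝ) (f : Vel → ℝ) : ℝ≥0∞ :=
  eLpNorm (fun v => weightW l v * f v) 2 volume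

/-- The classical partial derivative `∂_i f`. -/
def partialD (i : Fin 3) (f : Vel → ℝ) : Vel → ℝ :=
  fun x => fderiv ℝ f x (EuclideanSpace.single i 1)

/-- The classical partial derivative `∂^α f` for a multi-index `α ∈ ℕ³`
(used only for smooth `f`, so that the order of differentiation is immaterial). -/
def partialMulti (α : Fin 3 → ℕ) (f : Vel → ℝ) : Vel → ℝ :=
  (partialD 0)^[α 0] ((partialD 1)^[α 1] ((partialD 2)^[α 2] f))

/-- `F` is the weak (distributional) derivative `∂^α f` on `ℝ³`. -/
def IsWeakPartial (α : Fin 3 → ℕ) (f F : Vel → ℝ) : Prop :=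
  LocallyIntegrable f volume ∧ LocallyIntegrable F volume ∧
    ∀ ψ : Vel → ℝ, ContDiff ℝ ∞ ψ → HasCompactSupport ψ →
      ∫ x, f x * partialMulti α ψ x = (-1) ^ (∑ i, α i) * ∫ x, F x * ψ x

open Classical in
/-- The weak derivative `∂^α f`, which is unique up to null sets
(the value is `0` if there is none). -/
def weakPartial (α : Fin 3 → ℕ) (f : Vel → ℝ) : Vel → ℝ :=
  if h : ∃ F, IsWeakPartial α f F then h.choose else 0

/-- The multi-indices `α ∈ ℕ³` with `|α| ≤ N`. -/
def multiIndices (N : ℕ) : Finset (Fin 3 → ℕ) :=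
  (Fintype.piFinset fun _ : Fin 3 => Finset.range (N + 1)).filter fun α => ∑ i, α i ≤ N

/-- Membership `f ∈ H^N_l`: all weak derivatives up to order `N` exist and lie in `L²_l`. -/
def MemH (N : ℕ) (l : ℝ) (f : Vel → ℝ) : Prop :=
  ∀ α ∈ multiIndices N, ∃ F, IsWeakPartial α f F ∧
    MemLp (fun v => weightW l v * F v) 2 volume

/-- The norm `‖f‖_{H^N_l} = ∑_{|α| ≤ N} ‖∂^α f‖_{L²_l}` of `f ∈ H^N_l`. -/
def normH (N : ℕ) (l : ℝ) (f : Vel → ℝ) : ℝ≥0∞ :=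
  ∑ α ∈ multiIndices N, normL2 l (weakPartial α f)

/-! ### The potential -/

/-- `I_a = ∫₀^∞ φ̂(r)² r^a dr`. -/
def momentI (phiHat : ℝ → ℝ) (a : ℝ) : ℝ :=
  ∫ r in Ioi (0 : ℝ), phiHat r ^ 2 * r ^ a

/-- `I_a < ∞`. -/
def FiniteMomentI (phiHat : ℝ → ℝ) (a : ℝ) : Prop :=
  IntegrableOn (fun r : ℝ => phiHat r ^ 2 * r ^ a) (Ioi 0) volume

/-! ### The operator `Q₁` -/

/-- `v' = (v + v_*)/2 + |v - v_*|/2 σ`. -/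
def postV (v w σ : Vel) : Vel := (1 / 2 : ℝ) • (v + w) + (‖v - w‖ / 2) • σ

/-- `v'_* = (v + v_*)/2 - |v - v_*|/2 σ`. -/
def postVStar (v w σ : Vel) : Vel := (1 / 2 : ℝ) • (v + w) - (‖v - w‖ / 2) • σ

/-- `B₁^ε = ε⁻⁴ ρ φ̂(ε⁻¹ ρ sin(θ/2))²`, where `ρ = |v - v_*|`. -/
def kernelB1 (phiHat : ℝ → ℝ) (ε ρ θ : ℝ) : ℝ :=
  ε⁻¹ ^ 4 * ρ * phiHat (ε⁻¹ * ρ * Real.sin (θ / 2)) ^ 2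

/-- The measure `dv_* dσ` on the set of `(v_*, σ) ∈ ℝ³ × 𝕊²` with `θ ∈ [0, π/2]`, that is
`(v - v_*) · σ ≥ 0`; here `dσ` is the surface measure of the unit sphere. -/
def collisionMeasure (v : Vel) : Measure (Vel × Metric.sphere (0 : Vel) 1) :=
  ((volume : Measure Vel).prod (volume : Measure Vel).toSphere).restrict
    {p | 0 ≤ inner ℝ (v - p.1) (p.2 : Vel)}

/-- The integrand `B₁^ε (g'_* h' - g_* h)`, where `θ` is the angle between `v - v_*` and `σ`. -/
def integrandQ1 (phiHat : ℝ → ℝ) (ε : ℝ) (g h : Vel → ℝ) (v : Vel)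
    (p : Vel × Metric.sphere (0 : Vel) 1) : ℝ :=
  kernelB1 phiHat ε ‖v - p.1‖ (InnerProductGeometry.angle (v - p.1) (p.2 : Vel)) *
    (g (postVStar v p.1 p.2) * h (postV v p.1 p.2) - g p.1 * h v)

/-- `Q₁(g,h)(v) = ∫ B₁^ε (g'_* h' - g_* h) dσ dv_*`. -/
def opQ1 (phiHat : ℝ → ℝ) (ε : ℝ) (g h : Vel → ℝ) (v : Vel) : ℝ :=
  ∫ p, integrandQ1 phiHat ε g h v p ∂(collisionMeasure v)

/-! ### The Landau operator -/

/-- `a_{ij}(z) = 2π I₃ |z|⁻¹ (δ_{ij} - z_i z_j / |z|²)`. -/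
def landauA (phiHat : ℝ → ℝ) (z : Vel) (i j : Fin 3) : ℝ :=
  2 * Real.pi * momentI phiHat 3 * ‖z‖⁻¹ *
    ((if i = j then 1 else 0) - z i * z j / ‖z‖ ^ 2)

/-- The weak first order derivative `∂_i f`. -/
def weakGrad (f : Vel → ℝ) (i : Fin 3) : Vel → ℝ := weakPartial (Pi.single i 1) f

/-- The integrand `a(v - v_*) (g(v_*) ∇h(v) - ∇g(v_*) h(v))`, `i`-th component. -/
def landauIntegrand (phiHat : ℝ → ℝ) (g h : Vel → ℝ) (i : Fin 3) (v w : Vel) : ℝ :=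
  ∑ j, landauA phiHat (v - w) i j * (g w * weakGrad h j v - weakGrad g j w * h v)

/-- The vector field `∫ a(v - v_*) (g(v_*) ∇h(v) - ∇g(v_*) h(v)) dv_*`, `i`-th component. -/
def landauFlux (phiHat : ℝ → ℝ) (g h : Vel → ℝ) (i : Fin 3) (v : Vel) : ℝ :=
  ∫ w, landauIntegrand phiHat g h i v w

/-- `q` is the weak (distributional) divergence `∇ · J` on `ℝ³`. -/
def IsWeakDiv (J : Fin 3 → Vel → ℝ) (q : Vel → ℝ) : Prop :=
  (∀ i, LocallyIntegrable (J i) volume) ∧ LocallyIntegrable q volume ∧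
    ∀ ψ : Vel → ℝ, ContDiff ℝ ∞ ψ → HasCompactSupport ψ →
      ∫ x, ∑ i, J i x * partialD i ψ x = -∫ x, q x * ψ x

open Classical in
/-- The weak divergence of `J`, which is unique up to null sets
(the value is `0` if there is none). -/
def weakDiv (J : Fin 3 → Vel → ℝ) : Vel → ℝ :=
  if h : ∃ q, IsWeakDiv J q then h.choose else 0

/-- `Q_L(g,h) = ∇ · ∫ a(v - v_*) (g(v_*) ∇h(v) - ∇g(v_*) h(v)) dv_*`. -/
def opQL (phiHat : ℝ → ℝ) (g h : Vel → ℝ) : Vel → ℝ :=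
  weakDiv (landauFlux phiHat g h)

end

/-!
Write `z = v - v_*` and let `k = v' - v = (|z| σ - z) / 2` be the momentum transfer, so that
`v'_* = v - z - k` and `v' = v + k`. The operator `Q₁` integrates the kernel against
`g(v - z - k) h(v + k) - g(v - z) h(v)`, which is expanded in `k` to second order.

*Leading part.* The first and second moments of `k` under the kernel follow from the symmetry about
the axis `z`. With `b_i = ∑_j ∂_j a_{ij}`, the first moment is `2 b` and half of the second moment is
`a`, up to the part of `I₃` that lies beyond the largest angle `π / 2` and up to the fourth moment of
`sin (θ / 2)` (`driftK_eq`, `half_diffK_eq`); both errors are `O(ε ^ θ I_{3+θ})`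
(`abs_drift_error_le`, `abs_diffusion_error_le`). Integration by parts
(`IsJet.ae_landau_by_parts`) turns the terms with `b` into second-order terms, and the sum is the
Landau operator in the form `∑ a_{ij} * g ∂_{ij} h - ∑ (a_{ij} * ∂_{ij} g) h`, which is the weak
divergence of the flux (`WeightedJets.isWeakDiv_jetFlux`).

*Remainder.* It is bounded by `|k| ^ 3` and, for `|k| ≥ 1`, by `|k| ^ 2`, hence by `|k| ^ (2 + θ)`
(`WeightedJets.ae_taylorRem_le`). The moment of order `2 + θ` of `k` is at most a constant times
`ε ^ θ I_{3+θ} |z|⁻¹` (`lintegral_collB_moment_le`).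

*Norms.* All error terms are integrals, over `z` and over intermediate points, of products of
derivatives of `g` and `h` of total order at most three. One of the factors carries at most one
derivative, and is bounded by the weighted Sobolev embedding `H³ ⊂ W^{1,∞}` (`IsJet.ae_weighted_le`).
Because angles do not exceed `π / 2`, the points at which the factors are evaluated control both `v`
and `z`, so that three additional weights yield the decay `⟨z⟩⁻³`, which makes the kernel
`|z|⁻¹ + |z|⁻²` integrable (`WeightedJets.l2_jetPair_le`, `WeightedJets.l2_lintegral_jetPair_le`).
The drift error `|z| ^ (-(2 + θ))` is too singular for this at `θ = 1`. It is odd, however, so near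
the origin `g(v)` may be subtracted from `g(v - z)`, which gains a factor `|z|` at the cost of one
derivative (`WeightedJets.l2_pairInt_odd_le`).

*Weak derivatives.* Functions are replaced by jets, that is, by measurable representatives of their
weak derivatives. Taylor's formula, the Sobolev bound and the integration by parts are linear
translation-invariant identities. They are proved for test functions, and carry over to jets almost
everywhere by duality (`ae_sum_integral_eq_zero_of_test`).
-/

noncomputable section

/-! ### Test functions and multi-indices -/

/-- Test functions: smooth functions of compact support. -/
def IsTest (ψ : Vel → ℝ) : Prop := ContDiff ℝ ∞ ψ ∧ HasCompactSupport ψ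

theorem contDiff_partialD {ψ : Vel → ℝ} (h : ContDiff ℝ ∞ ψ) (i : Fin 3) :
    ContDiff ℝ ∞ (partialD i ψ) := by
  unfold partialD
  exact (h.fderiv_right (m := ∞) (by simp)).clm_apply contDiff_const

theorem IsTest.partialD {ψ : Vel → ℝ} (h : IsTest ψ) (i : Fin 3) : IsTest (partialD i ψ) :=
  ⟨contDiff_partialD h.1 i, h.2.fderiv_apply (𝕜 := ℝ) _⟩

theorem IsTest.iterate_partialD {ψ : Vel → ℝ} (h : IsTest ψ) (i : Fin 3) (n : ℕ) :
    IsTest ((_root_.partialD i)^[n] ψ) := by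
  induction n with
  | zero => exact h
  | succ n ih => rw [Function.iterate_succ_apply']; exact ih.partialD i

theorem IsTest.partialMulti {ψ : Vel → ℝ} (h : IsTest ψ) (α : Fin 3 → ℕ) :
    IsTest (partialMulti α ψ) :=
  ((h.iterate_partialD 2 _).iterate_partialD 1 _).iterate_partialD 0 _

theorem contDiff_iterate_partialD {ψ : Vel → ℝ} (h : ContDiff ℝ ∞ ψ) (i : Fin 3) (n : ℕ) :
    ContDiff ℝ ∞ ((partialD i)^[n] ψ) := by
  induction n with
  | zero => exact h
  | succ n ih => rw [Function.iterate_succ_apply']; exact contDiff_partialD ih i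

theorem partialD_comm {ψ : Vel → ℝ} (h : ContDiff ℝ ∞ ψ) (i j : Fin 3) :
    partialD i (partialD j ψ) = partialD j (partialD i ψ) := by
  ext x
  have h1 : ∀ a : Vel, fderiv ℝ (fun y => fderiv ℝ ψ y a) x = (fderiv ℝ (fderiv ℝ ψ) x).flip a := by
    intro a
    have hd : DifferentiableAt ℝ (fderiv ℝ ψ) x :=
      (h.fderiv_right (m := ∞) (by simp)).differentiable (by simp) x
    ext b
    rw [fderiv_clm_apply hd (differentiableAt_const a)]
    simp
  have hs : IsSymmSndFDerivAt ℝ ψ x := (h.contDiffAt).isSymmSndFDerivAt (by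
    simp only [minSmoothness_of_isRCLikeNormedField]
    exact WithTop.coe_le_coe.2 (le_top : (2 : ℕ∞) ≤ ⊤))
  unfold partialD
  rw [h1, h1]
  exact hs.eq _ _

theorem partialD_iterate_comm {ψ : Vel → ℝ} (h : ContDiff ℝ ∞ ψ) (i j : Fin 3) (n : ℕ) :
    partialD i ((partialD j)^[n] ψ) = (partialD j)^[n] (partialD i ψ) := by
  induction n with
  | zero => rfl
  | succ n ih =>
    rw [Function.iterate_succ_apply', Function.iterate_succ_apply',
      partialD_comm (contDiff_iterate_partialD h j n), ih]

theorem partialMulti_single_add {ψ : Vel → ℝ} (h : ContDiff ℝ ∞ ψ) (i : Fin 3) (α : Fin 3 → ℕ) :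
    partialMulti (Pi.single i 1 + α) ψ = partialD i (partialMulti α ψ) := by
  have h2 := contDiff_iterate_partialD h 2 (α 2)
  have h1 := contDiff_iterate_partialD h2 1 (α 1)
  unfold partialMulti
  fin_cases i
  · simp only [Fin.zero_eta, Pi.add_apply, Pi.single_eq_same, ne_eq, one_ne_zero,
      not_false_eq_true, Pi.single_eq_of_ne, zero_add, Fin.reduceEq]
    rw [add_comm, Function.iterate_succ_apply']
  · simp only [Fin.mk_one, Pi.add_apply, Pi.single_eq_same, ne_eq,
      not_false_eq_true, Pi.single_eq_of_ne, zero_add, Fin.reduceEq, zero_ne_one]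
    rw [partialD_iterate_comm h1, add_comm 1, Function.iterate_succ_apply']
  · simp only [Fin.reduceFinMk, Pi.add_apply, Pi.single_eq_same, ne_eq,
      not_false_eq_true, Pi.single_eq_of_ne, zero_add, Fin.reduceEq]
    rw [partialD_iterate_comm h1, partialD_iterate_comm h2, add_comm 1,
      Function.iterate_succ_apply']

theorem partialMulti_zero (ψ : Vel → ℝ) : partialMulti 0 ψ = ψ := rfl

theorem partialMulti_single {ψ : Vel → ℝ} (h : ContDiff ℝ ∞ ψ) (i : Fin 3) :
    partialMulti (Pi.single i 1) ψ = partialD i ψ := by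
  simpa [partialMulti_zero] using partialMulti_single_add h i 0

/-- Induction on multi-indices, adding one derivative at a time. -/
theorem multiIndex_induction {P : (Fin 3 → ℕ) → Prop} (h0 : P 0)
    (hs : ∀ i α, P α → P (Pi.single i 1 + α)) (α : Fin 3 → ℕ) : P α := by
  induction hn : ∑ i, α i generalizing α with
  | zero =>
    have : α = 0 := by
      ext i
      exact (Finset.sum_eq_zero_iff.1 hn) i (Finset.mem_univ i)
    rwa [this]
  | succ n ih =>
    obtain ⟨i, hi⟩ : ∃ i, α i ≠ 0 := by
      by_contra! hc
      simp [hc] at hn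
    have hα : α = Pi.single i 1 + (α - Pi.single i 1) := by
      ext j
      by_cases hj : j = i
      · subst hj; simp; omega
      · simp [hj]
    rw [hα]
    refine hs i _ (ih _ ?_)
    have : ∑ j, α j = ∑ j, (Pi.single i 1 : Fin 3 → ℕ) j + ∑ j, (α - Pi.single i 1 : Fin 3 → ℕ) j := by
      rw [← Finset.sum_add_distrib]
      exact Finset.sum_congr rfl fun j _ => congrFun hα j
    rw [hn, Finset.sum_pi_single'] at this
    simp only [Finset.mem_univ, if_true] at this
    omega

theorem partialMulti_add {ψ : Vel → ℝ} (h : ContDiff ℝ ∞ ψ) (α β : Fin 3 → ℕ) :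
    partialMulti (α + β) ψ = partialMulti α (partialMulti β ψ) := by
  have hβ : ContDiff ℝ ∞ (partialMulti β ψ) :=
    contDiff_iterate_partialD (contDiff_iterate_partialD (contDiff_iterate_partialD h 2 _) 1 _) 0 _
  induction α using multiIndex_induction with
  | h0 => rw [zero_add, partialMulti_zero]
  | hs i α ih => rw [add_assoc, partialMulti_single_add h, partialMulti_single_add hβ, ih]

theorem IsTest.comp_sub_left {ψ : Vel → ℝ} (h : IsTest ψ) (x : Vel) :
    IsTest (fun y => ψ (x - y)) :=
  ⟨h.1.comp (contDiff_const.sub contDiff_id), h.2.comp_homeomorph (Homeomorph.subLeft x)⟩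

theorem partialD_comp_sub_left {ψ : Vel → ℝ} (h : IsTest ψ) (x : Vel) (i : Fin 3) :
    partialD i (fun y => ψ (x - y)) = fun y => -partialD i ψ (x - y) := by
  ext y
  unfold partialD
  have : HasFDerivAt (fun y => ψ (x - y)) ((fderiv ℝ ψ (x - y)).comp (-ContinuousLinearMap.id ℝ Vel)) y := by
    refine HasFDerivAt.comp y (h.1.differentiable (by simp) _).hasFDerivAt ?_
    exact (hasFDerivAt_id y).const_sub x
  rw [this.fderiv]
  simp

theorem partialMulti_comp_sub_left {ψ : Vel → ℝ} (h : IsTest ψ) (x : Vel) (α : Fin 3 → ℕ) :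
    partialMulti α (fun y => ψ (x - y)) =
      fun y => (-1) ^ (∑ i, α i) * partialMulti α ψ (x - y) := by
  induction α using multiIndex_induction with
  | h0 => ext; simp [partialMulti_zero]
  | hs i α ih =>
    rw [partialMulti_single_add (h.comp_sub_left x).1, ih, partialMulti_single_add h.1]
    ext y
    have hd := (((h.partialMulti α).comp_sub_left x).1.differentiable (by simp)) y
    have := congrFun (partialD_comp_sub_left (h.partialMulti α) x i) y
    unfold partialD at this ⊢
    rw [fderiv_const_mul hd]
    simp only [smul_apply, this, smul_eq_mul, Pi.add_apply,
      Finset.sum_add_distrib, Finset.sum_pi_single', Finset.mem_univ, if_true, pow_add, pow_one]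
    simp

theorem IsTest.comp_add_right {ψ : Vel → ℝ} (h : IsTest ψ) (c : Vel) :
    IsTest (fun y => ψ (y + c)) :=
  ⟨h.1.comp (contDiff_id.add contDiff_const), h.2.comp_homeomorph (Homeomorph.addRight c)⟩

theorem partialD_comp_add_right (ψ : Vel → ℝ) (c : Vel) (i : Fin 3) :
    partialD i (fun y => ψ (y + c)) = fun y => partialD i ψ (y + c) := by
  ext y
  unfold partialD
  rw [fderiv_comp_add_right]

theorem IsTest.continuous {ψ : Vel → ℝ} (h : IsTest ψ) : Continuous ψ := h.1.continuous

theorem IsTest.integrable {ψ : Vel → ℝ} (h : IsTest ψ) : Integrable ψ volume :=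
  h.continuous.integrable_of_hasCompactSupport h.2

theorem IsTest.bounded {ψ : Vel → ℝ} (h : IsTest ψ) : ∃ C, ∀ x, |ψ x| ≤ C := by
  obtain ⟨C, hC⟩ := h.2.exists_bound_of_continuous h.continuous
  exact ⟨C, fun x => by simpa using hC x⟩

theorem IsTest.eq_zero_of_norm {ψ : Vel → ℝ} (h : IsTest ψ) :
    ∃ R : ℝ, 0 < R ∧ ∀ x, R ≤ ‖x‖ → ψ x = 0 := by
  obtain ⟨R, hR⟩ := h.2.isCompact.isBounded.subset_ball 0
  refine ⟨max R 1, by positivity, fun x hx => ?_⟩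
  by_contra hne
  have := hR (subset_tsupport _ (Function.mem_support.2 hne))
  simp at this
  have := le_max_left R 1
  linarith

/-! ### Weak derivatives -/

theorem isWeakPartial_zero {f : Vel → ℝ} (hf : LocallyIntegrable f volume) :
    IsWeakPartial 0 f f := ⟨hf, hf, fun ψ _ _ => by simp [partialMulti_zero]⟩

theorem LocallyIntegrable.integrable_mul_test {f ψ : Vel → ℝ} (hf : LocallyIntegrable f volume)
    (hψ : IsTest ψ) : Integrable (fun x => f x * ψ x) volume :=
  hf.integrable_smul_right_of_hasCompactSupport hψ.continuous hψ.2

/-- The fundamental lemma of the calculus of variations. -/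
theorem ae_eq_of_forall_test {f g : Vel → ℝ} (hf : LocallyIntegrable f volume)
    (hg : LocallyIntegrable g volume)
    (h : ∀ ψ, IsTest ψ → ∫ x, f x * ψ x = ∫ x, g x * ψ x) : f =ᵐ[volume] g := by
  have := ae_eq_zero_of_integral_contDiff_smul_eq_zero (hf.sub hg) (fun ψ h1 h2 => by
    have h3 := h ψ ⟨h1, h2⟩
    have h4 := integral_sub (LocallyIntegrable.integrable_mul_test hf ⟨h1, h2⟩)
      (LocallyIntegrable.integrable_mul_test hg ⟨h1, h2⟩)
    rw [h3, sub_self] at h4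
    rw [← h4]
    congr 1
    ext x
    simp; ring)
  filter_upwards [this] with x hx
  simpa [sub_eq_zero] using hx

theorem IsWeakPartial.ae_eq {α : Fin 3 → ℕ} {f F G : Vel → ℝ} (hF : IsWeakPartial α f F)
    (hG : IsWeakPartial α f G) : F =ᵐ[volume] G := by
  refine ae_eq_of_forall_test hF.2.1 hG.2.1 fun ψ hψ => ?_
  have h1 := hF.2.2 ψ hψ.1 hψ.2
  rw [hG.2.2 ψ hψ.1 hψ.2] at h1
  exact (mul_left_cancel₀ (by simp) h1).symm

theorem LocallyIntegrable.congr_ae {f g : Vel → ℝ} (hf : LocallyIntegrable f volume)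
    (h : f =ᵐ[volume] g) : LocallyIntegrable g volume := fun x => by
  obtain ⟨s, hs, hi⟩ := hf x
  exact ⟨s, hs, hi.congr (ae_restrict_of_ae h)⟩

theorem IsWeakPartial.congr {α : Fin 3 → ℕ} {f F f' F' : Vel → ℝ} (h : IsWeakPartial α f F)
    (hf : f =ᵐ[volume] f') (hF : F =ᵐ[volume] F') : IsWeakPartial α f' F' := by
  refine ⟨LocallyIntegrable.congr_ae h.1 hf, LocallyIntegrable.congr_ae h.2.1 hF,
    fun ψ h1 h2 => ?_⟩
  rw [← integral_congr_ae (hf.mono fun x hx => by simp only [hx] :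
    (fun x => f x * partialMulti α ψ x) =ᵐ[volume] fun x => f' x * partialMulti α ψ x),
    h.2.2 ψ h1 h2]
  congr 1
  exact integral_congr_ae (hF.mono fun x hx => by simp only [hx])

/-- A weak derivative of order `α + β` is a weak derivative of order `β` of the one of order `α`. -/
theorem IsWeakPartial.of_add {α β : Fin 3 → ℕ} {f F G : Vel → ℝ} (hF : IsWeakPartial α f F)
    (hG : IsWeakPartial (α + β) f G) : IsWeakPartial β F G := by
  refine ⟨hF.2.1, hG.2.1, fun ψ h1 h2 => ?_⟩
  have hβ := IsTest.partialMulti ⟨h1, h2⟩ β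
  have e1 := hF.2.2 _ hβ.1 hβ.2
  rw [← partialMulti_add h1, hG.2.2 ψ h1 h2] at e1
  simp only [Pi.add_apply, Finset.sum_add_distrib, pow_add] at e1
  rw [mul_assoc] at e1
  exact (mul_left_cancel₀ (by simp) e1).symm

theorem MemH.isWeakPartial {N : ℕ} {l : ℝ} {f : Vel → ℝ} (h : MemH N l f) {α : Fin 3 → ℕ}
    (hα : α ∈ multiIndices N) : IsWeakPartial α f (weakPartial α f) := by
  have : ∃ F, IsWeakPartial α f F := let ⟨F, hF, _⟩ := h α hα; ⟨F, hF⟩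
  unfold weakPartial
  rw [dif_pos this]
  exact this.choose_spec

theorem mem_multiIndices {N : ℕ} {α : Fin 3 → ℕ} : α ∈ multiIndices N ↔ ∑ i, α i ≤ N := by
  unfold multiIndices
  simp only [Finset.mem_filter, Fintype.mem_piFinset, Finset.mem_range, and_iff_right_iff_imp]
  intro h i
  have := Finset.single_le_sum (f := α) (fun j _ => Nat.zero_le _) (Finset.mem_univ i)
  omega

/-- A family of measurable representatives `D α` of the weak derivatives, up to order three,
of one function `D 0`. -/
structure IsJet (D : (Fin 3 → ℕ) → Vel → ℝ) : Prop where
  measurable : ∀ α, Measurable (D α)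
  weak : ∀ α β, ∑ i, (α + β) i ≤ 3 → IsWeakPartial β (D α) (D (α + β))

theorem MemH.exists_jet {l : ℝ} {f : Vel → ℝ} (h : MemH 3 l f) :
    ∃ D, IsJet D ∧ f =ᵐ[volume] D 0 ∧ ∀ α ∈ multiIndices 3, weakPartial α f =ᵐ[volume] D α := by
  classical
  have hm : ∀ α ∈ multiIndices 3, AEStronglyMeasurable (weakPartial α f) volume :=
    fun α hα => (h.isWeakPartial hα).2.1.aestronglyMeasurable
  let D : (Fin 3 → ℕ) → Vel → ℝ := fun α =>
    if hα : α ∈ multiIndices 3 then (hm α hα).mk else 0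
  have hD : ∀ α ∈ multiIndices 3, weakPartial α f =ᵐ[volume] D α := fun α hα => by
    simp only [D, dif_pos hα]
    exact (hm α hα).ae_eq_mk
  have h0 : f =ᵐ[volume] D 0 := by
    have h0m : (0 : Fin 3 → ℕ) ∈ multiIndices 3 := mem_multiIndices.2 (by simp)
    have h1 := h.isWeakPartial h0m
    exact ((isWeakPartial_zero h1.1).ae_eq h1).trans (hD 0 h0m)
  refine ⟨D, ⟨fun α => ?_, fun α β hαβ => ?_⟩, h0, hD⟩
  · by_cases hα : α ∈ multiIndices 3
    · simp only [D, dif_pos hα]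
      exact (hm α hα).stronglyMeasurable_mk.measurable
    · simp only [D, dif_neg hα]
      exact measurable_const
  · have hβ : α + β ∈ multiIndices 3 := mem_multiIndices.2 hαβ
    have hα : α ∈ multiIndices 3 := mem_multiIndices.2 (by
      simp only [Pi.add_apply, Finset.sum_add_distrib] at hαβ
      omega)
    exact (((h.isWeakPartial hα).congr h0 (hD α hα)).of_add
      ((h.isWeakPartial hβ).congr h0 (hD _ hβ)))

/-! ### From test functions to weak derivatives -/

theorem integrable_prod_of_lintegral_lt_top {X Y : Type*} [MeasurableSpace X] [MeasurableSpace Y]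
    {μ : Measure X} {ν : Measure Y} [SFinite μ] [SFinite ν] {F : X × Y → ℝ} (hF : Measurable F)
    (h : ∫⁻ x, ∫⁻ y, ‖F (x, y)‖ₑ ∂ν ∂μ < ⊤) : Integrable F (μ.prod ν) := by
  refine ⟨hF.aestronglyMeasurable, ?_⟩
  rw [hasFiniteIntegral_iff_enorm, lintegral_prod _ hF.enorm.aemeasurable]
  exact h

/-- Absolute integrability on balls suffices for integrals against a test function. -/
theorem lintegral_mul_test_lt_top {Y : Type*} [MeasurableSpace Y] {ν : Measure Y}
    {K : Vel → Y → ℝ} (h : ∀ R : ℝ, ∫⁻ x in Metric.ball 0 R, ∫⁻ y, ‖K x y‖ₑ ∂ν < ⊤)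
    {ψ : Vel → ℝ} (hψ : IsTest ψ) : ∫⁻ x, ∫⁻ y, ‖K x y * ψ x‖ₑ ∂ν < ⊤ := by
  obtain ⟨R, hR, hψR⟩ := hψ.eq_zero_of_norm
  obtain ⟨C, hC⟩ := hψ.bounded
  calc ∫⁻ x, ∫⁻ y, ‖K x y * ψ x‖ₑ ∂ν
      = ∫⁻ x in Metric.ball 0 R, ∫⁻ y, ‖K x y * ψ x‖ₑ ∂ν := by
        symm
        refine setLIntegral_eq_of_support_subset (fun x hx => ?_)
        by_contra hx'
        simp only [Metric.mem_ball, dist_zero_right, not_lt] at hx'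
        exact hx (by simp [hψR x hx'])
    _ ≤ ∫⁻ x in Metric.ball 0 R, ENNReal.ofReal C * ∫⁻ y, ‖K x y‖ₑ ∂ν := by
        refine lintegral_mono fun x => ?_
        rw [← lintegral_const_mul' _ _ ENNReal.ofReal_ne_top]
        refine lintegral_mono fun y => ?_
        rw [enorm_mul, mul_comm]
        gcongr
        rw [Real.enorm_eq_ofReal_abs]
        exact ENNReal.ofReal_le_ofReal (hC x)
    _ < ⊤ := by
        rw [lintegral_const_mul' _ _ ENNReal.ofReal_ne_top]
        exact ENNReal.mul_lt_top ENNReal.ofReal_lt_top (h R)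

/-- Transfer principle: a linear translation-invariant relation between the derivatives of test
functions holds, almost everywhere, for the weak derivatives of any function. -/
theorem ae_sum_integral_eq_zero_of_test {ι Y : Type*} [MeasurableSpace Y] (s : Finset ι)
    (ν : ι → Measure Y) [∀ i, SFinite (ν i)] {c : ι → Y → ℝ} (hc : ∀ i, Measurable (c i))
    {p : Y → Vel} (hp : Measurable p) {f : Vel → ℝ} (hf : Measurable f) {α : ι → Fin 3 → ℕ}
    {F : ι → Vel → ℝ} (hFm : ∀ i, Measurable (F i)) (hF : ∀ i ∈ s, IsWeakPartial (α i) f (F i))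
    (hintF : ∀ i ∈ s, ∀ R : ℝ, ∫⁻ x in Metric.ball 0 R, ∫⁻ y, ‖c i y * F i (x + p y)‖ₑ ∂ν i < ⊤)
    (hintf : ∀ i ∈ s, ∀ R : ℝ, ∫⁻ x in Metric.ball 0 R, ∫⁻ y, ‖c i y * f (x + p y)‖ₑ ∂ν i < ⊤)
    (hid : ∀ ψ, IsTest ψ → ∑ i ∈ s, ∫ y, c i y * partialMulti (α i) ψ (p y) ∂ν i = 0) :
    ∀ᵐ x, ∑ i ∈ s, ∫ y, c i y * F i (x + p y) ∂ν i = 0 := by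
  have hmeas : ∀ (i : ι) (g : Vel → ℝ), Measurable g →
      Measurable fun q : Vel × Y => c i q.2 * g (q.1 + p q.2) := fun i g hg =>
    ((hc i).comp measurable_snd).mul (hg.comp (measurable_fst.add (hp.comp measurable_snd)))
  have hLm : ∀ i, StronglyMeasurable fun x => ∫ y, c i y * F i (x + p y) ∂ν i := fun i =>
    (hmeas i _ (hFm i)).stronglyMeasurable.integral_prod_right
  have hLloc : ∀ i ∈ s, LocallyIntegrable (fun x => ∫ y, c i y * F i (x + p y) ∂ν i) volume := by
    intro i hi x
    refine ⟨Metric.ball 0 (‖x‖ + 1), Metric.isOpen_ball.mem_nhds (by simp),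
      (hLm i).aestronglyMeasurable, ?_⟩
    rw [hasFiniteIntegral_iff_enorm]
    exact (lintegral_mono fun x => enorm_integral_le_lintegral_enorm _).trans_lt (hintF i hi _)
  -- Test the left-hand side against `ψ`, exchange the integrals, and move the derivatives to `ψ`: this
  -- leaves `f` tested against the relation for the test functions `z ↦ ψ (x - z)`.
  have key : ∀ i ∈ s, ∀ ψ, IsTest ψ →
      Integrable (fun x => f x * ∫ y, c i y * partialMulti (α i) (fun z => ψ (x - z)) (p y) ∂ν i) ∧
      ∫ x, (∫ y, c i y * F i (x + p y) ∂ν i) * ψ x =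
        ∫ x, f x * ∫ y, c i y * partialMulti (α i) (fun z => ψ (x - z)) (p y) ∂ν i := by
    intro i hi ψ hψ
    have hD := hψ.partialMulti (α i)
    have hψm := hψ.continuous.measurable
    have hDm := hD.continuous.measurable
    have hI1 : Integrable (fun q : Vel × Y => c i q.2 * F i (q.1 + p q.2) * ψ q.1)
        (volume.prod (ν i)) :=
      integrable_prod_of_lintegral_lt_top ((hmeas i _ (hFm i)).mul (hψm.comp measurable_fst))
        (lintegral_mul_test_lt_top (hintF i hi) hψ)
    have hI2 : Integrable (fun q : Vel × Y => c i q.2 * f (q.1 + p q.2) *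
        partialMulti (α i) ψ q.1) (volume.prod (ν i)) :=
      integrable_prod_of_lintegral_lt_top ((hmeas i _ hf).mul (hDm.comp measurable_fst))
        (lintegral_mul_test_lt_top (hintf i hi) hD)
    have hI3 : Integrable (fun q : Vel × Y => f q.1 * (c i q.2 *
        partialMulti (α i) (fun z => ψ (q.1 - z)) (p q.2))) (volume.prod (ν i)) := by
      simp only [partialMulti_comp_sub_left hψ]
      have hm : Measurable (fun q : Vel × Y => f q.1 * (c i q.2 *
          ((-1) ^ (∑ j, α i j) * partialMulti (α i) ψ (q.1 - p q.2)))) :=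
        (hf.comp measurable_fst).mul (((hc i).comp measurable_snd).mul (measurable_const.mul
          (hDm.comp (measurable_fst.sub (hp.comp measurable_snd)))))
      refine ⟨hm.aestronglyMeasurable, ?_⟩
      have h2 := hI2.2
      rw [hasFiniteIntegral_iff_enorm] at h2 ⊢
      have hm2 : Measurable (fun q : Vel × Y => c i q.2 * f (q.1 + p q.2) *
        partialMulti (α i) ψ q.1) := (hmeas i _ hf).mul (hDm.comp measurable_fst)
      rw [lintegral_prod_symm _ hm2.enorm.aemeasurable] at h2
      rw [lintegral_prod_symm _ hm.enorm.aemeasurable]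
      convert h2 using 3 with y
      rw [← lintegral_add_right_eq_self _ (p y)]
      congr 1
      ext x
      simp only [add_sub_cancel_right, enorm_mul]
      simp only [enorm_pow, enorm_neg, enorm_one, one_pow, one_mul]
      ring
    refine ⟨hI3.integral_prod_left.congr (Filter.Eventually.of_forall fun x => ?_), ?_⟩
    · simp only [integral_const_mul]
    calc ∫ x, (∫ y, c i y * F i (x + p y) ∂ν i) * ψ x
        = ∫ x, ∫ y, c i y * F i (x + p y) * ψ x ∂ν i := by simp only [integral_mul_const]
      _ = ∫ y, ∫ x, c i y * F i (x + p y) * ψ x ∂volume ∂ν i := integral_integral_swap hI1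
      _ = ∫ y, ∫ x, f x * (c i y * partialMulti (α i) (fun z => ψ (x - z)) (p y)) ∂volume
            ∂ν i := by
          congr 1
          ext y
          have ht : IsTest (fun x => ψ (x + -p y)) := hψ.comp_add_right _
          have hw := (hF i hi).2.2 _ ht.1 ht.2
          have e1 : partialMulti (α i) (fun x => ψ (x + -p y)) =
              fun x => partialMulti (α i) ψ (x + -p y) := by
            generalize α i = β
            induction β using multiIndex_induction with
            | h0 => rfl
            | hs j β ih =>
              rw [partialMulti_single_add ht.1, ih, partialMulti_single_add hψ.1,
                partialD_comp_add_right]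
          rw [e1] at hw
          have e2 : ∫ x, c i y * F i (x + p y) * ψ x = c i y * ∫ x, F i x * ψ (x + -p y) := by
            rw [← integral_add_right_eq_self (fun x => F i x * ψ (x + -p y)) (p y),
              ← integral_const_mul]
            congr 1
            ext x
            rw [mul_assoc, add_neg_cancel_right]
          have e3 : ∫ x, f x * (c i y * partialMulti (α i) (fun z => ψ (x - z)) (p y)) =
              c i y * ((-1) ^ (∑ j, α i j) * ∫ x, f x * partialMulti (α i) ψ (x + -p y)) := by
            rw [← integral_const_mul, ← integral_const_mul]
            congr 1
            ext x
            rw [partialMulti_comp_sub_left hψ, ← sub_eq_add_neg]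
            ring
          rw [e2, e3, hw, ← mul_assoc ((-1 : ℝ) ^ _), ← mul_pow]
          simp
      _ = ∫ x, ∫ y, f x * (c i y * partialMulti (α i) (fun z => ψ (x - z)) (p y)) ∂ν i :=
          (integral_integral_swap hI3).symm
      _ = _ := by simp only [integral_const_mul]
  have hsum : LocallyIntegrable (fun x => ∑ i ∈ s, ∫ y, c i y * F i (x + p y) ∂ν i) volume :=
    locallyIntegrable_finsetSum _ hLloc
  refine ae_eq_of_forall_test hsum (locallyIntegrable_const (0 : ℝ)) fun ψ hψ => ?_
  simp only [Finset.sum_mul, zero_mul, integral_zero]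
  rw [integral_finsetSum _ fun i hi => LocallyIntegrable.integrable_mul_test (hLloc i hi) hψ,
    Finset.sum_congr rfl fun i hi => (key i hi ψ hψ).2,
    ← integral_finsetSum _ fun i hi => (key i hi ψ hψ).1]
  simp only [← Finset.mul_sum]
  rw [integral_eq_zero_of_ae]
  refine Filter.Eventually.of_forall fun x => ?_
  simp only [hid _ (hψ.comp_sub_left x), mul_zero, Pi.zero_apply]

/-! ### Taylor's formula for weak derivatives -/

/-- The multi-index counting the letters of a word in the coordinates `0, 1, 2`. -/
def wordIndex {m : ℕ} (s : Fin m → Fin 3) : Fin 3 → ℕ := ∑ j, Pi.single (s j) 1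

/-- The `m`-th derivative `∑ k_{i₁} ⋯ k_{i_m} ∂_{i₁} ⋯ ∂_{i_m}` in the direction `k`, of a function
whose partial derivatives are listed in `D`. -/
def dirDeriv (D : (Fin 3 → ℕ) → Vel → ℝ) (m : ℕ) (k x : Vel) : ℝ :=
  ∑ s : Fin m → Fin 3, (∏ j, k (s j)) * D (wordIndex s) x

theorem sum_wordIndex {m : ℕ} (s : Fin m → Fin 3) : ∑ i, wordIndex s i = m := by
  unfold wordIndex
  simp only [Finset.sum_apply]
  rw [Finset.sum_comm]
  simp [Finset.sum_pi_single']

theorem wordIndex_cons {m : ℕ} (i : Fin 3) (s : Fin m → Fin 3) :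
    wordIndex (Fin.cons i s : Fin (m + 1) → Fin 3) = Pi.single i 1 + wordIndex s := by
  unfold wordIndex
  rw [Fin.sum_univ_succ]
  simp

theorem sum_word_succ {m : ℕ} (F : (Fin (m + 1) → Fin 3) → ℝ) :
    ∑ s, F s = ∑ i, ∑ s, F (Fin.cons i s) := by
  rw [← Fintype.sum_prod_type', ← (Fin.consEquiv (fun _ : Fin (m + 1) => Fin 3)).sum_comp]
  rfl

theorem fderiv_apply_eq_sum_partialD (ψ : Vel → ℝ) (x k : Vel) :
    fderiv ℝ ψ x k = ∑ i, k i * partialD i ψ x := by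
  have : k = ∑ i, k i • EuclideanSpace.single i (1 : ℝ) := by
    ext j
    simp [Finset.sum_apply, Pi.single_apply]
  conv_lhs => rw [this]
  simp [partialD]

/-- For test functions, `dirDeriv` of order `m` along a line is the `m`-th derivative in the line
parameter. -/
theorem hasDerivAt_dirDeriv_test {ψ : Vel → ℝ} (hψ : IsTest ψ) (m : ℕ) (k : Vel) (t : ℝ) :
    HasDerivAt (fun t : ℝ => dirDeriv (fun α => partialMulti α ψ) m k (t • k))
      (dirDeriv (fun α => partialMulti α ψ) (m + 1) k (t • k)) t := by
  have h1 : ∀ s : Fin m → Fin 3, HasDerivAt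
      (fun t : ℝ => (∏ j, k (s j)) * partialMulti (wordIndex s) ψ (t • k))
      ((∏ j, k (s j)) * fderiv ℝ (partialMulti (wordIndex s) ψ) (t • k) k) t := by
    intro s
    refine HasDerivAt.const_mul _ ?_
    have hd := ((hψ.partialMulti (wordIndex s)).1.differentiable (by simp) (t • k)).hasFDerivAt
    refine hd.comp_hasDerivAt t ?_
    simpa using (hasDerivAt_id t).smul_const k
  have h2 := HasDerivAt.fun_sum (u := Finset.univ) fun s _ => h1 s
  refine h2.congr_deriv ?_
  unfold dirDeriv
  symm
  rw [sum_word_succ, Finset.sum_comm]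
  refine Finset.sum_congr rfl fun s _ => ?_
  rw [fderiv_apply_eq_sum_partialD, Finset.mul_sum]
  refine Finset.sum_congr rfl fun i _ => ?_
  simp only [wordIndex_cons, partialMulti_single_add hψ.1, Fin.prod_univ_succ]
  simp only [Fin.cons_zero, Fin.cons_succ]
  ring

/-- Taylor's formula with integral remainder for a sequence of successive derivatives. -/
theorem taylor_integral_sequence {g : ℕ → ℝ → ℝ} (hg : ∀ m t, HasDerivAt (g m) (g (m + 1) t) t)
    (n : ℕ) :
    g 0 1 = ∑ m ∈ Finset.range (n + 1), (m.factorial : ℝ)⁻¹ * g m 0 +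
      ∫ t in (0 : ℝ)..1, (n.factorial : ℝ)⁻¹ * (1 - t) ^ n * g (n + 1) t := by
  have hc : ∀ m, Continuous (g m) := fun m =>
    continuous_iff_continuousAt.2 fun t => (hg m t).continuousAt
  induction n with
  | zero =>
    simp only [zero_add, Finset.range_one, Finset.sum_singleton, Nat.factorial_zero, Nat.cast_one,
      inv_one, one_mul, pow_zero]
    rw [intervalIntegral.integral_eq_sub_of_hasDerivAt (fun t _ => hg 0 t)
      ((hc 1).intervalIntegrable _ _)]
    ring
  | succ n ih =>
    rw [ih, Finset.sum_range_succ _ (n + 1), add_assoc]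
    congr 1
    have hu : ∀ t : ℝ, HasDerivAt (fun t : ℝ => -(((n + 1).factorial : ℝ)⁻¹ * (1 - t) ^ (n + 1)))
        ((n.factorial : ℝ)⁻¹ * (1 - t) ^ n) t := by
      intro t
      have := ((((hasDerivAt_id t).const_sub 1).pow (n + 1)).const_mul
        (((n + 1).factorial : ℝ)⁻¹)).neg
      refine this.congr_deriv ?_
      have h1 : (n.factorial : ℝ) ≠ 0 := by positivity
      have h2 : ((n : ℝ) + 1) ≠ 0 := by positivity
      rw [Nat.factorial_succ]
      push_cast
      simp only [id]
      field_simp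
    have := intervalIntegral.integral_mul_deriv_eq_deriv_mul (a := (0 : ℝ)) (b := 1)
      (u := fun t : ℝ => -(((n + 1).factorial : ℝ)⁻¹ * (1 - t) ^ (n + 1)))
      (u' := fun t : ℝ => (n.factorial : ℝ)⁻¹ * (1 - t) ^ n)
      (v := g (n + 1)) (v' := g (n + 1 + 1)) (fun t _ => hu t) (fun t _ => hg (n + 1) t)
      ((by fun_prop : Continuous fun t : ℝ => (n.factorial : ℝ)⁻¹ * (1 - t) ^ n).intervalIntegrable
        _ _) ((hc _).intervalIntegrable _ _)
    simp only [neg_mul, intervalIntegral.integral_neg] at this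
    simp only [sub_self, sub_zero, one_pow, mul_one, ne_eq, Nat.add_eq_zero_iff, one_ne_zero,
      and_false, not_false_eq_true, zero_pow, mul_zero, zero_mul, neg_zero] at this
    linarith

/-- The integrability needed in `ae_sum_integral_eq_zero_of_test`, for translations by bounded vectors
and coefficients of finite total mass. -/
theorem lintegral_ball_translate_lt_top {Y : Type*} [MeasurableSpace Y] {ν : Measure Y} [SFinite ν]
    {c : Y → ℝ} (hc : Measurable c) {p : Y → Vel} (hp : Measurable p) {F : Vel → ℝ}
    (hF : Measurable F) (hFl : LocallyIntegrable F volume) (hcν : ∫⁻ y, ‖c y‖ₑ ∂ν < ⊤) {P : ℝ}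
    (hP : ∀ᵐ y ∂ν, ‖p y‖ ≤ P) (R : ℝ) :
    ∫⁻ x in Metric.ball 0 R, ∫⁻ y, ‖c y * F (x + p y)‖ₑ ∂ν < ⊤ := by
  have hm : Measurable fun q : Vel × Y => ‖c q.2 * F (q.1 + p q.2)‖ₑ :=
    ((hc.comp measurable_snd).mul (hF.comp (measurable_fst.add (hp.comp measurable_snd)))).enorm
  have hfin : ∫⁻ x in Metric.ball 0 (R + P), ‖F x‖ₑ < ⊤ :=
    ((hFl.integrableOn_isCompact (isCompact_closedBall 0 (R + P))).mono_set
      Metric.ball_subset_closedBall).2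
  rw [lintegral_lintegral_swap hm.aemeasurable]
  calc ∫⁻ y, ∫⁻ x in Metric.ball 0 R, ‖c y * F (x + p y)‖ₑ ∂volume ∂ν
      ≤ ∫⁻ y, ‖c y‖ₑ * (∫⁻ x in Metric.ball 0 (R + P), ‖F x‖ₑ) ∂ν := by
        refine lintegral_mono_ae (hP.mono fun y hy => ?_)
        simp only [enorm_mul]
        rw [lintegral_const_mul' _ _ enorm_ne_top]
        refine mul_le_mul_right ?_ _
        rw [← lintegral_indicator Metric.isOpen_ball.measurableSet,
          ← lintegral_indicator Metric.isOpen_ball.measurableSet,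
          ← lintegral_add_right_eq_self (μ := volume)
            ((Metric.ball (0 : Vel) (R + P)).indicator fun x => ‖F x‖ₑ) (p y)]
        refine lintegral_mono fun x => ?_
        by_cases hx : x ∈ Metric.ball (0 : Vel) R
        · have : x + p y ∈ Metric.ball (0 : Vel) (R + P) := by
            simp only [Metric.mem_ball, dist_zero_right] at hx ⊢
            have := norm_add_le x (p y)
            linarith
          rw [indicator_of_mem hx, indicator_of_mem this]
        · rw [indicator_of_notMem hx]
          exact zero_le
    _ < ⊤ := by
        rw [lintegral_mul_const' _ _ hfin.ne]
        exact ENNReal.mul_lt_top hcν hfin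

/-- Taylor's formula for weakly differentiable functions, as an estimate of the remainder. The
increment `k` is fixed and the estimate holds at almost every point; it is Taylor's formula for test
functions, transferred by `ae_sum_integral_eq_zero_of_test`. -/
theorem ae_taylor_remainder_le {D : (Fin 3 → ℕ) → Vel → ℝ} (hDm : ∀ α, Measurable (D α)) {n : ℕ}
    (hD : ∀ α : Fin 3 → ℕ, ∑ i, α i ≤ n + 1 → IsWeakPartial α (D 0) (D α)) (k : Vel) :
    ∀ᵐ x : Vel, ‖D 0 (x + k) - ∑ m ∈ Finset.range (n + 1),
        (m.factorial : ℝ)⁻¹ * dirDeriv D m k x‖ₑ ≤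
      ENNReal.ofReal (‖k‖ ^ (n + 1)) * ∑ s : Fin (n + 1) → Fin 3,
        ∫⁻ t in Ioc (0 : ℝ) 1, ‖D (wordIndex s) (x + t • k)‖ₑ := by
  classical
  -- The terms of the formula: `none` is the value at `x + k`, a word of length `m ≤ n` is a term of
  -- the Taylor polynomial, evaluated at `t = 0`, and a word of length `n + 1` is a term of the
  -- remainder, an integral over `0 < t ≤ 1`.
  let ι := Option (Σ m : Fin (n + 2), (Fin m → Fin 3))
  let ν : ι → Measure ℝ
    | none => Measure.dirac 1
    | some ⟨m, _⟩ => if (m : ℕ) ≤ n then Measure.dirac 0 else volume.restrict (Ioc 0 1)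
  let c : ι → ℝ → ℝ
    | none => fun _ => 1
    | some ⟨m, s⟩ => if (m : ℕ) ≤ n then fun _ => -(((m : ℕ).factorial : ℝ)⁻¹ * ∏ j, k (s j))
        else fun t => -((n.factorial : ℝ)⁻¹ * (1 - t) ^ n * ∏ j, k (s j))
  let α : ι → Fin 3 → ℕ
    | none => 0
    | some ⟨m, s⟩ => wordIndex s
  have hc : ∀ i, Measurable (c i) := by
    rintro (_ | ⟨m, s⟩)
    · exact measurable_const
    · simp only [c]
      split_ifs <;> fun_prop
  have hfin : ∀ i, IsFiniteMeasure (ν i) := by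
    rintro (_ | ⟨m, s⟩)
    · simp only [ν]; infer_instance
    · simp only [ν]
      split_ifs <;> infer_instance
  have hp : Measurable fun t : ℝ => t • k := by fun_prop
  have hν01 : ∀ i, ∀ᵐ t ∂(ν i), t ∈ Icc (0 : ℝ) 1 := by
    rintro (_ | ⟨m, s⟩)
    · simp [ν, ae_dirac_eq]
    · simp only [ν]
      split_ifs
      · simp [ae_dirac_eq]
      · filter_upwards [ae_restrict_mem measurableSet_Ioc] with t ht using Ioc_subset_Icc_self ht
  have hP : ∀ i, ∀ᵐ t ∂(ν i), ‖t • k‖ ≤ ‖k‖ := fun i => (hν01 i).mono fun t ht => by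
    rw [norm_smul, Real.norm_of_nonneg ht.1]
    exact mul_le_of_le_one_left (norm_nonneg _) ht.2
  have hcν : ∀ i, ∫⁻ t, ‖c i t‖ₑ ∂(ν i) < ⊤ := by
    intro i
    have hcont : Continuous (c i) := by
      rcases i with _ | ⟨m, s⟩
      · exact continuous_const
      · simp only [c]
        split_ifs <;> fun_prop
    obtain ⟨C, hC⟩ := isCompact_Icc.exists_bound_of_continuousOn
      (hcont.continuousOn (s := Icc (0 : ℝ) 1))
    calc ∫⁻ t, ‖c i t‖ₑ ∂(ν i) ≤ ∫⁻ _, ENNReal.ofReal C ∂(ν i) :=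
          lintegral_mono_ae ((hν01 i).mono fun t ht => by
            rw [← ofReal_norm]
            exact ENNReal.ofReal_le_ofReal (hC t ht))
      _ < ⊤ := by
          rw [lintegral_const]
          exact ENNReal.mul_lt_top ENNReal.ofReal_lt_top (measure_lt_top _ _)
  have hα : ∀ i, ∑ j, α i j ≤ n + 1 := by
    rintro (_ | ⟨m, s⟩)
    · simp [α]
    · simp only [α, sum_wordIndex]; omega
  have expand : ∀ (E : (Fin 3 → ℕ) → Vel → ℝ) (x : Vel),
      ∑ i, ∫ t, c i t * E (α i) (x + t • k) ∂(ν i) =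
      E 0 (x + k) - ∑ m ∈ Finset.range (n + 1), (m.factorial : ℝ)⁻¹ * dirDeriv E m k x
        - ∑ s : Fin (n + 1) → Fin 3, ∫ t in Ioc (0 : ℝ) 1,
            (n.factorial : ℝ)⁻¹ * (1 - t) ^ n * (∏ j, k (s j)) * E (wordIndex s) (x + t • k) := by
    intro E x
    rw [Fintype.sum_option, Fintype.sum_sigma, Fin.sum_univ_castSucc]
    simp only [c, ν, α, integral_dirac, one_mul, one_smul, Fin.val_castSucc, Fin.val_last]
    rw [sub_sub, sub_eq_add_neg, neg_add, ← Fin.sum_univ_eq_sum_range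
      (fun m => (m.factorial : ℝ)⁻¹ * dirDeriv E m k x)]
    congr 2
    · rw [← Finset.sum_neg_distrib]
      refine Finset.sum_congr rfl fun m _ => ?_
      have hm : (m : ℕ) ≤ n := by omega
      simp only [hm, if_true, integral_dirac, dirDeriv, Finset.mul_sum, zero_smul, add_zero]
      rw [← Finset.sum_neg_distrib]
      exact Finset.sum_congr rfl fun s _ => by ring
    · rw [← Finset.sum_neg_distrib]
      refine Finset.sum_congr rfl fun s _ => ?_
      simp only [add_le_iff_nonpos_right, nonpos_iff_eq_zero, one_ne_zero,
        if_false, ← integral_neg, neg_mul]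
  have main := ae_sum_integral_eq_zero_of_test (Finset.univ) ν hc hp (hDm 0) (α := α)
    (F := fun i => D (α i)) (fun i => hDm _) (fun i _ => hD _ (hα i))
    (fun i _ R => lintegral_ball_translate_lt_top (hc i) hp (hDm _) (hD _ (hα i)).2.1 (hcν i)
      (hP i) R)
    (fun i _ R => lintegral_ball_translate_lt_top (hc i) hp (hDm _) (hD _ (hα i)).1 (hcν i)
      (hP i) R) (fun ψ hψ => by
      have := expand (fun α => partialMulti α ψ) 0
      simp only [zero_add] at this
      rw [this, sub_sub, sub_eq_zero]
      have ht := taylor_integral_sequence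
        (g := fun m t => dirDeriv (fun α => partialMulti α ψ) m k (t • k))
        (fun m t => hasDerivAt_dirDeriv_test hψ m k t) n
      simp only [zero_smul, one_smul] at ht
      have e0 : dirDeriv (fun α => partialMulti α ψ) 0 k k = partialMulti 0 ψ k := by
        simp [dirDeriv, wordIndex]
      rw [e0] at ht
      rw [ht]
      congr 1
      rw [intervalIntegral.integral_of_le zero_le_one, ← integral_finsetSum]
      · simp only [dirDeriv, Finset.mul_sum, mul_assoc]
      · intro s _
        refine (Continuous.integrableOn_Ioc ?_)
        have := (hψ.partialMulti (wordIndex s)).continuous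
        fun_prop)
  filter_upwards [main] with x hx
  rw [expand D x, sub_eq_zero] at hx
  rw [hx, Finset.mul_sum]
  refine (enorm_sum_le _ _).trans (Finset.sum_le_sum fun s _ => ?_)
  refine (enorm_integral_le_lintegral_enorm _).trans ?_
  rw [← lintegral_const_mul' _ _ ENNReal.ofReal_ne_top]
  refine setLIntegral_mono_ae' measurableSet_Ioc (Filter.Eventually.of_forall fun t ht => ?_)
  rw [enorm_mul]
  gcongr
  rw [← ofReal_norm]
  refine ENNReal.ofReal_le_ofReal ?_
  rw [norm_mul]
  have h1 : ‖(n.factorial : ℝ)⁻¹ * (1 - t) ^ n‖ ≤ 1 := by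
    have h01 : 0 ≤ 1 - t := by linarith [ht.2]
    rw [Real.norm_of_nonneg (by positivity)]
    refine mul_le_one₀ (inv_le_one_of_one_le₀ (by exact_mod_cast n.factorial_pos)) (by positivity)
      (pow_le_one₀ h01 (by linarith [ht.1]))
  have h2 : ‖∏ j, k (s j)‖ ≤ ‖k‖ ^ (n + 1) := by
    rw [norm_prod]
    refine (Finset.prod_le_prod (fun _ _ => norm_nonneg _)
      (fun j _ => PiLp.norm_apply_le k (s j))).trans ?_
    simp
  calc _ ≤ 1 * ‖k‖ ^ (n + 1) := mul_le_mul h1 h2 (norm_nonneg _) zero_le_one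
    _ = _ := one_mul _

/-! ### Integration over the unit sphere -/

/-- The surface measure of the unit sphere of the velocity space. -/
abbrev surf : Measure (Metric.sphere (0 : Vel) 1) := (volume : Measure Vel).toSphere

/-- Polar coordinates in the velocity space. -/
theorem lintegral_polar {f : Vel → ℝ≥0∞} (hf : Measurable f) :
    ∫⁻ x, f x =
      ∫⁻ σ, (∫⁻ r in Ioi (0 : ℝ), ENNReal.ofReal (r ^ 2) * f (r • (σ : Vel))) ∂surf := by
  have hmp := (volume : Measure Vel).measurePreserving_homeomorphUnitSphereProd
  have hsymm : MeasurePreserving (homeomorphUnitSphereProd Vel).symm _ _ :=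
    hmp.symm (homeomorphUnitSphereProd Vel).toMeasurableEquiv
  calc ∫⁻ x, f x = ∫⁻ x in ({0}ᶜ : Set Vel), f x := by
        rw [← restrict_compl_singleton (μ := (volume : Measure Vel)) 0]
        simp
    _ = ∫⁻ x : ({0}ᶜ : Set Vel), f x ∂(volume.comap Subtype.val) := by
        rw [lintegral_subtype_comap (measurableSet_singleton _).compl]
    _ = ∫⁻ p, f ((homeomorphUnitSphereProd Vel).symm p)
          ∂(surf.prod (Measure.volumeIoiPow (Module.finrank ℝ Vel - 1))) := by
        rw [hsymm.lintegral_comp (f := fun x : ({0}ᶜ : Set Vel) => f x)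
          (hf.comp measurable_subtype_coe)]
    _ = ∫⁻ σ, ∫⁻ r, f ((r : ℝ) • (σ : Vel))
          ∂(Measure.volumeIoiPow (Module.finrank ℝ Vel - 1)) ∂surf := by
        rw [lintegral_prod]
        · rfl
        · exact (hf.comp (measurable_subtype_coe.comp
            (homeomorphUnitSphereProd Vel).symm.continuous.measurable)).aemeasurable
    _ = _ := by
        congr 1
        ext σ
        have h3 : Module.finrank ℝ Vel - 1 = 2 := by simp
        rw [h3, Measure.volumeIoiPow, lintegral_withDensity_eq_lintegral_mul _ (by fun_prop)]
        · rw [← lintegral_subtype_comap measurableSet_Ioi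
            (fun r : ℝ => ENNReal.ofReal (r ^ 2) * f (r • (σ : Vel)))]
          rfl
        · exact hf.comp (measurable_subtype_coe.smul measurable_const)

theorem lintegral_Ioo_sq : ∫⁻ r in Ioo (0 : ℝ) 1, ENNReal.ofReal (r ^ 2) = ENNReal.ofReal (1 / 3) := by
  rw [← ofReal_integral_eq_lintegral_ofReal]
  · rw [← integral_Ioc_eq_integral_Ioo, ← intervalIntegral.integral_of_le zero_le_one]
    norm_num
  · exact ((continuous_pow 2).integrableOn_Icc (a := (0 : ℝ)) (b := 1)).mono_set Ioo_subset_Icc_self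
  · exact Filter.Eventually.of_forall fun r => sq_nonneg r

/-- Integrals over the sphere as integrals over the unit ball. -/
theorem lintegral_sphere_eq_ball {f : Vel → ℝ≥0∞} (hf : Measurable f) :
    ∫⁻ x in Metric.ball (0 : Vel) 1, f (‖x‖⁻¹ • x) =
      ENNReal.ofReal (1 / 3) * ∫⁻ σ, f σ ∂surf := by
  have hm : Measurable fun x : Vel => f (‖x‖⁻¹ • x) :=
    hf.comp (measurable_norm.inv.smul measurable_id)
  rw [← lintegral_indicator Metric.isOpen_ball.measurableSet, lintegral_polar
    (hm.indicator Metric.isOpen_ball.measurableSet), ← lintegral_Ioo_sq,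
    ← lintegral_const_mul' _ _ (by rw [lintegral_Ioo_sq]; exact ENNReal.ofReal_ne_top)]
  congr 1
  ext σ
  have hσ : ‖(σ : Vel)‖ = 1 := by simp
  rw [← lintegral_mul_const _ (by fun_prop), ← lintegral_indicator measurableSet_Ioi,
    ← lintegral_indicator measurableSet_Ioo]
  congr 1
  ext r
  by_cases hr : r ∈ Ioi (0 : ℝ)
  · have hr' : 0 < r := hr
    have hn : ‖r • (σ : Vel)‖ = r := by rw [norm_smul, hσ, mul_one, Real.norm_of_nonneg hr'.le]
    rw [indicator_of_mem hr]
    by_cases h1 : r < 1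
    · rw [indicator_of_mem (show r ∈ Ioo (0 : ℝ) 1 from ⟨hr', h1⟩), indicator_of_mem]
      · rw [hn, smul_smul, inv_mul_cancel₀ hr'.ne', one_smul]
      · simpa [hn] using h1
    · rw [indicator_of_notMem (show r ∉ Ioo (0 : ℝ) 1 from fun h => h1 h.2), indicator_of_notMem,
        mul_zero]
      rw [Metric.mem_ball, dist_zero_right, hn]
      exact h1
  · rw [indicator_of_notMem hr, indicator_of_notMem fun h => hr h.1]

theorem lintegral_sphere_eq {f : Vel → ℝ≥0∞} (hf : Measurable f) :
    ∫⁻ σ, f σ ∂surf = 3 * ∫⁻ x in Metric.ball (0 : Vel) 1, f (‖x‖⁻¹ • x) := by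
  rw [lintegral_sphere_eq_ball hf, ← mul_assoc]
  have : (3 : ℝ≥0∞) * ENNReal.ofReal (1 / 3) = 1 := by
    rw [show (3 : ℝ≥0∞) = ENNReal.ofReal 3 by simp, ← ENNReal.ofReal_mul (by norm_num)]
    norm_num
  rw [this, one_mul]

theorem lintegral_sphere_isometry {f : Vel → ℝ≥0∞} (hf : Measurable f) (R : Vel ≃ₗᵢ[ℝ] Vel) :
    ∫⁻ σ, f (R σ) ∂surf = ∫⁻ σ, f σ ∂surf := by
  have hR : Measurable fun x : Vel => R x := R.continuous.measurable
  rw [lintegral_sphere_eq (f := fun x => f (R x)) (hf.comp hR), lintegral_sphere_eq hf]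
  congr 1
  have hm : Measurable fun x : Vel => f (‖x‖⁻¹ • x) :=
    hf.comp (measurable_norm.inv.smul measurable_id)
  rw [← lintegral_indicator Metric.isOpen_ball.measurableSet,
    ← lintegral_indicator Metric.isOpen_ball.measurableSet,
    ← R.measurePreserving.lintegral_comp (hm.indicator Metric.isOpen_ball.measurableSet)]
  congr 1
  ext x
  by_cases hx : x ∈ Metric.ball (0 : Vel) 1
  · rw [indicator_of_mem hx, indicator_of_mem (by simpa using hx)]
    simp
  · rw [indicator_of_notMem hx, indicator_of_notMem (by simpa using hx)]

/-- The action of a linear isometry on the unit sphere. -/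
def sphereMap (R : Vel ≃ₗᵢ[ℝ] Vel) (σ : Metric.sphere (0 : Vel) 1) : Metric.sphere (0 : Vel) 1 :=
  ⟨R σ, by simp⟩

theorem measurable_sphereMap (R : Vel ≃ₗᵢ[ℝ] Vel) : Measurable (sphereMap R) :=
  (R.continuous.measurable.comp measurable_subtype_coe).subtype_mk

theorem measurePreserving_sphereMap (R : Vel ≃ₗᵢ[ℝ] Vel) :
    MeasurePreserving (sphereMap R) surf surf := by
  refine ⟨measurable_sphereMap R, Measure.ext fun s hs => ?_⟩
  have hs' : MeasurableSet ((↑) '' s : Set Vel) :=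
    (MeasurableEmbedding.subtype_coe Metric.isClosed_sphere.measurableSet).measurableSet_image.2 hs
  have h := lintegral_sphere_isometry (measurable_one.indicator hs') R
  have e : ∀ σ : Metric.sphere (0 : Vel) 1, ((↑) '' s : Set Vel).indicator (1 : Vel → ℝ≥0∞) σ =
      s.indicator 1 σ := fun σ => by
    by_cases hσ : σ ∈ s
    · rw [indicator_of_mem hσ, indicator_of_mem (mem_image_of_mem _ hσ)]; rfl
    · rw [indicator_of_notMem hσ, indicator_of_notMem]
      rintro ⟨τ, hτ, hτσ⟩
      exact hσ (Subtype.ext hτσ ▸ hτ)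
  have h2 : ∫⁻ σ, s.indicator 1 (sphereMap R σ) ∂surf = ∫⁻ σ, s.indicator 1 σ ∂surf := by
    simp only [← e]
    exact h
  rw [lintegral_indicator_one hs] at h2
  rw [← h2, ← lintegral_indicator_one hs, lintegral_map (measurable_one.indicator hs)
    (measurable_sphereMap R)]

/-- Cartesian coordinates. -/
theorem measurePreserving_coords :
    MeasurePreserving (fun x : Vel => (x 0, (x 1, x 2)))
      (volume : Measure Vel) (volume : Measure (ℝ × ℝ × ℝ)) := by
  have h1 := EuclideanSpace.volume_preserving_symm_measurableEquiv_toLp (Fin 3)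
  have h2 := volume_preserving_piFinSuccAbove (fun _ : Fin 3 => ℝ) 0
  have h3 := (MeasurePreserving.id (volume : Measure ℝ)).prod (volume_preserving_finTwoArrow ℝ)
  exact (h3.comp h2).comp h1

theorem norm_sq_coords (x : Vel) : ‖x‖ ^ 2 = x 0 ^ 2 + (x 1 ^ 2 + x 2 ^ 2) := by
  rw [EuclideanSpace.norm_sq_eq, Fin.sum_univ_three]
  simp only [Real.norm_eq_abs, sq_abs]
  ring

/-- Spherical coordinates for functions that are symmetric about the first coordinate axis. -/
theorem lintegral_axisymmetric {H : ℝ → ℝ → ℝ≥0∞} (hH : Measurable (Function.uncurry H)) :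
    ∫⁻ x : Vel, H ‖x‖ (x 0) = ENNReal.ofReal (2 * Real.pi) *
      ∫⁻ ρ in Ioi (0 : ℝ), ∫⁻ θ in Ioo 0 Real.pi,
        ENNReal.ofReal (ρ ^ 2 * Real.sin θ) * H ρ (ρ * Real.cos θ) := by
  have hG : Measurable fun p : ℝ × ℝ => H (√(p.1 ^ 2 + p.2 ^ 2)) p.1 :=
    hH.comp (Measurable.prodMk (by fun_prop) measurable_fst)
  have hG3 : Measurable fun p : ℝ × ℝ × ℝ => H (√(p.1 ^ 2 + (p.2.1 ^ 2 + p.2.2 ^ 2))) p.1 :=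
    hH.comp (Measurable.prodMk (by fun_prop) measurable_fst)
  have hpi : ENNReal.ofReal (2 * Real.pi) = volume (Ioo (-Real.pi) Real.pi) := by
    rw [Real.volume_Ioo]; congr 1; ring
  -- polar coordinates in the plane orthogonal to the axis
  have step1 : ∀ a : ℝ, ∫⁻ q : ℝ × ℝ, H (√(a ^ 2 + (q.1 ^ 2 + q.2 ^ 2))) a =
      ENNReal.ofReal (2 * Real.pi) *
        ∫⁻ r in Ioi (0 : ℝ), ENNReal.ofReal r * H (√(a ^ 2 + r ^ 2)) a := by
    intro a
    have hGa : Measurable fun r : ℝ => ENNReal.ofReal r * H (√(a ^ 2 + r ^ 2)) a :=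
      (by fun_prop : Measurable fun r : ℝ => ENNReal.ofReal r).mul
        (hH.comp (Measurable.prodMk (by fun_prop) measurable_const))
    rw [← lintegral_comp_polarCoord_symm, polarCoord_target, Measure.volume_eq_prod,
      ← Measure.prod_restrict, lintegral_prod _ (by
        refine Measurable.aemeasurable ?_
        refine Measurable.mul (by fun_prop) (hH.comp (Measurable.prodMk ?_ measurable_const))
        simp only [polarCoord_symm_apply]
        fun_prop)]
    have : ∀ (r : ℝ), ∫⁻ φ in Ioo (-Real.pi) Real.pi, ENNReal.ofReal (r, φ).1 •
        H (√(a ^ 2 + ((polarCoord.symm (r, φ)).1 ^ 2 + (polarCoord.symm (r, φ)).2 ^ 2))) a =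
        ENNReal.ofReal (2 * Real.pi) * (ENNReal.ofReal r * H (√(a ^ 2 + r ^ 2)) a) := by
      intro r
      have : ∀ φ : ℝ, (polarCoord.symm (r, φ)).1 ^ 2 + (polarCoord.symm (r, φ)).2 ^ 2 = r ^ 2 := by
        intro φ
        simp only [polarCoord_symm_apply]
        nlinarith [Real.sin_sq_add_cos_sq φ]
      simp only [this, smul_eq_mul]
      rw [setLIntegral_const, hpi, mul_comm]
    simp only [this]
    rw [lintegral_const_mul _ hGa]
  -- polar coordinates in a half-plane bounded by the axis
  have step2 : ∫⁻ a : ℝ, ∫⁻ r in Ioi (0 : ℝ), ENNReal.ofReal r * H (√(a ^ 2 + r ^ 2)) a =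
      ∫⁻ ρ in Ioi (0 : ℝ), ∫⁻ θ in Ioo 0 Real.pi,
        ENNReal.ofReal (ρ ^ 2 * Real.sin θ) * H ρ (ρ * Real.cos θ) := by
    have hm : Measurable fun p : ℝ × ℝ =>
        (Ioi (0 : ℝ)).indicator (fun r => ENNReal.ofReal r) p.2 * H (√(p.1 ^ 2 + p.2 ^ 2)) p.1 :=
      (((by fun_prop : Measurable fun r : ℝ => ENNReal.ofReal r).indicator
        measurableSet_Ioi).comp measurable_snd).mul hG
    have e1 : ∫⁻ a : ℝ, ∫⁻ r in Ioi (0 : ℝ), ENNReal.ofReal r * H (√(a ^ 2 + r ^ 2)) a =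
        ∫⁻ p : ℝ × ℝ, (Ioi (0 : ℝ)).indicator (fun r => ENNReal.ofReal r) p.2 *
          H (√(p.1 ^ 2 + p.2 ^ 2)) p.1 := by
      rw [Measure.volume_eq_prod, lintegral_prod _ hm.aemeasurable]
      congr 1
      ext a
      rw [← lintegral_indicator measurableSet_Ioi]
      congr 1
      ext r
      by_cases hr : r ∈ Ioi (0 : ℝ)
      · rw [indicator_of_mem hr, indicator_of_mem hr]
      · rw [indicator_of_notMem hr, indicator_of_notMem hr, zero_mul]
    rw [e1, ← lintegral_comp_polarCoord_symm, polarCoord_target, Measure.volume_eq_prod,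
      ← Measure.prod_restrict, lintegral_prod _ (by
        refine Measurable.aemeasurable ?_
        refine Measurable.mul (by fun_prop) (hm.comp ?_)
        exact continuous_polarCoord_symm.measurable)]
    refine setLIntegral_congr_fun measurableSet_Ioi fun ρ hρ => ?_
    have hρ' : 0 < ρ := hρ
    simp only [polarCoord_symm_apply, smul_eq_mul]
    rw [← lintegral_indicator measurableSet_Ioo, ← lintegral_indicator measurableSet_Ioo]
    congr 1
    ext θ
    by_cases hθ : θ ∈ Ioo 0 Real.pi
    · have hs : 0 < Real.sin θ := Real.sin_pos_of_mem_Ioo hθ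
      rw [indicator_of_mem hθ, indicator_of_mem (show θ ∈ Ioo (-Real.pi) Real.pi from
        ⟨by linarith [hθ.1, Real.pi_pos], hθ.2⟩),
        indicator_of_mem (show ρ * Real.sin θ ∈ Ioi (0 : ℝ) from mul_pos hρ' hs), ← mul_assoc,
        ← ENNReal.ofReal_mul hρ'.le]
      have : √((ρ * Real.cos θ) ^ 2 + (ρ * Real.sin θ) ^ 2) = ρ := by
        rw [show (ρ * Real.cos θ) ^ 2 + (ρ * Real.sin θ) ^ 2 = ρ ^ 2 by
          nlinarith [Real.sin_sq_add_cos_sq θ]]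
        exact Real.sqrt_sq hρ'.le
      rw [this]
      congr 2
      ring
    · rw [indicator_of_notMem hθ]
      by_cases hθ2 : θ ∈ Ioo (-Real.pi) Real.pi
      · have hs : Real.sin θ ≤ 0 := by
          refine Real.sin_nonpos_of_nonpos_of_neg_pi_le ?_ hθ2.1.le
          by_contra! h
          exact hθ ⟨h, hθ2.2⟩
        rw [indicator_of_mem hθ2, indicator_of_notMem, zero_mul, mul_zero]
        simp only [mem_Ioi, not_lt]
        exact mul_nonpos_of_nonneg_of_nonpos hρ'.le hs
      · rw [indicator_of_notMem hθ2]
  have e0 : ∀ x : Vel, H ‖x‖ (x 0) =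
      (fun p : ℝ × ℝ × ℝ => H (√(p.1 ^ 2 + (p.2.1 ^ 2 + p.2.2 ^ 2))) p.1) (x 0, (x 1, x 2)) := by
    intro x
    simp only
    rw [← norm_sq_coords, Real.sqrt_sq (norm_nonneg _)]
  simp only [e0]
  rw [measurePreserving_coords.lintegral_comp hG3, Measure.volume_eq_prod,
    lintegral_prod _ hG3.aemeasurable]
  simp only [step1]
  rw [lintegral_const_mul' _ _ ENNReal.ofReal_ne_top, step2]

theorem angle_isometry (R : Vel ≃ₗᵢ[ℝ] Vel) (x y : Vel) :
    InnerProductGeometry.angle (R x) (R y) = InnerProductGeometry.angle x y :=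
  R.toLinearIsometry.angle_map x y

/-- The angle with a fixed direction has density `2π sin θ` under the surface measure. -/
theorem lintegral_sphere_angle {z : Vel} (hz : z ≠ 0) {F : ℝ → ℝ≥0∞} (hF : Measurable F) :
    ∫⁻ σ, F (InnerProductGeometry.angle z (σ : Vel)) ∂surf =
      ENNReal.ofReal (2 * Real.pi) * ∫⁻ θ in Ioo 0 Real.pi, ENNReal.ofReal (Real.sin θ) * F θ := by
  have hcoord : Measurable fun x : Vel => x 0 := by fun_prop
  -- it suffices to treat the first coordinate direction
  set e : Vel := EuclideanSpace.single 0 1 with he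
  have hnorm : ‖z‖ = ‖‖z‖ • e‖ := by simp [he, norm_smul]
  have hR := Submodule.reflection_sub (v := z) (w := ‖z‖ • e) hnorm
  set R := (ℝ ∙ (z - ‖z‖ • e))ᗮ.reflection with hRdef
  have hz' : 0 < ‖z‖ := norm_pos_iff.2 hz
  have hang : ∀ x : Vel, InnerProductGeometry.angle z x = Real.arccos ((R x) 0 / ‖R x‖) := by
    intro x
    rw [← angle_isometry R z x, hR, InnerProductGeometry.angle_smul_left_of_pos _ _ hz']
    unfold InnerProductGeometry.angle
    simp [he, EuclideanSpace.inner_single_left]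
  have hf : Measurable fun x : Vel => F (Real.arccos (x 0 / ‖x‖)) :=
    hF.comp (Real.continuous_arccos.measurable.comp (hcoord.div measurable_norm))
  simp only [hang]
  rw [lintegral_sphere_isometry hf R, lintegral_sphere_eq hf]
  have hH : Measurable (Function.uncurry fun ρ a : ℝ =>
      (Iio (1 : ℝ)).indicator 1 ρ * F (Real.arccos (a / ρ))) :=
    ((measurable_one.indicator measurableSet_Iio).comp measurable_fst).mul
      (hF.comp (Real.continuous_arccos.measurable.comp (measurable_snd.div measurable_fst)))
  have e1 : ∫⁻ x in Metric.ball (0 : Vel) 1,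
      F (Real.arccos ((‖x‖⁻¹ • x) 0 / ‖‖x‖⁻¹ • x‖)) =
      ∫⁻ x : Vel, (fun ρ a : ℝ => (Iio (1 : ℝ)).indicator 1 ρ * F (Real.arccos (a / ρ)))
        ‖x‖ (x 0) := by
    rw [← lintegral_indicator Metric.isOpen_ball.measurableSet]
    congr 1
    ext x
    by_cases hx : ‖x‖ < 1
    · simp only
      rw [indicator_of_mem (by simpa using hx),
        indicator_of_mem (show ‖x‖ ∈ Iio (1 : ℝ) from hx)]
      simp only [Pi.one_apply, one_mul]
      congr 2
      rcases eq_or_ne x 0 with rfl | hx0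
      · simp
      · have : ‖x‖ ≠ 0 := norm_ne_zero_iff.2 hx0
        rw [norm_smul, norm_inv, norm_norm, inv_mul_cancel₀ this, div_one]
        simp [div_eq_inv_mul]
    · simp only
      rw [indicator_of_notMem (by simpa using hx),
        indicator_of_notMem (show ‖x‖ ∉ Iio (1 : ℝ) from hx), zero_mul]
  rw [e1, lintegral_axisymmetric hH]
  have e2 : ∀ ρ ∈ Ioi (0 : ℝ), ∫⁻ θ in Ioo 0 Real.pi, ENNReal.ofReal (ρ ^ 2 * Real.sin θ) *
      ((Iio (1 : ℝ)).indicator 1 ρ * F (Real.arccos (ρ * Real.cos θ / ρ))) =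
      (Iio (1 : ℝ)).indicator (fun ρ => ENNReal.ofReal (ρ ^ 2)) ρ *
        ∫⁻ θ in Ioo 0 Real.pi, ENNReal.ofReal (Real.sin θ) * F θ := by
    intro ρ hρ
    have hρ' : 0 < ρ := hρ
    have hfin : (Iio (1 : ℝ)).indicator (fun ρ => ENNReal.ofReal (ρ ^ 2)) ρ ≠ ⊤ := by
      by_cases h : ρ ∈ Iio (1 : ℝ)
      · rw [indicator_of_mem h]; exact ENNReal.ofReal_ne_top
      · rw [indicator_of_notMem h]; exact ENNReal.zero_ne_top
    rw [← lintegral_const_mul' _ _ hfin]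
    refine setLIntegral_congr_fun measurableSet_Ioo fun θ hθ => ?_
    rw [mul_div_cancel_left₀ _ hρ'.ne', Real.arccos_cos hθ.1.le hθ.2.le,
      ENNReal.ofReal_mul (sq_nonneg ρ)]
    by_cases h : ρ ∈ Iio (1 : ℝ)
    · rw [indicator_of_mem h, indicator_of_mem h]
      simp only [Pi.one_apply]
      ring
    · rw [indicator_of_notMem h, indicator_of_notMem h]
      ring
  have hsplit : ∫⁻ ρ in Ioi (0 : ℝ), (Iio (1 : ℝ)).indicator (fun ρ => ENNReal.ofReal (ρ ^ 2)) ρ =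
      ENNReal.ofReal (1 / 3) := by
    rw [← lintegral_Ioo_sq, lintegral_indicator measurableSet_Iio,
      Measure.restrict_restrict measurableSet_Iio, inter_comm, Ioi_inter_Iio]
  rw [setLIntegral_congr_fun measurableSet_Ioi e2, lintegral_mul_const _ (by
    exact ((by fun_prop : Measurable fun r : ℝ => ENNReal.ofReal (r ^ 2)).indicator
        measurableSet_Iio)), hsplit]
  have : (3 : ℝ≥0∞) * ENNReal.ofReal (1 / 3) = 1 := by
    rw [show (3 : ℝ≥0∞) = ENNReal.ofReal 3 by simp, ← ENNReal.ofReal_mul (by norm_num)]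
    norm_num
  calc _ = (3 * ENNReal.ofReal (1 / 3)) * (ENNReal.ofReal (2 * Real.pi) *
        ∫⁻ θ in Ioo 0 Real.pi, ENNReal.ofReal (Real.sin θ) * F θ) := by ring
    _ = _ := by rw [this, one_mul]

/-! ### Moments of the momentum transfer over a hemisphere -/

/-- The surface measure on the hemisphere of directions `σ` with `z · σ ≥ 0`. -/
def hemi (z : Vel) : Measure (Metric.sphere (0 : Vel) 1) := surf.restrict {σ | 0 ≤ inner ℝ z (σ : Vel)}

/-- `sin (θ / 2)`, where `θ` is the angle between `z` and `σ`. -/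
def sinHalf (z σ : Vel) : ℝ := Real.sin (InnerProductGeometry.angle z σ / 2)

/-- The momentum transfer `v' - v`, as a function of `z = v - v_*` and `σ`. -/
def transfer (z σ : Vel) : Vel := (1 / 2 : ℝ) • (‖z‖ • σ - z)

theorem measurable_angle : Measurable fun p : Vel × Vel => InnerProductGeometry.angle p.1 p.2 := by
  unfold InnerProductGeometry.angle
  exact Real.continuous_arccos.measurable.comp (by fun_prop)

theorem measurable_sinHalf : Measurable fun p : Vel × Vel => sinHalf p.1 p.2 :=
  Real.continuous_sin.measurable.comp (measurable_angle.div_const 2)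

theorem measurable_transfer : Measurable fun p : Vel × Vel => transfer p.1 p.2 := by
  unfold transfer; fun_prop

theorem measurableSet_hemi (z : Vel) :
    MeasurableSet {σ : Metric.sphere (0 : Vel) 1 | 0 ≤ inner ℝ z (σ : Vel)} :=
  measurableSet_le measurable_const (by fun_prop)

theorem inner_nonneg_iff_angle_le (z σ : Vel) :
    0 ≤ inner ℝ z σ ↔ InnerProductGeometry.angle z σ ≤ Real.pi / 2 := by
  unfold InnerProductGeometry.angle
  rw [Real.arccos_le_pi_div_two]
  constructor
  · intro h; positivity
  · intro h
    rw [← InnerProductGeometry.cos_angle_mul_norm_mul_norm, InnerProductGeometry.cos_angle]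
    positivity

theorem sinHalf_nonneg (z σ : Vel) : 0 ≤ sinHalf z σ :=
  Real.sin_nonneg_of_nonneg_of_le_pi
    (div_nonneg (InnerProductGeometry.angle_nonneg _ _) zero_le_two)
    (by linarith [InnerProductGeometry.angle_le_pi z σ, Real.pi_pos])

theorem sinHalf_le_one (z σ : Vel) : sinHalf z σ ≤ 1 := Real.sin_le_one _

theorem norm_sphere (σ : Metric.sphere (0 : Vel) 1) : ‖(σ : Vel)‖ = 1 := by simp

theorem sinHalf_sq (z σ : Vel) :
    2 * sinHalf z σ ^ 2 = 1 - Real.cos (InnerProductGeometry.angle z σ) := by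
  unfold sinHalf
  have h := Real.cos_sq (InnerProductGeometry.angle z σ / 2)
  have h2 := Real.sin_sq_add_cos_sq (InnerProductGeometry.angle z σ / 2)
  rw [mul_div_cancel₀ _ two_ne_zero] at h
  linarith

theorem inner_eq_sinHalf (z : Vel) (σ : Metric.sphere (0 : Vel) 1) :
    inner ℝ z (σ : Vel) = ‖z‖ * (1 - 2 * sinHalf z σ ^ 2) := by
  rw [sinHalf_sq, ← InnerProductGeometry.cos_angle_mul_norm_mul_norm z (σ : Vel), norm_sphere]
  ring

theorem norm_transfer (z : Vel) (σ : Metric.sphere (0 : Vel) 1) :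
    ‖transfer z σ‖ = ‖z‖ * sinHalf z σ := by
  have h : ‖transfer z σ‖ ^ 2 = (‖z‖ * sinHalf z σ) ^ 2 := by
    unfold transfer
    rw [norm_smul, mul_pow, norm_sub_sq_real, norm_smul, inner_smul_left, real_inner_comm,
      inner_eq_sinHalf, norm_sphere, norm_norm]
    norm_num
    ring
  exact (sq_eq_sq₀ (norm_nonneg _) (mul_nonneg (norm_nonneg _) (sinHalf_nonneg _ _))).1 h

theorem norm_transfer_le (z : Vel) (σ : Metric.sphere (0 : Vel) 1) : ‖transfer z σ‖ ≤ ‖z‖ := by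
  rw [norm_transfer]
  exact mul_le_of_le_one_right (norm_nonneg _) (sinHalf_le_one _ _)

theorem inner_transfer (z : Vel) (σ : Metric.sphere (0 : Vel) 1) :
    inner ℝ z (transfer z σ) = -(‖z‖ ^ 2 * sinHalf z σ ^ 2) := by
  unfold transfer
  rw [inner_smul_right, inner_sub_right, inner_smul_right, inner_eq_sinHalf,
    real_inner_self_eq_norm_sq]
  ring

/-- Scalar moments of a function of `sin (θ / 2)` over the hemisphere, by the substitution
`r = λ sin (θ / 2)`; the largest angle `θ = π / 2` corresponds to `r = λ / √2`. -/
theorem lintegral_hemi {z : Vel} (hz : z ≠ 0) {lam : ℝ} (hlam : 0 < lam) {φ : ℝ → ℝ}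
    (hφ : Measurable φ) {G : ℝ → ℝ≥0∞} (hG : Measurable G) :
    ∫⁻ σ, ENNReal.ofReal (φ (lam * sinHalf z σ) ^ 2) * G (sinHalf z σ) ∂(hemi z) =
      ENNReal.ofReal (8 * Real.pi / lam ^ 2) *
        ∫⁻ r in Ioo 0 (lam / √2), ENNReal.ofReal (φ r ^ 2 * r) * G (r / lam) := by
  have hpi := Real.pi_pos
  set F : ℝ → ℝ≥0∞ := (Iic (Real.pi / 2)).indicator fun θ =>
    ENNReal.ofReal (φ (lam * Real.sin (θ / 2)) ^ 2) * G (Real.sin (θ / 2)) with hFdef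
  have hsin : Measurable fun θ : ℝ => Real.sin (θ / 2) := by fun_prop
  have hF : Measurable F := (Measurable.mul
    ((hφ.comp (measurable_const.mul hsin)).pow_const 2).ennreal_ofReal (hG.comp hsin)).indicator
      measurableSet_Iic
  have e1 : ∫⁻ σ, ENNReal.ofReal (φ (lam * sinHalf z σ) ^ 2) * G (sinHalf z σ) ∂(hemi z) =
      ∫⁻ σ, F (InnerProductGeometry.angle z (σ : Vel)) ∂surf := by
    rw [hemi, ← lintegral_indicator (measurableSet_hemi z)]
    congr 1
    ext σ
    by_cases h : 0 ≤ inner ℝ z (σ : Vel)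
    · rw [indicator_of_mem (by exact h), hFdef, indicator_of_mem
        (by exact inner_nonneg_iff_angle_le z σ |>.1 h)]
      rfl
    · rw [indicator_of_notMem (by exact h), hFdef, indicator_of_notMem
        (fun h' : InnerProductGeometry.angle z σ ∈ Iic (Real.pi / 2) => h (inner_nonneg_iff_angle_le z σ |>.2 h'))]
  rw [e1, lintegral_sphere_angle hz hF]
  have e2 : ∫⁻ θ in Ioo 0 Real.pi, ENNReal.ofReal (Real.sin θ) * F θ =
      ∫⁻ θ in Ioo 0 (Real.pi / 2), ENNReal.ofReal (Real.sin θ) *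
        (ENNReal.ofReal (φ (lam * Real.sin (θ / 2)) ^ 2) * G (Real.sin (θ / 2))) := by
    rw [setLIntegral_congr (Ioo_ae_eq_Ioc (a := (0 : ℝ)) (b := Real.pi / 2)),
      ← lintegral_indicator measurableSet_Ioo, ← lintegral_indicator measurableSet_Ioc]
    congr 1
    ext θ
    by_cases h : θ ∈ Ioc 0 (Real.pi / 2)
    · rw [indicator_of_mem h, indicator_of_mem (show θ ∈ Ioo 0 Real.pi from
        ⟨h.1, by linarith [h.2]⟩), hFdef, indicator_of_mem (by exact h.2)]
    · rw [indicator_of_notMem h]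
      by_cases h2 : θ ∈ Ioo 0 Real.pi
      · rw [indicator_of_mem h2, hFdef, indicator_of_notMem (fun h3 : θ ∈ Iic (Real.pi / 2) =>
          h ⟨h2.1, h3⟩), mul_zero]
      · rw [indicator_of_notMem h2]
  have himg : (fun θ => lam * Real.sin (θ / 2)) '' Ioo 0 (Real.pi / 2) = Ioo 0 (lam / √2) := by
    have hs4 : Real.sin (Real.pi / 4) = 1 / √2 := by
      rw [Real.sin_pi_div_four, div_eq_div_iff (by norm_num) (by positivity)]
      norm_num
    ext r
    constructor
    · rintro ⟨θ, hθ, rfl⟩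
      have h1 : 0 < Real.sin (θ / 2) :=
        Real.sin_pos_of_pos_of_lt_pi (by linarith [hθ.1]) (by linarith [hθ.2])
      have h2 : Real.sin (θ / 2) < Real.sin (Real.pi / 4) :=
        Real.sin_lt_sin_of_lt_of_le_pi_div_two (by linarith [hθ.1]) (by linarith)
          (by linarith [hθ.2])
      rw [hs4] at h2
      refine ⟨by positivity, ?_⟩
      rw [div_eq_mul_one_div]
      exact mul_lt_mul_of_pos_left h2 hlam
    · rintro ⟨h0, h1⟩
      have hr0 : 0 < r / lam := by positivity
      have hr1 : r / lam < 1 / √2 := by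
        rw [div_lt_iff₀ hlam, one_div, inv_mul_eq_div]
        exact h1
      rw [← hs4] at hr1
      have hr2 : r / lam ≤ 1 := hr1.le.trans (Real.sin_le_one _)
      refine ⟨2 * Real.arcsin (r / lam), ⟨by linarith [Real.arcsin_pos.2 hr0], ?_⟩, ?_⟩
      · have : Real.arcsin (r / lam) < Real.pi / 4 :=
          (Real.arcsin_lt_iff_lt_sin ⟨by linarith, hr2⟩ ⟨by linarith, by linarith⟩).2 hr1
        linarith
      · simp only
        rw [mul_div_cancel_left₀ _ two_ne_zero, Real.sin_arcsin (by linarith) hr2]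
        field_simp
  have hinj : InjOn (fun θ => lam * Real.sin (θ / 2)) (Ioo 0 (Real.pi / 2)) := by
    intro a ha b hb hab
    have := mul_left_cancel₀ hlam.ne' hab
    have := Real.injOn_sin ⟨by linarith [ha.1], by linarith [ha.2]⟩
      ⟨by linarith [hb.1], by linarith [hb.2]⟩ this
    linarith
  have hcv := lintegral_image_eq_lintegral_abs_deriv_mul (s := Ioo 0 (Real.pi / 2))
    (f := fun θ => lam * Real.sin (θ / 2)) (f' := fun θ => lam * (Real.cos (θ / 2) * (1 / 2)))
    measurableSet_Ioo (fun θ _ => (((hasDerivAt_id θ).div_const 2).sin.const_mul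
      lam).hasDerivWithinAt) hinj
    (fun r => ENNReal.ofReal (4 / lam ^ 2) * (ENNReal.ofReal (φ r ^ 2 * r) * G (r / lam)))
  rw [himg, lintegral_const_mul' _ _ ENNReal.ofReal_ne_top] at hcv
  rw [e2, show 8 * Real.pi / lam ^ 2 = 2 * Real.pi * (4 / lam ^ 2) by ring,
    ENNReal.ofReal_mul (p := 2 * Real.pi) (by positivity), mul_assoc, hcv]
  congr 1
  refine setLIntegral_congr_fun measurableSet_Ioo fun θ hθ => ?_
  have hs : 0 < Real.sin (θ / 2) :=
    Real.sin_pos_of_pos_of_lt_pi (by linarith [hθ.1]) (by linarith [hθ.2])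
  have hc : 0 < Real.cos (θ / 2) := Real.cos_pos_of_mem_Ioo
    ⟨by linarith [hθ.1], by linarith [hθ.2]⟩
  have hst : Real.sin θ = 2 * Real.sin (θ / 2) * Real.cos (θ / 2) := by
    rw [← Real.sin_two_mul]; congr 1; ring
  rw [mul_div_cancel_left₀ _ hlam.ne', ← mul_assoc, ← mul_assoc, ← mul_assoc,
    ← ENNReal.ofReal_mul (by rw [hst]; positivity), ← ENNReal.ofReal_mul (abs_nonneg _),
    ← ENNReal.ofReal_mul (by positivity), abs_of_pos (by positivity), hst]
  congr 2
  field_simp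
  ring

theorem measurePreserving_hemi {z : Vel} (R : Vel ≃ₗᵢ[ℝ] Vel) (hR : R z = z) :
    MeasurePreserving (sphereMap R) (hemi z) (hemi z) := by
  have h := (measurePreserving_sphereMap R).restrict_preimage (measurableSet_hemi z)
  have e : sphereMap R ⁻¹' {σ : Metric.sphere (0 : Vel) 1 | 0 ≤ inner ℝ z (σ : Vel)} =
      {σ : Metric.sphere (0 : Vel) 1 | 0 ≤ inner ℝ z (σ : Vel)} := by
    ext σ
    simp only [mem_preimage, mem_ofPred_eq, sphereMap]
    rw [← R.inner_map_map z σ, hR]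
  rw [e] at h
  exact h

theorem integral_hemi_isometry {z : Vel} (R : Vel ≃ₗᵢ[ℝ] Vel) (hR : R z = z) {f : Vel → ℝ}
    (hf : Measurable f) : ∫ σ, f (R σ) ∂(hemi z) = ∫ σ, f σ ∂(hemi z) := by
  have h := (measurePreserving_hemi R hR)
  have h2 := integral_map (f := fun σ : Metric.sphere (0 : Vel) 1 => f σ) (μ := hemi z)
    h.measurable.aemeasurable (hf.comp measurable_subtype_coe).aestronglyMeasurable
  rw [h.map_eq] at h2
  exact h2.symm

theorem inner_reflection_right (K : Submodule ℝ Vel) (x y : Vel) :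
    inner ℝ x (Kᗮ.reflection y) = inner ℝ (Kᗮ.reflection x) y := by
  rw [← LinearIsometryEquiv.inner_map_map Kᗮ.reflection x, Submodule.reflection_reflection]

/-- An orthonormal basis whose first vector is the direction of `z`. -/
theorem exists_orthonormalBasis_direction {z : Vel} (hz : z ≠ 0) :
    ∃ b : OrthonormalBasis (Fin 3) ℝ Vel, b 0 = ‖z‖⁻¹ • z := by
  have hv : Orthonormal ℝ (({0} : Set (Fin 3)).domRestrict fun _ : Fin 3 => ‖z‖⁻¹ • z) := by
    refine ⟨fun i => ?_, fun i j hij => absurd (Subsingleton.elim i j) hij⟩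
    change ‖‖z‖⁻¹ • z‖ = 1
    rw [norm_smul, norm_inv, norm_norm, inv_mul_cancel₀ (norm_ne_zero_iff.2 hz)]
  obtain ⟨b, hb⟩ := hv.exists_orthonormalBasis_extension_of_card_eq (by simp)
  exact ⟨b, hb 0 rfl⟩

section Moments

variable {z : Vel} (hz : z ≠ 0) {β : ℝ → ℝ} (hβ : Measurable β)
  (hint : Integrable (fun σ : Metric.sphere (0 : Vel) 1 => β (sinHalf z σ)) (hemi z))

theorem Integrable.mul_bounded_hemi {f : Metric.sphere (0 : Vel) 1 → ℝ}
    (hf : Integrable f (hemi z)) {g : Vel → ℝ} (hg : Measurable g) {C : ℝ}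
    (hC : ∀ σ : Metric.sphere (0 : Vel) 1, |g σ| ≤ C) :
    Integrable (fun σ => f σ * g σ) (hemi z) :=
  hf.mul_bdd (c := C) (hg.comp measurable_subtype_coe).aestronglyMeasurable
    (Filter.Eventually.of_forall fun σ => by simpa using hC σ)

theorem measurable_sinHalf_right (z : Vel) : Measurable fun σ : Vel => sinHalf z σ :=
  Measurable.comp (g := fun p : Vel × Vel => sinHalf p.1 p.2) (f := fun σ : Vel => (z, σ))
    measurable_sinHalf (by fun_prop)

theorem measurable_transfer_right (z : Vel) : Measurable fun σ : Vel => transfer z σ :=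
  Measurable.comp (g := fun p : Vel × Vel => transfer p.1 p.2) (f := fun σ : Vel => (z, σ))
    measurable_transfer (by fun_prop)

theorem sinHalf_isometry (R : Vel ≃ₗᵢ[ℝ] Vel) (hR : R z = z) (σ : Vel) :
    sinHalf z (R σ) = sinHalf z σ := by
  unfold sinHalf
  conv_lhs => rw [← hR]
  rw [angle_isometry]

theorem transfer_isometry (R : Vel ≃ₗᵢ[ℝ] Vel) (hR : R z = z) (σ : Vel) :
    transfer z (R σ) = R (transfer z σ) := by
  unfold transfer
  rw [map_smul, map_sub, map_smul, hR]

theorem reflection_fix {b : OrthonormalBasis (Fin 3) ℝ Vel} (hb : b 0 = ‖z‖⁻¹ • z) (hz : z ≠ 0)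
    {w : Vel} (hw : inner ℝ w (b 0) = 0) : (ℝ ∙ w)ᗮ.reflection z = z := by
  rw [Submodule.reflection_eq_self_iff, Submodule.mem_orthogonal_singleton_iff_inner_right]
  rw [hb, inner_smul_right] at hw
  exact (mul_eq_zero.1 hw).resolve_left (inv_ne_zero (norm_ne_zero_iff.2 hz))

include hβ hz in
/-- The components of the momentum transfer orthogonal to `z` have mean zero: the reflection that
reverses `b j` fixes `z`. -/
theorem integral_hemi_odd {b : OrthonormalBasis (Fin 3) ℝ Vel} (hb : b 0 = ‖z‖⁻¹ • z) {j : Fin 3}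
    (hj : j ≠ 0) :
    ∫ σ, β (sinHalf z σ) * inner ℝ (b j) (transfer z σ) ∂(hemi z) = 0 := by
  have hR := reflection_fix hb hz (w := b j) (b.orthonormal.2 hj)
  have h := integral_hemi_isometry (ℝ ∙ b j)ᗮ.reflection hR
    (f := fun σ => β (sinHalf z σ) * inner ℝ (b j) (transfer z σ))
    ((hβ.comp (measurable_sinHalf_right z)).mul
      (measurable_const.inner (measurable_transfer_right z)))
  simp only [sinHalf_isometry _ hR, transfer_isometry _ hR, inner_reflection_right,
    Submodule.reflection_orthogonalComplement_singleton_eq_neg, inner_neg_left, mul_neg,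
    integral_neg] at h
  linarith

include hβ hz in
/-- The mixed second moments vanish, by the same reflection as in `integral_hemi_odd`. -/
theorem integral_hemi_offdiag {b : OrthonormalBasis (Fin 3) ℝ Vel} (hb : b 0 = ‖z‖⁻¹ • z)
    {i j : Fin 3} (hj : j ≠ 0) (hij : i ≠ j) :
    ∫ σ, β (sinHalf z σ) * (inner ℝ (b i) (transfer z σ) * inner ℝ (b j) (transfer z σ))
      ∂(hemi z) = 0 := by
  have hR := reflection_fix hb hz (w := b j) (b.orthonormal.2 hj)
  have hi : (ℝ ∙ b j)ᗮ.reflection (b i) = b i := by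
    rw [Submodule.reflection_eq_self_iff, Submodule.mem_orthogonal_singleton_iff_inner_right]
    exact b.orthonormal.2 hij.symm
  have h := integral_hemi_isometry (ℝ ∙ b j)ᗮ.reflection hR
    (f := fun σ => β (sinHalf z σ) * (inner ℝ (b i) (transfer z σ) * inner ℝ (b j) (transfer z σ)))
    ((hβ.comp (measurable_sinHalf_right z)).mul
      ((measurable_const.inner (measurable_transfer_right z)).mul
        (measurable_const.inner (measurable_transfer_right z))))
  simp only [sinHalf_isometry _ hR, transfer_isometry _ hR, inner_reflection_right, hi,
    Submodule.reflection_orthogonalComplement_singleton_eq_neg, inner_neg_left, mul_neg,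
    integral_neg] at h
  linarith

include hβ hz in
/-- The two second moments orthogonal to `z` agree: the reflection that exchanges `b 1` and `b 2`
fixes `z`. -/
theorem integral_hemi_diag_eq {b : OrthonormalBasis (Fin 3) ℝ Vel} (hb : b 0 = ‖z‖⁻¹ • z) :
    ∫ σ, β (sinHalf z σ) * inner ℝ (b 1) (transfer z σ) ^ 2 ∂(hemi z) =
      ∫ σ, β (sinHalf z σ) * inner ℝ (b 2) (transfer z σ) ^ 2 ∂(hemi z) := by
  have hw : inner ℝ (b 1 - b 2) (b 0) = 0 := by
    rw [inner_sub_left, b.orthonormal.2 (by decide), b.orthonormal.2 (by decide), sub_zero]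
  have hR := reflection_fix hb hz hw
  have h12 : (ℝ ∙ (b 1 - b 2))ᗮ.reflection (b 1) = b 2 :=
    Submodule.reflection_sub (by rw [b.orthonormal.1, b.orthonormal.1])
  have h := integral_hemi_isometry (ℝ ∙ (b 1 - b 2))ᗮ.reflection hR
    (f := fun σ => β (sinHalf z σ) * inner ℝ (b 1) (transfer z σ) ^ 2)
    ((hβ.comp (measurable_sinHalf_right z)).mul
      ((measurable_const.inner (measurable_transfer_right z)).pow_const 2))
  simp only [sinHalf_isometry _ hR, transfer_isometry _ hR, inner_reflection_right, h12] at h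
  exact h.symm

theorem abs_inner_transfer_le (z y : Vel) (σ : Metric.sphere (0 : Vel) 1) :
    |inner ℝ y (transfer z σ)| ≤ ‖y‖ * ‖z‖ :=
  (abs_real_inner_le_norm _ _).trans
    (mul_le_mul_of_nonneg_left (norm_transfer_le z σ) (norm_nonneg _))

include hβ hz hint in
/-- First moments of the momentum transfer. Only the component along `z` survives, and
`k · z = -|z|² sin² (θ / 2)` for the transfer `k`. -/
theorem integral_hemi_transfer (y : Vel) :
    ∫ σ, β (sinHalf z σ) * inner ℝ y (transfer z σ) ∂(hemi z) =
      -(inner ℝ y z * ∫ σ, β (sinHalf z σ) * sinHalf z σ ^ 2 ∂(hemi z)) := by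
  obtain ⟨b, hb⟩ := exists_orthonormalBasis_direction hz
  have hz' : ‖z‖ ≠ 0 := norm_ne_zero_iff.2 hz
  have hi : ∀ i, Integrable (fun σ : Metric.sphere (0 : Vel) 1 =>
      β (sinHalf z σ) * inner ℝ (b i) (transfer z σ)) (hemi z) := fun i =>
    Integrable.mul_bounded_hemi hint (measurable_const.inner (measurable_transfer_right z))
      (abs_inner_transfer_le z (b i))
  have hexp : ∀ k : Vel, inner ℝ y k = ∑ i, inner ℝ y (b i) * inner ℝ (b i) k := fun k =>
    (b.sum_inner_mul_inner y k).symm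
  simp only [hexp (transfer z _), Finset.mul_sum]
  rw [integral_finsetSum _ fun i _ => by
    simpa [mul_left_comm] using (hi i).const_mul (inner ℝ y (b i))]
  rw [Fin.sum_univ_three]
  have hz0 : ∀ σ : Metric.sphere (0 : Vel) 1, inner ℝ (b 0) (transfer z σ) =
      -(‖z‖ * sinHalf z σ ^ 2) := fun σ => by
    rw [hb, inner_smul_left, inner_transfer]
    simp only [conj_trivial]
    field_simp
  simp only [mul_left_comm _ (inner ℝ y (b _))]
  simp only [integral_const_mul, integral_hemi_odd hz hβ hb (show (1 : Fin 3) ≠ 0 by decide),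
    integral_hemi_odd hz hβ hb (show (2 : Fin 3) ≠ 0 by decide), hz0, mul_zero, add_zero]
  rw [hb, inner_smul_right]
  simp only [mul_neg, integral_neg, mul_left_comm _ ‖z‖, integral_const_mul]
  field_simp

include hβ hz hint in
/-- Second moments of the momentum transfer: the component along `z` is explicit, and the two
orthogonal ones share the remainder of `|k|² = |z|² sin² (θ / 2)` equally. -/
theorem integral_hemi_transfer_transfer (y y' : Vel) :
    ∫ σ, β (sinHalf z σ) * (inner ℝ y (transfer z σ) * inner ℝ y' (transfer z σ)) ∂(hemi z) =
      inner ℝ y z * inner ℝ y' z * ∫ σ, β (sinHalf z σ) * sinHalf z σ ^ 4 ∂(hemi z) +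
      (‖z‖ ^ 2 * inner ℝ y y' - inner ℝ y z * inner ℝ y' z) / 2 *
        ((∫ σ, β (sinHalf z σ) * sinHalf z σ ^ 2 ∂(hemi z)) -
          ∫ σ, β (sinHalf z σ) * sinHalf z σ ^ 4 ∂(hemi z)) := by
  obtain ⟨b, hb⟩ := exists_orthonormalBasis_direction hz
  have hz' : ‖z‖ ≠ 0 := norm_ne_zero_iff.2 hz
  have hi : ∀ i j, Integrable (fun σ : Metric.sphere (0 : Vel) 1 => β (sinHalf z σ) *
      (inner ℝ (b i) (transfer z σ) * inner ℝ (b j) (transfer z σ))) (hemi z) := fun i j => by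
    refine Integrable.mul_bounded_hemi hint (C := (‖b i‖ * ‖z‖) * (‖b j‖ * ‖z‖))
      (g := fun σ => inner ℝ (b i) (transfer z σ) * inner ℝ (b j) (transfer z σ))
      ((measurable_const.inner (measurable_transfer_right z)).mul
      (measurable_const.inner (measurable_transfer_right z))) fun σ => ?_
    rw [abs_mul]
    exact mul_le_mul (abs_inner_transfer_le z (b i) σ) (abs_inner_transfer_le z (b j) σ)
      (abs_nonneg _) (by positivity)
  have hs : ∀ n : ℕ, Integrable (fun σ : Metric.sphere (0 : Vel) 1 =>
      β (sinHalf z σ) * sinHalf z σ ^ n) (hemi z) := fun n =>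
    Integrable.mul_bounded_hemi hint (g := fun σ => sinHalf z σ ^ n)
      ((measurable_sinHalf_right z).pow_const n) (C := 1) fun σ => by
      rw [abs_of_nonneg (pow_nonneg (sinHalf_nonneg _ _) _)]
      exact pow_le_one₀ (sinHalf_nonneg _ _) (sinHalf_le_one _ _)
  have hz0 : ∀ σ : Metric.sphere (0 : Vel) 1, inner ℝ (b 0) (transfer z σ) =
      -(‖z‖ * sinHalf z σ ^ 2) := fun σ => by
    rw [hb, inner_smul_left, inner_transfer]
    simp only [conj_trivial]
    field_simp
  set M : Fin 3 → Fin 3 → ℝ := fun i j => ∫ σ, β (sinHalf z σ) *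
    (inner ℝ (b i) (transfer z σ) * inner ℝ (b j) (transfer z σ)) ∂(hemi z) with hM
  set m2 := ∫ σ, β (sinHalf z σ) * sinHalf z σ ^ 2 ∂(hemi z) with hm2
  set m4 := ∫ σ, β (sinHalf z σ) * sinHalf z σ ^ 4 ∂(hemi z) with hm4
  have hM00 : M 0 0 = ‖z‖ ^ 2 * m4 := by
    simp only [hM, hm4, hz0, ← integral_const_mul]
    congr 1; ext σ; ring
  have hMod : ∀ i j, i ≠ j → M i j = 0 := by
    intro i j hij
    by_cases hj : j = 0
    · have hi0 : i ≠ 0 := fun h => hij (h.trans hj.symm)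
      have := integral_hemi_offdiag hz hβ hb hi0 (Ne.symm hij)
      simp only [hM, mul_comm (inner ℝ (b i) _)]
      exact this
    · exact integral_hemi_offdiag hz hβ hb hj hij
  have hM12 : M 1 1 = M 2 2 := by
    simpa only [hM, sq] using integral_hemi_diag_eq hz hβ hb
  have htr : M 0 0 + M 1 1 + M 2 2 = ‖z‖ ^ 2 * m2 := by
    simp only [hM, hm2]
    rw [← integral_add (hi 0 0) (hi 1 1), ← integral_const_mul]
    refine (integral_add ((hi 0 0).add (hi 1 1)) (hi 2 2)).symm.trans ?_
    congr 1
    ext σ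
    have h1 : ‖transfer z σ‖ ^ 2 = ∑ i, inner ℝ (transfer z σ) (b i) * inner ℝ (b i) (transfer z σ) := by
      rw [b.sum_inner_mul_inner, real_inner_self_eq_norm_sq]
    rw [norm_transfer, Fin.sum_univ_three] at h1
    simp only [real_inner_comm (b _)] at h1
    simp only [Pi.add_apply]
    linear_combination (-β (sinHalf z σ)) * h1
  have hM11 : M 1 1 = ‖z‖ ^ 2 * (m2 - m4) / 2 := by linarith
  have hM22 : M 2 2 = ‖z‖ ^ 2 * (m2 - m4) / 2 := by linarith
  have hexp : ∀ y k : Vel, inner ℝ y k = ∑ i, inner ℝ y (b i) * inner ℝ (b i) k := fun y k =>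
    (b.sum_inner_mul_inner y k).symm
  have hLHS : ∫ σ, β (sinHalf z σ) * (inner ℝ y (transfer z σ) * inner ℝ y' (transfer z σ))
      ∂(hemi z) = ∑ i, ∑ j, inner ℝ y (b i) * inner ℝ y' (b j) * M i j := by
    simp only [hM, ← integral_const_mul]
    have e : ∀ i, ∑ j, ∫ σ : Metric.sphere (0 : Vel) 1, inner ℝ y (b i) * inner ℝ y' (b j) *
        (β (sinHalf z σ) * (inner ℝ (b i) (transfer z σ) * inner ℝ (b j) (transfer z σ)))
          ∂(hemi z) =
        ∫ σ : Metric.sphere (0 : Vel) 1, ∑ j, inner ℝ y (b i) * inner ℝ y' (b j) *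
        (β (sinHalf z σ) * (inner ℝ (b i) (transfer z σ) * inner ℝ (b j) (transfer z σ)))
          ∂(hemi z) := fun i =>
      (integral_finsetSum _ fun j _ => (hi i j).const_mul _).symm
    simp only [e]
    rw [← integral_finsetSum _ fun i _ => integrable_finsetSum _ fun j _ => (hi i j).const_mul _]
    congr 1
    ext σ
    rw [hexp y (transfer z σ), hexp y' (transfer z σ), Finset.sum_mul_sum, Finset.mul_sum]
    refine Finset.sum_congr rfl fun i _ => ?_
    rw [Finset.mul_sum]
    exact Finset.sum_congr rfl fun j _ => by ring
  rw [hLHS]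
  simp only [Fin.sum_univ_three]
  rw [hMod 0 1 (by decide), hMod 0 2 (by decide), hMod 1 0 (by decide), hMod 1 2 (by decide),
    hMod 2 0 (by decide), hMod 2 1 (by decide), hM00, hM11, hM22]
  have hyy := hexp y y'
  simp only [Fin.sum_univ_three, real_inner_comm y' (b _)] at hyy
  have hy0 : ∀ y : Vel, inner ℝ y z = ‖z‖ * inner ℝ y (b 0) := fun y => by
    rw [hb, inner_smul_right]
    field_simp
  rw [hyy, hy0 y, hy0 y']
  ring
end Moments

/-! ### Moments of the collision kernel and their grazing limits -/

/-- The collision kernel as a function of `z = v - v_*` and `σ`. -/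
def collB (φ : ℝ → ℝ) (ε : ℝ) (z σ : Vel) : ℝ :=
  kernelB1 φ ε ‖z‖ (InnerProductGeometry.angle z σ)

theorem collB_eq (φ : ℝ → ℝ) (ε : ℝ) (z σ : Vel) :
    collB φ ε z σ = ε⁻¹ ^ 4 * ‖z‖ * φ (ε⁻¹ * ‖z‖ * sinHalf z σ) ^ 2 := rfl

theorem collB_nonneg (φ : ℝ → ℝ) {ε : ℝ} (hε : 0 < ε) (z σ : Vel) : 0 ≤ collB φ ε z σ := by
  rw [collB_eq]; positivity

theorem measurable_collB {φ : ℝ → ℝ} (hφ : Measurable φ) (ε : ℝ) :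
    Measurable fun p : Vel × Vel => collB φ ε p.1 p.2 := by
  simp only [collB_eq]
  have := measurable_sinHalf
  refine (by fun_prop : Measurable fun p : Vel × Vel => ε⁻¹ ^ 4 * ‖p.1‖).mul
    ((hφ.comp (Measurable.mul (by fun_prop) this)).pow_const 2)

theorem momentI_nonneg (φ : ℝ → ℝ) (a : ℝ) : 0 ≤ momentI φ a :=
  setIntegral_nonneg measurableSet_Ioi fun _ hr =>
    mul_nonneg (sq_nonneg _) (Real.rpow_nonneg (le_of_lt hr) _)

theorem FiniteMomentI.lintegral_eq {φ : ℝ → ℝ} {a : ℝ} (h : FiniteMomentI φ a) :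
    ∫⁻ r in Ioi (0 : ℝ), ENNReal.ofReal (φ r ^ 2 * r ^ a) = ENNReal.ofReal (momentI φ a) := by
  rw [momentI, ofReal_integral_eq_lintegral_ofReal h]
  filter_upwards [ae_restrict_mem measurableSet_Ioi] with r hr
  exact mul_nonneg (sq_nonneg _) (Real.rpow_nonneg (le_of_lt hr) _)

/-- Moments of intermediate order are finite, since `r ^ a ≤ 1 + r ^ 3` for `0 ≤ a ≤ 3`. -/
theorem FiniteMomentI.between {φ : ℝ → ℝ} (hφ : Measurable φ) (h0 : FiniteMomentI φ 0)
    (h3 : FiniteMomentI φ 3) {a : ℝ} (ha0 : 0 ≤ a) (ha3 : a ≤ 3) : FiniteMomentI φ a := by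
  have hsum := Integrable.add h0 h3
  refine Integrable.mono' hsum
    ((hφ.pow_const 2).mul (measurable_id.pow_const a)).aestronglyMeasurable ?_
  filter_upwards [ae_restrict_mem measurableSet_Ioi] with r hr
  have hr' : 0 < r := hr
  rw [Real.norm_of_nonneg (by positivity)]
  simp only [Pi.add_apply, ← mul_add]
  refine mul_le_mul_of_nonneg_left ?_ (sq_nonneg _)
  rw [Real.rpow_zero]
  rcases le_total r 1 with h1 | h1
  · have := Real.rpow_le_one hr'.le h1 ha0
    have : 0 ≤ r ^ (3 : ℝ) := by positivity
    linarith
  · have := Real.rpow_le_rpow_of_exponent_le h1 ha3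
    linarith

section
variable {φ : ℝ → ℝ} {ε : ℝ} {z : Vel}

/-- The substitution `r = ε⁻¹ |z| sin (θ / 2)` in integrals of the collision kernel. -/
theorem lintegral_collB_mul (hφ : Measurable φ) (hε : 0 < ε) (hz : z ≠ 0) {G : ℝ → ℝ≥0∞}
    (hG : Measurable G) :
    ∫⁻ σ, ENNReal.ofReal (collB φ ε z σ) * G (sinHalf z σ) ∂(hemi z) =
      ENNReal.ofReal (8 * Real.pi * ε⁻¹ ^ 2 * ‖z‖⁻¹) *
        ∫⁻ r in Ioo 0 (ε⁻¹ * ‖z‖ / √2), ENNReal.ofReal (φ r ^ 2 * r) * G (r / (ε⁻¹ * ‖z‖)) := by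
  have hz' : 0 < ‖z‖ := norm_pos_iff.2 hz
  have hlam : 0 < ε⁻¹ * ‖z‖ := by positivity
  have h := lintegral_hemi hz hlam hφ hG
  have e : ∀ σ : Metric.sphere (0 : Vel) 1, ENNReal.ofReal (collB φ ε z σ) * G (sinHalf z σ) =
      ENNReal.ofReal (ε⁻¹ ^ 4 * ‖z‖) *
        (ENNReal.ofReal (φ (ε⁻¹ * ‖z‖ * sinHalf z σ) ^ 2) * G (sinHalf z σ)) := fun σ => by
    rw [collB_eq, ENNReal.ofReal_mul (by positivity), mul_assoc]
  simp only [e]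
  rw [lintegral_const_mul' _ _ ENNReal.ofReal_ne_top, h, ← mul_assoc,
    ← ENNReal.ofReal_mul (by positivity)]
  congr 2
  have := Real.pi_pos
  field_simp

/-- Moments of the momentum transfer under the collision kernel. -/
theorem lintegral_collB_transfer_le (hφ : Measurable φ) (hε : 0 < ε) (hz : z ≠ 0) {a : ℝ}
    (hfin : FiniteMomentI φ (1 + a)) :
    ∫⁻ σ, ENNReal.ofReal (collB φ ε z σ) * ENNReal.ofReal (‖transfer z σ‖ ^ a) ∂(hemi z) ≤
      ENNReal.ofReal (8 * Real.pi * ε ^ (a - 2) * momentI φ (1 + a) * ‖z‖⁻¹) := by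
  have hz' : 0 < ‖z‖ := norm_pos_iff.2 hz
  have hpi := Real.pi_pos
  have h := lintegral_collB_mul hφ hε hz (G := fun s => ENNReal.ofReal ((‖z‖ * s) ^ a))
    (by fun_prop)
  simp only [← norm_transfer] at h
  rw [h]
  calc _ ≤ ENNReal.ofReal (8 * Real.pi * ε⁻¹ ^ 2 * ‖z‖⁻¹) *
        ∫⁻ r in Ioi (0 : ℝ), ENNReal.ofReal (ε ^ a) * ENNReal.ofReal (φ r ^ 2 * r ^ (1 + a)) := by
        refine mul_le_mul_right ?_ _
        refine (setLIntegral_mono' measurableSet_Ioo fun r hr => ?_).trans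
          (lintegral_mono_set (Ioo_subset_Ioi_self))
        rw [← ENNReal.ofReal_mul (by have := hr.1; positivity),
          ← ENNReal.ofReal_mul (by positivity)]
        refine ENNReal.ofReal_le_ofReal (le_of_eq ?_)
        have : ‖z‖ * (r / (ε⁻¹ * ‖z‖)) = ε * r := by field_simp
        rw [this, Real.mul_rpow hε.le hr.1.le, Real.rpow_add hr.1, Real.rpow_one]
        ring
    _ = _ := by
        rw [lintegral_const_mul' _ _ ENNReal.ofReal_ne_top, hfin.lintegral_eq,
          ← ENNReal.ofReal_mul (by positivity), ← ENNReal.ofReal_mul (by positivity)]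
        congr 1
        rw [Real.rpow_sub hε, Real.rpow_two]
        field_simp

theorem integrable_collB (hφ : Measurable φ) (hε : 0 < ε) (hz : z ≠ 0) (h1 : FiniteMomentI φ 1) :
    Integrable (fun σ : Metric.sphere (0 : Vel) 1 => collB φ ε z σ) (hemi z) := by
  have hm : Measurable fun σ : Metric.sphere (0 : Vel) 1 => collB φ ε z σ :=
    Measurable.comp (g := fun p : Vel × Vel => collB φ ε p.1 p.2)
      (f := fun σ : Metric.sphere (0 : Vel) 1 => (z, (σ : Vel))) (measurable_collB hφ ε)
      (by fun_prop)
  refine ⟨hm.aestronglyMeasurable, ?_⟩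
  rw [hasFiniteIntegral_iff_ofReal (Filter.Eventually.of_forall fun σ : Metric.sphere (0 : Vel) 1 =>
    collB_nonneg φ hε z σ)]
  have h := lintegral_collB_transfer_le hφ hε hz (a := 0) (by simpa using h1)
  simp only [Real.rpow_zero, ENNReal.ofReal_one, mul_one] at h
  exact h.trans_lt ENNReal.ofReal_lt_top

/-- The part of the third moment of the potential over `r ≥ |z| / (√2 ε)`, the values of
`r = ε⁻¹ |z| sin (θ / 2)` that no angle `θ < π / 2` attains. -/
def tailMoment (φ : ℝ → ℝ) (ε : ℝ) (z : Vel) : ℝ :=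
  ∫ r in Ici (ε⁻¹ * ‖z‖ / √2), φ r ^ 2 * r ^ (3 : ℝ)

theorem tailMoment_nonneg (φ : ℝ → ℝ) (hε : 0 < ε) (z : Vel) : 0 ≤ tailMoment φ ε z :=
  setIntegral_nonneg measurableSet_Ici fun r hr => by
    have : 0 ≤ r := le_trans (by positivity) (mem_Ici.1 hr)
    positivity

theorem tailMoment_neg (φ : ℝ → ℝ) (ε : ℝ) (z : Vel) : tailMoment φ ε (-z) = tailMoment φ ε z := by
  simp [tailMoment]

theorem tailMoment_le_moment (hε : 0 < ε) (hz : z ≠ 0) (h3 : FiniteMomentI φ 3) :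
    tailMoment φ ε z ≤ momentI φ 3 := by
  have hz' : 0 < ‖z‖ := norm_pos_iff.2 hz
  refine setIntegral_mono_set h3 ?_ (LE.le.eventuallyLE fun r hr => ?_)
  · filter_upwards [ae_restrict_mem measurableSet_Ioi] with r hr
    exact mul_nonneg (sq_nonneg _) (Real.rpow_nonneg (le_of_lt hr) _)
  · exact lt_of_lt_of_le (by positivity : 0 < ε⁻¹ * ‖z‖ / √2) hr

/-- The tail is small in `ε`, because `1 ≤ (√2 ε r / |z|) ^ θ` on it. -/
theorem tailMoment_le (hε : 0 < ε) (hz : z ≠ 0) (h3 : FiniteMomentI φ 3) {θ : ℝ} (hθ : 0 < θ)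
    (hθ1 : θ ≤ 1) (hθ3 : FiniteMomentI φ (3 + θ)) :
    tailMoment φ ε z ≤ 2 * ε ^ θ * momentI φ (3 + θ) * ‖z‖ ^ (-θ) := by
  have hz' : 0 < ‖z‖ := norm_pos_iff.2 hz
  set R := ε⁻¹ * ‖z‖ / √2 with hR
  have hR0 : 0 < R := by positivity
  have hsub : Ici R ⊆ Ioi 0 := fun r hr => lt_of_lt_of_le hR0 hr
  have h1 : tailMoment φ ε z ≤ ∫ r in Ici R, R ^ (-θ) * (φ r ^ 2 * r ^ (3 + θ)) := by
    refine setIntegral_mono_on (h3.mono_set hsub) ((hθ3.mono_set hsub).const_mul _)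
      measurableSet_Ici fun r hr => ?_
    have hr0 : 0 < r := hsub hr
    rw [Real.rpow_add hr0]
    have : 1 ≤ R ^ (-θ) * r ^ θ := by
      rw [Real.rpow_neg hR0.le, ← Real.inv_rpow hR0.le, ← Real.mul_rpow (by positivity) hr0.le]
      refine Real.one_le_rpow ?_ hθ.le
      rw [inv_mul_eq_div, one_le_div hR0]
      exact hr
    calc φ r ^ 2 * r ^ (3 : ℝ) = (φ r ^ 2 * r ^ (3 : ℝ)) * 1 := (mul_one _).symm
      _ ≤ (φ r ^ 2 * r ^ (3 : ℝ)) * (R ^ (-θ) * r ^ θ) :=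
          mul_le_mul_of_nonneg_left this (by positivity)
      _ = _ := by ring
  have h2 : ∫ r in Ici R, R ^ (-θ) * (φ r ^ 2 * r ^ (3 + θ)) ≤ R ^ (-θ) * momentI φ (3 + θ) := by
    rw [integral_const_mul]
    refine mul_le_mul_of_nonneg_left (setIntegral_mono_set hθ3 ?_
      (LE.le.eventuallyLE hsub)) (by positivity)
    filter_upwards [ae_restrict_mem measurableSet_Ioi] with r hr
    exact mul_nonneg (sq_nonneg _) (Real.rpow_nonneg (le_of_lt hr) _)
  have h3 : R ^ (-θ) ≤ 2 * ε ^ θ * ‖z‖ ^ (-θ) := by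
    have h2 : (√2) ^ θ ≤ 2 := by
      calc (√2) ^ θ ≤ (√2) ^ (1 : ℝ) := Real.rpow_le_rpow_of_exponent_le (by
            rw [Real.one_le_sqrt]; norm_num) hθ1
        _ ≤ 2 := by rw [Real.rpow_one, Real.sqrt_le_left (by norm_num)]; norm_num
    have e : R ^ (-θ) = (√2) ^ θ * (ε ^ θ * ‖z‖ ^ (-θ)) := by
      rw [hR, Real.div_rpow (by positivity) (by positivity), Real.mul_rpow (by positivity) hz'.le,
        Real.inv_rpow hε.le, Real.rpow_neg hε.le, Real.rpow_neg (by positivity : (0 : ℝ) ≤ √2),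
        inv_inv, div_inv_eq_mul]
      ring
    rw [e, mul_assoc]
    exact mul_le_mul_of_nonneg_right h2 (by positivity)
  calc _ ≤ R ^ (-θ) * momentI φ (3 + θ) := h1.trans h2
    _ ≤ (2 * ε ^ θ * ‖z‖ ^ (-θ)) * momentI φ (3 + θ) :=
        mul_le_mul_of_nonneg_right h3 (momentI_nonneg _ _)
    _ = _ := by ring

/-- The second moment of `sin (θ / 2)` is exact up to the tail of `I₃`. -/
theorem integral_collB_sinHalf_sq (hφ : Measurable φ) (hε : 0 < ε) (hz : z ≠ 0)
    (h3 : FiniteMomentI φ 3) :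
    ∫ σ, collB φ ε z σ * sinHalf z σ ^ 2 ∂(hemi z) =
      8 * Real.pi * ‖z‖⁻¹ ^ 3 * (momentI φ 3 - tailMoment φ ε z) := by
  have hz' : 0 < ‖z‖ := norm_pos_iff.2 hz
  have hpi := Real.pi_pos
  set R := ε⁻¹ * ‖z‖ / √2 with hR
  have hR0 : 0 < R := by positivity
  have hm : Measurable fun σ : Metric.sphere (0 : Vel) 1 => collB φ ε z σ * sinHalf z σ ^ 2 :=
    Measurable.comp (g := fun p : Vel × Vel => collB φ ε p.1 p.2 * sinHalf p.1 p.2 ^ 2)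
      (f := fun σ : Metric.sphere (0 : Vel) 1 => (z, (σ : Vel)))
      ((measurable_collB hφ ε).mul (measurable_sinHalf.pow_const 2)) (by fun_prop)
  have hsub : Ioo 0 R ⊆ Ioi 0 := Ioo_subset_Ioi_self
  have hsplit : ∫ r in Ioo 0 R, φ r ^ 2 * r ^ (3 : ℝ) = momentI φ 3 - tailMoment φ ε z := by
    rw [eq_sub_iff_add_eq, momentI, tailMoment, ← Ioo_union_Ici_eq_Ioi hR0]
    refine (setIntegral_union ?_ measurableSet_Ici (h3.mono_set hsub)
      (h3.mono_set fun r hr => lt_of_lt_of_le hR0 hr)).symm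
    exact Set.disjoint_left.2 fun r hr hr' => not_lt.2 hr' hr.2
  rw [integral_eq_lintegral_of_nonneg_ae (Filter.Eventually.of_forall
    fun σ : Metric.sphere (0 : Vel) 1 => mul_nonneg (collB_nonneg φ hε z σ) (sq_nonneg _)) hm.aestronglyMeasurable]
  simp only [ENNReal.ofReal_mul (collB_nonneg φ hε z _)]
  rw [lintegral_collB_mul hφ hε hz (G := fun s => ENNReal.ofReal (s ^ 2)) (by fun_prop), ← hsplit,
    ← hR]
  have e : ∫⁻ r in Ioo 0 R, ENNReal.ofReal (φ r ^ 2 * r) *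
      ENNReal.ofReal ((r / (ε⁻¹ * ‖z‖)) ^ 2) =
      ENNReal.ofReal (ε ^ 2 * ‖z‖⁻¹ ^ 2 * ∫ r in Ioo 0 R, φ r ^ 2 * r ^ (3 : ℝ)) := by
    rw [← integral_const_mul, ofReal_integral_eq_lintegral_ofReal
      ((h3.mono_set hsub).const_mul _)]
    · refine setLIntegral_congr_fun measurableSet_Ioo fun r hr => ?_
      have hr0 := hr.1
      rw [← ENNReal.ofReal_mul (by positivity)]
      congr 1
      rw [show (3 : ℝ) = ((3 : ℕ) : ℝ) by norm_num, Real.rpow_natCast]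
      field_simp
    · filter_upwards [ae_restrict_mem measurableSet_Ioo] with r hr
      have hr0 := hr.1
      simp only [Pi.zero_apply]
      positivity
  rw [e, ← ENNReal.ofReal_mul (by positivity), ENNReal.toReal_ofReal]
  · field_simp
  · refine mul_nonneg (by positivity) (mul_nonneg (by positivity)
      (setIntegral_nonneg measurableSet_Ioo fun r hr => ?_))
    have hr0 := hr.1
    positivity

theorem integral_collB_sinHalf_four_nonneg (φ : ℝ → ℝ) (hε : 0 < ε) (z : Vel) :
    0 ≤ ∫ σ, collB φ ε z σ * sinHalf z σ ^ 4 ∂(hemi z) :=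
  integral_nonneg fun σ => mul_nonneg (collB_nonneg φ hε z σ) (by positivity)

/-- The fourth moment of `sin (θ / 2)` is of lower order, because `s ^ 4 ≤ s ^ (2 + θ)` for
`0 ≤ s ≤ 1`. -/
theorem integral_collB_sinHalf_four_le (hφ : Measurable φ) (hε : 0 < ε) (hz : z ≠ 0) {θ : ℝ}
    (hθ : 0 < θ) (hθ1 : θ ≤ 1) (hθ3 : FiniteMomentI φ (3 + θ)) :
    ∫ σ, collB φ ε z σ * sinHalf z σ ^ 4 ∂(hemi z) ≤
      8 * Real.pi * ε ^ θ * momentI φ (3 + θ) * ‖z‖ ^ (-(3 + θ)) := by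
  have hz' : 0 < ‖z‖ := norm_pos_iff.2 hz
  have hpi := Real.pi_pos
  have hI := momentI_nonneg φ (3 + θ)
  have hm : Measurable fun σ : Metric.sphere (0 : Vel) 1 => collB φ ε z σ * sinHalf z σ ^ 4 :=
    Measurable.comp (g := fun p : Vel × Vel => collB φ ε p.1 p.2 * sinHalf p.1 p.2 ^ 4)
      (f := fun σ : Metric.sphere (0 : Vel) 1 => (z, (σ : Vel)))
      ((measurable_collB hφ ε).mul (measurable_sinHalf.pow_const 4)) (by fun_prop)
  rw [integral_eq_lintegral_of_nonneg_ae (Filter.Eventually.of_forall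
    fun σ : Metric.sphere (0 : Vel) 1 => mul_nonneg (collB_nonneg φ hε z σ) (by positivity)) hm.aestronglyMeasurable]
  refine ENNReal.toReal_le_of_le_ofReal (by positivity) ?_
  have h := lintegral_collB_transfer_le hφ hε hz (a := 2 + θ)
    (by convert hθ3 using 1; ring)
  calc ∫⁻ σ, ENNReal.ofReal (collB φ ε z σ * sinHalf z σ ^ 4) ∂(hemi z)
      ≤ ∫⁻ σ, ENNReal.ofReal (‖z‖ ^ (-(2 + θ))) * (ENNReal.ofReal (collB φ ε z σ) *
          ENNReal.ofReal (‖transfer z σ‖ ^ (2 + θ))) ∂(hemi z) := by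
        refine lintegral_mono fun σ => ?_
        rw [← ENNReal.ofReal_mul (collB_nonneg φ hε z σ), ← ENNReal.ofReal_mul (by positivity)]
        refine ENNReal.ofReal_le_ofReal ?_
        have hs0 := sinHalf_nonneg z σ
        rw [norm_transfer, Real.mul_rpow hz'.le hs0, Real.rpow_neg hz'.le]
        have h4 : sinHalf z σ ^ 4 ≤ sinHalf z σ ^ (2 + θ) := by
          rcases hs0.eq_or_lt with h0 | h0
          · rw [← h0, Real.zero_rpow (by positivity)]; norm_num
          · rw [← Real.rpow_natCast]
            exact Real.rpow_le_rpow_of_exponent_ge h0 (sinHalf_le_one _ _) (by norm_num; linarith)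
        have hp : ‖z‖ ^ (2 + θ) ≠ 0 := by positivity
        calc _ ≤ collB φ ε z σ * sinHalf z σ ^ (2 + θ) :=
              mul_le_mul_of_nonneg_left h4 (collB_nonneg φ hε z σ)
          _ = _ := by field_simp
    _ ≤ ENNReal.ofReal (‖z‖ ^ (-(2 + θ))) *
          ENNReal.ofReal (8 * Real.pi * ε ^ (2 + θ - 2) * momentI φ (1 + (2 + θ)) * ‖z‖⁻¹) := by
        rw [lintegral_const_mul' _ _ ENNReal.ofReal_ne_top]
        gcongr
    _ = _ := by
        rw [← ENNReal.ofReal_mul (by positivity)]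
        congr 1
        have e1 : 1 + (2 + θ) = 3 + θ := by ring
        have e2 : 2 + θ - 2 = θ := by ring
        have e3 : ‖z‖ ^ (-(3 + θ)) = ‖z‖ ^ (-(2 + θ)) * ‖z‖⁻¹ := by
          rw [← Real.rpow_neg_one, ← Real.rpow_add hz']; congr 1; ring
        rw [e1, e2, e3]
        ring

theorem coord_eq_inner (z : Vel) (i : Fin 3) : z i = inner ℝ (EuclideanSpace.single i 1) z := by
  simp [EuclideanSpace.inner_single_left]

/-- The drift coefficient `∫ B₁ (v' - v)_i dσ`. -/
def driftK (φ : ℝ → ℝ) (ε : ℝ) (i : Fin 3) (z : Vel) : ℝ :=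
  ∫ σ, collB φ ε z σ * transfer z σ i ∂(hemi z)

/-- The diffusion coefficient `∫ B₁ (v' - v)_i (v' - v)_j dσ`. -/
def diffK (φ : ℝ → ℝ) (ε : ℝ) (i j : Fin 3) (z : Vel) : ℝ :=
  ∫ σ, collB φ ε z σ * (transfer z σ i * transfer z σ j) ∂(hemi z)

/-- The divergence `b_i = ∑_j ∂_j a_{ij}` of the Landau matrix, off the origin. -/
def landauB (φ : ℝ → ℝ) (i : Fin 3) (z : Vel) : ℝ :=
  -(4 * Real.pi * momentI φ 3 * (z i * ‖z‖⁻¹ ^ 3))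

/-- The drift coefficient is twice the divergence of the Landau matrix, up to the tail of `I₃`. -/
theorem driftK_eq (hφ : Measurable φ) (hε : 0 < ε) (hz : z ≠ 0) (h1 : FiniteMomentI φ 1)
    (h3 : FiniteMomentI φ 3) (i : Fin 3) :
    driftK φ ε i z = 2 * landauB φ i z + 8 * Real.pi * (z i * ‖z‖⁻¹ ^ 3) * tailMoment φ ε z := by
  have h := integral_hemi_transfer hz (β := fun s => ε⁻¹ ^ 4 * ‖z‖ * φ (ε⁻¹ * ‖z‖ * s) ^ 2)
    (by fun_prop) (integrable_collB hφ hε hz h1) (EuclideanSpace.single i 1)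
  simp only [← collB_eq, ← coord_eq_inner] at h
  rw [driftK, h, integral_collB_sinHalf_sq hφ hε hz h3, landauB]
  ring

/-- Half the diffusion coefficient is the Landau matrix, up to the tail of `I₃` and a fourth moment of
`sin (θ / 2)`. -/
theorem half_diffK_eq (hφ : Measurable φ) (hε : 0 < ε) (hz : z ≠ 0) (h1 : FiniteMomentI φ 1)
    (h3 : FiniteMomentI φ 3) (i j : Fin 3) :
    diffK φ ε i j z / 2 = landauA φ z i j
      - 2 * Real.pi * ‖z‖⁻¹ * ((if i = j then 1 else 0) - z i * z j / ‖z‖ ^ 2) * tailMoment φ ε z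
      + (3 * (z i * z j) - ‖z‖ ^ 2 * (if i = j then 1 else 0)) / 4 *
        ∫ σ, collB φ ε z σ * sinHalf z σ ^ 4 ∂(hemi z) := by
  have hz' : ‖z‖ ≠ 0 := norm_ne_zero_iff.2 hz
  have h := integral_hemi_transfer_transfer hz
    (β := fun s => ε⁻¹ ^ 4 * ‖z‖ * φ (ε⁻¹ * ‖z‖ * s) ^ 2)
    (by fun_prop) (integrable_collB hφ hε hz h1) (EuclideanSpace.single i 1)
    (EuclideanSpace.single j 1)
  simp only [← collB_eq, ← coord_eq_inner] at h
  have hij : (EuclideanSpace.single j (1 : ℝ) : Vel) i = if i = j then 1 else 0 := by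
    simp
  rw [diffK, h, integral_collB_sinHalf_sq hφ hε hz h3, landauA, hij]
  field_simp
  ring

theorem abs_coord_le (z : Vel) (i : Fin 3) : |z i| ≤ ‖z‖ := PiLp.norm_apply_le z i

/-- The error term of `driftK_eq`. The singularity `|z| ^ (-(2 + θ))` is not locally integrable for
`θ = 1`; the oddness of the error is used to compensate for this in
`WeightedJets.l2_pairInt_odd_le`. -/
theorem abs_drift_error_le (hε : 0 < ε) (hz : z ≠ 0)
    (h3 : FiniteMomentI φ 3) {θ : ℝ} (hθ : 0 < θ) (hθ1 : θ ≤ 1) (hθ3 : FiniteMomentI φ (3 + θ))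
    (i : Fin 3) :
    |8 * Real.pi * (z i * ‖z‖⁻¹ ^ 3) * tailMoment φ ε z| ≤
      16 * Real.pi * ε ^ θ * momentI φ (3 + θ) * ‖z‖ ^ (-(2 + θ)) := by
  have hz' : 0 < ‖z‖ := norm_pos_iff.2 hz
  have hpi := Real.pi_pos
  have hI := momentI_nonneg φ (3 + θ)
  have ht := tailMoment_le hε hz h3 hθ hθ1 hθ3
  have ht0 := tailMoment_nonneg φ hε z
  rw [abs_mul, abs_mul, abs_mul (z i), abs_of_nonneg ht0,
    abs_of_pos (by positivity : 0 < 8 * Real.pi), abs_of_pos (by positivity : 0 < ‖z‖⁻¹ ^ 3)]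
  have e : ‖z‖ ^ (-(2 + θ)) = ‖z‖ * ‖z‖⁻¹ ^ 3 * ‖z‖ ^ (-θ) := by
    rw [neg_add, Real.rpow_add hz', Real.rpow_neg hz'.le, Real.rpow_two]
    field_simp
  calc _ ≤ 8 * Real.pi * (‖z‖ * ‖z‖⁻¹ ^ 3) * (2 * ε ^ θ * momentI φ (3 + θ) * ‖z‖ ^ (-θ)) := by
        gcongr
        exact abs_coord_le z i
    _ = _ := by rw [e]; ring

/-- The error terms of `half_diffK_eq`. -/
theorem abs_diffusion_error_le (hφ : Measurable φ) (hε : 0 < ε) (hz : z ≠ 0)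
    (h1 : FiniteMomentI φ 1) (h3 : FiniteMomentI φ 3) {θ : ℝ} (hθ : 0 < θ) (hθ1 : θ ≤ 1)
    (hθ3 : FiniteMomentI φ (3 + θ)) (i j : Fin 3) :
    |diffK φ ε i j z / 2 - landauA φ z i j| ≤
      16 * Real.pi * ε ^ θ * momentI φ (3 + θ) * ‖z‖ ^ (-(1 + θ)) := by
  have hz' : 0 < ‖z‖ := norm_pos_iff.2 hz
  have hpi := Real.pi_pos
  have hI := momentI_nonneg φ (3 + θ)
  have ht := tailMoment_le hε hz h3 hθ hθ1 hθ3
  have ht0 := tailMoment_nonneg φ hε z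
  have h4 := integral_collB_sinHalf_four_le hφ hε hz hθ hθ1 hθ3
  have h40 := integral_collB_sinHalf_four_nonneg φ hε z
  set m4 := ∫ σ, collB φ ε z σ * sinHalf z σ ^ 4 ∂(hemi z)
  have hzz : |z i * z j| ≤ ‖z‖ ^ 2 := by
    rw [abs_mul, sq]
    exact mul_le_mul (abs_coord_le z i) (abs_coord_le z j) (abs_nonneg _) hz'.le
  have hδ : |(if i = j then (1 : ℝ) else 0)| ≤ 1 := by split_ifs <;> simp
  have hq : |z i * z j / ‖z‖ ^ 2| ≤ 1 := by
    rw [abs_div, abs_of_pos (by positivity : 0 < ‖z‖ ^ 2), div_le_one (by positivity)]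
    exact hzz
  rw [half_diffK_eq hφ hε hz h1 h3]
  have e1 : ‖z‖ ^ (-(1 + θ)) = ‖z‖⁻¹ * ‖z‖ ^ (-θ) := by
    rw [neg_add, Real.rpow_add hz', Real.rpow_neg_one]
  have e2 : ‖z‖ ^ (-(3 + θ)) = ‖z‖⁻¹ ^ 3 * ‖z‖ ^ (-θ) := by
    rw [neg_add, Real.rpow_add hz', Real.rpow_neg hz'.le,
      show (3 : ℝ) = ((3 : ℕ) : ℝ) by norm_num, Real.rpow_natCast, inv_pow]
  have b1 : |2 * Real.pi * ‖z‖⁻¹ * ((if i = j then 1 else 0) - z i * z j / ‖z‖ ^ 2) *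
      tailMoment φ ε z| ≤ 2 * Real.pi * ‖z‖⁻¹ * 2 *
        (2 * ε ^ θ * momentI φ (3 + θ) * ‖z‖ ^ (-θ)) := by
    rw [abs_mul, abs_mul, abs_of_nonneg ht0, abs_of_pos (by positivity : 0 < 2 * Real.pi * ‖z‖⁻¹)]
    gcongr
    exact (abs_sub _ _).trans (by linarith)
  have b2 : |(3 * (z i * z j) - ‖z‖ ^ 2 * (if i = j then 1 else 0)) / 4 * m4| ≤
      ‖z‖ ^ 2 * (8 * Real.pi * ε ^ θ * momentI φ (3 + θ) * ‖z‖ ^ (-(3 + θ))) := by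
    rw [abs_mul, abs_of_nonneg h40]
    refine mul_le_mul ?_ h4 h40 (by positivity)
    rw [abs_div, abs_of_pos (by norm_num : (0 : ℝ) < 4), div_le_iff₀ (by norm_num)]
    refine (abs_sub _ _).trans ?_
    rw [abs_mul 3, abs_mul (‖z‖ ^ 2), abs_of_pos (by norm_num : (0 : ℝ) < 3),
      abs_of_pos (by positivity : 0 < ‖z‖ ^ 2)]
    nlinarith [sq_nonneg ‖z‖]
  have hsum : ∀ a b c : ℝ, |a - b + c - a| ≤ |b| + |c| := fun a b c => by
    rw [show a - b + c - a = c - b by ring, add_comm]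
    exact abs_sub _ _
  refine (hsum _ _ _).trans ((add_le_add b1 b2).trans (le_of_eq ?_))
  rw [e1, e2]
  field_simp
  ring

end

/-! ### The `L²` norm of nonnegative functions -/

/-- The `L²` norm of a nonnegative function on the velocity space. -/
def l2 (f : Vel → ℝ≥0∞) : ℝ≥0∞ := (∫⁻ v, f v ^ (2 : ℝ)) ^ (1 / 2 : ℝ)

theorem l2_mono_ae {f g : Vel → ℝ≥0∞} (h : ∀ᵐ v, f v ≤ g v) : l2 f ≤ l2 g := by
  unfold l2
  refine ENNReal.rpow_le_rpow (lintegral_mono_ae (h.mono fun v hv => ?_)) (by norm_num)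
  exact ENNReal.rpow_le_rpow hv (by norm_num)

theorem l2_mono {f g : Vel → ℝ≥0∞} (h : ∀ v, f v ≤ g v) : l2 f ≤ l2 g :=
  l2_mono_ae (Filter.Eventually.of_forall h)

theorem l2_const_mul {c : ℝ≥0∞} (hc : c ≠ ⊤) (f : Vel → ℝ≥0∞) :
    l2 (fun v => c * f v) = c * l2 f := by
  unfold l2
  simp only [ENNReal.mul_rpow_of_nonneg _ _ (zero_le_two : (0 : ℝ) ≤ 2)]
  rw [lintegral_const_mul' _ _ (ENNReal.rpow_ne_top_of_nonneg zero_le_two hc),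
    ENNReal.mul_rpow_of_nonneg _ _ (by norm_num), ← ENNReal.rpow_mul]
  norm_num

theorem l2_add_le {f g : Vel → ℝ≥0∞} (hf : Measurable f) (hg : Measurable g) :
    l2 (fun v => f v + g v) ≤ l2 f + l2 g := by
  have := ENNReal.lintegral_Lp_add_le (μ := (volume : Measure Vel)) (p := 2) hf.aemeasurable
    hg.aemeasurable (by norm_num)
  exact this

theorem l2_comp_add {f : Vel → ℝ≥0∞} (b : Vel) : l2 (fun v => f (v + b)) = l2 f := by
  unfold l2
  rw [lintegral_add_right_eq_self (fun v => f v ^ (2 : ℝ)) b]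

theorem l2_sq (f : Vel → ℝ≥0∞) : l2 f * l2 f = ∫⁻ v, f v ^ (2 : ℝ) := by
  unfold l2
  rw [← ENNReal.rpow_add_of_nonneg _ _ (by norm_num) (by norm_num)]
  norm_num

theorem lintegral_mul_le_l2 {f g : Vel → ℝ≥0∞} (hf : Measurable f) (hg : Measurable g) :
    ∫⁻ v, f v * g v ≤ l2 f * l2 g :=
  ENNReal.lintegral_mul_le_Lp_mul_Lq volume Real.HolderConjugate.two_two hf.aemeasurable
    hg.aemeasurable

theorem measurable_l2 {Y : Type*} [MeasurableSpace Y] {F : Vel → Y → ℝ≥0∞}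
    (hF : Measurable (Function.uncurry F)) : Measurable fun y => l2 fun v => F v y := by
  unfold l2
  exact (Measurable.lintegral_prod_left' (f := fun p : Vel × Y => F p.1 p.2 ^ (2 : ℝ))
    (hF.pow_const 2)).pow_const _

/-- Minkowski's integral inequality in `L²`. -/
theorem l2_lintegral_le {Y : Type*} [MeasurableSpace Y] {ν : Measure Y} [SFinite ν]
    {F : Vel → Y → ℝ≥0∞} (hF : Measurable (Function.uncurry F)) :
    l2 (fun v => ∫⁻ y, F v y ∂ν) ≤ ∫⁻ y, l2 (fun v => F v y) ∂ν := by
  have hFv : ∀ v, Measurable (F v) := fun v => hF.of_uncurry_left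
  have hFy : ∀ y, Measurable fun v => F v y := fun y => hF.of_uncurry_right
  have hl2 := measurable_l2 hF
  have h3 : Measurable fun p : Vel × Y × Y => F p.1 p.2.1 * F p.1 p.2.2 :=
    (hF.comp (measurable_fst.prodMk measurable_snd.fst)).mul
      (hF.comp (measurable_fst.prodMk measurable_snd.snd))
  have key : l2 (fun v => ∫⁻ y, F v y ∂ν) * l2 (fun v => ∫⁻ y, F v y ∂ν) ≤
      (∫⁻ y, l2 (fun v => F v y) ∂ν) * ∫⁻ y, l2 (fun v => F v y) ∂ν := by
    rw [l2_sq]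
    calc ∫⁻ v, (∫⁻ y, F v y ∂ν) ^ (2 : ℝ)
        = ∫⁻ v, ∫⁻ q : Y × Y, F v q.1 * F v q.2 ∂(ν.prod ν) := by
          refine lintegral_congr fun v => ?_
          rw [lintegral_prod_mul (hFv v).aemeasurable (hFv v).aemeasurable, ENNReal.rpow_two, sq]
      _ = ∫⁻ q : Y × Y, (∫⁻ v, F v q.1 * F v q.2) ∂(ν.prod ν) :=
          lintegral_lintegral_swap h3.aemeasurable
      _ ≤ ∫⁻ q : Y × Y, l2 (fun v => F v q.1) * l2 (fun v => F v q.2) ∂(ν.prod ν) :=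
          lintegral_mono fun q => lintegral_mul_le_l2 (hFy _) (hFy _)
      _ = _ := lintegral_prod_mul hl2.aemeasurable hl2.aemeasurable
  by_contra! h
  exact absurd key (not_le.2 (ENNReal.mul_lt_mul h h))

theorem eLpNorm_two_eq_l2 (f : Vel → ℝ) : eLpNorm f 2 volume = l2 fun v => ‖f v‖ₑ := by
  rw [eLpNorm_eq_lintegral_rpow_enorm_toReal (by norm_num) (by norm_num), l2]
  norm_num

/-- The product of a translate of a bounded function and a translate of a function in `L²`. -/
theorem l2_mul_le_of_ae_le {A D : Vel → ℝ≥0∞} {M : ℝ≥0∞} (hM : M ≠ ⊤) (hA : ∀ᵐ v, A v ≤ M)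
    (a b : Vel) : l2 (fun v => A (v + a) * D (v + b)) ≤ M * l2 D := by
  calc l2 (fun v => A (v + a) * D (v + b)) ≤ l2 (fun v => M * D (v + b)) := by
        refine l2_mono_ae ?_
        have h := (measurePreserving_add_right (volume : Measure Vel) a).quasiMeasurePreserving.ae hA
        filter_upwards [h] with v hv
        gcongr
    _ = _ := by rw [l2_const_mul hM, l2_comp_add]

/-! ### Weights -/

theorem weightW_pos (m : ℝ) (v : Vel) : 0 < weightW m v :=
  Real.rpow_pos_of_pos (by positivity) _

theorem continuous_weightW (m : ℝ) : Continuous (weightW m) := by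
  unfold weightW
  exact (continuous_const.add (continuous_norm.pow 2)).rpow_const fun v =>
    Or.inl (by positivity : (1 : ℝ) + ‖v‖ ^ 2 ≠ 0)

theorem weightW_zero (v : Vel) : weightW 0 v = 1 := by simp [weightW]

theorem weightW_mono {m n : ℝ} (h : m ≤ n) (v : Vel) : weightW m v ≤ weightW n v :=
  Real.rpow_le_rpow_of_exponent_le (by have := sq_nonneg ‖v‖; linarith) (by linarith)

/-- The weight at `v` and the decay in `z` are controlled by the weights at two points whose
norms control both `v` and `z`. -/
theorem weightW_mul_le {l n : ℝ} (hl : 0 ≤ l) (hn : 0 ≤ n) {v z x y : Vel}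
    (hv : ‖v‖ ≤ 3 * (‖x‖ + ‖y‖)) (hz : ‖z‖ ≤ 3 * (‖x‖ + ‖y‖)) :
    weightW l v * weightW n z ≤
      36 ^ ((l + n) / 2) * (weightW (l + n) x + weightW (l + n) y) := by
  set M := max (1 + ‖x‖ ^ 2) (1 + ‖y‖ ^ 2) with hM
  have hM1 : 1 ≤ M := le_max_of_le_left (by have := sq_nonneg ‖x‖; linarith)
  have h36 : ∀ w : Vel, ‖w‖ ≤ 3 * (‖x‖ + ‖y‖) → 1 + ‖w‖ ^ 2 ≤ 36 * M := by
    intro w hw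
    have h1 : ‖w‖ ^ 2 ≤ (3 * (‖x‖ + ‖y‖)) ^ 2 := pow_le_pow_left₀ (norm_nonneg _) hw 2
    have h2 := le_max_left (1 + ‖x‖ ^ 2) (1 + ‖y‖ ^ 2)
    have h3 := le_max_right (1 + ‖x‖ ^ 2) (1 + ‖y‖ ^ 2)
    nlinarith [sq_nonneg (‖x‖ - ‖y‖)]
  calc weightW l v * weightW n z ≤ (36 * M) ^ (l / 2) * (36 * M) ^ (n / 2) := by
        unfold weightW
        gcongr
        · exact h36 v hv
        · exact h36 z hz
    _ = 36 ^ ((l + n) / 2) * M ^ ((l + n) / 2) := by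
        rw [← Real.rpow_add (by positivity), ← Real.mul_rpow (by norm_num) (by positivity)]
        congr 1; ring
    _ ≤ _ := by
        gcongr
        have hx := weightW_pos (l + n) x
        have hy := weightW_pos (l + n) y
        rcases max_choice (1 + ‖x‖ ^ 2) (1 + ‖y‖ ^ 2) with h | h
        · rw [hM, h]; unfold weightW at *; linarith
        · rw [hM, h]; unfold weightW at *; linarith

/-- The weight as an extended nonnegative function. -/
def wE (m : ℝ) (v : Vel) : ℝ≥0∞ := ENNReal.ofReal (weightW m v)

theorem measurable_wE (m : ℝ) : Measurable (wE m) :=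
  (continuous_weightW m).measurable.ennreal_ofReal

theorem wE_zero (v : Vel) : wE 0 v = 1 := by simp [wE, weightW_zero]

theorem wE_mono {m n : ℝ} (h : m ≤ n) (v : Vel) : wE m v ≤ wE n v :=
  ENNReal.ofReal_le_ofReal (weightW_mono h v)

theorem one_le_wE {m : ℝ} (h : 0 ≤ m) (v : Vel) : 1 ≤ wE m v := by
  rw [← wE_zero v]; exact wE_mono h v

/-- The weighted `L²` norm of a nonnegative function. -/
def wL2 (m : ℝ) (f : Vel → ℝ≥0∞) : ℝ≥0∞ := l2 fun v => wE m v * f v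

theorem wL2_zero (f : Vel → ℝ≥0∞) : wL2 0 f = l2 f := by simp [wL2, wE_zero]

theorem wL2_mono {m n : ℝ} (h : m ≤ n) (f : Vel → ℝ≥0∞) : wL2 m f ≤ wL2 n f :=
  l2_mono fun v => by gcongr; exact wE_mono h v

/-- A product of a function in weighted `L^∞` and a function in weighted `L²`, evaluated at two
translates of `v`; the weights are split between the factors. -/
theorem l2_bilinear_le {l m κ C : ℝ} (hC : 0 ≤ C) {a b : Vel}
    (hw : ∀ v, weightW l v * κ ≤ C * (weightW m (v + a) + weightW m (v + b)))
    {A D : Vel → ℝ≥0∞} (hA : Measurable A) (hD : Measurable D) {M₀ M : ℝ≥0∞} (hM₀ : M₀ ≠ ⊤)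
    (hM : M ≠ ⊤) (hA₀ : ∀ᵐ v, A v ≤ M₀) (hAm : ∀ᵐ v, wE m v * A v ≤ M) :
    ENNReal.ofReal κ * l2 (fun v => wE l v * (A (v + a) * D (v + b))) ≤
      ENNReal.ofReal C * (M * l2 D + M₀ * wL2 m D) := by
  have hsh : ∀ c : Vel, Measurable fun v : Vel => v + c := fun c => by fun_prop
  have hwA := (measurable_wE m).mul hA
  have hwD := (measurable_wE m).mul hD
  rw [← l2_const_mul ENNReal.ofReal_ne_top]
  calc l2 (fun v => ENNReal.ofReal κ * (wE l v * (A (v + a) * D (v + b))))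
      ≤ l2 (fun v => ENNReal.ofReal C * ((wE m (v + a) * A (v + a)) * D (v + b) +
          A (v + a) * (wE m (v + b) * D (v + b)))) := by
        refine l2_mono fun v => ?_
        calc ENNReal.ofReal κ * (wE l v * (A (v + a) * D (v + b)))
            = ENNReal.ofReal (weightW l v * κ) * (A (v + a) * D (v + b)) := by
              rw [ENNReal.ofReal_mul (weightW_pos l v).le, wE]; ring
          _ ≤ ENNReal.ofReal (C * (weightW m (v + a) + weightW m (v + b))) *
                (A (v + a) * D (v + b)) :=
              mul_le_mul_left (ENNReal.ofReal_le_ofReal (hw v)) _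
          _ = _ := by
              rw [ENNReal.ofReal_mul hC, ENNReal.ofReal_add (weightW_pos _ _).le
                (weightW_pos _ _).le, ← wE, ← wE]
              ring
    _ ≤ ENNReal.ofReal C * (l2 (fun v => (wE m (v + a) * A (v + a)) * D (v + b)) +
          l2 (fun v => A (v + a) * (wE m (v + b) * D (v + b)))) := by
        rw [l2_const_mul ENNReal.ofReal_ne_top]
        gcongr
        exact l2_add_le ((hwA.comp (hsh a)).mul (hD.comp (hsh b)))
          ((hA.comp (hsh a)).mul (hwD.comp (hsh b)))
    _ ≤ _ := by
        gcongr
        · exact l2_mul_le_of_ae_le (A := fun v => wE m v * A v) hM hAm a b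
        · exact l2_mul_le_of_ae_le (D := fun v => wE m v * D v) hM₀ hA₀ a b

/-! ### An integrable radial kernel -/

theorem lintegral_radial {f : ℝ → ℝ≥0∞} (hf : Measurable f) :
    ∫⁻ x : Vel, f ‖x‖ = surf univ * ∫⁻ r in Ioi (0 : ℝ), ENNReal.ofReal (r ^ 2) * f r := by
  rw [lintegral_polar (f := fun x => f ‖x‖) (hf.comp measurable_norm), mul_comm, ← lintegral_const]
  refine lintegral_congr fun σ => setLIntegral_congr_fun measurableSet_Ioi fun r hr => ?_
  have hr' : 0 < r := hr
  rw [norm_smul, norm_sphere, mul_one, Real.norm_of_nonneg hr'.le]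

/-- The kernel `(|z|⁻¹ + |z|⁻²) ⟨z⟩⁻³` has finite integral. -/
theorem lintegral_kernel_lt_top :
    ∫⁻ z : Vel, ENNReal.ofReal ((‖z‖⁻¹ + ‖z‖⁻¹ ^ 2) * (weightW 3 z)⁻¹) < ⊤ := by
  have hm : Measurable fun r : ℝ => ENNReal.ofReal ((r⁻¹ + r⁻¹ ^ 2) *
      ((1 + r ^ 2) ^ ((3 : ℝ) / 2))⁻¹) := by fun_prop
  unfold weightW
  rw [lintegral_radial hm]
  refine ENNReal.mul_lt_top (measure_lt_top _ _) ?_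
  calc _ ≤ ∫⁻ r in Ioi (0 : ℝ), ENNReal.ofReal (2 * (1 + r ^ 2)⁻¹) := by
        refine setLIntegral_mono' measurableSet_Ioi fun r hr => ?_
        have hr' : 0 < r := hr
        rw [← ENNReal.ofReal_mul (by positivity)]
        refine ENNReal.ofReal_le_ofReal ?_
        have e : (1 + r ^ 2) ^ ((3 : ℝ) / 2) = (1 + r ^ 2) * √(1 + r ^ 2) := by
          rw [Real.sqrt_eq_rpow, ← Real.rpow_one_add' (by positivity) (by norm_num)]
          norm_num
        have hs : r + 1 ≤ 2 * √(1 + r ^ 2) := by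
          rw [← div_le_iff₀' two_pos]
          refine Real.le_sqrt_of_sq_le ?_
          nlinarith [sq_nonneg (r - 1)]
        have hs0 : 0 < √(1 + r ^ 2) := by positivity
        rw [e]
        have e2 : r ^ 2 * ((r⁻¹ + r⁻¹ ^ 2) * ((1 + r ^ 2) * √(1 + r ^ 2))⁻¹) =
            (r + 1) / √(1 + r ^ 2) * (1 + r ^ 2)⁻¹ := by
          field_simp
        rw [e2]
        gcongr
        rw [div_le_iff₀ hs0]
        exact hs
    _ ≤ ∫⁻ r : ℝ, ENNReal.ofReal (2 * (1 + r ^ 2)⁻¹) := setLIntegral_le_lintegral _ _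
    _ < ⊤ := (integrable_inv_one_add_sq.const_mul 2).lintegral_lt_top

/-! ### A weighted Sobolev embedding -/

/-- The radial weights of the representation formula
`ψ(0) = ∫₀¹ r ((1-r)² ψ_{rr} - 4 (1-r) ψ_r + 2 ψ) dr`. -/
def radialCoeff (m : ℕ) (r : ℝ) : ℝ :=
  match m with
  | 0 => 2 * r
  | 1 => -(4 * r * (1 - r))
  | _ => r * (1 - r) ^ 2

theorem continuous_radialCoeff (m : ℕ) : Continuous (radialCoeff m) := by
  unfold radialCoeff
  split <;> fun_prop

theorem abs_radialCoeff_le (m : ℕ) {r : ℝ} (hr : r ∈ Icc (0 : ℝ) 1) : |radialCoeff m r| ≤ 4 * r := by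
  obtain ⟨h0, h1⟩ := hr
  have h2 : 0 ≤ 1 - r := by linarith
  unfold radialCoeff
  split
  · rw [abs_of_nonneg (by positivity)]; linarith
  · rw [abs_neg, abs_of_nonneg (by positivity)]; nlinarith
  · rw [abs_of_nonneg (by positivity)]
    have : (1 - r) ^ 2 ≤ 1 := pow_le_one₀ h2 (by linarith)
    nlinarith

/-- A function in terms of its radial derivatives of order at most two on a unit segment. The weights
vanish at `r = 0`, which makes their average over the directions a potential with kernel `|y|⁻¹`,
and the boundary terms at `r = 1` drop out. -/
theorem radial_representation {ψ : Vel → ℝ} (hψ : IsTest ψ) (k : Vel) :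
    ∫ r in (0 : ℝ)..1, ∑ m ∈ Finset.range 3,
      radialCoeff m r * dirDeriv (fun α => partialMulti α ψ) m k (r • k) = ψ 0 := by
  set g : ℕ → ℝ → ℝ := fun m r => dirDeriv (fun α => partialMulti α ψ) m k (r • k) with hg
  have hd : ∀ m r, HasDerivAt (g m) (g (m + 1) r) r := fun m r => hasDerivAt_dirDeriv_test hψ m k r
  have hc : ∀ m, Continuous (g m) := fun m =>
    continuous_iff_continuousAt.2 fun t => (hd m t).continuousAt
  have hH : ∀ r, HasDerivAt (fun r : ℝ => r * ((1 - r) ^ 2 * g 1 r - 2 * (1 - r) * g 0 r) -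
      (1 - r) ^ 2 * g 0 r)
      (∑ m ∈ Finset.range 3, radialCoeff m r * g m r) r := by
    intro r
    have h1 : HasDerivAt (fun r : ℝ => 1 - r) (-1) r := by
      simpa using (hasDerivAt_id r).const_sub 1
    have hA := ((hasDerivAt_id r).fun_mul (((h1.fun_pow 2).fun_mul (hd 1 r)).fun_sub
      ((h1.const_mul 2).fun_mul (hd 0 r)))).fun_sub ((h1.fun_pow 2).fun_mul (hd 0 r))
    refine hA.congr_deriv ?_
    simp only [Finset.sum_range_succ, Finset.range_zero, Finset.sum_empty, radialCoeff, id]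
    push_cast
    ring
  have hcont : Continuous fun r => ∑ m ∈ Finset.range 3, radialCoeff m r * g m r :=
    continuous_finsetSum _ fun m _ => (continuous_radialCoeff m).mul (hc m)
  have := intervalIntegral.integral_eq_sub_of_hasDerivAt (a := 0) (b := 1) (fun r _ => hH r)
    (hcont.intervalIntegrable _ _)
  rw [this]
  have e0 : g 0 0 = ψ 0 := by simp [hg, dirDeriv, wordIndex, partialMulti_zero]
  rw [e0]
  ring

/-- The area of the unit sphere. -/
def areaS : ℝ≥0∞ := surf univ

theorem areaS_ne_top : areaS ≠ ⊤ := measure_ne_top _ _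

theorem areaS_ne_zero : areaS ≠ 0 := by
  unfold areaS
  rw [Ne, Measure.measure_univ_eq_zero]
  exact Measure.toSphere_ne_zero _

theorem abs_prod_sphere_le {n : ℕ} (s : Fin n → Fin 3) (σ : Metric.sphere (0 : Vel) 1) :
    |∏ j, (σ : Vel) (s j)| ≤ 1 := by
  rw [Finset.abs_prod]
  exact Finset.prod_le_one (fun _ _ => abs_nonneg _)
    fun j _ => (abs_coord_le _ _).trans (norm_sphere σ).le

/-- A pointwise bound of a weakly differentiable function by potentials of its derivatives: the
average of `radial_representation` over all directions, transferred to weak derivatives. -/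
theorem ae_enorm_le_potential {D : (Fin 3 → ℕ) → Vel → ℝ} (hDm : ∀ α, Measurable (D α))
    (hD : ∀ α : Fin 3 → ℕ, ∑ i, α i ≤ 2 → IsWeakPartial α (D 0) (D α)) :
    ∀ᵐ x : Vel, areaS * ‖D 0 x‖ₑ ≤ ∑ q : Σ m : Fin 3, (Fin m → Fin 3),
      4 * ∫⁻ y in Metric.ball (0 : Vel) 1, ENNReal.ofReal ‖y‖⁻¹ * ‖D (wordIndex q.2) (x + y)‖ₑ := by
  classical
  -- The terms of the formula: `none` is the value at `x`, with the coefficient `-|S²|`, and words of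
  -- length at most two are the radial derivatives, integrated over directions and radii. In Cartesian
  -- coordinates `r dr dσ` is `|y|⁻¹ dy`.
  let σ₀ : Metric.sphere (0 : Vel) 1 := ⟨EuclideanSpace.single 0 1, by simp⟩
  let ρ : Measure (Metric.sphere (0 : Vel) 1 × ℝ) := surf.prod (volume.restrict (Ioc (0 : ℝ) 1))
  let ι := Option (Σ m : Fin 3, (Fin m → Fin 3))
  let ν : ι → Measure (Metric.sphere (0 : Vel) 1 × ℝ)
    | none => Measure.dirac (σ₀, 0)
    | some _ => ρ
  let c : ι → Metric.sphere (0 : Vel) 1 × ℝ → ℝ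
    | none => fun _ => -areaS.toReal
    | some ⟨m, s⟩ => fun q => radialCoeff m q.2 * ∏ j, (q.1 : Vel) (s j)
  let α : ι → Fin 3 → ℕ
    | none => 0
    | some ⟨_, s⟩ => wordIndex s
  let p : Metric.sphere (0 : Vel) 1 × ℝ → Vel := fun q => q.2 • (q.1 : Vel)
  have hcoord : ∀ i : Fin 3, Continuous fun q : Metric.sphere (0 : Vel) 1 × ℝ => (q.1 : Vel) i := fun i => by fun_prop
  have hccont : ∀ i, Continuous (c i) := by
    rintro (_ | ⟨m, s⟩)
    · exact continuous_const
    · exact ((continuous_radialCoeff m).comp continuous_snd).mul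
        (continuous_finsetProd _ fun j _ => hcoord (s j))
  have hpcont : Continuous p := by
    exact continuous_snd.smul (continuous_subtype_val.comp continuous_fst)
  have hfin : ∀ i, IsFiniteMeasure (ν i) := by
    rintro (_ | _) <;> simp only [ν, ρ] <;> infer_instance
  have hρ : ∀ᵐ q ∂ρ, q.2 ∈ Ioc (0 : ℝ) 1 :=
    (Measure.quasiMeasurePreserving_snd (μ := surf) (ν := volume.restrict (Ioc (0 : ℝ) 1))).ae
      (ae_restrict_mem measurableSet_Ioc)
  have hP : ∀ i, ∀ᵐ q ∂(ν i), ‖p q‖ ≤ 1 := by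
    rintro (_ | _)
    · rw [show ν none = Measure.dirac (σ₀, 0) from rfl, ae_dirac_iff
        (measurableSet_le (by fun_prop) measurable_const)]
      simp [p]
    · filter_upwards [hρ] with q hq
      simp only [p]
      rw [norm_smul, norm_sphere, mul_one, Real.norm_of_nonneg hq.1.le]
      exact hq.2
  have hcbd : ∀ q : Σ m : Fin 3, (Fin m → Fin 3), ∀ w : Metric.sphere (0 : Vel) 1 × ℝ, w.2 ∈ Icc (0 : ℝ) 1 →
      |c (some q) w| ≤ 4 * w.2 := by
    rintro ⟨m, s⟩ w hw
    simp only [c]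
    rw [abs_mul]
    calc _ ≤ (4 * w.2) * 1 := mul_le_mul (abs_radialCoeff_le _ hw) (abs_prod_sphere_le s w.1)
          (abs_nonneg _) (by linarith [hw.1])
      _ = _ := mul_one _
  have hcν : ∀ i, ∫⁻ q, ‖c i q‖ₑ ∂(ν i) < ⊤ := by
    rintro (_ | q)
    · simp only [c]
      rw [lintegral_const]
      exact ENNReal.mul_lt_top (by simp) (measure_lt_top _ _)
    · calc ∫⁻ w, ‖c (some q) w‖ₑ ∂ρ ≤ ∫⁻ _, ENNReal.ofReal 4 ∂ρ := by
            refine lintegral_mono_ae (hρ.mono fun w hw => ?_)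
            rw [Real.enorm_eq_ofReal_abs]
            refine ENNReal.ofReal_le_ofReal ((hcbd q w (Ioc_subset_Icc_self hw)).trans ?_)
            linarith [hw.2]
        _ < ⊤ := by
            rw [lintegral_const]
            exact ENNReal.mul_lt_top ENNReal.ofReal_lt_top (hfin (some q)).measure_univ_lt_top
  have hα : ∀ i, ∑ j, α i j ≤ 2 := by
    rintro (_ | ⟨m, s⟩)
    · simp [α]
    · simp only [α, sum_wordIndex]; omega
  have main := ae_sum_integral_eq_zero_of_test Finset.univ ν (fun i => (hccont i).measurable)
    hpcont.measurable (hDm 0) (α := α) (F := fun i => D (α i)) (fun i => hDm _)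
    (fun i _ => hD _ (hα i))
    (fun i _ R => lintegral_ball_translate_lt_top (hccont i).measurable hpcont.measurable (hDm _)
      (hD _ (hα i)).2.1 (hcν i) (hP i) R)
    (fun i _ R => lintegral_ball_translate_lt_top (hccont i).measurable hpcont.measurable (hDm _)
      (hD _ (hα i)).1 (hcν i) (hP i) R) (fun ψ hψ => by
      rw [Fintype.sum_option]
      have h0 : ∫ y, c none y * partialMulti (α none) ψ (p y) ∂(ν none) =
          -(areaS.toReal * ψ 0) := by
        simp only [ν, c, α, integral_dirac, p, zero_smul, partialMulti_zero]
        ring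
      have hint : ∀ q, Integrable (fun y => c (some q) y * partialMulti (α (some q)) ψ (p y)) ρ := by
        intro q
        obtain ⟨C, hC⟩ := (hψ.partialMulti (α (some q))).bounded
        refine Integrable.mul_bdd (c := C) ?_ (((hψ.partialMulti _).continuous.comp
          hpcont).aestronglyMeasurable) (Filter.Eventually.of_forall fun y => by
            simpa using hC (p y))
        exact ⟨(hccont (some q)).aestronglyMeasurable, hcν (some q)⟩
      have h1 : ∑ q, ∫ y, c (some q) y * partialMulti (α (some q)) ψ (p y) ∂(ν (some q)) =
          areaS.toReal * ψ 0 := by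
        simp only [ν]
        rw [← integral_finsetSum _ fun q _ => hint q,
          integral_prod _ (integrable_finsetSum _ fun q _ => hint q)]
        have : ∀ σ : Metric.sphere (0 : Vel) 1, ∫ r in Ioc (0 : ℝ) 1,
            ∑ q, c (some q) (σ, r) * partialMulti (α (some q)) ψ (p (σ, r)) = ψ 0 := by
          intro σ
          rw [← radial_representation hψ σ, intervalIntegral.integral_of_le zero_le_one]
          congr 1
          ext r
          rw [Fintype.sum_sigma, ← Fin.sum_univ_eq_sum_range (fun m => radialCoeff m r *
            dirDeriv (fun α => partialMulti α ψ) m (σ : Vel) (r • (σ : Vel)))]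
          refine Finset.sum_congr rfl fun m _ => ?_
          simp only [dirDeriv, Finset.mul_sum, c, α, p, mul_assoc]
        simp only [this]
        rw [integral_const, smul_eq_mul]
        rfl
      rw [h0, h1]
      ring)
  filter_upwards [main] with x hx
  rw [Fintype.sum_option] at hx
  have h0 : ∫ y, c none y * D (α none) (x + p y) ∂(ν none) = -(areaS.toReal * D 0 x) := by
    simp only [ν, c, α, integral_dirac, p, zero_smul, add_zero]
    ring
  rw [h0, neg_add_eq_zero] at hx
  have hA : areaS * ‖D 0 x‖ₑ = ‖areaS.toReal * D 0 x‖ₑ := by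
    rw [enorm_mul, Real.enorm_eq_ofReal ENNReal.toReal_nonneg, ENNReal.ofReal_toReal areaS_ne_top]
  rw [hA, hx]
  refine (enorm_sum_le _ _).trans (Finset.sum_le_sum fun q _ => ?_)
  have hF : Measurable fun y : Vel => ‖D (wordIndex q.2) (x + y)‖ₑ :=
    ((hDm _).comp (measurable_const.add measurable_id)).enorm
  have hG : Measurable fun y : Vel => ENNReal.ofReal ‖y‖⁻¹ * ‖D (wordIndex q.2) (x + y)‖ₑ :=
    (by fun_prop : Measurable fun y : Vel => ENNReal.ofReal ‖y‖⁻¹).mul hF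
  calc _ ≤ ∫⁻ y, ‖c (some q) y * D (α (some q)) (x + p y)‖ₑ ∂ρ :=
        enorm_integral_le_lintegral_enorm _
    _ ≤ ∫⁻ y, 4 * (ENNReal.ofReal y.2 * ‖D (wordIndex q.2) (x + p y)‖ₑ) ∂ρ := by
        refine lintegral_mono_ae (hρ.mono fun w hw => ?_)
        rw [enorm_mul, ← mul_assoc]
        gcongr
        · rw [Real.enorm_eq_ofReal_abs, show (4 : ℝ≥0∞) = ENNReal.ofReal 4 by simp,
            ← ENNReal.ofReal_mul (by norm_num)]
          exact ENNReal.ofReal_le_ofReal (hcbd q w (Ioc_subset_Icc_self hw))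
    _ = 4 * ∫⁻ σ, (∫⁻ r in Ioc (0 : ℝ) 1, ENNReal.ofReal r *
          ‖D (wordIndex q.2) (x + r • (σ : Vel))‖ₑ) ∂surf := by
        rw [lintegral_const_mul' _ _ (by simp), lintegral_prod]
        refine Measurable.aemeasurable ?_
        exact (by fun_prop : Measurable fun y : Metric.sphere (0 : Vel) 1 × ℝ => ENNReal.ofReal y.2).mul
          (hF.comp hpcont.measurable)
    _ = _ := by
        congr 1
        rw [← lintegral_indicator Metric.isOpen_ball.measurableSet,
          lintegral_polar (hG.indicator Metric.isOpen_ball.measurableSet)]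
        refine lintegral_congr fun σ => ?_
        rw [← setLIntegral_congr (Ioo_ae_eq_Ioc (a := (0 : ℝ)) (b := 1)),
          ← lintegral_indicator measurableSet_Ioo, ← lintegral_indicator measurableSet_Ioi]
        refine lintegral_congr fun r => ?_
        by_cases hr : 0 < r
        · have hn : ‖r • (σ : Vel)‖ = r := by
            rw [norm_smul, norm_sphere, mul_one, Real.norm_of_nonneg hr.le]
          rw [indicator_of_mem (show r ∈ Ioi (0 : ℝ) from hr)]
          by_cases h1 : r < 1
          · rw [indicator_of_mem (show r ∈ Ioo (0 : ℝ) 1 from ⟨hr, h1⟩), indicator_of_mem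
              (by simpa [hn] using h1), hn, ← mul_assoc, ← ENNReal.ofReal_mul (sq_nonneg r)]
            congr 2
            field_simp
          · rw [indicator_of_notMem (fun h : r ∈ Ioo (0 : ℝ) 1 => h1 h.2), indicator_of_notMem
              (by rw [Metric.mem_ball, dist_zero_right, hn]; exact h1), mul_zero]
        · rw [indicator_of_notMem (fun h : r ∈ Ioo (0 : ℝ) 1 => hr h.1),
            indicator_of_notMem (fun h : r ∈ Ioi (0 : ℝ) => hr h)]

theorem weightW_le_of_norm_le_one {m : ℝ} (hm : 0 ≤ m) {x y : Vel} (hy : ‖y‖ ≤ 1) :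
    weightW m x ≤ 3 ^ (m / 2) * weightW m (x + y) := by
  unfold weightW
  rw [← Real.mul_rpow (by norm_num) (by positivity)]
  refine Real.rpow_le_rpow (by positivity) ?_ (by positivity)
  have h1 : ‖x‖ ≤ ‖x + y‖ + 1 := by
    calc ‖x‖ = ‖(x + y) - y‖ := by rw [add_sub_cancel_right]
      _ ≤ ‖x + y‖ + ‖y‖ := norm_sub_le _ _
      _ ≤ _ := by linarith
  nlinarith [norm_nonneg x, norm_nonneg (x + y), sq_nonneg (‖x + y‖ - 1)]

/-- The `L²` norm of `1/|y|` on the unit ball. -/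
def potentialConst : ℝ≥0∞ := l2 ((Metric.ball (0 : Vel) 1).indicator fun y => ENNReal.ofReal ‖y‖⁻¹)

theorem potentialConst_ne_top : potentialConst ≠ ⊤ := by
  have h : potentialConst * potentialConst ≠ ⊤ := by
    unfold potentialConst
    rw [l2_sq]
    have hm : Measurable fun r : ℝ => (Iio (1 : ℝ)).indicator (fun r => ENNReal.ofReal r⁻¹) r ^ (2 : ℝ) :=
      ((by fun_prop : Measurable fun r : ℝ => ENNReal.ofReal r⁻¹).indicator
        measurableSet_Iio).pow_const _
    have e : ∀ y : Vel, (Metric.ball (0 : Vel) 1).indicator (fun y => ENNReal.ofReal ‖y‖⁻¹) y ^ (2 : ℝ)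
        = (fun r : ℝ => (Iio (1 : ℝ)).indicator (fun r => ENNReal.ofReal r⁻¹) r ^ (2 : ℝ)) ‖y‖ := by
      intro y
      by_cases hy : ‖y‖ < 1
      · simp [indicator_of_mem, hy]
      · simp [indicator_of_notMem, hy]
    simp only [e]
    rw [lintegral_radial hm]
    refine ENNReal.mul_ne_top (measure_ne_top _ _) (ne_of_lt ?_)
    calc _ ≤ ∫⁻ r in Ioi (0 : ℝ), (Iio (1 : ℝ)).indicator 1 r := by
          refine setLIntegral_mono' measurableSet_Ioi fun r hr => ?_
          have hr' : 0 < r := hr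
          by_cases h : r ∈ Iio (1 : ℝ)
          · rw [indicator_of_mem h, indicator_of_mem h, ENNReal.ofReal_rpow_of_nonneg (by positivity)
              (by norm_num), ← ENNReal.ofReal_mul (by positivity), Real.rpow_two, inv_pow,
              mul_inv_cancel₀ (by positivity)]
            simp
          · rw [indicator_of_notMem h, indicator_of_notMem h]
            simp
      _ = volume (Iio (1 : ℝ) ∩ Ioi 0) := by
          rw [lintegral_indicator_one measurableSet_Iio, Measure.restrict_apply measurableSet_Iio]
      _ < ⊤ := by
          rw [inter_comm, Ioi_inter_Iio, Real.volume_Ioo]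
          exact ENNReal.ofReal_lt_top
  intro h'
  rw [h'] at h
  simp at h

/-- The kernel `|y|⁻¹` is square integrable near the origin, so the potentials of
`ae_enorm_le_potential` are bounded by the Cauchy–Schwarz inequality; within distance one the
weight varies by a bounded factor. -/
theorem weighted_potential_le {m : ℝ} (hm : 0 ≤ m) {F : Vel → ℝ≥0∞} (hF : Measurable F) (x : Vel) :
    wE m x * ∫⁻ y in Metric.ball (0 : Vel) 1, ENNReal.ofReal ‖y‖⁻¹ * F (x + y) ≤
      ENNReal.ofReal (3 ^ (m / 2)) * potentialConst * wL2 m F := by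
  have hk : Measurable ((Metric.ball (0 : Vel) 1).indicator fun y : Vel => ENNReal.ofReal ‖y‖⁻¹) :=
    (by fun_prop : Measurable fun y : Vel => ENNReal.ofReal ‖y‖⁻¹).indicator
      Metric.isOpen_ball.measurableSet
  have hwF : Measurable fun y => wE m y * F y := (measurable_wE m).mul hF
  rw [← lintegral_const_mul' (wE m x) _ (by unfold wE; exact ENNReal.ofReal_ne_top),
    ← lintegral_indicator Metric.isOpen_ball.measurableSet]
  calc _ ≤ ∫⁻ y, ENNReal.ofReal (3 ^ (m / 2)) *
        ((Metric.ball (0 : Vel) 1).indicator (fun y => ENNReal.ofReal ‖y‖⁻¹) y *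
          (wE m (y + x) * F (y + x))) := by
        refine lintegral_mono fun y => ?_
        by_cases hy : y ∈ Metric.ball (0 : Vel) 1
        · rw [indicator_of_mem hy, indicator_of_mem hy, add_comm y x]
          have hy' : ‖y‖ ≤ 1 := by
            have : ‖y‖ < 1 := by simpa using hy
            exact this.le
          calc wE m x * (ENNReal.ofReal ‖y‖⁻¹ * F (x + y))
              ≤ ENNReal.ofReal (3 ^ (m / 2) * weightW m (x + y)) *
                  (ENNReal.ofReal ‖y‖⁻¹ * F (x + y)) := by
                gcongr
                exact ENNReal.ofReal_le_ofReal (weightW_le_of_norm_le_one hm hy')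
            _ = _ := by
                rw [ENNReal.ofReal_mul (by positivity), ← wE]
                ring
        · rw [indicator_of_notMem hy]
          exact zero_le
    _ ≤ ENNReal.ofReal (3 ^ (m / 2)) * (potentialConst * wL2 m F) := by
        rw [lintegral_const_mul' _ _ ENNReal.ofReal_ne_top]
        gcongr
        refine (lintegral_mul_le_l2 hk (hwF.comp (measurable_id.add_const x))).trans ?_
        gcongr
        · rfl
        · exact le_of_eq (l2_comp_add (f := fun y => wE m y * F y) x)
    _ = _ := by ring

/-- The sum of the moduli of the derivatives up to order `N`. -/
def jetSum (N : ℕ) (D : (Fin 3 → ℕ) → Vel → ℝ) (v : Vel) : ℝ≥0∞ :=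
  ∑ α ∈ multiIndices N, ‖D α v‖ₑ

theorem IsJet.measurable_jetSum {D : (Fin 3 → ℕ) → Vel → ℝ} (hD : IsJet D) (N : ℕ) :
    Measurable (jetSum N D) := by
  unfold jetSum
  exact Finset.measurable_fun_sum _ fun α _ => (hD.measurable α).enorm

theorem enorm_le_jetSum {D : (Fin 3 → ℕ) → Vel → ℝ} {N : ℕ} {α : Fin 3 → ℕ} (hα : ∑ i, α i ≤ N)
    (v : Vel) : ‖D α v‖ₑ ≤ jetSum N D v :=
  Finset.single_le_sum (f := fun α => ‖D α v‖ₑ) (fun _ _ => zero_le) (mem_multiIndices.2 hα)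

/-- The constant of the Sobolev embedding `H³_m ⊂ W^{1,∞}_m`. -/
def sobolevConst (m : ℝ) : ℝ≥0∞ :=
  ∑ _α ∈ multiIndices 1, ∑ _q : Σ m : Fin 3, (Fin m → Fin 3),
    areaS⁻¹ * (4 * (ENNReal.ofReal (3 ^ (m / 2)) * potentialConst))

theorem sobolevConst_ne_top (m : ℝ) : sobolevConst m ≠ ⊤ := by
  unfold sobolevConst
  refine (ENNReal.sum_lt_top.2 fun _ _ => ENNReal.sum_lt_top.2 fun _ _ => ?_).ne
  exact ENNReal.mul_lt_top (ENNReal.inv_lt_top.2 (pos_iff_ne_zero.2 areaS_ne_zero))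
    (ENNReal.mul_lt_top (by simp) (ENNReal.mul_lt_top ENNReal.ofReal_lt_top
      potentialConst_ne_top.lt_top))

/-- Weighted Sobolev embedding: derivatives up to order one are bounded by the `L²` norms of
derivatives up to order three. -/
theorem IsJet.ae_weighted_le {D : (Fin 3 → ℕ) → Vel → ℝ} (hD : IsJet D) {m : ℝ} (hm : 0 ≤ m) :
    ∀ᵐ x, wE m x * jetSum 1 D x ≤ sobolevConst m * wL2 m (jetSum 3 D) := by
  have h1 : ∀ α ∈ multiIndices 1, ∀ᵐ x : Vel, wE m x * ‖D α x‖ₑ ≤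
      ∑ _q : Σ m : Fin 3, (Fin m → Fin 3), areaS⁻¹ *
        (4 * (ENNReal.ofReal (3 ^ (m / 2)) * potentialConst)) * wL2 m (jetSum 3 D) := by
    intro α hα
    have hα1 := mem_multiIndices.1 hα
    have h := ae_enorm_le_potential (D := fun β => D (α + β)) (fun β => hD.measurable _)
      (fun β hβ => by
        rw [show α + 0 = α from add_zero α]
        refine hD.weak α β ?_
        simp only [Pi.add_apply, Finset.sum_add_distrib]
        omega)
    filter_upwards [h] with x hx
    simp only [add_zero] at hx
    have hx2 : ‖D α x‖ₑ ≤ areaS⁻¹ * ∑ q : Σ m : Fin 3, (Fin m → Fin 3),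
        4 * ∫⁻ y in Metric.ball (0 : Vel) 1,
          ENNReal.ofReal ‖y‖⁻¹ * ‖D (α + wordIndex q.2) (x + y)‖ₑ := by
      calc ‖D α x‖ₑ = areaS⁻¹ * (areaS * ‖D α x‖ₑ) := by
            rw [← mul_assoc, ENNReal.inv_mul_cancel areaS_ne_zero areaS_ne_top, one_mul]
        _ ≤ _ := by gcongr
    calc wE m x * ‖D α x‖ₑ ≤ wE m x * (areaS⁻¹ * ∑ q : Σ m : Fin 3, (Fin m → Fin 3),
        4 * ∫⁻ y in Metric.ball (0 : Vel) 1,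
          ENNReal.ofReal ‖y‖⁻¹ * ‖D (α + wordIndex q.2) (x + y)‖ₑ) := by gcongr
      _ = ∑ q : Σ m : Fin 3, (Fin m → Fin 3), areaS⁻¹ * (4 * (wE m x *
          ∫⁻ y in Metric.ball (0 : Vel) 1,
            ENNReal.ofReal ‖y‖⁻¹ * ‖D (α + wordIndex q.2) (x + y)‖ₑ)) := by
          rw [Finset.mul_sum, Finset.mul_sum]
          exact Finset.sum_congr rfl fun q _ => by ring
      _ ≤ _ := by
          refine Finset.sum_le_sum fun q _ => ?_
          rw [mul_assoc, mul_assoc]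
          refine mul_le_mul_right (mul_le_mul_right ?_ _) _
          have hF : Measurable fun y => ‖D (α + wordIndex q.2) y‖ₑ := (hD.measurable _).enorm
          refine (weighted_potential_le hm hF x).trans (mul_le_mul_right ?_ _)
          refine l2_mono fun v => mul_le_mul_right ?_ _
          refine enorm_le_jetSum ?_ v
          have := sum_wordIndex q.2
          simp only [Pi.add_apply, Finset.sum_add_distrib]
          omega
  have h2 : ∀ᵐ x : Vel, ∀ α ∈ multiIndices 1, wE m x * ‖D α x‖ₑ ≤
      ∑ _q : Σ m : Fin 3, (Fin m → Fin 3), areaS⁻¹ *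
        (4 * (ENNReal.ofReal (3 ^ (m / 2)) * potentialConst)) * wL2 m (jetSum 3 D) :=
    (Finset.eventually_all _).2 h1
  filter_upwards [h2] with x hx
  unfold jetSum sobolevConst
  rw [Finset.mul_sum, Finset.sum_mul]
  refine Finset.sum_le_sum fun α hα => ?_
  rw [Finset.sum_mul]
  exact hx α hα

/-! ### The bilinear estimate -/

/-- A bilinear majorant of products of derivatives: one factor carries at most one derivative, so
that it is bounded, and the other one carries up to three. -/
def jetPair (G H : (Fin 3 → ℕ) → Vel → ℝ) (x y : Vel) : ℝ≥0∞ :=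
  jetSum 1 G x * jetSum 3 H y + jetSum 3 G x * jetSum 1 H y

/-- The bilinear expression in weighted norms that bounds `jetPair`. -/
def crossNorm (l : ℝ) (G H : (Fin 3 → ℕ) → Vel → ℝ) : ℝ≥0∞ :=
  wL2 (l + 3) (jetSum 3 G) * l2 (jetSum 3 H) + l2 (jetSum 3 G) * wL2 (l + 3) (jetSum 3 H)

/-- Two jets of functions in `H³_{l+3}`. -/
structure WeightedJets (l : ℝ) (G H : (Fin 3 → ℕ) → Vel → ℝ) : Prop where
  nonneg : 0 ≤ l
  left : IsJet G
  right : IsJet H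
  finite_left : wL2 (l + 3) (jetSum 3 G) ≠ ⊤
  finite_right : wL2 (l + 3) (jetSum 3 H) ≠ ⊤

/-- The constant of the bilinear estimate. -/
def masterConst (l : ℝ) : ℝ≥0∞ :=
  ENNReal.ofReal (36 ^ ((l + 3) / 2)) * (2 * (sobolevConst (l + 3) + sobolevConst 0))

theorem masterConst_ne_top (l : ℝ) : masterConst l ≠ ⊤ :=
  ENNReal.mul_ne_top ENNReal.ofReal_ne_top (ENNReal.mul_ne_top (by simp)
    (ENNReal.add_ne_top.2 ⟨sobolevConst_ne_top _, sobolevConst_ne_top _⟩))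

section
variable {l : ℝ} {G H : (Fin 3 → ℕ) → Vel → ℝ}

theorem WeightedJets.measurable_jetPair (hJ : WeightedJets l G H) {Y : Type*} [MeasurableSpace Y]
    {x y : Y → Vel} (hx : Measurable x) (hy : Measurable y) :
    Measurable fun q => jetPair G H (x q) (y q) := by
  unfold jetPair
  exact (((hJ.left.measurable_jetSum 1).comp hx).mul ((hJ.right.measurable_jetSum 3).comp hy)).add
    (((hJ.left.measurable_jetSum 3).comp hx).mul ((hJ.right.measurable_jetSum 1).comp hy))

theorem WeightedJets.crossNorm_ne_top (hJ : WeightedJets l G H) : crossNorm l G H ≠ ⊤ := by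
  have h0 := hJ.nonneg
  have e : ∀ D, l2 (jetSum 3 D) ≤ wL2 (l + 3) (jetSum 3 D) := fun D => by
    rw [← wL2_zero]; exact wL2_mono (by linarith) _
  unfold crossNorm
  exact ENNReal.add_ne_top.2
    ⟨ENNReal.mul_ne_top hJ.finite_left (ne_top_of_le_ne_top hJ.finite_right (e H)),
      ENNReal.mul_ne_top (ne_top_of_le_ne_top hJ.finite_left (e G)) hJ.finite_right⟩

/-- The bilinear estimate. If two translates of `v` cannot both be small unless `v` and `z` are, the
weights at `v` and the decay `⟨z⟩⁻³` are paid for by the weights of the two factors; the factor with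
at most one derivative is bounded by the Sobolev embedding. -/
theorem WeightedJets.l2_jetPair_le (hJ : WeightedJets l G H) {a b z : Vel}
    (hv : ∀ v : Vel, ‖v‖ ≤ 3 * (‖v + a‖ + ‖v + b‖))
    (hz : ∀ v : Vel, ‖z‖ ≤ 3 * (‖v + a‖ + ‖v + b‖)) :
    ENNReal.ofReal (weightW 3 z) * l2 (fun v => wE l v * jetPair G H (v + a) (v + b)) ≤
      masterConst l * crossNorm l G H := by
  have h0 := hJ.nonneg
  have hl3 : 0 ≤ l + 3 := by linarith
  have hw : ∀ v, weightW l v * weightW 3 z ≤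
      36 ^ ((l + 3) / 2) * (weightW (l + 3) (v + a) + weightW (l + 3) (v + b)) := fun v =>
    weightW_mul_le h0 (by norm_num) (hv v) (hz v)
  have hle : ∀ D, wL2 0 (jetSum 3 D) ≤ wL2 (l + 3) (jetSum 3 D) := fun D =>
    wL2_mono hl3 _
  have key : ∀ {A D : (Fin 3 → ℕ) → Vel → ℝ}, IsJet A → IsJet D → wL2 (l + 3) (jetSum 3 A) ≠ ⊤ →
      ∀ {a b : Vel}, (∀ v, weightW l v * weightW 3 z ≤
        36 ^ ((l + 3) / 2) * (weightW (l + 3) (v + a) + weightW (l + 3) (v + b))) →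
      ENNReal.ofReal (weightW 3 z) *
        l2 (fun v => wE l v * (jetSum 1 A (v + a) * jetSum 3 D (v + b))) ≤
      ENNReal.ofReal (36 ^ ((l + 3) / 2)) * ((sobolevConst (l + 3) + sobolevConst 0) *
        (wL2 (l + 3) (jetSum 3 A) * l2 (jetSum 3 D) +
          l2 (jetSum 3 A) * wL2 (l + 3) (jetSum 3 D))) := by
    intro A D hA hD hfin a b hab
    have hA0 : ∀ᵐ v, jetSum 1 A v ≤ sobolevConst 0 * l2 (jetSum 3 A) := by
      filter_upwards [hA.ae_weighted_le le_rfl] with v hv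
      rwa [wE_zero, one_mul, wL2_zero] at hv
    have hf0 : l2 (jetSum 3 A) ≠ ⊤ := by
      rw [← wL2_zero]; exact ne_top_of_le_ne_top hfin (hle A)
    refine (l2_bilinear_le (by positivity) hab (hA.measurable_jetSum 1) (hD.measurable_jetSum 3)
      (ENNReal.mul_ne_top (sobolevConst_ne_top 0) hf0)
      (ENNReal.mul_ne_top (sobolevConst_ne_top _) hfin) hA0 (hA.ae_weighted_le hl3)).trans ?_
    refine mul_le_mul_right ?_ _
    rw [mul_add, add_mul, add_mul, ← mul_assoc, ← mul_assoc]
    rw [mul_assoc, mul_assoc]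
    gcongr
    · exact le_self_add
    · rw [← mul_assoc]; exact le_add_self
  have k1 := key hJ.left hJ.right hJ.finite_left hw
  have k2 := key (a := b) (b := a) hJ.right hJ.left hJ.finite_right fun v => by
    rw [add_comm (weightW (l + 3) (v + b))]; exact hw v
  have hsh : ∀ c : Vel, Measurable fun v : Vel => v + c := fun c => by fun_prop
  have hm : ∀ {A D : (Fin 3 → ℕ) → Vel → ℝ}, IsJet A → IsJet D → ∀ a b : Vel,
      Measurable fun v => wE l v * (jetSum 1 A (v + a) * jetSum 3 D (v + b)) := fun hA hD a b =>
    (measurable_wE l).mul (((hA.measurable_jetSum 1).comp (hsh a)).mul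
      ((hD.measurable_jetSum 3).comp (hsh b)))
  calc _ = ENNReal.ofReal (weightW 3 z) * l2 (fun v =>
        wE l v * (jetSum 1 G (v + a) * jetSum 3 H (v + b)) +
        wE l v * (jetSum 1 H (v + b) * jetSum 3 G (v + a))) := by
        congr 2
        ext v
        unfold jetPair
        ring
    _ ≤ ENNReal.ofReal (weightW 3 z) * (l2 (fun v =>
        wE l v * (jetSum 1 G (v + a) * jetSum 3 H (v + b))) + l2 (fun v =>
        wE l v * (jetSum 1 H (v + b) * jetSum 3 G (v + a)))) :=
        mul_le_mul_right (l2_add_le (hm hJ.left hJ.right a b) (hm hJ.right hJ.left b a)) _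
    _ ≤ _ := by
        rw [mul_add]
        refine (add_le_add k1 k2).trans (le_of_eq ?_)
        unfold masterConst crossNorm
        ring

/-- The bilinear estimate for superpositions of translates. -/
theorem WeightedJets.l2_lintegral_jetPair_le (hJ : WeightedJets l G H) {Y : Type*}
    [MeasurableSpace Y] {ν : Measure Y} [SFinite ν] {c : Y → ℝ} {a b z : Y → Vel}
    (hc : Measurable c) (ha : Measurable a) (hb : Measurable b)
    (hv : ∀ᵐ y ∂ν, ∀ v : Vel, ‖v‖ ≤ 3 * (‖v + a y‖ + ‖v + b y‖) ∧
      ‖z y‖ ≤ 3 * (‖v + a y‖ + ‖v + b y‖)) :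
    l2 (fun v => wE l v * ∫⁻ y, ENNReal.ofReal (c y) * jetPair G H (v + a y) (v + b y) ∂ν) ≤
      (∫⁻ y, ENNReal.ofReal (c y * (weightW 3 (z y))⁻¹) ∂ν) *
        (masterConst l * crossNorm l G H) := by
  have hmF : Measurable (Function.uncurry fun (v : Vel) (y : Y) =>
      wE l v * (ENNReal.ofReal (c y) * jetPair G H (v + a y) (v + b y))) := by
    have ha' : Measurable fun p : Vel × Y => p.1 + a p.2 := by fun_prop
    have hb' : Measurable fun p : Vel × Y => p.1 + b p.2 := by fun_prop
    have hP : Measurable fun p : Vel × Y => jetPair G H (p.1 + a p.2) (p.1 + b p.2) :=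
      hJ.measurable_jetPair ha' hb'
    have hw : Measurable fun p : Vel × Y => wE l p.1 := (measurable_wE l).comp measurable_fst
    have hc' : Measurable fun p : Vel × Y => ENNReal.ofReal (c p.2) :=
      (hc.comp measurable_snd).ennreal_ofReal
    exact hw.mul (hc'.mul hP)
  calc _ = l2 (fun v => ∫⁻ y, wE l v *
        (ENNReal.ofReal (c y) * jetPair G H (v + a y) (v + b y)) ∂ν) := by
        congr 1
        ext v
        rw [lintegral_const_mul' _ _ (by unfold wE; exact ENNReal.ofReal_ne_top)]
    _ ≤ ∫⁻ y, l2 (fun v => wE l v *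
        (ENNReal.ofReal (c y) * jetPair G H (v + a y) (v + b y))) ∂ν := l2_lintegral_le hmF
    _ ≤ ∫⁻ y, ENNReal.ofReal (c y * (weightW 3 (z y))⁻¹) * (masterConst l * crossNorm l G H) ∂ν := by
        refine lintegral_mono_ae (hv.mono fun y hy => ?_)
        have h := hJ.l2_jetPair_le (fun v => (hy v).1) fun v => (hy v).2
        have hw := weightW_pos 3 (z y)
        calc l2 (fun v => wE l v * (ENNReal.ofReal (c y) * jetPair G H (v + a y) (v + b y)))
            = ENNReal.ofReal (c y) * l2 (fun v => wE l v * jetPair G H (v + a y) (v + b y)) := by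
              rw [← l2_const_mul ENNReal.ofReal_ne_top]
              congr 1
              ext v
              ring
          _ = ENNReal.ofReal (c y * (weightW 3 (z y))⁻¹) * (ENNReal.ofReal (weightW 3 (z y)) *
                l2 (fun v => wE l v * jetPair G H (v + a y) (v + b y))) := by
              rw [← mul_assoc, ← ENNReal.ofReal_mul' hw.le, mul_assoc (c y),
                inv_mul_cancel₀ hw.ne', mul_one]
          _ ≤ _ := mul_le_mul_right h _
    _ = _ := lintegral_mul_const' _ _ (ENNReal.mul_ne_top (masterConst_ne_top l)
        hJ.crossNorm_ne_top)

end

/-! ### Finiteness from weighted bounds -/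

theorem ae_lt_top_of_l2 {l : ℝ} {F : Vel → ℝ≥0∞} (hF : Measurable F)
    (h : l2 (fun v => wE l v * F v) ≠ ⊤) : ∀ᵐ v, F v < ⊤ := by
  have h1 : ∫⁻ v, (wE l v * F v) ^ (2 : ℝ) ≠ ⊤ := by
    rw [← l2_sq]; exact ENNReal.mul_ne_top h h
  filter_upwards [ae_lt_top (((measurable_wE l).mul hF).pow_const _) h1] with v hv
  by_contra hc
  rw [not_lt, top_le_iff] at hc
  rw [Pi.mul_apply, hc, ENNReal.mul_top (by unfold wE; simpa using weightW_pos l v)] at hv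
  simp at hv

theorem lintegral_ball_lt_top_of_l2 {l : ℝ} (hl : 0 ≤ l) {F : Vel → ℝ≥0∞} (hF : Measurable F)
    (h : l2 (fun v => wE l v * F v) ≠ ⊤) (R : ℝ) : ∫⁻ v in Metric.ball 0 R, F v < ⊤ := by
  have hB : MeasurableSet (Metric.ball (0 : Vel) R) := Metric.isOpen_ball.measurableSet
  calc ∫⁻ v in Metric.ball 0 R, F v = ∫⁻ v, (Metric.ball (0 : Vel) R).indicator 1 v * F v := by
        rw [← lintegral_indicator hB]
        refine lintegral_congr fun v => ?_
        by_cases hv : v ∈ Metric.ball (0 : Vel) R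
        · rw [indicator_of_mem hv, indicator_of_mem hv, Pi.one_apply, one_mul]
        · rw [indicator_of_notMem hv, indicator_of_notMem hv, zero_mul]
    _ ≤ l2 ((Metric.ball (0 : Vel) R).indicator 1) * l2 F :=
        lintegral_mul_le_l2 (measurable_one.indicator hB) hF
    _ < ⊤ := by
        refine ENNReal.mul_lt_top ?_ (lt_of_le_of_lt (l2_mono fun v => ?_) (lt_top_iff_ne_top.2 h))
        · unfold l2
          refine ENNReal.rpow_lt_top_of_nonneg (by norm_num) ?_
          have : ∀ v, (Metric.ball (0 : Vel) R).indicator (1 : Vel → ℝ≥0∞) v ^ (2 : ℝ) =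
              (Metric.ball (0 : Vel) R).indicator 1 v := fun v => by
            by_cases hv : v ∈ Metric.ball (0 : Vel) R
            · rw [indicator_of_mem hv]; simp
            · rw [indicator_of_notMem hv]; simp
          simp only [this]
          rw [lintegral_indicator_one hB]
          exact measure_ball_lt_top.ne
        · exact le_mul_of_one_le_left zero_le (one_le_wE hl v)

/-! ### Geometry of collisions -/

/-- For a collision with angle at most `π / 2` and transfer `k`, the vector `z + u k`, which is the
difference of the points `v + t k` and `v_* - s k` for `u = s + t`, is bounded below by a fraction of
`|z|` and by `|k|`. -/
theorem norm_le_of_collision {z : Vel} {σ : Metric.sphere (0 : Vel) 1}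
    (hσ : 0 ≤ inner ℝ z (σ : Vel)) (u : ℝ) :
    ‖z‖ ≤ 2 * ‖z + u • transfer z σ‖ ∧ ‖transfer z σ‖ ≤ ‖z + u • transfer z σ‖ := by
  have hi := inner_transfer z σ
  have hn := norm_transfer z σ
  have hs0 := sinHalf_nonneg z σ
  have hz0 := norm_nonneg z
  have e1 : ‖z + u • transfer z σ‖ ^ 2 = ‖z‖ ^ 2 * (1 - sinHalf z σ ^ 2 * (u * (2 - u))) := by
    rw [norm_add_sq_real, inner_smul_right, hi, norm_smul, hn, mul_pow, Real.norm_eq_abs, sq_abs]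
    ring
  -- The angle is at most `π / 2`, hence `sin² (θ / 2) ≤ 1 / 2`.
  have hs : ‖z‖ ^ 2 * (2 * sinHalf z σ ^ 2) ≤ ‖z‖ ^ 2 := by
    have h := inner_eq_sinHalf z σ
    rw [h] at hσ
    nlinarith
  have hu : u * (2 - u) ≤ 1 := by nlinarith [sq_nonneg (u - 1)]
  have e2 : ‖z‖ ^ 2 ≤ 2 * ‖z + u • transfer z σ‖ ^ 2 := by
    rw [e1]
    have : ‖z‖ ^ 2 * sinHalf z σ ^ 2 * (u * (2 - u)) ≤ ‖z‖ ^ 2 * sinHalf z σ ^ 2 * 1 :=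
      mul_le_mul_of_nonneg_left hu (by positivity)
    nlinarith
  constructor
  · refine le_of_sq_le_sq ?_ (by positivity)
    nlinarith [sq_nonneg ‖z + u • transfer z σ‖]
  · refine le_of_sq_le_sq ?_ (by positivity)
    rw [hn, mul_pow]
    nlinarith

/-- The hypothesis of the bilinear estimate, for points on the segments that join the velocities before
and after a collision. -/
theorem norm_le_of_collision_shift {z : Vel} {σ : Metric.sphere (0 : Vel) 1}
    (hσ : 0 ≤ inner ℝ z (σ : Vel)) {s t : ℝ} (ht : t ∈ Icc (0 : ℝ) 1) (v : Vel) :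
    ‖v‖ ≤ 3 * (‖v + (-z - s • transfer z σ)‖ + ‖v + t • transfer z σ‖) ∧
      ‖z‖ ≤ 3 * (‖v + (-z - s • transfer z σ)‖ + ‖v + t • transfer z σ‖) := by
  obtain ⟨h1, h2⟩ := norm_le_of_collision hσ (s + t)
  set x := v + (-z - s • transfer z σ)
  set y := v + t • transfer z σ
  have e : z + (s + t) • transfer z σ = y - x := by
    simp only [x, y]; rw [add_smul]; abel
  rw [e] at h1 h2
  have h3 := norm_sub_le y x
  have h4 : ‖v‖ ≤ ‖y‖ + ‖transfer z σ‖ := by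
    calc ‖v‖ = ‖y - t • transfer z σ‖ := by simp [y]
      _ ≤ ‖y‖ + ‖t • transfer z σ‖ := norm_sub_le _ _
      _ ≤ _ := by
        rw [norm_smul, Real.norm_of_nonneg ht.1]
        have := mul_le_of_le_one_left (norm_nonneg (transfer z σ)) ht.2
        linarith
  have := norm_nonneg x
  have := norm_nonneg y
  constructor <;> linarith

/-- The hypothesis of the bilinear estimate, for the velocities before a collision. -/
theorem norm_le_of_sub (z v : Vel) :
    ‖v‖ ≤ 3 * (‖v + -z‖ + ‖v + 0‖) ∧ ‖z‖ ≤ 3 * (‖v + -z‖ + ‖v + 0‖) := by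
  rw [add_zero]
  have h1 : ‖z‖ ≤ ‖v + -z‖ + ‖v‖ := by
    calc ‖z‖ = ‖v - (v + -z)‖ := by rw [← sub_eq_add_neg, sub_sub_cancel]
      _ ≤ ‖v‖ + ‖v + -z‖ := norm_sub_le _ _
      _ = _ := add_comm _ _
  have := norm_nonneg (v + -z)
  have := norm_nonneg v
  constructor <;> linarith

/-! ### Norms of jets -/

theorem l2_finset_sum_le {ι : Type*} (s : Finset ι) {F : ι → Vel → ℝ≥0∞}
    (hF : ∀ i, Measurable (F i)) : l2 (fun v => ∑ i ∈ s, F i v) ≤ ∑ i ∈ s, l2 (F i) := by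
  classical
  induction s using Finset.induction_on with
  | empty =>
    simp only [Finset.sum_empty]
    unfold l2
    simp
  | insert i s hi ih =>
    simp only [Finset.sum_insert hi]
    exact (l2_add_le (hF i) (Finset.measurable_fun_sum _ fun i _ => hF i)).trans
      (add_le_add le_rfl ih)

theorem wL2_jetSum_le_normH {m : ℝ} {f : Vel → ℝ} {D : (Fin 3 → ℕ) → Vel → ℝ} (hD : IsJet D)
    (h : ∀ α ∈ multiIndices 3, weakPartial α f =ᵐ[volume] D α) :
    wL2 m (jetSum 3 D) ≤ normH 3 m f := by
  unfold wL2 jetSum normH normL2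
  simp only [Finset.mul_sum]
  refine (l2_finset_sum_le _ fun α => (measurable_wE m).mul (hD.measurable α).enorm).trans ?_
  refine Finset.sum_le_sum fun α hα => ?_
  rw [eLpNorm_two_eq_l2]
  refine l2_mono_ae ((h α hα).mono fun v hv => ?_)
  rw [hv, enorm_mul, Real.enorm_of_nonneg (weightW_pos m v).le]
  rfl

theorem MemH.normH_ne_top {m : ℝ} {f : Vel → ℝ} (h : MemH 3 m f) : normH 3 m f ≠ ⊤ := by
  unfold normH
  refine (ENNReal.sum_lt_top.2 fun α hα => ?_).ne
  obtain ⟨F, hF, hL⟩ := h α hα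
  unfold normL2
  rw [eLpNorm_congr_ae (g := fun v => weightW m v * F v)]
  · exact hL.2
  · filter_upwards [(h.isWeakPartial hα).ae_eq hF] with v hv
    rw [hv]

/-! ### Integration by parts in the Landau kernel -/

/-- The dominating kernel `|z|⁻¹ + |z|⁻²`. -/
def kern (z : Vel) : ℝ := ‖z‖⁻¹ + ‖z‖⁻¹ ^ 2

theorem kern_nonneg (z : Vel) : 0 ≤ kern z := by unfold kern; positivity

theorem measurable_kern : Measurable kern := by unfold kern; fun_prop

theorem integrable_kern_weight : Integrable (fun z : Vel => kern z * (weightW 3 z)⁻¹) volume := by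
  refine ⟨(measurable_kern.mul (continuous_weightW 3).measurable.inv).aestronglyMeasurable, ?_⟩
  rw [hasFiniteIntegral_iff_ofReal (Filter.Eventually.of_forall fun z =>
    mul_nonneg (kern_nonneg z) (inv_nonneg.2 (weightW_pos 3 z).le))]
  exact lintegral_kernel_lt_top

theorem integrable_kern_mul_test {ψ : Vel → ℝ} (hψ : IsTest ψ) :
    Integrable (fun z => kern z * ψ z) volume := by
  have hc : Continuous fun z => weightW 3 z * ψ z := (continuous_weightW 3).mul hψ.continuous
  obtain ⟨C, hC⟩ := (hψ.2.mul_left (f := weightW 3)).exists_bound_of_continuous hc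
  have := integrable_kern_weight.mul_bdd (c := C) hc.aestronglyMeasurable
    (Filter.Eventually.of_forall hC)
  refine this.congr (Filter.Eventually.of_forall fun z => ?_)
  have := (weightW_pos 3 z).ne'
  simp only
  field_simp

/-- The regularisation `δ_{ij} r⁻¹ - z_i z_j r⁻³`, `r = (|z|² + δ)^{1/2}`, of the projection
kernel. -/
def regKernel (δ : ℝ) (i j : Fin 3) (z : Vel) : ℝ :=
  (if i = j then 1 else 0) * (√(‖z‖ ^ 2 + δ))⁻¹ - z i * z j * (√(‖z‖ ^ 2 + δ))⁻¹ ^ 3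

theorem differentiable_regKernel {δ : ℝ} (hδ : 0 < δ) (i j : Fin 3) :
    Differentiable ℝ (regKernel δ i j) := by
  have h1 : Differentiable ℝ fun z : Vel => ‖z‖ ^ 2 + δ :=
    (differentiable_id.norm_sq ℝ).add_const δ
  have h2 : Differentiable ℝ fun z : Vel => (√(‖z‖ ^ 2 + δ))⁻¹ :=
    (h1.sqrt fun z => by positivity).inv fun z => by positivity
  have h3 : ∀ i : Fin 3, Differentiable ℝ fun z : Vel => z i := fun i => by fun_prop
  exact (h2.const_mul _).sub (((h3 i).mul (h3 j)).mul (h2.pow 3))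

theorem fderiv_regKernel {δ : ℝ} (hδ : 0 < δ) (i j : Fin 3) (z : Vel) :
    fderiv ℝ (regKernel δ i j) z (EuclideanSpace.single j 1) =
      -((if i = j then 1 else 0) * z j) * (√(‖z‖ ^ 2 + δ))⁻¹ ^ 3
      - ((if i = j then 1 else 0) * z j + z i) * (√(‖z‖ ^ 2 + δ))⁻¹ ^ 3
      + 3 * z i * z j ^ 2 * (√(‖z‖ ^ 2 + δ))⁻¹ ^ 5 := by
  rw [← (differentiable_regKernel hδ i j z).lineDeriv_eq_fderiv]
  refine HasLineDerivAt.lineDeriv ?_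
  unfold HasLineDerivAt
  have hpos : 0 < ‖z‖ ^ 2 + δ := by positivity
  have hco : ∀ i : Fin 3, HasDerivAt (fun t : ℝ => (z + t • EuclideanSpace.single j (1 : ℝ)) i)
      (if i = j then 1 else 0) 0 := by
    intro i
    have : (fun t : ℝ => (z + t • EuclideanSpace.single j (1 : ℝ)) i) =
        fun t => z i + t * (if i = j then 1 else 0) := by
      ext t
      simp
    rw [this]
    simpa using ((hasDerivAt_id (0 : ℝ)).mul_const (if i = j then (1 : ℝ) else 0)).const_add (z i)
  have hli : HasDerivAt (fun t : ℝ => z + t • EuclideanSpace.single j (1 : ℝ))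
      (EuclideanSpace.single j (1 : ℝ)) 0 := by
    simpa using ((hasDerivAt_id (0 : ℝ)).smul_const (EuclideanSpace.single j (1 : ℝ))).const_add z
  have hq : HasDerivAt (fun t : ℝ => ‖z + t • EuclideanSpace.single j (1 : ℝ)‖ ^ 2 + δ)
      (2 * z j) 0 := by
    refine (hli.norm_sq.add_const δ).congr_deriv ?_
    rw [zero_smul, add_zero, real_inner_comm, ← coord_eq_inner]
  have e0 : ‖z + (0 : ℝ) • EuclideanSpace.single j (1 : ℝ)‖ ^ 2 + δ = ‖z‖ ^ 2 + δ := by simp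
  have hr := (hq.sqrt (by rw [e0]; exact hpos.ne')).inv (by rw [e0]; positivity)
  have := (hr.const_mul (if i = j then (1 : ℝ) else 0)).sub (((hco i).mul (hco j)).mul (hr.pow 3))
  refine this.congr_deriv ?_
  simp only [zero_smul, add_zero, if_true, Pi.mul_apply, Pi.pow_apply, Pi.inv_apply]
  set r := √(‖z‖ ^ 2 + δ) with hrdef
  have hr0 : r ≠ 0 := by positivity
  push_cast
  field_simp
  ring

theorem sum_fderiv_regKernel {δ : ℝ} (hδ : 0 < δ) (i : Fin 3) (z : Vel) :
    ∑ j, fderiv ℝ (regKernel δ i j) z (EuclideanSpace.single j 1) =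
      -(2 * z i * (√(‖z‖ ^ 2 + δ))⁻¹ ^ 3 + 3 * δ * z i * (√(‖z‖ ^ 2 + δ))⁻¹ ^ 5) := by
  have hn : ‖z‖ ^ 2 = z 0 ^ 2 + (z 1 ^ 2 + z 2 ^ 2) := norm_sq_coords z
  have hpos : 0 < ‖z‖ ^ 2 + δ := by positivity
  have hs : √(‖z‖ ^ 2 + δ) ^ 2 = ‖z‖ ^ 2 + δ := Real.sq_sqrt hpos.le
  simp only [fderiv_regKernel hδ]
  set r := √(‖z‖ ^ 2 + δ) with hrdef
  have hr0 : r ≠ 0 := by positivity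
  have h5 : r⁻¹ ^ 3 = r⁻¹ ^ 5 * (z 0 ^ 2 + (z 1 ^ 2 + z 2 ^ 2) + δ) := by
    rw [← hn, ← hs]; field_simp
  rw [h5]
  fin_cases i <;> simp [Fin.sum_univ_three] <;> ring

theorem norm_le_sqrt {δ : ℝ} (hδ : 0 < δ) (z : Vel) : ‖z‖ ≤ √(‖z‖ ^ 2 + δ) :=
  Real.le_sqrt_of_sq_le (by linarith)

theorem abs_regKernel_le {δ : ℝ} (hδ : 0 < δ) (i j : Fin 3) {z : Vel} (hz : z ≠ 0) :
    |regKernel δ i j z| ≤ 2 * kern z := by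
  have hz' : 0 < ‖z‖ := norm_pos_iff.2 hz
  have hr := norm_le_sqrt hδ z
  unfold regKernel kern
  set r := √(‖z‖ ^ 2 + δ) with hrdef
  have hr0 : 0 < r := hz'.trans_le hr
  have h1 : r⁻¹ ≤ ‖z‖⁻¹ := inv_anti₀ hz' hr
  have h2 : |z i * z j * r⁻¹ ^ 3| ≤ r⁻¹ := by
    rw [abs_mul, abs_mul, abs_of_pos (show 0 < r⁻¹ ^ 3 by positivity)]
    calc |z i| * |z j| * r⁻¹ ^ 3 ≤ r * r * r⁻¹ ^ 3 := by
          gcongr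
          · exact (abs_coord_le z i).trans hr
          · exact (abs_coord_le z j).trans hr
      _ = r⁻¹ := by field_simp
  have h3 : |(if i = j then (1 : ℝ) else 0) * r⁻¹| ≤ r⁻¹ := by
    split
    · rw [one_mul, abs_of_pos (by positivity)]
    · simp; positivity
  calc _ ≤ |(if i = j then (1 : ℝ) else 0) * r⁻¹| + |z i * z j * r⁻¹ ^ 3| := abs_sub _ _
    _ ≤ 2 * ‖z‖⁻¹ := by linarith
    _ ≤ _ := by nlinarith [sq_nonneg ‖z‖⁻¹]

theorem abs_sum_fderiv_regKernel_le {δ : ℝ} (hδ : 0 < δ) (i : Fin 3) {z : Vel} (hz : z ≠ 0) :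
    |2 * z i * (√(‖z‖ ^ 2 + δ))⁻¹ ^ 3 + 3 * δ * z i * (√(‖z‖ ^ 2 + δ))⁻¹ ^ 5| ≤ 5 * kern z := by
  have hz' : 0 < ‖z‖ := norm_pos_iff.2 hz
  have hr := norm_le_sqrt hδ z
  have hpos : 0 < ‖z‖ ^ 2 + δ := by positivity
  have hs : √(‖z‖ ^ 2 + δ) ^ 2 = ‖z‖ ^ 2 + δ := Real.sq_sqrt hpos.le
  unfold kern
  set r := √(‖z‖ ^ 2 + δ) with hrdef
  have hr0 : 0 < r := hz'.trans_le hr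
  have h1 : r⁻¹ ≤ ‖z‖⁻¹ := inv_anti₀ hz' hr
  have hi := (abs_coord_le z i).trans hr
  have hd : δ ≤ r ^ 2 := by rw [hs]; nlinarith [sq_nonneg ‖z‖]
  calc _ ≤ |2 * z i * r⁻¹ ^ 3| + |3 * δ * z i * r⁻¹ ^ 5| := abs_add_le _ _
    _ = 2 * |z i| * r⁻¹ ^ 3 + 3 * δ * |z i| * r⁻¹ ^ 5 := by
        rw [abs_mul, abs_mul, abs_mul, abs_mul, abs_of_pos (show 0 < r⁻¹ ^ 3 by positivity),
          abs_of_pos (show 0 < r⁻¹ ^ 5 by positivity), abs_of_pos (show 0 < 3 * δ by positivity)]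
        norm_num
    _ ≤ 2 * r * r⁻¹ ^ 3 + 3 * r ^ 2 * r * r⁻¹ ^ 5 := by gcongr
    _ = 5 * r⁻¹ ^ 2 := by field_simp; norm_num
    _ ≤ 5 * ‖z‖⁻¹ ^ 2 := by gcongr
    _ ≤ _ := by have : 0 ≤ ‖z‖⁻¹ := by positivity
                linarith

/-- The divergence of the regularised kernel, which is smooth, tested against `ψ`. -/
theorem integral_regKernel_test {δ : ℝ} (hδ : 0 < δ) (i : Fin 3) {ψ : Vel → ℝ} (hψ : IsTest ψ) :
    ∑ j, ∫ z, regKernel δ i j z * partialD j ψ z =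
      ∫ z, (2 * z i * (√(‖z‖ ^ 2 + δ))⁻¹ ^ 3 + 3 * δ * z i * (√(‖z‖ ^ 2 + δ))⁻¹ ^ 5) * ψ z := by
  have hK : ∀ j, Continuous (regKernel δ i j) := fun j => (differentiable_regKernel hδ i j).continuous
  have hK' : ∀ j, Continuous fun z => fderiv ℝ (regKernel δ i j) z (EuclideanSpace.single j 1) := by
    intro j
    simp only [fderiv_regKernel hδ]
    have : ∀ z : Vel, √(‖z‖ ^ 2 + δ) ≠ 0 := fun z => by positivity
    fun_prop (disch := exact this)
  have hint : ∀ {f χ : Vel → ℝ}, Continuous f → IsTest χ → Integrable (fun z => f z * χ z) volume :=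
    fun hf hχ => (hf.mul hχ.continuous).integrable_of_hasCompactSupport hχ.2.mul_left
  have h1 : ∀ j, ∫ z, regKernel δ i j z * partialD j ψ z =
      -∫ z, fderiv ℝ (regKernel δ i j) z (EuclideanSpace.single j 1) * ψ z := fun j =>
    integral_mul_fderiv_eq_neg_fderiv_mul_of_integrable (hint (hK' j) hψ)
      (hint (hK j) (hψ.partialD j)) (hint (hK j) hψ) (fun z _ => differentiable_regKernel hδ i j z)
      fun z _ => hψ.1.differentiable (by simp) z
  simp only [h1]
  rw [Finset.sum_neg_distrib, ← integral_finsetSum _ fun j _ => hint (hK' j) hψ, ← integral_neg]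
  congr 1
  ext z
  rw [← Finset.sum_mul, sum_fderiv_regKernel hδ]
  ring

theorem landauA_eq (φ : ℝ → ℝ) (z : Vel) (i j : Fin 3) :
    landauA φ z i j = 2 * Real.pi * momentI φ 3 *
      ((if i = j then 1 else 0) * ‖z‖⁻¹ - z i * z j * ‖z‖⁻¹ ^ 3) := by
  unfold landauA
  by_cases hz : ‖z‖ = 0
  · simp [hz]
  · field_simp

theorem abs_landauA_le (φ : ℝ → ℝ) (z : Vel) (i j : Fin 3) :
    |landauA φ z i j| ≤ 4 * Real.pi * momentI φ 3 * ‖z‖⁻¹ := by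
  rw [landauA_eq]
  have hI := momentI_nonneg φ 3
  have hpi := Real.pi_pos
  rw [abs_mul, abs_of_nonneg (by positivity)]
  have h2 : |z i * z j * ‖z‖⁻¹ ^ 3| ≤ ‖z‖⁻¹ := by
    by_cases hz : ‖z‖ = 0
    · simp [hz]
    rw [abs_mul, abs_mul, abs_of_nonneg (show 0 ≤ ‖z‖⁻¹ ^ 3 by positivity)]
    calc |z i| * |z j| * ‖z‖⁻¹ ^ 3 ≤ ‖z‖ * ‖z‖ * ‖z‖⁻¹ ^ 3 := by
          gcongr
          · exact abs_coord_le z i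
          · exact abs_coord_le z j
      _ = ‖z‖⁻¹ := by field_simp
  have h3 : |(if i = j then (1 : ℝ) else 0) * ‖z‖⁻¹| ≤ ‖z‖⁻¹ := by
    split
    · rw [one_mul, abs_of_nonneg (by positivity)]
    · simp
  calc _ ≤ 2 * Real.pi * momentI φ 3 * (‖z‖⁻¹ + ‖z‖⁻¹) :=
        mul_le_mul_of_nonneg_left ((abs_sub _ _).trans (add_le_add h3 h2)) (by positivity)
    _ = _ := by ring

theorem measurable_landauA (φ : ℝ → ℝ) (i j : Fin 3) : Measurable fun z => landauA φ z i j := by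
  simp only [landauA_eq]
  fun_prop

theorem abs_landauB_le (φ : ℝ → ℝ) (z : Vel) (i : Fin 3) :
    |landauB φ i z| ≤ 4 * Real.pi * momentI φ 3 * ‖z‖⁻¹ ^ 2 := by
  unfold landauB
  have hI := momentI_nonneg φ 3
  have hpi := Real.pi_pos
  by_cases hz : ‖z‖ = 0
  · simp [hz]
  have : |z i * ‖z‖⁻¹ ^ 3| ≤ ‖z‖⁻¹ ^ 2 := by
    rw [abs_mul, abs_of_nonneg (show 0 ≤ ‖z‖⁻¹ ^ 3 by positivity)]
    calc |z i| * ‖z‖⁻¹ ^ 3 ≤ ‖z‖ * ‖z‖⁻¹ ^ 3 := by gcongr; exact abs_coord_le z i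
      _ = _ := by field_simp
  rw [abs_neg, abs_mul, abs_of_nonneg (by positivity : 0 ≤ 4 * Real.pi * momentI φ 3)]
  gcongr

theorem measurable_landauB (φ : ℝ → ℝ) (i : Fin 3) : Measurable (landauB φ i) := by
  unfold landauB
  fun_prop

/-- `∑_j ∂_j a_{ij} = b_i` in the sense of distributions. -/
theorem integral_landauA_test (φ : ℝ → ℝ) (i : Fin 3) {ψ : Vel → ℝ} (hψ : IsTest ψ) :
    ∑ j, ∫ z, landauA φ z i j * partialD j ψ z = -∫ z, landauB φ i z * ψ z := by
  -- Both sides are limits of the identity for the regularised kernel, dominated by multiples of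
  -- `kern`.
  set δ : ℕ → ℝ := fun n => 1 / ((n : ℝ) + 1) with hδdef
  have hδ : ∀ n, 0 < δ n := fun n => by simp only [hδdef]; positivity
  have hδ0 : Filter.Tendsto δ Filter.atTop (nhds 0) := tendsto_one_div_add_atTop_nhds_zero_nat
  have hne : ∀ᵐ z : Vel, z ≠ 0 := by
    rw [ae_iff]; simp
  have hr : ∀ z : Vel, z ≠ 0 → Filter.Tendsto (fun n => (√(‖z‖ ^ 2 + δ n))⁻¹) Filter.atTop
      (nhds ‖z‖⁻¹) := by
    intro z hz
    have h1 : Filter.Tendsto (fun n => √(‖z‖ ^ 2 + δ n)) Filter.atTop (nhds ‖z‖) := by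
      have := (hδ0.const_add (‖z‖ ^ 2)).sqrt
      rwa [add_zero, Real.sqrt_sq (norm_nonneg z)] at this
    exact h1.inv₀ (norm_ne_zero_iff.2 hz)
  have hL : ∀ j, Filter.Tendsto (fun n => ∫ z, regKernel (δ n) i j z * partialD j ψ z) Filter.atTop
      (nhds (∫ z, ((if i = j then 1 else 0) * ‖z‖⁻¹ - z i * z j * ‖z‖⁻¹ ^ 3) * partialD j ψ z)) := by
    intro j
    refine tendsto_integral_of_dominated_convergence (fun z => ‖2 * (kern z * partialD j ψ z)‖)
      (fun n => ((differentiable_regKernel (hδ n) i j).continuous.mul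
        (hψ.partialD j).continuous).aestronglyMeasurable)
      ((integrable_kern_mul_test (hψ.partialD j)).const_mul 2).norm (fun n => ?_) ?_
    · filter_upwards [hne] with z hz
      rw [← mul_assoc, norm_mul, norm_mul (2 * kern z)]
      gcongr
      exact (abs_regKernel_le (hδ n) i j hz).trans (le_abs_self _)
    · filter_upwards [hne] with z hz
      unfold regKernel
      exact (((hr z hz).const_mul _).sub (((hr z hz).pow 3).const_mul _)).mul_const _
  have hR : Filter.Tendsto (fun n => ∫ z, (2 * z i * (√(‖z‖ ^ 2 + δ n))⁻¹ ^ 3 +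
      3 * δ n * z i * (√(‖z‖ ^ 2 + δ n))⁻¹ ^ 5) * ψ z) Filter.atTop
      (nhds (∫ z, (2 * z i * ‖z‖⁻¹ ^ 3) * ψ z)) := by
    refine tendsto_integral_of_dominated_convergence (fun z => ‖5 * (kern z * ψ z)‖)
      (fun n => ?_) ((integrable_kern_mul_test hψ).const_mul 5).norm (fun n => ?_) ?_
    · have := hψ.continuous.measurable
      exact Measurable.aestronglyMeasurable (by fun_prop)
    · filter_upwards [hne] with z hz
      rw [← mul_assoc, norm_mul, norm_mul (5 * kern z)]
      gcongr
      exact (abs_sum_fderiv_regKernel_le (hδ n) i hz).trans (le_abs_self _)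
    · filter_upwards [hne] with z hz
      have := (((hr z hz).pow 3).const_mul (2 * z i)).add
        (((hδ0.const_mul 3).mul_const (z i)).mul ((hr z hz).pow 5))
      simpa using this.mul_const (ψ z)
  have hS := tendsto_finsetSum Finset.univ fun j _ => hL j
  have key := tendsto_nhds_unique (hS.congr fun n => integral_regKernel_test (hδ n) i hψ) hR
  simp only [landauA_eq, mul_assoc (2 * Real.pi * momentI φ 3), integral_const_mul,
    ← Finset.mul_sum] at key ⊢
  rw [key, ← integral_const_mul, ← integral_neg]
  congr 1
  ext z
  unfold landauB
  ring

/-! ### Integration by parts for weakly differentiable functions -/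

/-- Convolutions of kernels bounded by `kern` with functions in `L²_3` are locally integrable. -/
theorem lintegral_ball_conv_lt_top {c F : Vel → ℝ} (hc : Measurable c) (hF : Measurable F) {K : ℝ}
    (hK : ∀ z, |c z| ≤ K * kern z) (hfin : wL2 3 (fun v => ‖F v‖ₑ) ≠ ⊤) (R : ℝ) :
    ∫⁻ x in Metric.ball 0 R, ∫⁻ y, ‖c y * F (x + -y)‖ₑ < ⊤ := by
  have hB : MeasurableSet (Metric.ball (0 : Vel) R) := Metric.isOpen_ball.measurableSet
  set A : Vel → ℝ≥0∞ := (Metric.ball (0 : Vel) R).indicator 1 with hA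
  have hAm : Measurable A := measurable_one.indicator hB
  have hFm : Measurable fun v => ‖F v‖ₑ := hF.enorm
  set N : ℝ≥0∞ := ENNReal.ofReal (36 ^ ((0 + 3 : ℝ) / 2)) *
    (ENNReal.ofReal ((1 + R ^ 2) ^ ((3 : ℝ) / 2)) * l2 (fun v => ‖F v‖ₑ) +
      wL2 3 fun v => ‖F v‖ₑ) with hN
  have hN' : N ≠ ⊤ := by
    refine ENNReal.mul_ne_top ENNReal.ofReal_ne_top (ENNReal.add_ne_top.2
      ⟨ENNReal.mul_ne_top ENNReal.ofReal_ne_top ?_, hfin⟩)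
    rw [← wL2_zero]
    exact ne_top_of_le_ne_top hfin (wL2_mono (by norm_num) _)
  have hz : ∀ z : Vel, ENNReal.ofReal (weightW 3 z) * l2 (fun v => A v * ‖F (v + -z)‖ₑ) ≤ N := by
    intro z
    have := l2_bilinear_le (l := 0) (m := 3) (κ := weightW 3 z) (C := 36 ^ ((0 + 3 : ℝ) / 2))
      (by positivity) (a := 0) (b := -z) (fun v => by
        have h := norm_le_of_sub z v
        have := weightW_mul_le (l := 0) (n := 3) le_rfl (by norm_num) h.1 h.2
        rw [add_comm (weightW _ (v + 0))]
        simpa only [zero_add] using this) hAm hFm (M₀ := 1)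
        (M := ENNReal.ofReal ((1 + R ^ 2) ^ ((3 : ℝ) / 2))) (by simp) ENNReal.ofReal_ne_top
        (Filter.Eventually.of_forall fun v => indicator_le_self _ _ v)
        (Filter.Eventually.of_forall fun v => by
          by_cases hv : v ∈ Metric.ball (0 : Vel) R
          · rw [hA, indicator_of_mem hv, Pi.one_apply, mul_one, wE, weightW]
            have : ‖v‖ < R := by simpa using hv
            gcongr
          · rw [hA, indicator_of_notMem hv, mul_zero]
            exact zero_le)
    simpa only [wE_zero, one_mul, add_zero] using this
  have hmF : Measurable (Function.uncurry fun (v y : Vel) => A v * (‖c y‖ₑ * ‖F (v + -y)‖ₑ)) := by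
    have h1 : Measurable fun p : Vel × Vel => F (p.1 + -p.2) :=
      hF.comp (measurable_fst.add measurable_snd.neg)
    exact (hAm.comp measurable_fst).mul ((hc.comp measurable_snd).enorm.mul h1.enorm)
  have hl2 : l2 (fun v => ∫⁻ y, A v * (‖c y‖ₑ * ‖F (v + -y)‖ₑ)) < ⊤ := by
    calc _ ≤ ∫⁻ y, l2 (fun v => A v * (‖c y‖ₑ * ‖F (v + -y)‖ₑ)) := l2_lintegral_le hmF
      _ ≤ ∫⁻ y, ENNReal.ofReal (K * (kern y * (weightW 3 y)⁻¹)) * N := by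
          refine lintegral_mono fun y => ?_
          have hw := weightW_pos 3 y
          calc l2 (fun v => A v * (‖c y‖ₑ * ‖F (v + -y)‖ₑ))
              = ‖c y‖ₑ * l2 (fun v => A v * ‖F (v + -y)‖ₑ) := by
                rw [← l2_const_mul enorm_ne_top]
                congr 1; ext v; ring
            _ ≤ ENNReal.ofReal (K * kern y) * l2 (fun v => A v * ‖F (v + -y)‖ₑ) := by
                gcongr
                rw [Real.enorm_eq_ofReal_abs]
                exact ENNReal.ofReal_le_ofReal (hK y)
            _ = ENNReal.ofReal (K * (kern y * (weightW 3 y)⁻¹)) * (ENNReal.ofReal (weightW 3 y) *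
                l2 (fun v => A v * ‖F (v + -y)‖ₑ)) := by
                rw [← mul_assoc, ← ENNReal.ofReal_mul' hw.le]
                congr 2
                field_simp
            _ ≤ _ := mul_le_mul_right (hz y) _
      _ = _ := lintegral_mul_const' _ _ hN'
      _ < ⊤ := ENNReal.mul_lt_top (integrable_kern_weight.const_mul K).lintegral_lt_top
          hN'.lt_top
  have hm2 : Measurable fun v => ∫⁻ y, A v * (‖c y‖ₑ * ‖F (v + -y)‖ₑ) := hmF.lintegral_prod_right'
  calc _ = ∫⁻ v in Metric.ball 0 R, ∫⁻ y, A v * (‖c y‖ₑ * ‖F (v + -y)‖ₑ) := by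
        refine setLIntegral_congr_fun hB fun v hv => ?_
        simp only [hA, indicator_of_mem hv, Pi.one_apply, one_mul, enorm_mul]
    _ < ⊤ := lintegral_ball_lt_top_of_l2 (l := 0) le_rfl hm2 (by
        simp only [wE_zero, one_mul]; exact hl2.ne) R

theorem IsJet.wL2_ne_top {D : (Fin 3 → ℕ) → Vel → ℝ} {m : ℝ} (hfin : wL2 m (jetSum 3 D) ≠ ⊤)
    {α : Fin 3 → ℕ} (hα : ∑ i, α i ≤ 3) : wL2 m (fun v => ‖D α v‖ₑ) ≠ ⊤ :=
  ne_top_of_le_ne_top hfin (l2_mono fun v => mul_le_mul_right (enorm_le_jetSum hα v) _)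

/-- Integration by parts against the Landau kernel, for functions with weak derivatives: the identity
`integral_landauA_test`, transferred by `ae_sum_integral_eq_zero_of_test`. -/
theorem IsJet.ae_landau_by_parts {D : (Fin 3 → ℕ) → Vel → ℝ} (hD : IsJet D)
    (hfin : wL2 3 (jetSum 3 D) ≠ ⊤) (φ : ℝ → ℝ) (i : Fin 3) {α : Fin 3 → ℕ} (hα : ∑ i, α i ≤ 2) :
    ∀ᵐ v : Vel, ∑ j, ∫ z, landauA φ z i j * D (α + Pi.single j 1) (v - z) =
      ∫ z, landauB φ i z * D α (v - z) := by
  -- The index `none` stands for the term with `b_i`, and `some j` for the one with `a_{ij}`.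
  let c : Option (Fin 3) → Vel → ℝ
    | none => fun z => -landauB φ i z
    | some j => fun z => landauA φ z i j
  let β : Option (Fin 3) → Fin 3 → ℕ
    | none => 0
    | some j => Pi.single j 1
  have hc : ∀ k, Measurable (c k) := by
    rintro (_ | j)
    · exact (measurable_landauB φ i).neg
    · exact measurable_landauA φ i j
  have hβ : ∀ k, ∑ i, (α + β k) i ≤ 3 := by
    rintro (_ | j)
    · simp only [β, add_zero]; omega
    · simp only [β, Pi.add_apply, Finset.sum_add_distrib, Finset.sum_pi_single', Finset.mem_univ,
        if_true]
      omega
  have hI := momentI_nonneg φ 3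
  have hpi := Real.pi_pos
  have hcb : ∀ k z, |c k z| ≤ 4 * Real.pi * momentI φ 3 * kern z := by
    rintro (_ | j) z
    · simp only [c, abs_neg]
      refine (abs_landauB_le φ z i).trans (mul_le_mul_of_nonneg_left ?_ (by positivity))
      unfold kern
      linarith [inv_nonneg.2 (norm_nonneg z)]
    · refine (abs_landauA_le φ z i j).trans (mul_le_mul_of_nonneg_left ?_ (by positivity))
      unfold kern
      linarith [sq_nonneg ‖z‖⁻¹]
  have hαle : ∑ i, α i ≤ 3 := by omega
  have main := ae_sum_integral_eq_zero_of_test Finset.univ (fun _ => volume) hc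
    (measurable_neg : Measurable fun y : Vel => -y) (hD.measurable α) (α := β)
    (F := fun k => D (α + β k)) (fun k => hD.measurable _) (fun k _ => hD.weak _ _ (hβ k))
    (fun k _ R => lintegral_ball_conv_lt_top (hc k) (hD.measurable _) (hcb k)
      (IsJet.wL2_ne_top hfin (hβ k)) R)
    (fun k _ R => lintegral_ball_conv_lt_top (hc k) (hD.measurable _) (hcb k)
      (IsJet.wL2_ne_top hfin hαle) R)
    (fun ψ hψ => by
      rw [Fintype.sum_option]
      have hχ := hψ.comp_sub_left 0
      have h := integral_landauA_test φ i hχ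
      have e1 : ∀ j, ∫ z, landauA φ z i j * partialD j (fun y => ψ (0 - y)) z =
          -∫ z, c (some j) z * partialMulti (β (some j)) ψ (-z) := by
        intro j
        rw [← integral_neg]
        congr 1
        ext z
        rw [partialD_comp_sub_left hψ]
        simp only [c, β, partialMulti_single hψ.1, zero_sub]
        ring
      have e2 : ∫ z, landauB φ i z * ψ (0 - z) =
          -∫ z, c none z * partialMulti (β none) ψ (-z) := by
        rw [← integral_neg]
        congr 1
        ext z
        simp only [c, β, partialMulti_zero, zero_sub]
        ring
      rw [e2] at h
      simp only [e1, Finset.sum_neg_distrib] at h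
      linarith)
  filter_upwards [main] with v hv
  rw [Fintype.sum_option] at hv
  simp only [c, β, add_zero, neg_mul, ← sub_eq_add_neg, integral_neg] at hv
  linarith

/-! ### Bilinear convolutions -/

section
variable {l : ℝ} {G H : (Fin 3 → ℕ) → Vel → ℝ}

/-- At most three derivatives fall on the two factors together, so one of them carries at most one. -/
theorem enorm_mul_le_jetPair {α β : Fin 3 → ℕ} (h : ∑ i, α i + ∑ i, β i ≤ 3) (x y : Vel) :
    ‖G α x * H β y‖ₑ ≤ jetPair G H x y := by
  rw [enorm_mul]
  unfold jetPair
  by_cases hα : ∑ i, α i ≤ 1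
  · exact (mul_le_mul' (enorm_le_jetSum hα x) (enorm_le_jetSum (by omega) y)).trans le_self_add
  · exact (mul_le_mul' (enorm_le_jetSum (by omega) x) (enorm_le_jetSum (by omega) y)).trans
      le_add_self

/-- The integral `∫ kern(z) Π(v - z, v) dz` of the bilinear majorant `Π` of `jetPair`. -/
def kernPair (G H : (Fin 3 → ℕ) → Vel → ℝ) (v : Vel) : ℝ≥0∞ :=
  ∫⁻ z, ENNReal.ofReal (kern z) * jetPair G H (v + -z) (v + 0)

/-- The total mass of `kern(z) ⟨z⟩⁻³`. -/
def kernMass : ℝ≥0∞ := ∫⁻ z : Vel, ENNReal.ofReal (kern z * (weightW 3 z)⁻¹)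

theorem kernMass_ne_top : kernMass ≠ ⊤ := lintegral_kernel_lt_top.ne

theorem WeightedJets.l2_kernPair_le (hJ : WeightedJets l G H) :
    l2 (fun v => wE l v * kernPair G H v) ≤ kernMass * (masterConst l * crossNorm l G H) :=
  hJ.l2_lintegral_jetPair_le (ν := volume) (a := fun z => -z) (b := fun _ => 0) (z := fun z => z)
    measurable_kern measurable_neg measurable_const
    (Filter.Eventually.of_forall fun z v => norm_le_of_sub z v)

theorem WeightedJets.l2_kernPair_ne_top (hJ : WeightedJets l G H) :
    l2 (fun v => wE l v * kernPair G H v) ≠ ⊤ :=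
  ne_top_of_le_ne_top (ENNReal.mul_ne_top kernMass_ne_top
    (ENNReal.mul_ne_top (masterConst_ne_top l) hJ.crossNorm_ne_top)) hJ.l2_kernPair_le

theorem WeightedJets.measurable_kernPair (hJ : WeightedJets l G H) : Measurable (kernPair G H) := by
  have h1 : Measurable fun p : Vel × Vel => p.1 + -p.2 := by fun_prop
  have h2 : Measurable fun p : Vel × Vel => p.1 + (0 : Vel) := by fun_prop
  have hk : Measurable fun p : Vel × Vel => ENNReal.ofReal (kern p.2) :=
    (measurable_kern.comp measurable_snd).ennreal_ofReal
  exact (hk.mul (hJ.measurable_jetPair h1 h2)).lintegral_prod_right'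

theorem lintegral_pair_le {c : Vel → ℝ} {K : ℝ} (hK : ∀ z, |c z| ≤ K * kern z)
    {α β : Fin 3 → ℕ} (h : ∑ i, α i + ∑ i, β i ≤ 3) (v : Vel) :
    ∫⁻ z, ‖c z * (G α (v - z) * H β v)‖ₑ ≤ ENNReal.ofReal K * kernPair G H v := by
  unfold kernPair
  rw [← lintegral_const_mul' _ _ ENNReal.ofReal_ne_top]
  refine lintegral_mono fun z => ?_
  rw [enorm_mul, ← mul_assoc]
  refine mul_le_mul' ?_ ?_
  · rw [Real.enorm_eq_ofReal_abs, ← ENNReal.ofReal_mul' (kern_nonneg z)]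
    exact ENNReal.ofReal_le_ofReal (hK z)
  · rw [add_zero, ← sub_eq_add_neg]
    exact enorm_mul_le_jetPair h _ _

theorem WeightedJets.measurable_pair (hJ : WeightedJets l G H) {c : Vel → ℝ} (hc : Measurable c)
    (α β : Fin 3 → ℕ) : Measurable fun p : Vel × Vel => c p.2 * (G α (p.1 - p.2) * H β p.1) :=
  (hc.comp measurable_snd).mul (((hJ.left.measurable α).comp (measurable_fst.sub measurable_snd)).mul
    ((hJ.right.measurable β).comp measurable_fst))

theorem WeightedJets.ae_kernPair_lt_top (hJ : WeightedJets l G H) : ∀ᵐ v, kernPair G H v < ⊤ :=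
  ae_lt_top_of_l2 hJ.measurable_kernPair hJ.l2_kernPair_ne_top

theorem WeightedJets.integrable_pair (hJ : WeightedJets l G H) {c : Vel → ℝ} (hc : Measurable c)
    {K : ℝ} (hK : ∀ z, |c z| ≤ K * kern z) {α β : Fin 3 → ℕ} (h : ∑ i, α i + ∑ i, β i ≤ 3) {v : Vel}
    (hv : kernPair G H v < ⊤) : Integrable (fun z => c z * (G α (v - z) * H β v)) volume :=
  ⟨((hJ.measurable_pair hc α β).comp measurable_prodMk_left).aestronglyMeasurable,
    (lintegral_pair_le hK h v).trans_lt (ENNReal.mul_lt_top ENNReal.ofReal_lt_top hv)⟩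

theorem WeightedJets.lintegral_ball_pair_lt_top (hJ : WeightedJets l G H) {c : Vel → ℝ}
    {K : ℝ} (hK : ∀ z, |c z| ≤ K * kern z) {α β : Fin 3 → ℕ}
    (h : ∑ i, α i + ∑ i, β i ≤ 3) (R : ℝ) :
    ∫⁻ v in Metric.ball 0 R, ∫⁻ z, ‖c z * (G α (v - z) * H β v)‖ₑ < ⊤ := by
  calc _ ≤ ∫⁻ v in Metric.ball 0 R, ENNReal.ofReal K * kernPair G H v :=
        lintegral_mono fun v => lintegral_pair_le hK h v
    _ = ENNReal.ofReal K * ∫⁻ v in Metric.ball 0 R, kernPair G H v :=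
        lintegral_const_mul' _ _ ENNReal.ofReal_ne_top
    _ < ⊤ := ENNReal.mul_lt_top ENNReal.ofReal_lt_top
        (lintegral_ball_lt_top_of_l2 hJ.nonneg hJ.measurable_kernPair hJ.l2_kernPair_ne_top R)

theorem WeightedJets.integrable_pair_mul_test (hJ : WeightedJets l G H) {c : Vel → ℝ}
    (hc : Measurable c) {K : ℝ} (hK : ∀ z, |c z| ≤ K * kern z) {α β : Fin 3 → ℕ}
    (h : ∑ i, α i + ∑ i, β i ≤ 3) {χ : Vel → ℝ} (hχ : IsTest χ) :
    Integrable (fun p : Vel × Vel => c p.2 * (G α (p.1 - p.2) * H β p.1) * χ p.1)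
      (volume.prod volume) :=
  integrable_prod_of_lintegral_lt_top ((hJ.measurable_pair hc α β).mul
    (hχ.continuous.measurable.comp measurable_fst))
    (lintegral_mul_test_lt_top (fun R => hJ.lintegral_ball_pair_lt_top hK h R) hχ)

theorem locallyIntegrable_of_lintegral_ball {f : Vel → ℝ} (hf : AEStronglyMeasurable f volume)
    (h : ∀ R : ℝ, ∫⁻ v in Metric.ball 0 R, ‖f v‖ₑ < ⊤) : LocallyIntegrable f volume := by
  intro x
  refine ⟨Metric.ball 0 (‖x‖ + 1), Metric.isOpen_ball.mem_nhds (by simp), hf.restrict, h _⟩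

theorem WeightedJets.locallyIntegrable_pair (hJ : WeightedJets l G H) {c : Vel → ℝ}
    (hc : Measurable c) {K : ℝ} (hK : ∀ z, |c z| ≤ K * kern z) {α β : Fin 3 → ℕ}
    (h : ∑ i, α i + ∑ i, β i ≤ 3) :
    LocallyIntegrable (fun v => ∫ z, c z * (G α (v - z) * H β v)) volume := by
  refine locallyIntegrable_of_lintegral_ball
    ((hJ.measurable_pair hc α β).stronglyMeasurable.integral_prod_right').aestronglyMeasurable
    fun R => lt_of_le_of_lt (lintegral_mono fun v => ?_) (hJ.lintegral_ball_pair_lt_top hK h R)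
  exact enorm_integral_le_lintegral_enorm _

end

/-! ### A product rule for weak derivatives -/

theorem IsTest.mul_contDiff {ψ u : Vel → ℝ} (hψ : IsTest ψ) (hu : ContDiff ℝ ∞ u) :
    IsTest fun x => u x * ψ x := ⟨hu.mul hψ.1, hψ.2.mul_left⟩

theorem partialD_mul {u ψ : Vel → ℝ} (hu : ContDiff ℝ ∞ u) (hψ : ContDiff ℝ ∞ ψ) (i : Fin 3)
    (x : Vel) : partialD i (fun x => u x * ψ x) x = u x * partialD i ψ x + partialD i u x * ψ x := by
  unfold partialD
  rw [fderiv_fun_mul (hu.differentiable (by simp) x) (hψ.differentiable (by simp) x)]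
  simp [mul_comm]

theorem IsWeakPartial.test_single {i : Fin 3} {f F ψ : Vel → ℝ}
    (h : IsWeakPartial (Pi.single i 1) f F) (hψ : IsTest ψ) :
    ∫ x, f x * partialD i ψ x = -∫ x, F x * ψ x := by
  have := h.2.2 ψ hψ.1 hψ.2
  rw [partialMulti_single hψ.1] at this
  simpa using this

/-- The mollification of `u` by `ρ`. -/
def mollify (ρ u : Vel → ℝ) (x : Vel) : ℝ := ∫ y, ρ (x - y) * u y

theorem mollify_eq_convolution (ρ u : Vel → ℝ) :
    mollify ρ u = convolution ρ u (ContinuousLinearMap.lsmul ℝ ℝ) volume := by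
  ext x
  rw [convolution_eq_swap]
  rfl

theorem contDiff_mollify {ρ u : Vel → ℝ} (hρ : IsTest ρ) (hu : LocallyIntegrable u volume) :
    ContDiff ℝ ∞ (mollify ρ u) := by
  rw [mollify_eq_convolution]
  exact hρ.2.contDiff_convolution_left _ hρ.1 hu

theorem partialD_mollify {ρ u U : Vel → ℝ} (hρ : IsTest ρ) {i : Fin 3}
    (hu : IsWeakPartial (Pi.single i 1) u U) (x : Vel) :
    partialD i (mollify ρ u) x = mollify ρ U x := by
  have h1 := hρ.2.hasFDerivAt_convolution_left (μ := volume) (ContinuousLinearMap.lsmul ℝ ℝ)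
    (hρ.1.of_le (by simp)) hu.1 x
  rw [← mollify_eq_convolution] at h1
  have hint : Integrable (fun t => ((ContinuousLinearMap.lsmul ℝ ℝ).precompL Vel)
      (fderiv ℝ ρ (x - t)) (u t)) volume := by
    have := (hρ.2.fderiv (𝕜 := ℝ)).convolutionExists_left
      ((ContinuousLinearMap.lsmul ℝ ℝ).precompL Vel) (hρ.1.continuous_fderiv (by simp)) hu.1 x
    exact this.integrable_swap
  have h2 : partialD i (mollify ρ u) x = ∫ y, partialD i ρ (x - y) * u y := by
    unfold partialD
    rw [h1.fderiv, convolution_eq_swap, ContinuousLinearMap.integral_apply hint]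
    rfl
  rw [h2]
  have h3 := hu.test_single (hρ.comp_sub_left x)
  rw [partialD_comp_sub_left hρ] at h3
  simp only [mul_neg, integral_neg, neg_inj] at h3
  unfold mollify
  simp only [mul_comm _ (u _), mul_comm _ (U _)]
  exact h3

/-- A sequence of smooth bumps of integral one, supported in shrinking balls. -/
def bumpSeq (n : ℕ) : ContDiffBump (0 : Vel) where
  rIn := 1 / ((n : ℝ) + 1)
  rOut := 2 * (1 / ((n : ℝ) + 1))
  rIn_pos := by positivity
  rIn_lt_rOut := by
    have : 0 < 1 / ((n : ℝ) + 1) := by positivity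
    linarith

theorem isTest_bumpSeq (n : ℕ) : IsTest ((bumpSeq n).normed volume) :=
  ⟨(bumpSeq n).contDiff_normed, (bumpSeq n).hasCompactSupport_normed⟩

theorem abs_mollify_bumpSeq_le {u : Vel → ℝ} {M : ℝ} (hM : ∀ᵐ x, |u x| ≤ M) (n : ℕ) (x : Vel) :
    |mollify ((bumpSeq n).normed volume) u x| ≤ M := by
  set ρ := (bumpSeq n).normed (volume : Measure Vel)
  have hρ : Integrable (fun y => ρ (x - y) * M) volume :=
    ((isTest_bumpSeq n).integrable.comp_sub_left x).mul_const M
  have h1 : ∫ y, ρ (x - y) * M = M := by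
    rw [integral_mul_const, integral_sub_left_eq_self ρ volume x, (bumpSeq n).integral_normed,
      one_mul]
  unfold mollify
  rw [← Real.norm_eq_abs]
  conv_rhs => rw [← h1]
  refine norm_integral_le_of_norm_le hρ (hM.mono fun y hy => ?_)
  rw [norm_mul, Real.norm_of_nonneg ((bumpSeq n).nonneg_normed _)]
  exact mul_le_mul_of_nonneg_left hy ((bumpSeq n).nonneg_normed _)

/-- Mollifications of a bounded function converge boundedly, hence in integrals against `f χ`. -/
theorem tendsto_integral_mollify {u f χ : Vel → ℝ} {M : ℝ} (hu : LocallyIntegrable u volume)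
    (hM : ∀ᵐ x, |u x| ≤ M) (hf : LocallyIntegrable f volume) (hχ : IsTest χ) :
    Filter.Tendsto (fun n => ∫ x, f x * χ x * mollify ((bumpSeq n).normed volume) u x) Filter.atTop
      (nhds (∫ x, f x * χ x * u x)) := by
  have hfχ := LocallyIntegrable.integrable_mul_test hf hχ
  have hlim : ∀ᵐ x, Filter.Tendsto (fun n => mollify ((bumpSeq n).normed volume) u x) Filter.atTop
      (nhds (u x)) := by
    have h0 : Filter.Tendsto (fun n : ℕ => 1 / ((n : ℝ) + 1)) Filter.atTop (nhds 0) :=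
      tendsto_one_div_add_atTop_nhds_zero_nat
    have := ContDiffBump.ae_convolution_tendsto_right_of_locallyIntegrable (φ := bumpSeq) (K := 2)
      (l := Filter.atTop) (by have := h0.const_mul 2; rw [mul_zero] at this; exact this) (Filter.Eventually.of_forall fun n => le_rfl) hu
    filter_upwards [this] with x hx
    simpa only [mollify_eq_convolution] using hx
  refine tendsto_integral_of_dominated_convergence (fun x => ‖f x * χ x‖ * M) (fun n => ?_)
    (hfχ.norm.mul_const M) (fun n => ?_) ?_
  · exact hfχ.aestronglyMeasurable.mul
      (contDiff_mollify (isTest_bumpSeq n) hu).continuous.aestronglyMeasurable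
  · refine Filter.Eventually.of_forall fun x => ?_
    rw [norm_mul]
    exact mul_le_mul_of_nonneg_left (abs_mollify_bumpSeq_le hM n x) (norm_nonneg _)
  · filter_upwards [hlim] with x hx
    exact hx.const_mul _

/-- Leibniz' rule for the product of a bounded function with bounded weak derivative and a function
with locally integrable weak derivative. -/
theorem IsWeakPartial.integral_mul_partialD {i : Fin 3} {u U w W ψ : Vel → ℝ} {M : ℝ}
    (hu : IsWeakPartial (Pi.single i 1) u U) (hw : IsWeakPartial (Pi.single i 1) w W)
    (huM : ∀ᵐ x, |u x| ≤ M) (hUM : ∀ᵐ x, |U x| ≤ M) (hψ : IsTest ψ) :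
    ∫ x, w x * partialD i ψ x * u x = -(∫ x, w x * ψ x * U x) - ∫ x, W x * ψ x * u x := by
  -- The rule is the definition of the weak derivative of `w` when `u` is smooth. It is applied to
  -- mollifications of `u`, and each of the three terms converges.
  have h1 := tendsto_integral_mollify hu.1 huM hw.1 (hψ.partialD i)
  have h2 := tendsto_integral_mollify hu.2.1 hUM hw.1 hψ
  have h3 := tendsto_integral_mollify hu.1 huM hw.2.1 hψ
  refine tendsto_nhds_unique h1 ((h2.neg.sub h3).congr fun n => ?_)
  set ρ := (bumpSeq n).normed (volume : Measure Vel)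
  have hρ : IsTest ρ := isTest_bumpSeq n
  have hcu := contDiff_mollify hρ hu.1
  have hcU := contDiff_mollify hρ hu.2.1
  have ht := hψ.mul_contDiff hcu
  have key := hw.test_single ht
  have i1 : Integrable (fun x => w x * partialD i ψ x * mollify ρ u x) volume := by
    refine (LocallyIntegrable.integrable_mul_test hw.1 ((hψ.partialD i).mul_contDiff hcu)).congr
      (Filter.Eventually.of_forall fun x => ?_)
    simp only; ring
  have i2 : Integrable (fun x => w x * ψ x * mollify ρ U x) volume := by
    refine (LocallyIntegrable.integrable_mul_test hw.1 (hψ.mul_contDiff hcU)).congr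
      (Filter.Eventually.of_forall fun x => ?_)
    simp only; ring
  have e : ∫ x, w x * partialD i (fun x => mollify ρ u x * ψ x) x =
      (∫ x, w x * partialD i ψ x * mollify ρ u x) + ∫ x, w x * ψ x * mollify ρ U x := by
    rw [← integral_add i1 i2]
    congr 1
    ext x
    rw [partialD_mul hcu hψ.1, partialD_mollify hρ hu]
    ring
  rw [e] at key
  have e2 : ∫ x, W x * (mollify ρ u x * ψ x) = ∫ x, W x * ψ x * mollify ρ u x := by
    congr 1; ext x; ring
  rw [e2] at key
  linarith

/-! ### The weak divergence of the Landau flux -/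

/-- The multi-index of the derivative `∂_i`. -/
abbrev unitIndex (i : Fin 3) : Fin 3 → ℕ := Pi.single i 1

theorem sum_unitIndex (i : Fin 3) : ∑ j, unitIndex i j = 1 := by simp [unitIndex]

theorem sum_unitIndex_add (i j : Fin 3) : ∑ k, (unitIndex i + unitIndex j) k = 2 := by
  simp only [Pi.add_apply, Finset.sum_add_distrib, sum_unitIndex]

theorem LocallyIntegrable.comp_sub_right {f : Vel → ℝ} (hf : LocallyIntegrable f volume) (z : Vel) :
    LocallyIntegrable (fun x => f (x - z)) volume := by
  have h := (locallyIntegrable_map_homeomorph (Homeomorph.subRight z) (f := f)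
    (μ := (volume : Measure Vel))).1
  refine h ?_
  rw [show Measure.map (Homeomorph.subRight z) (volume : Measure Vel) = volume from
    (measurePreserving_sub_right volume z).map_eq]
  exact hf

theorem IsWeakPartial.comp_sub_right {i : Fin 3} {f F : Vel → ℝ}
    (h : IsWeakPartial (Pi.single i 1) f F) (z : Vel) :
    IsWeakPartial (Pi.single i 1) (fun x => f (x - z)) (fun x => F (x - z)) := by
  refine ⟨LocallyIntegrable.comp_sub_right h.1 z, LocallyIntegrable.comp_sub_right h.2.1 z,
    fun ψ h1 h2 => ?_⟩
  have hψ : IsTest ψ := ⟨h1, h2⟩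
  have key := h.2.2 _ (hψ.comp_add_right z).1 (hψ.comp_add_right z).2
  rw [partialMulti_single (hψ.comp_add_right z).1, partialD_comp_add_right] at key
  rw [partialMulti_single h1]
  have e1 := integral_sub_right_eq_self (μ := (volume : Measure Vel))
    (fun x => f x * partialD i ψ (x + z)) z
  have e2 := integral_sub_right_eq_self (μ := (volume : Measure Vel))
    (fun x => F x * ψ (x + z)) z
  simp only [sub_add_cancel] at e1 e2
  rw [e1, e2, key]

/-- Derivatives up to order one are bounded, by the Sobolev embedding. -/
theorem IsJet.exists_bound {D : (Fin 3 → ℕ) → Vel → ℝ} (hD : IsJet D) {m : ℝ} (hm : 0 ≤ m)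
    (hfin : wL2 m (jetSum 3 D) ≠ ⊤) :
    ∃ M : ℝ, ∀ α : Fin 3 → ℕ, ∑ i, α i ≤ 1 → ∀ᵐ x, |D α x| ≤ M := by
  have h0 : sobolevConst 0 * wL2 0 (jetSum 3 D) ≠ ⊤ :=
    ENNReal.mul_ne_top (sobolevConst_ne_top 0) (ne_top_of_le_ne_top hfin (wL2_mono hm _))
  refine ⟨(sobolevConst 0 * wL2 0 (jetSum 3 D)).toReal, fun α hα => ?_⟩
  filter_upwards [hD.ae_weighted_le le_rfl] with x hx
  rw [wE_zero, one_mul] at hx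
  have := ENNReal.toReal_mono h0 ((enorm_le_jetSum hα x).trans hx)
  simpa using this

/-- The bilinear convolution `∫ c(z) ∂^α g(v - z) ∂^β h(v) dz`. -/
def pairInt (G H : (Fin 3 → ℕ) → Vel → ℝ) (c : Vel → ℝ) (α β : Fin 3 → ℕ) (v : Vel) : ℝ :=
  ∫ z, c z * (G α (v - z) * H β v)

section
variable {l : ℝ} {G H : (Fin 3 → ℕ) → Vel → ℝ}

theorem WeightedJets.left3 (hJ : WeightedJets l G H) : wL2 3 (jetSum 3 G) ≠ ⊤ :=
  ne_top_of_le_ne_top hJ.finite_left (wL2_mono (by linarith [hJ.nonneg]) _)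

theorem WeightedJets.right3 (hJ : WeightedJets l G H) : wL2 3 (jetSum 3 H) ≠ ⊤ :=
  ne_top_of_le_ne_top hJ.finite_right (wL2_mono (by linarith [hJ.nonneg]) _)

theorem WeightedJets.integral_pairInt_mul_test (hJ : WeightedJets l G H) {c : Vel → ℝ}
    (hc : Measurable c) {K : ℝ} (hK : ∀ z, |c z| ≤ K * kern z) {α β : Fin 3 → ℕ}
    (h : ∑ i, α i + ∑ i, β i ≤ 3) {χ : Vel → ℝ} (hχ : IsTest χ) :
    ∫ v, pairInt G H c α β v * χ v = ∫ z, c z * ∫ v, G α (v - z) * H β v * χ v := by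
  have hint := hJ.integrable_pair_mul_test hc hK h hχ
  calc _ = ∫ v, ∫ z, c z * (G α (v - z) * H β v) * χ v := by
        congr 1; ext v; rw [pairInt, integral_mul_const]
    _ = ∫ z, ∫ v, c z * (G α (v - z) * H β v) * χ v := integral_integral_swap hint
    _ = _ := by
        congr 1; ext z; rw [← integral_const_mul]; congr 1; ext v; ring

theorem WeightedJets.integrable_pair_mul_test_right (hJ : WeightedJets l G H) {c : Vel → ℝ}
    (hc : Measurable c) {K : ℝ} (hK : ∀ z, |c z| ≤ K * kern z) {α β : Fin 3 → ℕ}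
    (h : ∑ i, α i + ∑ i, β i ≤ 3) {χ : Vel → ℝ} (hχ : IsTest χ) :
    Integrable (fun z => c z * ∫ v, G α (v - z) * H β v * χ v) volume := by
  refine (hJ.integrable_pair_mul_test hc hK h hχ).integral_prod_right.congr
    (Filter.Eventually.of_forall fun z => ?_)
  simp only
  rw [← integral_const_mul]; congr 1; ext v; ring

/-- Leibniz' rule under the integral that defines `pairInt`, the undifferentiated factor being the
bounded function `g`. -/
theorem WeightedJets.integral_pairInt_mul_partialD_right (hJ : WeightedJets l G H) {c : Vel → ℝ}
    (hc : Measurable c) {K : ℝ} (hK : ∀ z, |c z| ≤ K * kern z) (i j : Fin 3) {ψ : Vel → ℝ}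
    (hψ : IsTest ψ) :
    ∫ v, pairInt G H c 0 (unitIndex j) v * partialD i ψ v =
      -(∫ v, pairInt G H c (unitIndex i) (unitIndex j) v * ψ v) -
        ∫ v, pairInt G H c 0 (unitIndex j + unitIndex i) v * ψ v := by
  have hi := sum_unitIndex i
  have hj := sum_unitIndex j
  have hij := sum_unitIndex_add j i
  have h0 : ∑ k, (0 : Fin 3 → ℕ) k = 0 := by simp
  obtain ⟨M, hM⟩ := hJ.left.exists_bound (by norm_num) hJ.left3
  rw [hJ.integral_pairInt_mul_test hc hK (by omega) (hψ.partialD i),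
    hJ.integral_pairInt_mul_test hc hK (by omega) hψ,
    hJ.integral_pairInt_mul_test hc hK (by omega) hψ, ← integral_neg]
  refine Eq.trans ?_ (integral_sub
    (hJ.integrable_pair_mul_test_right hc hK (α := unitIndex i) (β := unitIndex j) (by omega) hψ).neg
    (hJ.integrable_pair_mul_test_right hc hK (α := 0) (β := unitIndex j + unitIndex i)
      (by omega) hψ))
  congr 1
  ext z
  have hsub := (measurePreserving_sub_right (volume : Measure Vel) z).quasiMeasurePreserving
  have hu := (hJ.left.weak 0 (unitIndex i) (by simp only [zero_add]; omega)).comp_sub_right z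
  have hw := hJ.right.weak (unitIndex j) (unitIndex i) (by omega)
  rw [zero_add] at hu
  have key := hu.integral_mul_partialD hw (hsub.ae (hM 0 (by simp)))
    (hsub.ae (hM _ (by omega))) hψ
  have e : ∀ (α β : Fin 3 → ℕ) (χ : Vel → ℝ), ∫ v, G α (v - z) * H β v * χ v =
      ∫ v, H β v * χ v * G α (v - z) := fun α β χ => by
    congr 1; ext v; ring
  simp only [e]
  rw [key]
  ring

/-- Leibniz' rule under the integral that defines `pairInt`, the undifferentiated factor being the
bounded function `h`. -/
theorem WeightedJets.integral_pairInt_mul_partialD_left (hJ : WeightedJets l G H) {c : Vel → ℝ}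
    (hc : Measurable c) {K : ℝ} (hK : ∀ z, |c z| ≤ K * kern z) (i j : Fin 3) {ψ : Vel → ℝ}
    (hψ : IsTest ψ) :
    ∫ v, pairInt G H c (unitIndex j) 0 v * partialD i ψ v =
      -(∫ v, pairInt G H c (unitIndex j) (unitIndex i) v * ψ v) -
        ∫ v, pairInt G H c (unitIndex j + unitIndex i) 0 v * ψ v := by
  have hi := sum_unitIndex i
  have hj := sum_unitIndex j
  have hij := sum_unitIndex_add j i
  have h0 : ∑ k, (0 : Fin 3 → ℕ) k = 0 := by simp
  obtain ⟨M, hM⟩ := hJ.right.exists_bound (by norm_num) hJ.right3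
  rw [hJ.integral_pairInt_mul_test hc hK (by omega) (hψ.partialD i),
    hJ.integral_pairInt_mul_test hc hK (by omega) hψ,
    hJ.integral_pairInt_mul_test hc hK (by omega) hψ, ← integral_neg]
  refine Eq.trans ?_ (integral_sub
    (hJ.integrable_pair_mul_test_right hc hK (α := unitIndex j) (β := unitIndex i) (by omega) hψ).neg
    (hJ.integrable_pair_mul_test_right hc hK (α := unitIndex j + unitIndex i) (β := 0)
      (by omega) hψ))
  congr 1
  ext z
  have hu := hJ.right.weak 0 (unitIndex i) (by simp only [zero_add]; omega)
  have hw := (hJ.left.weak (unitIndex j) (unitIndex i) (by omega)).comp_sub_right z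
  rw [zero_add] at hu
  have key := hu.integral_mul_partialD hw (hM 0 (by simp)) (hM _ (by omega)) hψ
  have e : ∀ (α β : Fin 3 → ℕ) (χ : Vel → ℝ), ∫ v, G α (v - z) * H β v * χ v =
      ∫ v, G α (v - z) * χ v * H β v := fun α β χ => by
    congr 1; ext v; ring
  simp only [e]
  rw [key]
  ring

/-- The Landau flux in terms of jets. -/
def jetFlux (φ : ℝ → ℝ) (G H : (Fin 3 → ℕ) → Vel → ℝ) (i : Fin 3) (v : Vel) : ℝ :=
  ∑ j, (pairInt G H (fun z => landauA φ z i j) 0 (unitIndex j) v -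
    pairInt G H (fun z => landauA φ z i j) (unitIndex j) 0 v)

/-- The Landau operator in non-divergence form, in terms of jets. -/
def jetLandau (φ : ℝ → ℝ) (G H : (Fin 3 → ℕ) → Vel → ℝ) (v : Vel) : ℝ :=
  ∑ i, ∑ j, (pairInt G H (fun z => landauA φ z i j) 0 (unitIndex j + unitIndex i) v -
    pairInt G H (fun z => landauA φ z i j) (unitIndex j + unitIndex i) 0 v)

theorem abs_landauA_le_kern (φ : ℝ → ℝ) (i j : Fin 3) (z : Vel) :
    |landauA φ z i j| ≤ 4 * Real.pi * momentI φ 3 * kern z := by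
  have hI := momentI_nonneg φ 3
  have hpi := Real.pi_pos
  refine (abs_landauA_le φ z i j).trans (mul_le_mul_of_nonneg_left ?_ (by positivity))
  unfold kern
  linarith [sq_nonneg ‖z‖⁻¹]

theorem landauA_symm (φ : ℝ → ℝ) (z : Vel) (i j : Fin 3) : landauA φ z i j = landauA φ z j i := by
  unfold landauA
  rw [mul_comm (z i)]
  simp only [eq_comm]

/-- The divergence of the flux is the operator in non-divergence form: the convolution form of the flux
puts every derivative on `g` and `h`, and the mixed terms `∂_i g ∂_j h` cancel because `a` is
symmetric. -/
theorem WeightedJets.isWeakDiv_jetFlux (hJ : WeightedJets l G H) (φ : ℝ → ℝ) :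
    IsWeakDiv (jetFlux φ G H) (jetLandau φ G H) := by
  have hm := measurable_landauA φ
  have hK := abs_landauA_le_kern φ
  have h0 : ∑ k, (0 : Fin 3 → ℕ) k = 0 := by simp
  have h1 := sum_unitIndex
  have h2 := sum_unitIndex_add
  have hloc : ∀ i j : Fin 3, ∀ α β : Fin 3 → ℕ, ∑ i, α i + ∑ i, β i ≤ 3 →
      LocallyIntegrable (pairInt G H (fun z => landauA φ z i j) α β) volume :=
    fun i j α β h => hJ.locallyIntegrable_pair (hm i j) (hK i j) h
  have hJloc : ∀ i j, LocallyIntegrable (fun v =>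
      pairInt G H (fun z => landauA φ z i j) 0 (unitIndex j) v -
      pairInt G H (fun z => landauA φ z i j) (unitIndex j) 0 v) volume := fun i j =>
    (hloc i j _ _ (by rw [h0, h1]; omega)).sub (hloc i j _ _ (by rw [h0, h1]; omega))
  have hqloc : ∀ i j, LocallyIntegrable (fun v =>
      pairInt G H (fun z => landauA φ z i j) 0 (unitIndex j + unitIndex i) v -
      pairInt G H (fun z => landauA φ z i j) (unitIndex j + unitIndex i) 0 v) volume := fun i j =>
    (hloc i j _ _ (by rw [h0, h2]; omega)).sub (hloc i j _ _ (by rw [h0, h2]; omega))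
  refine ⟨fun i => locallyIntegrable_finsetSum _ fun j _ => hJloc i j,
    locallyIntegrable_finsetSum _ fun i _ => locallyIntegrable_finsetSum _ fun j _ => hqloc i j,
    fun ψ hψ1 hψ2 => ?_⟩
  have hψ : IsTest ψ := ⟨hψ1, hψ2⟩
  have int1 : ∀ i j, ∀ χ, IsTest χ → Integrable (fun v =>
      (pairInt G H (fun z => landauA φ z i j) 0 (unitIndex j) v -
      pairInt G H (fun z => landauA φ z i j) (unitIndex j) 0 v) * χ v) volume := fun i j χ hχ =>
    LocallyIntegrable.integrable_mul_test (hJloc i j) hχ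
  have int2 : ∀ i j, ∀ χ, IsTest χ → Integrable (fun v =>
      (pairInt G H (fun z => landauA φ z i j) 0 (unitIndex j + unitIndex i) v -
      pairInt G H (fun z => landauA φ z i j) (unitIndex j + unitIndex i) 0 v) * χ v) volume :=
    fun i j χ hχ => LocallyIntegrable.integrable_mul_test (hqloc i j) hχ
  have int3 : ∀ i j, ∀ α β : Fin 3 → ℕ, ∑ i, α i + ∑ i, β i ≤ 3 → ∀ χ, IsTest χ →
      Integrable (fun v => pairInt G H (fun z => landauA φ z i j) α β v * χ v) volume :=
    fun i j α β h χ hχ => LocallyIntegrable.integrable_mul_test (hloc i j α β h) hχ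
  have eL : ∫ v, ∑ i, jetFlux φ G H i v * partialD i ψ v = ∑ i, ∑ j, ∫ v,
      (pairInt G H (fun z => landauA φ z i j) 0 (unitIndex j) v -
      pairInt G H (fun z => landauA φ z i j) (unitIndex j) 0 v) * partialD i ψ v := by
    unfold jetFlux
    simp only [Finset.sum_mul]
    rw [integral_finsetSum _ fun i _ => integrable_finsetSum _ fun j _ =>
      int1 i j _ (hψ.partialD i)]
    refine Finset.sum_congr rfl fun i _ => ?_
    rw [integral_finsetSum _ fun j _ => int1 i j _ (hψ.partialD i)]
  have eR : ∫ v, jetLandau φ G H v * ψ v = ∑ i, ∑ j, ∫ v,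
      (pairInt G H (fun z => landauA φ z i j) 0 (unitIndex j + unitIndex i) v -
      pairInt G H (fun z => landauA φ z i j) (unitIndex j + unitIndex i) 0 v) * ψ v := by
    unfold jetLandau
    simp only [Finset.sum_mul]
    rw [integral_finsetSum _ fun i _ => integrable_finsetSum _ fun j _ => int2 i j _ hψ]
    refine Finset.sum_congr rfl fun i _ => ?_
    rw [integral_finsetSum _ fun j _ => int2 i j _ hψ]
  have e : ∀ i j, ∫ v, (pairInt G H (fun z => landauA φ z i j) 0 (unitIndex j) v -
      pairInt G H (fun z => landauA φ z i j) (unitIndex j) 0 v) * partialD i ψ v =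
      (∫ v, pairInt G H (fun z => landauA φ z i j) (unitIndex j) (unitIndex i) v * ψ v) -
      (∫ v, pairInt G H (fun z => landauA φ z i j) (unitIndex i) (unitIndex j) v * ψ v) -
      ∫ v, (pairInt G H (fun z => landauA φ z i j) 0 (unitIndex j + unitIndex i) v -
        pairInt G H (fun z => landauA φ z i j) (unitIndex j + unitIndex i) 0 v) * ψ v := by
    intro i j
    simp only [sub_mul]
    rw [integral_sub (int3 i j _ _ (by rw [h0, h1]; omega) _ (hψ.partialD i))
        (int3 i j _ _ (by rw [h0, h1]; omega) _ (hψ.partialD i)),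
      integral_sub (int3 i j _ _ (by rw [h0, h2]; omega) _ hψ)
        (int3 i j _ _ (by rw [h0, h2]; omega) _ hψ),
      hJ.integral_pairInt_mul_partialD_right (hm i j) (hK i j) i j hψ,
      hJ.integral_pairInt_mul_partialD_left (hm i j) (hK i j) i j hψ]
    ring
  have hsymm : ∑ i, ∑ j, ∫ v, pairInt G H (fun z => landauA φ z i j) (unitIndex j)
      (unitIndex i) v * ψ v = ∑ i, ∑ j, ∫ v, pairInt G H (fun z => landauA φ z i j) (unitIndex i)
      (unitIndex j) v * ψ v := by
    rw [Finset.sum_comm]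
    refine Finset.sum_congr rfl fun i _ => Finset.sum_congr rfl fun j _ => ?_
    simp only [landauA_symm φ _ j i]
  rw [eL, eR]
  simp only [e, Finset.sum_sub_distrib]
  rw [hsymm, sub_self, zero_sub]

end

theorem isWeakDiv_ae_unique {J : Fin 3 → Vel → ℝ} {p q : Vel → ℝ} (hp : IsWeakDiv J p)
    (hq : IsWeakDiv J q) : p =ᵐ[volume] q :=
  ae_eq_of_forall_test hp.2.1 hq.2.1 fun ψ hψ => by
    have h1 := hp.2.2 ψ hψ.1 hψ.2
    rw [hq.2.2 ψ hψ.1 hψ.2] at h1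
    linarith

theorem IsWeakDiv.congr_ae {J J' : Fin 3 → Vel → ℝ} {q : Vel → ℝ} (h : IsWeakDiv J q)
    (hJ : ∀ i, J i =ᵐ[volume] J' i) : IsWeakDiv J' q := by
  refine ⟨fun i => LocallyIntegrable.congr_ae (h.1 i) (hJ i), h.2.1, fun ψ h1 h2 => ?_⟩
  rw [← h.2.2 ψ h1 h2]
  refine integral_congr_ae ?_
  filter_upwards [ae_all_iff.2 hJ] with v hv
  simp only [hv]

/-- The chosen divergence is one as soon as there is any. -/
theorem isWeakDiv_weakDiv {J : Fin 3 → Vel → ℝ} {q : Vel → ℝ} (h : IsWeakDiv J q) :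
    IsWeakDiv J (weakDiv J) := by
  have h' : ∃ q, IsWeakDiv J q := ⟨q, h⟩
  unfold weakDiv
  rw [dif_pos h']
  exact h'.choose_spec

/-! ### Taylor expansion of the collision integrand -/

/-- The coefficient of `k_i` in the expansion of `g(v - z - k) h(v + k)`. -/
def driftPair (G H : (Fin 3 → ℕ) → Vel → ℝ) (i : Fin 3) (v z : Vel) : ℝ :=
  G 0 (v - z) * H (unitIndex i) v - G (unitIndex i) (v - z) * H 0 v

/-- Twice the coefficient of `k_i k_j` in the expansion of `g(v - z - k) h(v + k)`, up to
symmetrisation. -/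
def diffPair (G H : (Fin 3 → ℕ) → Vel → ℝ) (i j : Fin 3) (v z : Vel) : ℝ :=
  G 0 (v - z) * H (unitIndex i + unitIndex j) v -
    2 * (G (unitIndex i) (v - z) * H (unitIndex j) v) +
    G (unitIndex i + unitIndex j) (v - z) * H 0 v

/-- The remainder of second order in the expansion of `g(v - z - k) h(v + k)`. -/
def taylorRem (G H : (Fin 3 → ℕ) → Vel → ℝ) (v z k : Vel) : ℝ :=
  G 0 (v - z - k) * H 0 (v + k) - G 0 (v - z) * H 0 v - ∑ i, k i * driftPair G H i v z -
    2⁻¹ * ∑ i, ∑ j, k i * k j * diffPair G H i j v z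

theorem dirDeriv_zero (D : (Fin 3 → ℕ) → Vel → ℝ) (k x : Vel) : dirDeriv D 0 k x = D 0 x := by
  simp [dirDeriv, wordIndex]

theorem dirDeriv_one (D : (Fin 3 → ℕ) → Vel → ℝ) (k x : Vel) :
    dirDeriv D 1 k x = ∑ i, k i * D (unitIndex i) x := by
  unfold dirDeriv
  rw [sum_word_succ]
  simp [wordIndex]

theorem dirDeriv_two (D : (Fin 3 → ℕ) → Vel → ℝ) (k x : Vel) :
    dirDeriv D 2 k x = ∑ i, ∑ j, k i * k j * D (unitIndex i + unitIndex j) x := by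
  unfold dirDeriv
  rw [sum_word_succ]
  refine Finset.sum_congr rfl fun i _ => ?_
  rw [sum_word_succ]
  refine Finset.sum_congr rfl fun j _ => ?_
  simp [wordIndex, Fin.sum_univ_succ, Fin.prod_univ_succ]

theorem enorm_dirDeriv_le (D : (Fin 3 → ℕ) → Vel → ℝ) {m N : ℕ} (h : m ≤ N) (k x : Vel) :
    ‖dirDeriv D m k x‖ₑ ≤ ENNReal.ofReal (‖k‖ ^ m) * (3 ^ m * jetSum N D x) := by
  unfold dirDeriv
  calc _ ≤ ∑ s : Fin m → Fin 3, ‖(∏ j, k (s j)) * D (wordIndex s) x‖ₑ := enorm_sum_le _ _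
    _ ≤ ∑ _s : Fin m → Fin 3, ENNReal.ofReal (‖k‖ ^ m) * jetSum N D x := by
        refine Finset.sum_le_sum fun s _ => ?_
        rw [enorm_mul]
        refine mul_le_mul' ?_ (enorm_le_jetSum (by rw [sum_wordIndex]; exact h) x)
        rw [Real.enorm_eq_ofReal_abs]
        refine ENNReal.ofReal_le_ofReal ?_
        rw [Finset.abs_prod]
        calc ∏ j, |k (s j)| ≤ ∏ _j : Fin m, ‖k‖ :=
              Finset.prod_le_prod (fun _ _ => abs_nonneg _) fun j _ => abs_coord_le k _
          _ = _ := by simp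
    _ = _ := by
        simp only [Finset.sum_const, Finset.card_univ, Fintype.card_fun, Fintype.card_fin,
          nsmul_eq_mul]
        push_cast
        ring

/-- Taylor's formula for jets, with the remainder bounded by a mean of `jetSum`. -/
theorem IsJet.ae_taylor_le {D : (Fin 3 → ℕ) → Vel → ℝ} (hD : IsJet D) (α : Fin 3 → ℕ) {n N : ℕ}
    (hα : ∑ i, α i + (n + 1) ≤ N) (hN : N ≤ 3) (k : Vel) :
    ∀ᵐ x : Vel, ‖D α (x + k) - ∑ m ∈ Finset.range (n + 1),
        (m.factorial : ℝ)⁻¹ * dirDeriv (fun β => D (α + β)) m k x‖ₑ ≤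
      ENNReal.ofReal (‖k‖ ^ (n + 1)) *
        (3 ^ (n + 1) * ∫⁻ t in Ioc (0 : ℝ) 1, jetSum N D (x + t • k)) := by
  have h := ae_taylor_remainder_le (D := fun β => D (α + β)) (fun β => hD.measurable _) (n := n)
    (fun β hβ => by
      rw [show α + 0 = α from add_zero α]
      refine hD.weak α β ?_
      simp only [Pi.add_apply, Finset.sum_add_distrib]
      omega) k
  filter_upwards [h] with x hx
  rw [add_zero] at hx
  refine hx.trans (mul_le_mul_right ?_ _)
  calc _ ≤ ∑ _s : Fin (n + 1) → Fin 3, ∫⁻ t in Ioc (0 : ℝ) 1, jetSum N D (x + t • k) := by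
        refine Finset.sum_le_sum fun s _ => lintegral_mono fun t => enorm_le_jetSum ?_ _
        have := sum_wordIndex s
        simp only [Pi.add_apply, Finset.sum_add_distrib]
        omega
    _ = _ := by
        simp only [Finset.sum_const, Finset.card_univ, Fintype.card_fun, Fintype.card_fin,
          nsmul_eq_mul]
        push_cast
        ring

theorem enorm_driftPair_le (G H : (Fin 3 → ℕ) → Vel → ℝ) (i : Fin 3) (v z : Vel) :
    ‖driftPair G H i v z‖ₑ ≤ 2 * jetPair G H (v - z) v := by
  have h1 := sum_unitIndex i
  have h0 : ∑ k, (0 : Fin 3 → ℕ) k = 0 := by simp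
  unfold driftPair
  rw [two_mul]
  exact enorm_sub_le.trans (add_le_add (enorm_mul_le_jetPair (by omega) _ _)
    (enorm_mul_le_jetPair (by omega) _ _))

theorem enorm_diffPair_le (G H : (Fin 3 → ℕ) → Vel → ℝ) (i j : Fin 3) (v z : Vel) :
    ‖diffPair G H i j v z‖ₑ ≤ 4 * jetPair G H (v - z) v := by
  have h1 := sum_unitIndex i
  have h2 := sum_unitIndex j
  have h3 := sum_unitIndex_add i j
  have h0 : ∑ k, (0 : Fin 3 → ℕ) k = 0 := by simp
  unfold diffPair
  calc _ ≤ (jetPair G H (v - z) v + 2 * jetPair G H (v - z) v) + jetPair G H (v - z) v := by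
        refine (enorm_add_le _ _).trans (add_le_add (enorm_sub_le.trans (add_le_add
          (enorm_mul_le_jetPair (by omega) _ _) ?_)) (enorm_mul_le_jetPair (by omega) _ _))
        rw [enorm_mul]
        refine mul_le_mul' ?_ (enorm_mul_le_jetPair (by omega) _ _)
        rw [Real.enorm_of_nonneg (by norm_num)]
        simp
    _ = _ := by ring

/-- The remainder of the product in terms of the remainders of the factors. Each term has a total order
of three, and in each the remainder of one factor is multiplied by a derivative of the other that
is of low enough order for `jetPair`. -/
theorem taylorRem_eq (G H : (Fin 3 → ℕ) → Vel → ℝ) (v z k : Vel) :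
    taylorRem G H v z k =
      G 0 (v - z) * (H 0 (v + k) - (H 0 v + dirDeriv H 1 k v + 2⁻¹ * dirDeriv H 2 k v)) +
      dirDeriv G 1 (-k) (v - z) * (H 0 (v + k) - (H 0 v + dirDeriv H 1 k v)) +
      2⁻¹ * dirDeriv G 2 (-k) (v - z) * (H 0 (v + k) - H 0 v) +
      (G 0 (v - z - k) - (G 0 (v - z) + dirDeriv G 1 (-k) (v - z) +
        2⁻¹ * dirDeriv G 2 (-k) (v - z))) * H 0 (v + k) := by
  unfold taylorRem driftPair diffPair
  simp only [dirDeriv_one, dirDeriv_two, Fin.sum_univ_three, PiLp.neg_apply]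
  ring

/-- The superposition of `jetPair` that bounds the Taylor remainder. -/
def remMajorant (G H : (Fin 3 → ℕ) → Vel → ℝ) (v z k : Vel) : ℝ≥0∞ :=
  (∫⁻ t in Ioc (0 : ℝ) 1, jetPair G H (v - z) (v + t • k)) +
    (∫⁻ t in Ioc (0 : ℝ) 1, jetPair G H (v - z - t • k) (v + k)) +
    jetPair G H (v - z - k) (v + k) + jetPair G H (v - z) v

section
variable {l : ℝ} {G H : (Fin 3 → ℕ) → Vel → ℝ}

/-- The third-order bound, which is the better one for `|k| ≤ 1`. -/
theorem WeightedJets.ae_taylorRem_le_cube (hJ : WeightedJets l G H) (z k : Vel) :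
    ∀ᵐ v : Vel, ‖taylorRem G H v z k‖ₑ ≤
      ENNReal.ofReal (‖k‖ ^ 3) * (81 * remMajorant G H v z k) := by
  have hsub := (measurePreserving_sub_right (volume : Measure Vel) z).quasiMeasurePreserving
  have h0 : ∑ k, (0 : Fin 3 → ℕ) k = 0 := by simp
  have a3 := hJ.right.ae_taylor_le 0 (n := 2) (N := 3) (by omega) le_rfl k
  have a2 := hJ.right.ae_taylor_le 0 (n := 1) (N := 3) (by omega) le_rfl k
  have a1 := hJ.right.ae_taylor_le 0 (n := 0) (N := 1) (by omega) (by omega) k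
  have b3 := hsub.ae (hJ.left.ae_taylor_le 0 (n := 2) (N := 3) (by omega) le_rfl (-k))
  filter_upwards [a3, a2, a1, b3] with v h3 h2 h1 g3
  simp only [Finset.sum_range_succ, Finset.range_zero, Finset.sum_empty, zero_add, dirDeriv_zero,
    Nat.factorial, Nat.cast_one, inv_one, one_mul, mul_one, Nat.reduceAdd,
    Nat.cast_ofNat, Nat.succ_eq_add_one, norm_neg, smul_neg, ← sub_eq_add_neg] at h3 h2 h1 g3
  rw [taylorRem_eq]
  have i3 : ∀ F : ℝ → ℝ≥0∞, ∀ c : ℝ≥0∞, c ≠ ⊤ → c * ∫⁻ t in Ioc (0 : ℝ) 1, F t =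
      ∫⁻ t in Ioc (0 : ℝ) 1, c * F t := fun F c hc => (lintegral_const_mul' _ _ hc).symm
  have hk : ∀ {a b c : ℕ}, a + b = c → ENNReal.ofReal (‖k‖ ^ a) * ENNReal.ofReal (‖k‖ ^ b) =
      ENNReal.ofReal (‖k‖ ^ c) := fun {a b c} h => by
    rw [← ENNReal.ofReal_mul (by positivity), ← pow_add, h]
  have fin : ∀ {D : (Fin 3 → ℕ) → Vel → ℝ} {N : ℕ} {x : Vel}, jetSum N D x ≠ ⊤ := fun {D N x} =>
    (ENNReal.sum_lt_top.2 fun _ _ => enorm_lt_top).ne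
  set A := ∫⁻ t in Ioc (0 : ℝ) 1, jetPair G H (v - z) (v + t • k) with hA
  set B := ∫⁻ t in Ioc (0 : ℝ) 1, jetPair G H (v - z - t • k) (v + k) with hB
  have hA1 : jetSum 1 G (v - z) * ∫⁻ t in Ioc (0 : ℝ) 1, jetSum 3 H (v + t • k) ≤ A := by
    rw [i3 _ _ fin]
    exact lintegral_mono fun t => le_self_add
  have hA2 : jetSum 3 G (v - z) * ∫⁻ t in Ioc (0 : ℝ) 1, jetSum 1 H (v + t • k) ≤ A := by
    rw [i3 _ _ fin]
    exact lintegral_mono fun t => le_add_self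
  have hB1 : (∫⁻ t in Ioc (0 : ℝ) 1, jetSum 3 G (v - z - t • k)) * jetSum 1 H (v + k) ≤ B := by
    rw [mul_comm, i3 _ _ fin]
    exact lintegral_mono fun t => by
      unfold jetPair
      rw [mul_comm (jetSum 1 H _)]
      exact le_add_self
  have g1 := enorm_dirDeriv_le G (m := 1) (N := 1) le_rfl (-k) (v - z)
  have g2 := enorm_dirDeriv_le G (m := 2) (N := 3) (by omega) (-k) (v - z)
  rw [norm_neg] at g1 g2
  have g0 : ‖G 0 (v - z)‖ₑ ≤ jetSum 1 G (v - z) := enorm_le_jetSum (by omega) _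
  have hh : ‖H 0 (v + k)‖ₑ ≤ jetSum 1 H (v + k) := enorm_le_jetSum (by omega) _
  have t1 : ‖G 0 (v - z) * (H 0 (v + k) - (H 0 v + dirDeriv H 1 k v + 2⁻¹ * dirDeriv H 2 k v))‖ₑ ≤
      ENNReal.ofReal (‖k‖ ^ 3) * (27 * A) := by
    rw [enorm_mul]
    calc _ ≤ jetSum 1 G (v - z) * (ENNReal.ofReal (‖k‖ ^ 3) * (3 ^ 3 *
          ∫⁻ t in Ioc (0 : ℝ) 1, jetSum 3 H (v + t • k))) := mul_le_mul' g0 h3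
      _ = ENNReal.ofReal (‖k‖ ^ 3) * (27 * (jetSum 1 G (v - z) *
          ∫⁻ t in Ioc (0 : ℝ) 1, jetSum 3 H (v + t • k))) := by ring
      _ ≤ _ := mul_le_mul_right (mul_le_mul_right hA1 _) _
  have t2 : ‖dirDeriv G 1 (-k) (v - z) * (H 0 (v + k) - (H 0 v + dirDeriv H 1 k v))‖ₑ ≤
      ENNReal.ofReal (‖k‖ ^ 3) * (27 * A) := by
    rw [enorm_mul]
    calc _ ≤ (ENNReal.ofReal (‖k‖ ^ 1) * (3 ^ 1 * jetSum 1 G (v - z))) *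
          (ENNReal.ofReal (‖k‖ ^ 2) * (3 ^ 2 *
          ∫⁻ t in Ioc (0 : ℝ) 1, jetSum 3 H (v + t • k))) := mul_le_mul' g1 h2
      _ = ENNReal.ofReal (‖k‖ ^ 3) * (27 * (jetSum 1 G (v - z) *
          ∫⁻ t in Ioc (0 : ℝ) 1, jetSum 3 H (v + t • k))) := by
          rw [← hk (show 1 + 2 = 3 from rfl)]; ring
      _ ≤ _ := mul_le_mul_right (mul_le_mul_right hA1 _) _
  have t3 : ‖2⁻¹ * dirDeriv G 2 (-k) (v - z) * (H 0 (v + k) - H 0 v)‖ₑ ≤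
      ENNReal.ofReal (‖k‖ ^ 3) * (27 * A) := by
    rw [enorm_mul, enorm_mul]
    have h2' : ‖(2 : ℝ)⁻¹‖ₑ ≤ 1 := by
      rw [Real.enorm_of_nonneg (by norm_num)]
      exact ENNReal.ofReal_le_one.2 (by norm_num)
    calc _ ≤ (1 * (ENNReal.ofReal (‖k‖ ^ 2) * (3 ^ 2 * jetSum 3 G (v - z)))) *
          (ENNReal.ofReal (‖k‖ ^ 1) * (3 ^ 1 *
          ∫⁻ t in Ioc (0 : ℝ) 1, jetSum 1 H (v + t • k))) := by
          refine mul_le_mul' (mul_le_mul' h2' g2) ?_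
          simpa only [pow_one] using h1
      _ = ENNReal.ofReal (‖k‖ ^ 3) * (27 * (jetSum 3 G (v - z) *
          ∫⁻ t in Ioc (0 : ℝ) 1, jetSum 1 H (v + t • k))) := by
          rw [← hk (show 2 + 1 = 3 from rfl)]; ring
      _ ≤ _ := mul_le_mul_right (mul_le_mul_right hA2 _) _
  have t4 : ‖(G 0 (v - z - k) - (G 0 (v - z) + dirDeriv G 1 (-k) (v - z) +
      2⁻¹ * dirDeriv G 2 (-k) (v - z))) * H 0 (v + k)‖ₑ ≤
      ENNReal.ofReal (‖k‖ ^ 3) * (27 * B) := by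
    rw [enorm_mul]
    calc _ ≤ (ENNReal.ofReal (‖k‖ ^ 3) * (3 ^ 3 *
          ∫⁻ t in Ioc (0 : ℝ) 1, jetSum 3 G (v - z - t • k))) * jetSum 1 H (v + k) :=
          mul_le_mul' g3 hh
      _ = ENNReal.ofReal (‖k‖ ^ 3) * (27 * ((∫⁻ t in Ioc (0 : ℝ) 1, jetSum 3 G (v - z - t • k)) *
          jetSum 1 H (v + k))) := by ring
      _ ≤ _ := mul_le_mul_right (mul_le_mul_right hB1 _) _
  refine (enorm_add_le _ _).trans ((add_le_add ((enorm_add_le _ _).trans (add_le_add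
    ((enorm_add_le _ _).trans (add_le_add t1 t2)) t3)) t4).trans ?_)
  rw [← mul_add, ← mul_add, ← mul_add]
  refine mul_le_mul_right ?_ _
  unfold remMajorant
  rw [← hA, ← hB]
  calc 27 * A + 27 * A + 27 * A + 27 * B = 81 * A + 27 * B := by ring
    _ ≤ 81 * A + 81 * B := by gcongr; norm_num
    _ = 81 * (A + B) := by ring
    _ ≤ _ := by
        refine mul_le_mul_right ?_ _
        rw [add_assoc]
        exact le_self_add

theorem enorm_sum_drift_le (v z k : Vel) :
    ‖∑ i, k i * driftPair G H i v z‖ₑ ≤ ENNReal.ofReal ‖k‖ * (6 * jetPair G H (v - z) v) := by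
  calc _ ≤ ∑ i, ‖k i * driftPair G H i v z‖ₑ := enorm_sum_le _ _
    _ ≤ ∑ _i : Fin 3, ENNReal.ofReal ‖k‖ * (2 * jetPair G H (v - z) v) := by
        refine Finset.sum_le_sum fun i _ => ?_
        rw [enorm_mul, Real.enorm_eq_ofReal_abs (k i)]
        exact mul_le_mul' (ENNReal.ofReal_le_ofReal (abs_coord_le k i))
          (enorm_driftPair_le G H i v z)
    _ = _ := by
        rw [Finset.sum_const, Finset.card_univ, Fintype.card_fin, nsmul_eq_mul]
        push_cast; ring

theorem enorm_sum_diff_le (v z k : Vel) :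
    ‖2⁻¹ * ∑ i, ∑ j, k i * k j * diffPair G H i j v z‖ₑ ≤
      ENNReal.ofReal (‖k‖ ^ 2) * (36 * jetPair G H (v - z) v) := by
  have h2' : ‖(2 : ℝ)⁻¹‖ₑ ≤ 1 := by
    rw [Real.enorm_of_nonneg (by norm_num)]
    exact ENNReal.ofReal_le_one.2 (by norm_num)
  rw [enorm_mul]
  calc _ ≤ 1 * ∑ _i : Fin 3, ∑ _j : Fin 3,
        ENNReal.ofReal (‖k‖ ^ 2) * (4 * jetPair G H (v - z) v) := by
        refine mul_le_mul' h2' ((enorm_sum_le _ _).trans (Finset.sum_le_sum fun i _ =>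
          (enorm_sum_le _ _).trans (Finset.sum_le_sum fun j _ => ?_)))
        rw [enorm_mul, Real.enorm_eq_ofReal_abs (k i * k j), abs_mul, sq]
        exact mul_le_mul' (ENNReal.ofReal_le_ofReal (mul_le_mul (abs_coord_le k i)
          (abs_coord_le k j) (abs_nonneg _) (norm_nonneg _))) (enorm_diffPair_le G H i j v z)
    _ = _ := by
        simp only [Finset.sum_const, Finset.card_univ, Fintype.card_fin, nsmul_eq_mul]
        push_cast; ring

/-- The crude bound by the size of the terms, which is the better one for `|k| ≥ 1`. -/
theorem enorm_taylorRem_le_sq (v z k : Vel) (hk : 1 ≤ ‖k‖) :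
    ‖taylorRem G H v z k‖ₑ ≤ ENNReal.ofReal (‖k‖ ^ 2) * (81 * remMajorant G H v z k) := by
  have h0 : ∑ k, (0 : Fin 3 → ℕ) k = 0 := by simp
  set P := jetPair G H (v - z) v
  set Q := jetPair G H (v - z - k) (v + k)
  have hk1 : 1 ≤ ENNReal.ofReal (‖k‖ ^ 2) := ENNReal.one_le_ofReal.2 (one_le_pow₀ hk)
  have hk2 : ENNReal.ofReal ‖k‖ ≤ ENNReal.ofReal (‖k‖ ^ 2) :=
    ENNReal.ofReal_le_ofReal (by nlinarith)
  unfold taylorRem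
  calc _ ≤ Q + P + ENNReal.ofReal ‖k‖ * (6 * P) + ENNReal.ofReal (‖k‖ ^ 2) * (36 * P) :=
        enorm_sub_le.trans (add_le_add (enorm_sub_le.trans (add_le_add (enorm_sub_le.trans
          (add_le_add (enorm_mul_le_jetPair (by omega) _ _) (enorm_mul_le_jetPair (by omega) _ _)))
          (enorm_sum_drift_le v z k))) (enorm_sum_diff_le v z k))
    _ ≤ ENNReal.ofReal (‖k‖ ^ 2) * Q + ENNReal.ofReal (‖k‖ ^ 2) * P +
        ENNReal.ofReal (‖k‖ ^ 2) * (6 * P) + ENNReal.ofReal (‖k‖ ^ 2) * (36 * P) := by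
        gcongr
        · exact le_mul_of_one_le_left zero_le hk1
        · exact le_mul_of_one_le_left zero_le hk1
    _ = ENNReal.ofReal (‖k‖ ^ 2) * (Q + 43 * P) := by ring
    _ ≤ ENNReal.ofReal (‖k‖ ^ 2) * (81 * Q + 81 * P) := by
        gcongr
        · exact le_mul_of_one_le_left zero_le (by norm_num)
        · norm_num
    _ ≤ _ := by
        rw [← mul_add]
        unfold remMajorant
        refine mul_le_mul_right (mul_le_mul_right ?_ _) _
        rw [add_assoc]
        exact le_add_self

/-- The bound of order `2 + θ`, which the moment `I_{3+θ}` can absorb. -/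
theorem WeightedJets.ae_taylorRem_le (hJ : WeightedJets l G H) {θ : ℝ} (hθ : 0 < θ) (hθ1 : θ ≤ 1)
    (z k : Vel) : ∀ᵐ v : Vel, ‖taylorRem G H v z k‖ₑ ≤
      ENNReal.ofReal (‖k‖ ^ (2 + θ)) * (81 * remMajorant G H v z k) := by
  rcases le_total 1 ‖k‖ with hk | hk
  · refine Filter.Eventually.of_forall fun v => (enorm_taylorRem_le_sq v z k hk).trans ?_
    refine mul_le_mul_left (ENNReal.ofReal_le_ofReal ?_) _
    rw [← Real.rpow_two]
    exact Real.rpow_le_rpow_of_exponent_le hk (by linarith)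
  · filter_upwards [hJ.ae_taylorRem_le_cube z k] with v hv
    refine hv.trans (mul_le_mul_left (ENNReal.ofReal_le_ofReal ?_) _)
    rcases (norm_nonneg k).eq_or_lt' with h | h
    · rw [h, Real.zero_rpow (by linarith)]; norm_num
    · rw [← Real.rpow_natCast]
      exact Real.rpow_le_rpow_of_exponent_ge h hk (by push_cast; linarith)

theorem WeightedJets.l2_jetPair_le_inv (hJ : WeightedJets l G H) {a b z : Vel}
    (h : ∀ v : Vel, ‖v‖ ≤ 3 * (‖v + a‖ + ‖v + b‖) ∧ ‖z‖ ≤ 3 * (‖v + a‖ + ‖v + b‖)) :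
    l2 (fun v => wE l v * jetPair G H (v + a) (v + b)) ≤
      ENNReal.ofReal (weightW 3 z)⁻¹ * (masterConst l * crossNorm l G H) := by
  have hw := weightW_pos 3 z
  calc _ = ENNReal.ofReal (weightW 3 z)⁻¹ * (ENNReal.ofReal (weightW 3 z) *
        l2 (fun v => wE l v * jetPair G H (v + a) (v + b))) := by
        rw [← mul_assoc, ← ENNReal.ofReal_mul (by positivity), inv_mul_cancel₀ hw.ne',
          ENNReal.ofReal_one, one_mul]
    _ ≤ _ := mul_le_mul_right (hJ.l2_jetPair_le (fun v => (h v).1) fun v => (h v).2) _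

theorem WeightedJets.l2_mean_jetPair_le (hJ : WeightedJets l G H) {a b : ℝ → Vel} {z : Vel}
    (ha : Measurable a) (hb : Measurable b) (h : ∀ t ∈ Icc (0 : ℝ) 1, ∀ v : Vel,
      ‖v‖ ≤ 3 * (‖v + a t‖ + ‖v + b t‖) ∧ ‖z‖ ≤ 3 * (‖v + a t‖ + ‖v + b t‖)) :
    l2 (fun v => wE l v * ∫⁻ t in Ioc (0 : ℝ) 1, jetPair G H (v + a t) (v + b t)) ≤
      ENNReal.ofReal (weightW 3 z)⁻¹ * (masterConst l * crossNorm l G H) := by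
  have := hJ.l2_lintegral_jetPair_le (ν := volume.restrict (Ioc (0 : ℝ) 1)) (c := fun _ => 1)
    (z := fun _ => z) measurable_const ha hb (by
      filter_upwards [ae_restrict_mem measurableSet_Ioc] with t ht
      exact h t (Ioc_subset_Icc_self ht))
  simpa using this

theorem WeightedJets.measurable_mean_jetPair (hJ : WeightedJets l G H) {Y : Type*}
    [MeasurableSpace Y] {x y : Y × ℝ → Vel} (hx : Measurable x) (hy : Measurable y) :
    Measurable fun q => ∫⁻ t in Ioc (0 : ℝ) 1, jetPair G H (x (q, t)) (y (q, t)) :=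
  (hJ.measurable_jetPair hx hy).lintegral_prod_right'

theorem WeightedJets.l2_remMajorant_le (hJ : WeightedJets l G H) {z : Vel}
    {σ : Metric.sphere (0 : Vel) 1} (hσ : 0 ≤ inner ℝ z (σ : Vel)) :
    l2 (fun v => wE l v * remMajorant G H v z (transfer z σ)) ≤
      4 * (ENNReal.ofReal (weightW 3 z)⁻¹ * (masterConst l * crossNorm l G H)) := by
  set k := transfer z σ with hk
  have g : ∀ {s t : ℝ}, t ∈ Icc (0 : ℝ) 1 → ∀ v : Vel,
      ‖v‖ ≤ 3 * (‖v + (-z - s • k)‖ + ‖v + t • k‖) ∧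
      ‖z‖ ≤ 3 * (‖v + (-z - s • k)‖ + ‖v + t • k‖) := fun ht v =>
    norm_le_of_collision_shift hσ ht v
  set N := ENNReal.ofReal (weightW 3 z)⁻¹ * (masterConst l * crossNorm l G H)
  have p1 : l2 (fun v => wE l v * ∫⁻ t in Ioc (0 : ℝ) 1, jetPair G H (v + -z) (v + t • k)) ≤ N :=
    hJ.l2_mean_jetPair_le (a := fun _ => -z) (b := fun t => t • k) measurable_const (by fun_prop)
      fun t ht v => by simpa using g (s := 0) ht v
  have p2 : l2 (fun v => wE l v * ∫⁻ t in Ioc (0 : ℝ) 1,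
      jetPair G H (v + (-z - t • k)) (v + k)) ≤ N :=
    hJ.l2_mean_jetPair_le (a := fun t => -z - t • k) (b := fun _ => k) (by fun_prop)
      measurable_const fun t ht v => by
        simpa using g (s := t) (t := 1) (by norm_num) v
  have p3 : l2 (fun v => wE l v * jetPair G H (v + (-z - k)) (v + k)) ≤ N :=
    hJ.l2_jetPair_le_inv fun v => by simpa using g (s := 1) (t := 1) (by norm_num) v
  have p4 : l2 (fun v => wE l v * jetPair G H (v + -z) (v + 0)) ≤ N :=
    hJ.l2_jetPair_le_inv fun v => norm_le_of_sub z v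
  have m1 : Measurable fun v => wE l v * ∫⁻ t in Ioc (0 : ℝ) 1,
      jetPair G H (v + -z) (v + t • k) :=
    (measurable_wE l).mul (hJ.measurable_mean_jetPair (x := fun q : Vel × ℝ => q.1 + -z)
      (y := fun q : Vel × ℝ => q.1 + q.2 • k) (by fun_prop) (by fun_prop))
  have m2 : Measurable fun v => wE l v * ∫⁻ t in Ioc (0 : ℝ) 1,
      jetPair G H (v + (-z - t • k)) (v + k) :=
    (measurable_wE l).mul (hJ.measurable_mean_jetPair (x := fun q : Vel × ℝ => q.1 + (-z - q.2 • k))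
      (y := fun q : Vel × ℝ => q.1 + k) (by fun_prop) (by fun_prop))
  have m3 : Measurable fun v => wE l v * jetPair G H (v + (-z - k)) (v + k) :=
    (measurable_wE l).mul (hJ.measurable_jetPair (by fun_prop) (by fun_prop))
  have m4 : Measurable fun v => wE l v * jetPair G H (v + -z) (v + 0) :=
    (measurable_wE l).mul (hJ.measurable_jetPair (by fun_prop) (by fun_prop))
  calc _ = l2 (fun v => wE l v * (∫⁻ t in Ioc (0 : ℝ) 1, jetPair G H (v + -z) (v + t • k)) +
        wE l v * (∫⁻ t in Ioc (0 : ℝ) 1, jetPair G H (v + (-z - t • k)) (v + k)) +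
        wE l v * jetPair G H (v + (-z - k)) (v + k) + wE l v * jetPair G H (v + -z) (v + 0)) := by
        congr 1
        ext v
        unfold remMajorant
        simp only [mul_add, sub_eq_add_neg, add_assoc, add_zero]
    _ ≤ N + N + N + N :=
        (l2_add_le ((m1.add m2).add m3) m4).trans (add_le_add ((l2_add_le (m1.add m2) m3).trans
          (add_le_add ((l2_add_le m1 m2).trans (add_le_add p1 p2)) p3)) p4)
    _ = _ := by ring

end

/-! ### The measure on relative velocities and angles -/

/-- The measure `dz dσ` on the relative velocities `z` and directions `σ` with `z · σ ≥ 0`. -/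
def collisionPairs : Measure (Vel × Metric.sphere (0 : Vel) 1) :=
  ((volume : Measure Vel).prod surf).restrict {p | 0 ≤ inner ℝ p.1 (p.2 : Vel)}

instance : SFinite ((volume : Measure Vel).prod surf) := Measure.prod.instSFinite

instance : SFinite collisionPairs := by unfold collisionPairs; infer_instance

theorem measurableSet_collisionPairs :
    MeasurableSet {p : Vel × Metric.sphere (0 : Vel) 1 | 0 ≤ inner ℝ p.1 (p.2 : Vel)} :=
  measurableSet_le measurable_const
    (continuous_fst.inner (continuous_subtype_val.comp continuous_snd)).measurable

theorem ae_collisionPairs :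
    ∀ᵐ p ∂collisionPairs, 0 ≤ inner ℝ p.1 (p.2 : Vel) :=
  ae_restrict_mem measurableSet_collisionPairs

theorem lintegral_collisionPairs {f : Vel × Metric.sphere (0 : Vel) 1 → ℝ≥0∞}
    (hf : Measurable f) :
    ∫⁻ p, f p ∂collisionPairs = ∫⁻ z, (∫⁻ σ, f (z, σ) ∂(hemi z)) := by
  unfold collisionPairs hemi
  rw [← lintegral_indicator measurableSet_collisionPairs,
    lintegral_prod _ (hf.indicator measurableSet_collisionPairs).aemeasurable]
  refine lintegral_congr fun z => ?_
  rw [← lintegral_indicator (measurableSet_hemi z)]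
  rfl

theorem integral_collisionPairs {f : Vel × Metric.sphere (0 : Vel) 1 → ℝ}
    (hf : Integrable f collisionPairs) :
    ∫ p, f p ∂collisionPairs = ∫ z, (∫ σ, f (z, σ) ∂(hemi z)) := by
  unfold collisionPairs at hf
  unfold collisionPairs hemi
  rw [← integral_indicator measurableSet_collisionPairs,
    integral_prod _ ((integrable_indicator_iff measurableSet_collisionPairs).2 hf)]
  refine integral_congr_ae (Filter.Eventually.of_forall fun z => ?_)
  simp only
  rw [← integral_indicator (measurableSet_hemi z)]
  rfl

theorem measurable_prod_coe :
    Measurable fun p : Vel × Metric.sphere (0 : Vel) 1 => (p.1, (p.2 : Vel)) :=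
  measurable_fst.prodMk (measurable_subtype_coe.comp measurable_snd)

theorem measurable_collB_pair {φ : ℝ → ℝ} (hφ : Measurable φ) (ε : ℝ) :
    Measurable fun p : Vel × Metric.sphere (0 : Vel) 1 => collB φ ε p.1 p.2 := by
  have := (measurable_collB hφ ε).comp measurable_prod_coe
  exact this

theorem measurable_transfer_pair :
    Measurable fun p : Vel × Metric.sphere (0 : Vel) 1 => transfer p.1 p.2 := by
  have := measurable_transfer.comp measurable_prod_coe
  exact this

theorem measurable_integral_hemi {f : Vel × Metric.sphere (0 : Vel) 1 → ℝ} (hf : Measurable f) :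
    Measurable fun z => ∫ σ, f (z, σ) ∂(hemi z) := by
  have h : (fun z => ∫ σ, f (z, σ) ∂(hemi z)) = fun z => ∫ σ,
      {p : Vel × Metric.sphere (0 : Vel) 1 | 0 ≤ inner ℝ p.1 (p.2 : Vel)}.indicator f (z, σ)
        ∂surf := by
    ext z
    unfold hemi
    rw [← integral_indicator (measurableSet_hemi z)]
    rfl
  rw [h]
  exact (hf.indicator measurableSet_collisionPairs).stronglyMeasurable.integral_prod_right'.measurable

theorem ae_ne_zero : ∀ᵐ z : Vel, z ≠ 0 := by rw [ae_iff]; simp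

theorem measurable_driftK {φ : ℝ → ℝ} (hφ : Measurable φ) (ε : ℝ) (i : Fin 3) :
    Measurable (driftK φ ε i) := by
  have h := measurable_transfer_pair
  exact measurable_integral_hemi (f := fun p => collB φ ε p.1 p.2 * transfer p.1 p.2 i)
    ((measurable_collB_pair hφ ε).mul (by fun_prop))

theorem measurable_diffK {φ : ℝ → ℝ} (hφ : Measurable φ) (ε : ℝ) (i j : Fin 3) :
    Measurable (diffK φ ε i j) := by
  have h := measurable_transfer_pair
  exact measurable_integral_hemi
    (f := fun p => collB φ ε p.1 p.2 * (transfer p.1 p.2 i * transfer p.1 p.2 j))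
    ((measurable_collB_pair hφ ε).mul (by fun_prop))

section
variable {φ : ℝ → ℝ} {ε : ℝ} {l : ℝ} {G H : (Fin 3 → ℕ) → Vel → ℝ}

/-- Moments of the collision kernel against a function of the relative velocity: a moment of order
`a` of the transfer costs `ε ^ (a - 2) I_{1+a} |z|⁻¹`, and `|z|⁻¹` is estimated by `kern`. -/
theorem lintegral_collB_moment_le (hφ : Measurable φ) (hε : 0 < ε) {a : ℝ}
    (hfin : FiniteMomentI φ (1 + a)) {F : Vel → ℝ≥0∞} (hF : Measurable F) :
    ∫⁻ p, ENNReal.ofReal (collB φ ε p.1 p.2) * (ENNReal.ofReal (‖transfer p.1 p.2‖ ^ a) * F p.1)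
        ∂collisionPairs ≤
      ENNReal.ofReal (8 * Real.pi * ε ^ (a - 2) * momentI φ (1 + a)) *
        ∫⁻ z, ENNReal.ofReal (kern z) * F z := by
  have hB := measurable_collB_pair hφ ε
  have hT := measurable_transfer_pair
  have hI := momentI_nonneg φ (1 + a)
  have hpi := Real.pi_pos
  have hFf : Measurable fun p : Vel × Metric.sphere (0 : Vel) 1 => F p.1 := hF.comp measurable_fst
  have hm : Measurable fun p : Vel × Metric.sphere (0 : Vel) 1 =>
      ENNReal.ofReal (collB φ ε p.1 p.2) * (ENNReal.ofReal (‖transfer p.1 p.2‖ ^ a) * F p.1) :=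
    hB.ennreal_ofReal.mul ((hT.norm.pow_const a).ennreal_ofReal.mul hFf)
  rw [lintegral_collisionPairs hm, ← lintegral_const_mul' _ _ ENNReal.ofReal_ne_top]
  refine lintegral_mono_ae ?_
  filter_upwards [ae_ne_zero] with z hz
  have hz' : Measurable fun σ : Metric.sphere (0 : Vel) 1 => (z, σ) := measurable_prodMk_left
  have hBz : Measurable fun σ : Metric.sphere (0 : Vel) 1 => collB φ ε z σ := by
    have := hB.comp hz'
    exact this
  have hTz : Measurable fun σ : Metric.sphere (0 : Vel) 1 => transfer z σ := by
    have := hT.comp hz'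
    exact this
  calc ∫⁻ σ, ENNReal.ofReal (collB φ ε z σ) *
        (ENNReal.ofReal (‖transfer z σ‖ ^ a) * F z) ∂(hemi z)
      = (∫⁻ σ, ENNReal.ofReal (collB φ ε z σ) *
        ENNReal.ofReal (‖transfer z σ‖ ^ a) ∂(hemi z)) * F z := by
        simp only [← mul_assoc]
        exact lintegral_mul_const _ (hBz.ennreal_ofReal.mul (hTz.norm.pow_const a).ennreal_ofReal)
    _ ≤ ENNReal.ofReal (8 * Real.pi * ε ^ (a - 2) * momentI φ (1 + a) * ‖z‖⁻¹) * F z :=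
        mul_le_mul_left (lintegral_collB_transfer_le hφ hε hz hfin) _
    _ ≤ ENNReal.ofReal (8 * Real.pi * ε ^ (a - 2) * momentI φ (1 + a) * kern z) * F z := by
        refine mul_le_mul_left (ENNReal.ofReal_le_ofReal
          (mul_le_mul_of_nonneg_left ?_ (by positivity))) _
        unfold kern
        linarith [sq_nonneg ‖z‖⁻¹]
    _ = _ := by rw [ENNReal.ofReal_mul (by positivity), mul_assoc]

theorem WeightedJets.measurable_taylorRem (hJ : WeightedJets l G H) :
    Measurable fun q : Vel × (Vel × Metric.sphere (0 : Vel) 1) =>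
      taylorRem G H q.1 q.2.1 (transfer q.2.1 q.2.2) := by
  have hT : Measurable fun q : Vel × (Vel × Metric.sphere (0 : Vel) 1) =>
      transfer q.2.1 q.2.2 := by
    have hs : Measurable (Prod.snd : Vel × (Vel × Metric.sphere (0 : Vel) 1) → _) := measurable_snd
    have := measurable_transfer_pair.comp hs
    exact this
  have hG : ∀ α, Measurable (G α) := hJ.left.measurable
  have hH : ∀ α, Measurable (H α) := hJ.right.measurable
  have h1 : Measurable fun q : Vel × (Vel × Metric.sphere (0 : Vel) 1) => q.1 - q.2.1 :=
    measurable_fst.sub measurable_snd.fst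
  have hGz : ∀ α, Measurable fun q : Vel × (Vel × Metric.sphere (0 : Vel) 1) => G α (q.1 - q.2.1) :=
    fun α => (hG α).comp h1
  have hHv : ∀ α, Measurable fun q : Vel × (Vel × Metric.sphere (0 : Vel) 1) => H α q.1 :=
    fun α => (hH α).comp measurable_fst
  have hTi : ∀ i : Fin 3, Measurable fun q : Vel × (Vel × Metric.sphere (0 : Vel) 1) =>
      transfer q.2.1 q.2.2 i := fun i => by fun_prop
  unfold taylorRem driftPair diffPair
  refine (((((hG 0).comp (h1.sub hT)).mul ((hH 0).comp (measurable_fst.add hT))).sub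
    ((hGz 0).mul (hHv 0))).sub (Finset.measurable_fun_sum _ fun i _ => (hTi i).mul
      (((hGz _).mul (hHv _)).sub ((hGz _).mul (hHv _))))).sub
    ((Finset.measurable_fun_sum _ fun i _ => Finset.measurable_fun_sum _ fun j _ =>
      ((hTi i).mul (hTi j)).mul (((((hGz _).mul (hHv _))).sub (((hGz _).mul (hHv _)).const_mul 2)).add
        ((hGz _).mul (hHv _)))).const_mul _)

/-- The total Taylor remainder, with absolute values inside the integral. -/
def remIntegral (φ : ℝ → ℝ) (ε : ℝ) (G H : (Fin 3 → ℕ) → Vel → ℝ) (v : Vel) : ℝ≥0∞ :=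
  ∫⁻ p, ENNReal.ofReal (collB φ ε p.1 p.2) * ‖taylorRem G H v p.1 (transfer p.1 p.2)‖ₑ
    ∂collisionPairs

theorem WeightedJets.measurable_remIntegrand (hJ : WeightedJets l G H) (hφ : Measurable φ)
    (ε : ℝ) : Measurable fun q : Vel × (Vel × Metric.sphere (0 : Vel) 1) =>
      ENNReal.ofReal (collB φ ε q.2.1 q.2.2) *
        ‖taylorRem G H q.1 q.2.1 (transfer q.2.1 q.2.2)‖ₑ := by
  have hs : Measurable (Prod.snd : Vel × (Vel × Metric.sphere (0 : Vel) 1) → _) := measurable_snd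
  have h1 := ((measurable_collB_pair hφ ε).comp hs).ennreal_ofReal
  have h2 := h1.mul hJ.measurable_taylorRem.enorm
  exact h2

/-- The remainder is of size `ε ^ θ I_{3+θ}`: moment of order `2 + θ` of the transfer, with the decay
`⟨z⟩⁻³` that the bilinear estimate provides to make `kern` integrable. -/
theorem WeightedJets.l2_remIntegral_le (hJ : WeightedJets l G H) (hφ : Measurable φ) (hε : 0 < ε)
    {θ : ℝ} (hθ : 0 < θ) (hθ1 : θ ≤ 1) (hfin : FiniteMomentI φ (3 + θ)) :
    l2 (fun v => wE l v * remIntegral φ ε G H v) ≤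
      ENNReal.ofReal (8 * Real.pi * ε ^ θ * momentI φ (3 + θ)) *
        (324 * kernMass * (masterConst l * crossNorm l G H)) := by
  set N := masterConst l * crossNorm l G H with hN
  have hwm : Measurable fun z : Vel => ENNReal.ofReal (weightW 3 z)⁻¹ :=
    (continuous_weightW 3).measurable.inv.ennreal_ofReal
  have hmF : Measurable (Function.uncurry fun (v : Vel) (p : Vel × Metric.sphere (0 : Vel) 1) =>
      wE l v * (ENNReal.ofReal (collB φ ε p.1 p.2) *
        ‖taylorRem G H v p.1 (transfer p.1 p.2)‖ₑ)) :=
    ((measurable_wE l).comp measurable_fst).mul (hJ.measurable_remIntegrand hφ ε)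
  calc _ = l2 (fun v => ∫⁻ p, wE l v * (ENNReal.ofReal (collB φ ε p.1 p.2) *
        ‖taylorRem G H v p.1 (transfer p.1 p.2)‖ₑ) ∂collisionPairs) := by
        congr 1
        ext v
        unfold remIntegral
        rw [lintegral_const_mul' _ _ (by unfold wE; exact ENNReal.ofReal_ne_top)]
    _ ≤ ∫⁻ p, l2 (fun v => wE l v * (ENNReal.ofReal (collB φ ε p.1 p.2) *
        ‖taylorRem G H v p.1 (transfer p.1 p.2)‖ₑ)) ∂collisionPairs := l2_lintegral_le hmF
    _ ≤ ∫⁻ p, ENNReal.ofReal (collB φ ε p.1 p.2) * (ENNReal.ofReal (‖transfer p.1 p.2‖ ^ (2 + θ)) *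
        (324 * N * ENNReal.ofReal (weightW 3 p.1)⁻¹)) ∂collisionPairs := by
        refine lintegral_mono_ae ?_
        filter_upwards [ae_collisionPairs] with p hp
        set k := transfer p.1 p.2 with hk
        calc _ ≤ l2 (fun v => (ENNReal.ofReal (collB φ ε p.1 p.2) *
              (ENNReal.ofReal (‖k‖ ^ (2 + θ)) * 81)) * (wE l v * remMajorant G H v p.1 k)) := by
              refine l2_mono_ae ?_
              filter_upwards [hJ.ae_taylorRem_le hθ hθ1 p.1 k] with v hv
              calc _ ≤ wE l v * (ENNReal.ofReal (collB φ ε p.1 p.2) *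
                    (ENNReal.ofReal (‖k‖ ^ (2 + θ)) * (81 * remMajorant G H v p.1 k))) :=
                    mul_le_mul_right (mul_le_mul_right hv _) _
                _ = _ := by ring
          _ = (ENNReal.ofReal (collB φ ε p.1 p.2) * (ENNReal.ofReal (‖k‖ ^ (2 + θ)) * 81)) *
                l2 (fun v => wE l v * remMajorant G H v p.1 k) :=
              l2_const_mul (ENNReal.mul_ne_top ENNReal.ofReal_ne_top
                (ENNReal.mul_ne_top ENNReal.ofReal_ne_top (by simp))) _
          _ ≤ (ENNReal.ofReal (collB φ ε p.1 p.2) * (ENNReal.ofReal (‖k‖ ^ (2 + θ)) * 81)) *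
                (4 * (ENNReal.ofReal (weightW 3 p.1)⁻¹ * N)) :=
              mul_le_mul_right (hJ.l2_remMajorant_le hp) _
          _ = _ := by ring
    _ ≤ ENNReal.ofReal (8 * Real.pi * ε ^ (2 + θ - 2) * momentI φ (1 + (2 + θ))) *
          ∫⁻ z, ENNReal.ofReal (kern z) * (324 * N * ENNReal.ofReal (weightW 3 z)⁻¹) :=
        lintegral_collB_moment_le hφ hε (by rwa [show 1 + (2 + θ) = 3 + θ by ring])
          (hwm.const_mul _)
    _ = _ := by
        rw [show 2 + θ - 2 = θ by ring, show 1 + (2 + θ) = 3 + θ by ring]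
        congr 1
        unfold kernMass
        simp only [ENNReal.ofReal_mul (kern_nonneg _)]
        rw [show (324 : ℝ≥0∞) * (∫⁻ z, ENNReal.ofReal (kern z) * ENNReal.ofReal (weightW 3 z)⁻¹) * N =
          324 * N * (∫⁻ z, ENNReal.ofReal (kern z) * ENNReal.ofReal (weightW 3 z)⁻¹) by ring,
          ← lintegral_const_mul' _ _ (ENNReal.mul_ne_top (by simp) (ENNReal.mul_ne_top
            (masterConst_ne_top l) hJ.crossNorm_ne_top))]
        refine lintegral_congr fun z => ?_
        ring

theorem WeightedJets.ae_remIntegral_lt_top (hJ : WeightedJets l G H) (hφ : Measurable φ)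
    (hε : 0 < ε) {θ : ℝ} (hθ : 0 < θ) (hθ1 : θ ≤ 1) (hfin : FiniteMomentI φ (3 + θ)) :
    ∀ᵐ v, remIntegral φ ε G H v < ⊤ := by
  refine ae_lt_top_of_l2 (l := l) ?_ (ne_top_of_le_ne_top ?_
    (hJ.l2_remIntegral_le hφ hε hθ hθ1 hfin))
  · exact (hJ.measurable_remIntegrand hφ ε).lintegral_prod_right'
  · exact ENNReal.mul_ne_top ENNReal.ofReal_ne_top (ENNReal.mul_ne_top
      (ENNReal.mul_ne_top (by simp) kernMass_ne_top)
      (ENNReal.mul_ne_top (masterConst_ne_top l) hJ.crossNorm_ne_top))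

end

/-! ### The error kernels -/

/-- The difference of the drift coefficient and its grazing limit. -/
def driftErr (φ : ℝ → ℝ) (ε : ℝ) (i : Fin 3) (z : Vel) : ℝ :=
  driftK φ ε i z - 2 * landauB φ i z

/-- The difference of half the diffusion coefficient and its grazing limit. -/
def diffErr (φ : ℝ → ℝ) (ε : ℝ) (i j : Fin 3) (z : Vel) : ℝ :=
  diffK φ ε i j z / 2 - landauA φ z i j

theorem rpow_neg_le_kern {θ : ℝ} (hθ : 0 < θ) (hθ1 : θ ≤ 1) {z : Vel} (hz : z ≠ 0) :
    ‖z‖ ^ (-(1 + θ)) ≤ kern z := by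
  have hz' : 0 < ‖z‖ := norm_pos_iff.2 hz
  have e1 : ‖z‖ ^ (-1 : ℝ) = ‖z‖⁻¹ := Real.rpow_neg_one _
  have e2 : ‖z‖ ^ (-2 : ℝ) = ‖z‖⁻¹ ^ 2 := by
    rw [Real.rpow_neg hz'.le, Real.rpow_two, inv_pow]
  unfold kern
  rw [← e2, ← e1]
  have p1 : 0 ≤ ‖z‖ ^ (-1 : ℝ) := by positivity
  have p2 : 0 ≤ ‖z‖ ^ (-2 : ℝ) := by positivity
  rcases le_total ‖z‖ 1 with h | h
  · have := Real.rpow_le_rpow_of_exponent_ge hz' h (show (-2 : ℝ) ≤ -(1 + θ) by linarith)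
    linarith
  · have := Real.rpow_le_rpow_of_exponent_le h (show -(1 + θ) ≤ (-1 : ℝ) by linarith)
    linarith

theorem weightW_three_le {z : Vel} (hz : ‖z‖ ≤ 1) : weightW 3 z ≤ 4 := by
  unfold weightW
  have h1 : 1 + ‖z‖ ^ 2 ≤ 2 := by nlinarith [norm_nonneg z]
  calc (1 + ‖z‖ ^ 2) ^ ((3 : ℝ) / 2) ≤ 2 ^ ((3 : ℝ) / 2) :=
        Real.rpow_le_rpow (by positivity) h1 (by norm_num)
    _ ≤ 2 ^ (2 : ℝ) := Real.rpow_le_rpow_of_exponent_le (by norm_num) (by norm_num)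
    _ = 4 := by norm_num

theorem kern_le_of_norm_le_one {z : Vel} (hz : ‖z‖ ≤ 1) : kern z ≤ 4 * (kern z * (weightW 3 z)⁻¹) := by
  have hw := weightW_pos 3 z
  have h1 : 1 ≤ 4 * (weightW 3 z)⁻¹ := by
    rw [← div_eq_mul_inv, le_div_iff₀ hw, one_mul]
    exact weightW_three_le hz
  calc kern z = kern z * 1 := (mul_one _).symm
    _ ≤ kern z * (4 * (weightW 3 z)⁻¹) := mul_le_mul_of_nonneg_left h1 (kern_nonneg z)
    _ = _ := by ring

section
variable {φ : ℝ → ℝ} {ε θ : ℝ}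

theorem measurable_driftErr (hφ : Measurable φ) (ε : ℝ) (i : Fin 3) : Measurable (driftErr φ ε i) :=
  (measurable_driftK hφ ε i).sub ((measurable_landauB φ i).const_mul 2)

theorem measurable_diffErr (hφ : Measurable φ) (ε : ℝ) (i j : Fin 3) :
    Measurable (diffErr φ ε i j) :=
  ((measurable_diffK hφ ε i j).div_const 2).sub (measurable_landauA φ i j)

theorem transfer_zero (σ : Vel) : transfer 0 σ = 0 := by simp [transfer]

theorem driftErr_zero (φ : ℝ → ℝ) (ε : ℝ) (i : Fin 3) : driftErr φ ε i 0 = 0 := by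
  simp [driftErr, driftK, landauB, transfer_zero]

theorem diffErr_zero (φ : ℝ → ℝ) (ε : ℝ) (i j : Fin 3) : diffErr φ ε i j 0 = 0 := by
  simp [diffErr, diffK, landauA, transfer_zero]

/-- The error is an explicit odd function of `z`. -/
theorem driftErr_eq (hφ : Measurable φ) (hε : 0 < ε) (h1 : FiniteMomentI φ 1)
    (h3 : FiniteMomentI φ 3) (i : Fin 3) (z : Vel) :
    driftErr φ ε i z = 8 * Real.pi * (z i * ‖z‖⁻¹ ^ 3) * tailMoment φ ε z := by
  by_cases hz : z = 0
  · subst hz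
    rw [driftErr_zero]
    simp
  · unfold driftErr
    rw [driftK_eq hφ hε hz h1 h3]
    ring

theorem driftErr_neg (hφ : Measurable φ) (hε : 0 < ε) (h1 : FiniteMomentI φ 1)
    (h3 : FiniteMomentI φ 3) (i : Fin 3) (z : Vel) :
    driftErr φ ε i (-z) = -driftErr φ ε i z := by
  rw [driftErr_eq hφ hε h1 h3, driftErr_eq hφ hε h1 h3, tailMoment_neg, norm_neg, PiLp.neg_apply]
  ring

/-- A bound that is not small in `ε`, and serves for integrability only. -/
theorem abs_driftErr_le_kern (hφ : Measurable φ) (hε : 0 < ε) (h1 : FiniteMomentI φ 1)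
    (h3 : FiniteMomentI φ 3) (i : Fin 3) (z : Vel) :
    |driftErr φ ε i z| ≤ 8 * Real.pi * momentI φ 3 * kern z := by
  have hI := momentI_nonneg φ 3
  have hpi := Real.pi_pos
  by_cases hz : z = 0
  · subst hz
    rw [driftErr_zero, abs_zero]
    exact mul_nonneg (by positivity) (kern_nonneg _)
  have hz' : 0 < ‖z‖ := norm_pos_iff.2 hz
  have e : |8 * Real.pi * (z i * ‖z‖⁻¹ ^ 3) * tailMoment φ ε z| =
      8 * Real.pi * (|z i| * ‖z‖⁻¹ ^ 3) * tailMoment φ ε z := by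
    rw [abs_mul, abs_mul (8 * Real.pi), abs_mul (z i),
      abs_of_nonneg (tailMoment_nonneg φ hε z), abs_of_nonneg (show 0 ≤ 8 * Real.pi by positivity),
      abs_of_nonneg (show 0 ≤ ‖z‖⁻¹ ^ 3 by positivity)]
  rw [driftErr_eq hφ hε h1 h3, e]
  calc _ ≤ 8 * Real.pi * (‖z‖ * ‖z‖⁻¹ ^ 3) * momentI φ 3 := by
        gcongr
        · exact tailMoment_nonneg φ hε z
        · exact abs_coord_le z i
        · exact tailMoment_le_moment hε hz h3
    _ = 8 * Real.pi * momentI φ 3 * ‖z‖⁻¹ ^ 2 := by field_simp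
    _ ≤ _ := by
        unfold kern
        gcongr
        linarith [inv_nonneg.2 hz'.le]

/-- A bound that is small in `ε` and integrable near the origin, after a factor `|z|` is gained. -/
theorem abs_driftErr_mul_norm_le (hφ : Measurable φ) (hε : 0 < ε) (h1 : FiniteMomentI φ 1)
    (h3 : FiniteMomentI φ 3) (hθ : 0 < θ) (hθ1 : θ ≤ 1) (hθ3 : FiniteMomentI φ (3 + θ))
    (i : Fin 3) (z : Vel) :
    |driftErr φ ε i z| * ‖z‖ ≤ 16 * Real.pi * (ε ^ θ * momentI φ (3 + θ)) * kern z := by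
  have hI := momentI_nonneg φ (3 + θ)
  have hpi := Real.pi_pos
  by_cases hz : z = 0
  · subst hz
    rw [driftErr_zero, abs_zero, zero_mul]
    exact mul_nonneg (by positivity) (kern_nonneg _)
  have hz' : 0 < ‖z‖ := norm_pos_iff.2 hz
  have h := abs_drift_error_le hε hz h3 hθ hθ1 hθ3 i
  rw [← driftErr_eq hφ hε h1 h3] at h
  calc _ ≤ 16 * Real.pi * ε ^ θ * momentI φ (3 + θ) * ‖z‖ ^ (-(2 + θ)) * ‖z‖ := by gcongr
    _ = 16 * Real.pi * (ε ^ θ * momentI φ (3 + θ)) * ‖z‖ ^ (-(1 + θ)) := by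
        have : ‖z‖ ^ (-(1 + θ)) = ‖z‖ ^ (-(2 + θ)) * ‖z‖ := by
          rw [← Real.rpow_add_one hz'.ne']
          congr 1; ring
        rw [this]; ring
    _ ≤ _ := mul_le_mul_of_nonneg_left (rpow_neg_le_kern hθ hθ1 hz) (by positivity)

theorem abs_diffErr_le (hφ : Measurable φ) (hε : 0 < ε) (h1 : FiniteMomentI φ 1)
    (h3 : FiniteMomentI φ 3) (hθ : 0 < θ) (hθ1 : θ ≤ 1) (hθ3 : FiniteMomentI φ (3 + θ))
    (i j : Fin 3) (z : Vel) :
    |diffErr φ ε i j z| ≤ 16 * Real.pi * (ε ^ θ * momentI φ (3 + θ)) * kern z := by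
  have hI := momentI_nonneg φ (3 + θ)
  have hpi := Real.pi_pos
  by_cases hz : z = 0
  · subst hz
    rw [diffErr_zero, abs_zero]
    exact mul_nonneg (by positivity) (kern_nonneg _)
  refine (abs_diffusion_error_le hφ hε hz h1 h3 hθ hθ1 hθ3 i j).trans ?_
  rw [mul_assoc (16 * Real.pi)]
  exact mul_le_mul_of_nonneg_left (rpow_neg_le_kern hθ hθ1 hz) (by positivity)

end

section
variable {l : ℝ} {G H : (Fin 3 → ℕ) → Vel → ℝ}

theorem WeightedJets.measurable_pairInt (hJ : WeightedJets l G H) {c : Vel → ℝ} (hc : Measurable c)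
    (α β : Fin 3 → ℕ) : Measurable (pairInt G H c α β) :=
  (hJ.measurable_pair hc α β).stronglyMeasurable.integral_prod_right'.measurable

theorem WeightedJets.l2_pairInt_le (hJ : WeightedJets l G H) {c : Vel → ℝ} {K : ℝ}
    (hK : ∀ z, |c z| ≤ K * kern z) {α β : Fin 3 → ℕ} (h : ∑ i, α i + ∑ i, β i ≤ 3) :
    l2 (fun v => wE l v * ‖pairInt G H c α β v‖ₑ) ≤
      ENNReal.ofReal K * (kernMass * (masterConst l * crossNorm l G H)) := by
  calc _ ≤ l2 (fun v => ENNReal.ofReal K * (wE l v * kernPair G H v)) := by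
        refine l2_mono fun v => ?_
        calc _ ≤ wE l v * (ENNReal.ofReal K * kernPair G H v) :=
              mul_le_mul_right ((enorm_integral_le_lintegral_enorm _).trans
                (lintegral_pair_le hK h v)) _
          _ = _ := by ring
    _ = ENNReal.ofReal K * l2 (fun v => wE l v * kernPair G H v) :=
        l2_const_mul ENNReal.ofReal_ne_top _
    _ ≤ _ := mul_le_mul_right hJ.l2_kernPair_le _

/-- An increment of `g` gains a factor `|z|` at the cost of one derivative. -/
theorem WeightedJets.l2_increment_le (hJ : WeightedJets l G H) {α β : Fin 3 → ℕ}
    (h : ∑ i, α i + ∑ i, β i ≤ 2) (z : Vel) :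
    l2 (fun v => wE l v * ‖(G α (v - z) - G α v) * H β v‖ₑ) ≤
      ENNReal.ofReal ‖z‖ * (3 * (masterConst l * crossNorm l G H)) := by
  have key : ∀ᵐ v : Vel, ‖(G α (v - z) - G α v) * H β v‖ₑ ≤
      (ENNReal.ofReal ‖z‖ * 3) * ∫⁻ t in Ioc (0 : ℝ) 1, jetPair G H (v + t • (-z)) (v + 0) := by
    have hfin : ∀ v, ‖H β v‖ₑ ≠ ⊤ := fun v => enorm_ne_top
    by_cases hα : ∑ i, α i = 0
    · filter_upwards [hJ.left.ae_taylor_le α (n := 0) (N := 1) (by omega) (by omega) (-z)] with v hv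
      simp only [zero_add, Finset.range_one, Finset.sum_singleton, Nat.factorial_zero, Nat.cast_one,
        inv_one, one_mul, dirDeriv_zero, add_zero, pow_one, norm_neg, ← sub_eq_add_neg] at hv
      rw [enorm_mul]
      refine (mul_le_mul_left hv _).trans ?_
      rw [mul_assoc, mul_assoc, mul_assoc, ← lintegral_mul_const' _ _ (hfin v)]
      refine mul_le_mul_right (mul_le_mul_right (lintegral_mono fun t => ?_) _) _
      unfold jetPair
      rw [add_zero]
      exact le_trans (mul_le_mul_right (enorm_le_jetSum (by omega) v) _) le_self_add
    · filter_upwards [hJ.left.ae_taylor_le α (n := 0) (N := 3) (by omega) le_rfl (-z)] with v hv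
      simp only [zero_add, Finset.range_one, Finset.sum_singleton, Nat.factorial_zero, Nat.cast_one,
        inv_one, one_mul, dirDeriv_zero, add_zero, pow_one, norm_neg, ← sub_eq_add_neg] at hv
      rw [enorm_mul]
      refine (mul_le_mul_left hv _).trans ?_
      rw [mul_assoc, mul_assoc, mul_assoc, ← lintegral_mul_const' _ _ (hfin v)]
      refine mul_le_mul_right (mul_le_mul_right (lintegral_mono fun t => ?_) _) _
      unfold jetPair
      rw [add_zero]
      exact le_trans (mul_le_mul_right (enorm_le_jetSum (by omega) v) _) le_add_self
  have hmean := hJ.l2_mean_jetPair_le (a := fun t => t • (-z)) (b := fun _ => 0) (z := 0)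
    (by fun_prop) measurable_const (fun t _ v => by
      have h1 := norm_nonneg (v + t • (-z))
      have h2 := norm_nonneg v
      rw [add_zero, norm_zero]
      constructor <;> linarith)
  have hw0 : weightW 3 (0 : Vel) = 1 := by simp [weightW]
  rw [hw0, inv_one, ENNReal.ofReal_one, one_mul] at hmean
  calc _ ≤ l2 (fun v => (ENNReal.ofReal ‖z‖ * 3) * (wE l v *
        ∫⁻ t in Ioc (0 : ℝ) 1, jetPair G H (v + t • (-z)) (v + 0))) := by
        refine l2_mono_ae (key.mono fun v hv => ?_)
        calc _ ≤ wE l v * ((ENNReal.ofReal ‖z‖ * 3) *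
              ∫⁻ t in Ioc (0 : ℝ) 1, jetPair G H (v + t • (-z)) (v + 0)) := mul_le_mul_right hv _
          _ = _ := by ring
    _ = (ENNReal.ofReal ‖z‖ * 3) * l2 (fun v => wE l v *
        ∫⁻ t in Ioc (0 : ℝ) 1, jetPair G H (v + t • (-z)) (v + 0)) :=
        l2_const_mul (ENNReal.mul_ne_top ENNReal.ofReal_ne_top (by simp)) _
    _ ≤ (ENNReal.ofReal ‖z‖ * 3) * (masterConst l * crossNorm l G H) := mul_le_mul_right hmean _
    _ = _ := by ring

/-- For an odd kernel supported in the unit ball, one order of the singularity at the origin is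
gained by subtracting the value of `g` at `v`. -/
theorem WeightedJets.l2_pairInt_odd_le (hJ : WeightedJets l G H) {c : Vel → ℝ} (hc : Measurable c)
    {K K' : ℝ} (hK' : ∀ z, |c z| ≤ K' * kern z) (hK : ∀ z, |c z| * ‖z‖ ≤ K * kern z)
    (hodd : ∀ z, c (-z) = -c z) (hsupp : ∀ z, 1 < ‖z‖ → c z = 0) {α β : Fin 3 → ℕ}
    (h : ∑ i, α i + ∑ i, β i ≤ 2) :
    l2 (fun v => wE l v * ‖pairInt G H c α β v‖ₑ) ≤
      ENNReal.ofReal K * (12 * (kernMass * (masterConst l * crossNorm l G H))) := by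
  set N := masterConst l * crossNorm l G H with hN
  have hK0 : 0 ≤ K := by
    have h1 := hK (EuclideanSpace.single 0 1)
    have h2 : 0 < kern (EuclideanSpace.single 0 1) := by
      unfold kern
      simp
    have h3 : 0 ≤ K * kern (EuclideanSpace.single 0 1) := le_trans (by positivity) h1
    exact nonneg_of_mul_nonneg_left h3 h2
  have hcint : Integrable c volume := by
    refine (integrable_kern_weight.const_mul (|K'| * 4)).mono' hc.aestronglyMeasurable
      (Filter.Eventually.of_forall fun z => ?_)
    have hw : 0 ≤ kern z * (weightW 3 z)⁻¹ :=
      mul_nonneg (kern_nonneg z) (inv_nonneg.2 (weightW_pos 3 z).le)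
    rw [Real.norm_eq_abs]
    rcases le_or_gt ‖z‖ 1 with hz | hz
    · calc |c z| ≤ K' * kern z := hK' z
        _ ≤ |K'| * kern z := mul_le_mul_of_nonneg_right (le_abs_self _) (kern_nonneg z)
        _ ≤ |K'| * (4 * (kern z * (weightW 3 z)⁻¹)) :=
            mul_le_mul_of_nonneg_left (kern_le_of_norm_le_one hz) (abs_nonneg _)
        _ = _ := by ring
    · rw [hsupp z hz, abs_zero]
      positivity
  -- Since `c` is odd, `g(v)` may be subtracted from `g(v - z)` in the integral.
  have hc0 : ∫ z, c z = 0 := by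
    have := integral_neg_eq_self c volume
    simp only [hodd, integral_neg] at this
    linarith
  have hm : Measurable (Function.uncurry fun (v z : Vel) =>
      wE l v * (‖c z‖ₑ * ‖(G α (v - z) - G α v) * H β v‖ₑ)) := by
    have h1 : Measurable fun p : Vel × Vel => G α (p.1 - p.2) :=
      (hJ.left.measurable α).comp (measurable_fst.sub measurable_snd)
    have h2 : Measurable fun p : Vel × Vel => G α p.1 :=
      (hJ.left.measurable α).comp measurable_fst
    have h3 : Measurable fun p : Vel × Vel => H β p.1 :=
      (hJ.right.measurable β).comp measurable_fst
    exact ((measurable_wE l).comp measurable_fst).mul ((hc.comp measurable_snd).enorm.mul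
      ((h1.sub h2).mul h3).enorm)
  calc _ ≤ l2 (fun v => ∫⁻ z, wE l v * (‖c z‖ₑ * ‖(G α (v - z) - G α v) * H β v‖ₑ)) := by
        refine l2_mono_ae (hJ.ae_kernPair_lt_top.mono fun v hv => ?_)
        rw [lintegral_const_mul' _ _ (by unfold wE; exact ENNReal.ofReal_ne_top)]
        refine mul_le_mul_right ?_ _
        have hint := hJ.integrable_pair hc hK' (α := α) (β := β) (by omega) hv
        have e : pairInt G H c α β v = ∫ z, c z * ((G α (v - z) - G α v) * H β v) := by
          have : (fun z => c z * ((G α (v - z) - G α v) * H β v)) =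
              fun z => c z * (G α (v - z) * H β v) - c z * (G α v * H β v) := by
            ext z; ring
          rw [this, integral_sub hint (hcint.mul_const _), integral_mul_const, hc0, zero_mul,
            sub_zero]
          rfl
        rw [e]
        refine (enorm_integral_le_lintegral_enorm _).trans (lintegral_mono fun z => ?_)
        rw [enorm_mul]
    _ ≤ ∫⁻ z, l2 (fun v => wE l v * (‖c z‖ₑ * ‖(G α (v - z) - G α v) * H β v‖ₑ)) :=
        l2_lintegral_le hm
    _ ≤ ∫⁻ z, ENNReal.ofReal (kern z * (weightW 3 z)⁻¹) * (ENNReal.ofReal K * (12 * N)) := by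
        refine lintegral_mono fun z => ?_
        calc _ = ‖c z‖ₑ * l2 (fun v => wE l v * ‖(G α (v - z) - G α v) * H β v‖ₑ) := by
              rw [← l2_const_mul enorm_ne_top]
              congr 1; ext v; ring
          _ ≤ ‖c z‖ₑ * (ENNReal.ofReal ‖z‖ * (3 * N)) := mul_le_mul_right (hJ.l2_increment_le h z) _
          _ = ENNReal.ofReal (|c z| * ‖z‖) * (3 * N) := by
              rw [Real.enorm_eq_ofReal_abs, ← mul_assoc, ← ENNReal.ofReal_mul (abs_nonneg _)]
          _ ≤ ENNReal.ofReal (K * 4 * (kern z * (weightW 3 z)⁻¹)) * (3 * N) := by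
              refine mul_le_mul_left (ENNReal.ofReal_le_ofReal ?_) _
              have hw : 0 ≤ kern z * (weightW 3 z)⁻¹ :=
                mul_nonneg (kern_nonneg z) (inv_nonneg.2 (weightW_pos 3 z).le)
              rcases le_or_gt ‖z‖ 1 with hz | hz
              · calc _ ≤ K * kern z := hK z
                  _ ≤ K * (4 * (kern z * (weightW 3 z)⁻¹)) :=
                      mul_le_mul_of_nonneg_left (kern_le_of_norm_le_one hz) hK0
                  _ = _ := by ring
              · rw [hsupp z hz, abs_zero, zero_mul]
                positivity
          _ = _ := by
              rw [ENNReal.ofReal_mul (by positivity), ENNReal.ofReal_mul hK0]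
              rw [show ENNReal.ofReal (4 : ℝ) = 4 by simp]
              ring
    _ = _ := by
        rw [lintegral_mul_const' _ _ (ENNReal.mul_ne_top ENNReal.ofReal_ne_top
          (ENNReal.mul_ne_top (by simp) (ENNReal.mul_ne_top (masterConst_ne_top l)
            hJ.crossNorm_ne_top)))]
        unfold kernMass
        ring

end

/-! ### The collision operator on jets -/

section
variable {φ : ℝ → ℝ} {ε θ l : ℝ} {G H : (Fin 3 → ℕ) → Vel → ℝ}

theorem WeightedJets.pairInt_add (hJ : WeightedJets l G H) {c d : Vel → ℝ} (hc : Measurable c)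
    (hd : Measurable d) {K L : ℝ} (hK : ∀ z, |c z| ≤ K * kern z) (hL : ∀ z, |d z| ≤ L * kern z)
    {α β : Fin 3 → ℕ} (h : ∑ i, α i + ∑ i, β i ≤ 3) {v : Vel} (hv : kernPair G H v < ⊤) :
    pairInt G H (fun z => c z + d z) α β v = pairInt G H c α β v + pairInt G H d α β v := by
  unfold pairInt
  rw [← integral_add (hJ.integrable_pair hc hK h hv) (hJ.integrable_pair hd hL h hv)]
  simp only [add_mul]

theorem pairInt_const_mul (c : Vel → ℝ) (r : ℝ) (α β : Fin 3 → ℕ) (v : Vel) :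
    pairInt G H (fun z => r * c z) α β v = r * pairInt G H c α β v := by
  unfold pairInt
  rw [← integral_const_mul]
  simp only [mul_assoc]

/-- The contribution of the drift error, at the cost of one derivative of `g`. -/
theorem WeightedJets.l2_pairInt_driftErr_le (hJ : WeightedJets l G H) (hφ : Measurable φ)
    (hε : 0 < ε) (h1 : FiniteMomentI φ 1) (h3 : FiniteMomentI φ 3) (hθ : 0 < θ) (hθ1 : θ ≤ 1)
    (hθ3 : FiniteMomentI φ (3 + θ)) (i : Fin 3) {α β : Fin 3 → ℕ}
    (h : ∑ i, α i + ∑ i, β i ≤ 2) :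
    l2 (fun v => wE l v * ‖pairInt G H (driftErr φ ε i) α β v‖ₑ) ≤
      ENNReal.ofReal (16 * Real.pi * (ε ^ θ * momentI φ (3 + θ))) *
        (13 * (kernMass * (masterConst l * crossNorm l G H))) := by
  have hD := measurable_driftErr hφ ε i
  have hball : MeasurableSet {z : Vel | ‖z‖ ≤ 1} := measurableSet_le measurable_norm measurable_const
  have hb := abs_driftErr_le_kern hφ hε h1 h3 i
  have hbn := abs_driftErr_mul_norm_le hφ hε h1 h3 hθ hθ1 hθ3 i
  set K := 16 * Real.pi * (ε ^ θ * momentI φ (3 + θ)) with hKdef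
  have hK0 : 0 ≤ K := by
    have := momentI_nonneg φ (3 + θ)
    have := Real.pi_pos
    positivity
  have hI0 : 0 ≤ 8 * Real.pi * momentI φ 3 := by
    have := momentI_nonneg φ 3
    have := Real.pi_pos
    positivity
  -- Near the origin the kernel is odd, and the gained factor `|z|` makes it integrable; away from it
  -- that factor is at least one, so it can be inserted for free.
  set c := {z : Vel | ‖z‖ ≤ 1}.indicator (driftErr φ ε i) with hc
  set d := {z : Vel | ‖z‖ ≤ 1}ᶜ.indicator (driftErr φ ε i) with hd
  have cm : Measurable c := hD.indicator hball
  have dm : Measurable d := hD.indicator hball.compl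
  have c1 : ∀ z, ‖z‖ ≤ 1 → c z = driftErr φ ε i z := fun z hz =>
    indicator_of_mem (show z ∈ {z : Vel | ‖z‖ ≤ 1} from hz) _
  have c2 : ∀ z, 1 < ‖z‖ → c z = 0 := fun z hz =>
    indicator_of_notMem (show z ∉ {z : Vel | ‖z‖ ≤ 1} from not_le.2 hz) _
  have d1 : ∀ z, ‖z‖ ≤ 1 → d z = 0 := fun z hz =>
    indicator_of_notMem (show z ∉ {z : Vel | ‖z‖ ≤ 1}ᶜ from not_not.2 hz) _
  have d2 : ∀ z, 1 < ‖z‖ → d z = driftErr φ ε i z := fun z hz =>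
    indicator_of_mem (show z ∈ {z : Vel | ‖z‖ ≤ 1}ᶜ from not_le.2 hz) _
  have cK' : ∀ z, |c z| ≤ 8 * Real.pi * momentI φ 3 * kern z := fun z => by
    rcases le_or_gt ‖z‖ 1 with hz | hz
    · rw [c1 z hz]; exact hb z
    · rw [c2 z hz, abs_zero]; exact mul_nonneg hI0 (kern_nonneg z)
  have cK : ∀ z, |c z| * ‖z‖ ≤ K * kern z := fun z => by
    rcases le_or_gt ‖z‖ 1 with hz | hz
    · rw [c1 z hz]; exact hbn z
    · rw [c2 z hz, abs_zero, zero_mul]; exact mul_nonneg hK0 (kern_nonneg z)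
  have dK : ∀ z, |d z| ≤ K * kern z := fun z => by
    rcases le_or_gt ‖z‖ 1 with hz | hz
    · rw [d1 z hz, abs_zero]; exact mul_nonneg hK0 (kern_nonneg z)
    · rw [d2 z hz]
      exact (le_mul_of_one_le_right (abs_nonneg _) hz.le).trans (hbn z)
  have codd : ∀ z, c (-z) = -c z := fun z => by
    rcases le_or_gt ‖z‖ 1 with hz | hz
    · rw [c1 z hz, c1 (-z) (by rwa [norm_neg]), driftErr_neg hφ hε h1 h3]
    · rw [c2 z hz, c2 (-z) (by rwa [norm_neg]), neg_zero]
  have hsum : driftErr φ ε i = fun z => c z + d z := by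
    ext z
    rcases le_or_gt ‖z‖ 1 with hz | hz
    · rw [c1 z hz, d1 z hz, add_zero]
    · rw [c2 z hz, d2 z hz, zero_add]
  calc _ ≤ l2 (fun v => wE l v * ‖pairInt G H c α β v‖ₑ + wE l v * ‖pairInt G H d α β v‖ₑ) := by
        refine l2_mono_ae (hJ.ae_kernPair_lt_top.mono fun v hv => ?_)
        rw [hsum, hJ.pairInt_add cm dm cK' dK (by omega) hv, ← mul_add]
        exact mul_le_mul_right (enorm_add_le _ _) _
    _ ≤ _ := l2_add_le ((measurable_wE l).mul (hJ.measurable_pairInt cm α β).enorm)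
        ((measurable_wE l).mul (hJ.measurable_pairInt dm α β).enorm)
    _ ≤ _ := add_le_add (hJ.l2_pairInt_odd_le cm cK' cK codd c2 h)
        (hJ.l2_pairInt_le dK (show _ ≤ 3 by omega))
    _ = _ := by ring

theorem abs_landauB_le_kern (φ : ℝ → ℝ) (i : Fin 3) (z : Vel) :
    |landauB φ i z| ≤ 4 * Real.pi * momentI φ 3 * kern z := by
  have hI := momentI_nonneg φ 3
  exact (abs_landauB_le φ z i).trans (mul_le_mul_of_nonneg_left
    (le_add_of_nonneg_left (inv_nonneg.2 (norm_nonneg z))) (by positivity))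

theorem abs_driftK_le_kern (hφ : Measurable φ) (hε : 0 < ε) (h1 : FiniteMomentI φ 1)
    (h3 : FiniteMomentI φ 3) (i : Fin 3) (z : Vel) :
    |driftK φ ε i z| ≤ 16 * Real.pi * momentI φ 3 * kern z := by
  have e : driftK φ ε i z = 2 * landauB φ i z + driftErr φ ε i z := by unfold driftErr; ring
  have h := abs_driftErr_le_kern hφ hε h1 h3 i z
  have hb := abs_landauB_le_kern φ i z
  rw [e]
  refine (abs_add_le _ _).trans ?_
  rw [abs_mul, abs_two]
  linarith

theorem abs_diffK_le_kern (hφ : Measurable φ) (hε : 0 < ε) (h1 : FiniteMomentI φ 1)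
    (h3 : FiniteMomentI φ 3) (hθ : 0 < θ) (hθ1 : θ ≤ 1) (hθ3 : FiniteMomentI φ (3 + θ))
    (i j : Fin 3) (z : Vel) :
    |diffK φ ε i j z| ≤ 2 * (4 * Real.pi * momentI φ 3 +
      16 * Real.pi * (ε ^ θ * momentI φ (3 + θ))) * kern z := by
  have e : diffK φ ε i j z = 2 * (landauA φ z i j + diffErr φ ε i j z) := by unfold diffErr; ring
  have h := abs_diffErr_le hφ hε h1 h3 hθ hθ1 hθ3 i j z
  have h' := abs_landauA_le_kern φ i j z
  rw [e, abs_mul, abs_two]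
  have := abs_add_le (landauA φ z i j) (diffErr φ ε i j z)
  linarith

theorem WeightedJets.measurable_left_comp (hJ : WeightedJets l G H) (α : Fin 3 → ℕ) (v : Vel) :
    Measurable fun z => G α (v - z) :=
  (hJ.left.measurable α).comp (measurable_const.sub measurable_id)

/-- A moment of the collision kernel against a bilinear expression in `g(v - z)` and `h(v)` is
absolutely integrable at every `v` where `kernPair` is finite, hence almost everywhere. -/
theorem WeightedJets.integrable_collB_moment (hJ : WeightedJets l G H) (hφ : Measurable φ)
    (hε : 0 < ε) {a : ℝ} (hfin : FiniteMomentI φ (1 + a))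
    {m : Vel × Metric.sphere (0 : Vel) 1 → ℝ} (hm : Measurable m)
    (hma : ∀ p, |m p| ≤ ‖transfer p.1 p.2‖ ^ a) {u : Vel → ℝ} (hu : Measurable u) {v : Vel}
    {C : ℝ≥0∞} (hC : C ≠ ⊤) (hub : ∀ z, ‖u z‖ₑ ≤ C * jetPair G H (v - z) v)
    (hv : kernPair G H v < ⊤) :
    Integrable (fun p => collB φ ε p.1 p.2 * m p * u p.1) collisionPairs := by
  have hp : Measurable fun z : Vel => jetPair G H (v - z) v :=
    hJ.measurable_jetPair (measurable_const.sub measurable_id) measurable_const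
  refine ⟨(((measurable_collB_pair hφ ε).mul hm).mul
    (hu.comp measurable_fst)).aestronglyMeasurable, ?_⟩
  calc ∫⁻ p, ‖collB φ ε p.1 p.2 * m p * u p.1‖ₑ ∂collisionPairs
      ≤ ∫⁻ p, ENNReal.ofReal (collB φ ε p.1 p.2) * (ENNReal.ofReal (‖transfer p.1 p.2‖ ^ a) *
          (C * jetPair G H (v - p.1) v)) ∂collisionPairs := by
        refine lintegral_mono fun p => ?_
        rw [enorm_mul, enorm_mul, mul_assoc, Real.enorm_of_nonneg (collB_nonneg φ hε _ _),
          Real.enorm_eq_ofReal_abs (m p)]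
        exact mul_le_mul_right (mul_le_mul' (ENNReal.ofReal_le_ofReal (hma p)) (hub p.1)) _
    _ ≤ _ := lintegral_collB_moment_le hφ hε hfin (hp.const_mul C)
    _ < ⊤ := by
        refine ENNReal.mul_lt_top ENNReal.ofReal_lt_top ?_
        have e : ∫⁻ z, ENNReal.ofReal (kern z) * (C * jetPair G H (v - z) v) =
            C * kernPair G H v := by
          unfold kernPair
          rw [← lintegral_const_mul' _ _ hC]
          refine lintegral_congr fun z => ?_
          rw [add_zero, ← sub_eq_add_neg]
          ring
        rw [e]
        exact ENNReal.mul_lt_top hC.lt_top hv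

theorem WeightedJets.integrable_drift (hJ : WeightedJets l G H) (hφ : Measurable φ) (hε : 0 < ε)
    (h2 : FiniteMomentI φ 2) {v : Vel} (hv : kernPair G H v < ⊤) (i : Fin 3) :
    Integrable (fun p : Vel × Metric.sphere (0 : Vel) 1 =>
      collB φ ε p.1 p.2 * transfer p.1 p.2 i * driftPair G H i v p.1) collisionPairs := by
  have hT := measurable_transfer_pair
  refine hJ.integrable_collB_moment hφ hε (a := 1) (by rwa [show (1 : ℝ) + 1 = 2 by norm_num])
    (m := fun p => transfer p.1 p.2 i) (by fun_prop)
    (fun p => by rw [Real.rpow_one]; exact abs_coord_le _ i)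
    (u := driftPair G H i v) ?_ (C := 2) (by simp) (enorm_driftPair_le G H i v) hv
  exact ((hJ.measurable_left_comp _ v).mul_const _).sub ((hJ.measurable_left_comp _ v).mul_const _)

theorem WeightedJets.integrable_diff (hJ : WeightedJets l G H) (hφ : Measurable φ) (hε : 0 < ε)
    (h3 : FiniteMomentI φ 3) {v : Vel} (hv : kernPair G H v < ⊤) (i j : Fin 3) :
    Integrable (fun p : Vel × Metric.sphere (0 : Vel) 1 =>
      collB φ ε p.1 p.2 * (transfer p.1 p.2 i * transfer p.1 p.2 j) * diffPair G H i j v p.1)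
      collisionPairs := by
  have hT := measurable_transfer_pair
  refine hJ.integrable_collB_moment hφ hε (a := 2) (by rwa [show (1 : ℝ) + 2 = 3 by norm_num])
    (m := fun p => transfer p.1 p.2 i * transfer p.1 p.2 j) (by fun_prop)
    (fun p => by
      rw [Real.rpow_two, abs_mul, sq]
      exact mul_le_mul (abs_coord_le _ i) (abs_coord_le _ j) (abs_nonneg _) (norm_nonneg _))
    (u := diffPair G H i j v) ?_ (C := 4) (by simp) (enorm_diffPair_le G H i j v) hv
  exact (((hJ.measurable_left_comp _ v).mul_const _).sub
    (((hJ.measurable_left_comp _ v).mul_const _).const_mul 2)).add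
    ((hJ.measurable_left_comp _ v).mul_const _)

theorem WeightedJets.integrable_rem (hJ : WeightedJets l G H) (hφ : Measurable φ) (hε : 0 < ε)
    {v : Vel} (hv : remIntegral φ ε G H v < ⊤) :
    Integrable (fun p : Vel × Metric.sphere (0 : Vel) 1 =>
      collB φ ε p.1 p.2 * taylorRem G H v p.1 (transfer p.1 p.2)) collisionPairs := by
  have hT : Measurable fun p : Vel × Metric.sphere (0 : Vel) 1 =>
      taylorRem G H v p.1 (transfer p.1 p.2) := by
    have := hJ.measurable_taylorRem.comp (measurable_prodMk_left (x := v))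
    exact this
  refine ⟨((measurable_collB_pair hφ ε).mul hT).aestronglyMeasurable, lt_of_eq_of_lt ?_ hv⟩
  refine lintegral_congr fun p => ?_
  rw [enorm_mul, Real.enorm_of_nonneg (collB_nonneg φ hε _ _)]

/-- The integrand of the collision operator, in terms of jets and of the relative velocity. -/
def jetIntegrand (φ : ℝ → ℝ) (ε : ℝ) (G H : (Fin 3 → ℕ) → Vel → ℝ) (v : Vel)
    (p : Vel × Metric.sphere (0 : Vel) 1) : ℝ :=
  collB φ ε p.1 p.2 * (G 0 (v - p.1 - transfer p.1 p.2) * H 0 (v + transfer p.1 p.2) -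
    G 0 (v - p.1) * H 0 v)

theorem jetIntegrand_eq (φ : ℝ → ℝ) (ε : ℝ) (G H : (Fin 3 → ℕ) → Vel → ℝ) (v : Vel)
    (p : Vel × Metric.sphere (0 : Vel) 1) :
    jetIntegrand φ ε G H v p =
      collB φ ε p.1 p.2 * taylorRem G H v p.1 (transfer p.1 p.2) +
      (∑ i, collB φ ε p.1 p.2 * transfer p.1 p.2 i * driftPair G H i v p.1 +
      2⁻¹ * ∑ i, ∑ j, collB φ ε p.1 p.2 * (transfer p.1 p.2 i * transfer p.1 p.2 j) *
        diffPair G H i j v p.1) := by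
  unfold jetIntegrand taylorRem
  simp only [mul_assoc, ← Finset.mul_sum]
  ring

theorem WeightedJets.integrable_jetIntegrand (hJ : WeightedJets l G H) (hφ : Measurable φ)
    (hε : 0 < ε) (h2 : FiniteMomentI φ 2) (h3 : FiniteMomentI φ 3) {v : Vel}
    (hv : kernPair G H v < ⊤) (hr : remIntegral φ ε G H v < ⊤) :
    Integrable (jetIntegrand φ ε G H v) collisionPairs := by
  have e := funext (jetIntegrand_eq φ ε G H v)
  rw [e]
  exact (hJ.integrable_rem hφ hε hr).add ((integrable_finsetSum _ fun i _ =>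
    hJ.integrable_drift hφ hε h2 hv i).add ((integrable_finsetSum _ fun i _ =>
      integrable_finsetSum _ fun j _ => hJ.integrable_diff hφ hε h3 hv i j).const_mul _))

theorem WeightedJets.integral_drift (hJ : WeightedJets l G H) (hφ : Measurable φ) (hε : 0 < ε)
    (h1 : FiniteMomentI φ 1) (h2 : FiniteMomentI φ 2) (h3 : FiniteMomentI φ 3) {v : Vel}
    (hv : kernPair G H v < ⊤) (i : Fin 3) :
    ∫ p, collB φ ε p.1 p.2 * transfer p.1 p.2 i * driftPair G H i v p.1 ∂collisionPairs =
      pairInt G H (driftK φ ε i) 0 (unitIndex i) v -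
        pairInt G H (driftK φ ε i) (unitIndex i) 0 v := by
  have hs := sum_unitIndex i
  have h0 : ∑ k, (0 : Fin 3 → ℕ) k = 0 := by simp
  have hm := measurable_driftK hφ ε i
  have hK := abs_driftK_le_kern hφ hε h1 h3 i
  rw [integral_collisionPairs (hJ.integrable_drift hφ hε h2 hv i)]
  unfold pairInt
  rw [← integral_sub (hJ.integrable_pair hm hK (by omega) hv)
    (hJ.integrable_pair hm hK (by omega) hv)]
  refine integral_congr_ae (Filter.Eventually.of_forall fun z => ?_)
  simp only [integral_mul_const]
  unfold driftPair driftK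
  ring

theorem WeightedJets.integral_diff (hJ : WeightedJets l G H) (hφ : Measurable φ) (hε : 0 < ε)
    (h1 : FiniteMomentI φ 1) (h3 : FiniteMomentI φ 3) (hθ : 0 < θ) (hθ1 : θ ≤ 1)
    (hθ3 : FiniteMomentI φ (3 + θ)) {v : Vel} (hv : kernPair G H v < ⊤) (i j : Fin 3) :
    ∫ p, collB φ ε p.1 p.2 * (transfer p.1 p.2 i * transfer p.1 p.2 j) * diffPair G H i j v p.1
        ∂collisionPairs =
      pairInt G H (diffK φ ε i j) 0 (unitIndex i + unitIndex j) v -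
        2 * pairInt G H (diffK φ ε i j) (unitIndex i) (unitIndex j) v +
        pairInt G H (diffK φ ε i j) (unitIndex i + unitIndex j) 0 v := by
  have hi := sum_unitIndex i
  have hj := sum_unitIndex j
  have hij := sum_unitIndex_add i j
  have h0 : ∑ k, (0 : Fin 3 → ℕ) k = 0 := by simp
  have hm := measurable_diffK hφ ε i j
  have hK := abs_diffK_le_kern hφ hε h1 h3 hθ hθ1 hθ3 i j
  rw [integral_collisionPairs (hJ.integrable_diff hφ hε h3 hv i j)]
  unfold pairInt
  have i1 := hJ.integrable_pair hm hK (α := 0) (β := unitIndex i + unitIndex j) (by omega) hv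
  have i2 := hJ.integrable_pair hm hK (α := unitIndex i) (β := unitIndex j) (by omega) hv
  have i3 := hJ.integrable_pair hm hK (α := unitIndex i + unitIndex j) (β := 0) (by omega) hv
  rw [← integral_const_mul, ← integral_sub i1 (i2.const_mul 2), ← integral_add
    (f := fun z => diffK φ ε i j z * (G 0 (v - z) * H (unitIndex i + unitIndex j) v) -
      2 * (diffK φ ε i j z * (G (unitIndex i) (v - z) * H (unitIndex j) v)))
    (i1.sub (i2.const_mul 2)) i3]
  refine integral_congr_ae (Filter.Eventually.of_forall fun z => ?_)
  simp only [integral_mul_const]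
  unfold diffPair diffK
  ring

end

/-! ### Comparison of the two operators on jets -/

section
variable {φ : ℝ → ℝ} {ε θ l : ℝ} {G H : (Fin 3 → ℕ) → Vel → ℝ}

/-- Integration by parts against the Landau matrix. -/
theorem WeightedJets.ae_sum_pairInt_landauA (hJ : WeightedJets l G H) (φ : ℝ → ℝ) (i : Fin 3)
    {α : Fin 3 → ℕ} (hα : ∑ i, α i ≤ 2) :
    ∀ᵐ v, ∀ β, ∑ j, pairInt G H (fun z => landauA φ z i j) (α + unitIndex j) β v =
      pairInt G H (landauB φ i) α β v := by
  filter_upwards [hJ.left.ae_landau_by_parts hJ.left3 φ i hα] with v hv β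
  unfold pairInt
  simp only [← mul_assoc, integral_mul_const]
  rw [← Finset.sum_mul, hv]

/-- The formula for the difference of the collision operator and the Landau operator: the Taylor
remainder and the contributions of the errors of the drift and diffusion coefficients. -/
def jetError (φ : ℝ → ℝ) (ε : ℝ) (G H : (Fin 3 → ℕ) → Vel → ℝ) (v : Vel) : ℝ :=
  ∫ p, collB φ ε p.1 p.2 * taylorRem G H v p.1 (transfer p.1 p.2) ∂collisionPairs +
    (∑ i, (pairInt G H (driftErr φ ε i) 0 (unitIndex i) v -
      pairInt G H (driftErr φ ε i) (unitIndex i) 0 v) +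
    ∑ i, ∑ j, (pairInt G H (diffErr φ ε i j) 0 (unitIndex i + unitIndex j) v -
        2 * pairInt G H (diffErr φ ε i j) (unitIndex i) (unitIndex j) v +
        pairInt G H (diffErr φ ε i j) (unitIndex i + unitIndex j) 0 v))

/-- The collision operator is the Landau operator plus `jetError`. The leading part of the drift, with
kernel `2b`, becomes a second-order expression with kernel `2a` by parts. Added to the diffusion part
`a : (g ∇²h - 2 ∇g ∇h + ∇²g h)` it cancels the mixed term and changes the sign of the last one. -/
theorem WeightedJets.ae_integral_jetIntegrand (hJ : WeightedJets l G H) (hφ : Measurable φ)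
    (hε : 0 < ε) (h1 : FiniteMomentI φ 1) (h2 : FiniteMomentI φ 2) (h3 : FiniteMomentI φ 3)
    (hθ : 0 < θ) (hθ1 : θ ≤ 1) (hθ3 : FiniteMomentI φ (3 + θ)) :
    ∀ᵐ v, ∫ p, jetIntegrand φ ε G H v p ∂collisionPairs =
      jetLandau φ G H v + jetError φ ε G H v := by
  have s0 : ∑ k, (0 : Fin 3 → ℕ) k = 0 := by simp
  have s1 := sum_unitIndex
  have s2 := sum_unitIndex_add
  have ibp0 := ae_all_iff.2 fun i => hJ.ae_sum_pairInt_landauA φ i (α := 0) (by omega)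
  have ibp1 := ae_all_iff.2 fun i => hJ.ae_sum_pairInt_landauA φ i (α := unitIndex i)
    (by rw [s1]; omega)
  filter_upwards [hJ.ae_kernPair_lt_top, hJ.ae_remIntegral_lt_top hφ hε hθ hθ1 hθ3, ibp0, ibp1]
    with v hv hr p0 p1
  have eb : ∀ i {α β : Fin 3 → ℕ}, ∑ i, α i + ∑ i, β i ≤ 3 →
      pairInt G H (driftK φ ε i) α β v =
        2 * pairInt G H (landauB φ i) α β v + pairInt G H (driftErr φ ε i) α β v := by
    intro i α β h
    have e : driftK φ ε i = fun z => 2 * landauB φ i z + driftErr φ ε i z := by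
      ext z; unfold driftErr; ring
    rw [e, hJ.pairInt_add ((measurable_landauB φ i).const_mul 2) (measurable_driftErr hφ ε i)
      (K := 2 * (4 * Real.pi * momentI φ 3)) (fun z => by
        rw [abs_mul, abs_two, mul_assoc]
        exact mul_le_mul_of_nonneg_left (abs_landauB_le_kern φ i z) zero_le_two)
      (abs_driftErr_le_kern hφ hε h1 h3 i) h hv, pairInt_const_mul]
  have ea : ∀ i j {α β : Fin 3 → ℕ}, ∑ i, α i + ∑ i, β i ≤ 3 →
      pairInt G H (diffK φ ε i j) α β v =
        2 * (pairInt G H (fun z => landauA φ z i j) α β v +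
          pairInt G H (diffErr φ ε i j) α β v) := by
    intro i j α β h
    have e : diffK φ ε i j = fun z => 2 * (landauA φ z i j + diffErr φ ε i j z) := by
      ext z; unfold diffErr; ring
    rw [e, pairInt_const_mul, hJ.pairInt_add (measurable_landauA φ i j)
      (measurable_diffErr hφ ε i j) (abs_landauA_le_kern φ i j)
      (abs_diffErr_le hφ hε h1 h3 hθ hθ1 hθ3 i j) h hv]
  have iD := fun i => hJ.integrable_drift hφ hε h2 hv i
  have iE := fun i j => hJ.integrable_diff hφ hε h3 hv i j
  have split : ∫ p, jetIntegrand φ ε G H v p ∂collisionPairs =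
      ∫ p, collB φ ε p.1 p.2 * taylorRem G H v p.1 (transfer p.1 p.2) ∂collisionPairs +
      (∑ i, ∫ p, collB φ ε p.1 p.2 * transfer p.1 p.2 i * driftPair G H i v p.1 ∂collisionPairs +
      2⁻¹ * ∑ i, ∑ j, ∫ p, collB φ ε p.1 p.2 * (transfer p.1 p.2 i * transfer p.1 p.2 j) *
        diffPair G H i j v p.1 ∂collisionPairs) := by
    have i1 : Integrable (fun p : Vel × Metric.sphere (0 : Vel) 1 => ∑ i, collB φ ε p.1 p.2 *
        transfer p.1 p.2 i * driftPair G H i v p.1) collisionPairs :=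
      integrable_finsetSum _ fun i _ => iD i
    have i2 : Integrable (fun p : Vel × Metric.sphere (0 : Vel) 1 => 2⁻¹ * ∑ i, ∑ j,
        collB φ ε p.1 p.2 * (transfer p.1 p.2 i * transfer p.1 p.2 j) *
          diffPair G H i j v p.1) collisionPairs :=
      (integrable_finsetSum _ fun i _ => integrable_finsetSum _ fun j _ => iE i j).const_mul _
    have i12 : Integrable (fun p : Vel × Metric.sphere (0 : Vel) 1 => ∑ i, collB φ ε p.1 p.2 *
        transfer p.1 p.2 i * driftPair G H i v p.1 + 2⁻¹ * ∑ i, ∑ j,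
        collB φ ε p.1 p.2 * (transfer p.1 p.2 i * transfer p.1 p.2 j) *
          diffPair G H i j v p.1) collisionPairs := i1.add i2
    simp only [jetIntegrand_eq]
    rw [integral_add (hJ.integrable_rem hφ hε hr) i12,
      integral_add i1 i2, integral_finsetSum _ fun i _ => iD i, integral_const_mul,
      integral_finsetSum _ fun i _ => integrable_finsetSum _ fun j _ => iE i j]
    congr 3
    refine Finset.sum_congr rfl fun i _ => integral_finsetSum _ fun j _ => iE i j
  have hd : ∀ i, ∫ p, collB φ ε p.1 p.2 * transfer p.1 p.2 i * driftPair G H i v p.1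
      ∂collisionPairs = 2 * pairInt G H (landauB φ i) 0 (unitIndex i) v -
        2 * pairInt G H (landauB φ i) (unitIndex i) 0 v +
        (pairInt G H (driftErr φ ε i) 0 (unitIndex i) v -
          pairInt G H (driftErr φ ε i) (unitIndex i) 0 v) := by
    intro i
    rw [hJ.integral_drift hφ hε h1 h2 h3 hv i, eb i (by rw [s0, s1]; omega),
      eb i (by rw [s0, s1]; omega)]
    ring
  have he : ∀ i j, ∫ p, collB φ ε p.1 p.2 * (transfer p.1 p.2 i * transfer p.1 p.2 j) *
        diffPair G H i j v p.1 ∂collisionPairs =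
      2 * (pairInt G H (fun z => landauA φ z i j) 0 (unitIndex i + unitIndex j) v -
        2 * pairInt G H (fun z => landauA φ z i j) (unitIndex i) (unitIndex j) v +
        pairInt G H (fun z => landauA φ z i j) (unitIndex i + unitIndex j) 0 v +
      (pairInt G H (diffErr φ ε i j) 0 (unitIndex i + unitIndex j) v -
        2 * pairInt G H (diffErr φ ε i j) (unitIndex i) (unitIndex j) v +
        pairInt G H (diffErr φ ε i j) (unitIndex i + unitIndex j) 0 v)) := by
    intro i j
    rw [hJ.integral_diff hφ hε h1 h3 hθ hθ1 hθ3 hv i j, ea i j (by rw [s0, s2]; omega),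
      ea i j (by rw [s1, s1]; omega), ea i j (by rw [s0, s2]; omega)]
    ring
  -- The drift terms as second-order terms, by `∑_j ∂_j a_{ij} = b_i`.
  have hsymm : ∑ i, pairInt G H (landauB φ i) 0 (unitIndex i) v =
      ∑ i, ∑ j, pairInt G H (fun z => landauA φ z i j) (unitIndex i) (unitIndex j) v := by
    simp only [← p0, zero_add]
    rw [Finset.sum_comm]
    simp only [landauA_symm φ]
  have hb1 : ∑ i, pairInt G H (landauB φ i) (unitIndex i) 0 v =
      ∑ i, ∑ j, pairInt G H (fun z => landauA φ z i j) (unitIndex i + unitIndex j) 0 v := by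
    simp only [← p1]
  rw [split]
  simp only [hd, he]
  unfold jetLandau jetError
  simp only [add_comm (unitIndex _) (unitIndex _)] at hb1 ⊢
  simp only [Finset.sum_add_distrib, Finset.sum_sub_distrib, ← Finset.mul_sum, hsymm, hb1]
  ring

/-- The remainder contributes `324`, the six drift terms `13` each, and the diffusion terms
`4` for each of the nine pairs of indices, to the constant `438 = 324 + 78 + 36`. -/
theorem WeightedJets.l2_jetError_le (hJ : WeightedJets l G H) (hφ : Measurable φ) (hε : 0 < ε)
    (h1 : FiniteMomentI φ 1) (h3 : FiniteMomentI φ 3) (hθ : 0 < θ) (hθ1 : θ ≤ 1)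
    (hθ3 : FiniteMomentI φ (3 + θ)) :
    l2 (fun v => wE l v * ‖jetError φ ε G H v‖ₑ) ≤
      ENNReal.ofReal (16 * Real.pi * (ε ^ θ * momentI φ (3 + θ))) *
        (438 * (kernMass * (masterConst l * crossNorm l G H))) := by
  have s0 : ∑ k, (0 : Fin 3 → ℕ) k = 0 := by simp
  have s1 := sum_unitIndex
  have s2 := sum_unitIndex_add
  have hI := momentI_nonneg φ (3 + θ)
  have hpi := Real.pi_pos
  set X := kernMass * (masterConst l * crossNorm l G H) with hX
  set K := ENNReal.ofReal (16 * Real.pi * (ε ^ θ * momentI φ (3 + θ))) with hK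
  have mD : ∀ i (α β : Fin 3 → ℕ), Measurable fun v =>
      wE l v * ‖pairInt G H (driftErr φ ε i) α β v‖ₑ := fun i α β =>
    (measurable_wE l).mul (hJ.measurable_pairInt (measurable_driftErr hφ ε i) α β).enorm
  have mE : ∀ i j (α β : Fin 3 → ℕ), Measurable fun v =>
      wE l v * ‖pairInt G H (diffErr φ ε i j) α β v‖ₑ := fun i j α β =>
    (measurable_wE l).mul (hJ.measurable_pairInt (measurable_diffErr hφ ε i j) α β).enorm
  have bD : ∀ i {α β : Fin 3 → ℕ}, ∑ i, α i + ∑ i, β i ≤ 2 →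
      l2 (fun v => wE l v * ‖pairInt G H (driftErr φ ε i) α β v‖ₑ) ≤ K * (13 * X) :=
    fun i α β h => hJ.l2_pairInt_driftErr_le hφ hε h1 h3 hθ hθ1 hθ3 i h
  have bE : ∀ i j {α β : Fin 3 → ℕ}, ∑ i, α i + ∑ i, β i ≤ 3 →
      l2 (fun v => wE l v * ‖pairInt G H (diffErr φ ε i j) α β v‖ₑ) ≤ K * X :=
    fun i j α β h => hJ.l2_pairInt_le (abs_diffErr_le hφ hε h1 h3 hθ hθ1 hθ3 i j) h
  have bR : l2 (fun v => wE l v * remIntegral φ ε G H v) ≤ K * (324 * X) := by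
    refine (hJ.l2_remIntegral_le hφ hε hθ hθ1 hθ3).trans ?_
    rw [mul_assoc 324, ← hX]
    refine mul_le_mul_left (ENNReal.ofReal_le_ofReal ?_) _
    have : 0 ≤ Real.pi * (ε ^ θ * momentI φ (3 + θ)) := by positivity
    nlinarith
  let D : Fin 3 → Vel → ℝ≥0∞ := fun i v =>
    wE l v * ‖pairInt G H (driftErr φ ε i) 0 (unitIndex i) v‖ₑ +
      wE l v * ‖pairInt G H (driftErr φ ε i) (unitIndex i) 0 v‖ₑ
  let E : Fin 3 → Fin 3 → Vel → ℝ≥0∞ := fun i j v =>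
    wE l v * ‖pairInt G H (diffErr φ ε i j) 0 (unitIndex i + unitIndex j) v‖ₑ +
      2 * (wE l v * ‖pairInt G H (diffErr φ ε i j) (unitIndex i) (unitIndex j) v‖ₑ) +
      wE l v * ‖pairInt G H (diffErr φ ε i j) (unitIndex i + unitIndex j) 0 v‖ₑ
  have hD : ∀ i, Measurable (D i) := fun i => (mD i _ _).add (mD i _ _)
  have hE : ∀ i j, Measurable (E i j) := fun i j =>
    ((mE i j _ _).add ((mE i j _ _).const_mul 2)).add (mE i j _ _)
  have lD : ∀ i, l2 (D i) ≤ K * (26 * X) := fun i => by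
    refine (l2_add_le (mD i _ _) (mD i _ _)).trans ((add_le_add (bD i (by rw [s0, s1]; omega))
      (bD i (by rw [s0, s1]; omega))).trans_eq ?_)
    ring
  have lE : ∀ i j, l2 (E i j) ≤ K * (4 * X) := fun i j => by
    refine (l2_add_le ((mE i j _ _).add ((mE i j _ _).const_mul 2)) (mE i j _ _)).trans
      ((add_le_add ((l2_add_le (mE i j _ _) ((mE i j _ _).const_mul 2)).trans
        (add_le_add (bE i j (by rw [s0, s2]; omega)) ((l2_const_mul (by simp) _).trans_le
          (mul_le_mul_right (bE i j (by rw [s1, s1]; omega)) 2))))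
        (bE i j (by rw [s0, s2]; omega))).trans_eq ?_)
    ring
  have mR : Measurable fun v => wE l v * remIntegral φ ε G H v :=
    (measurable_wE l).mul (hJ.measurable_remIntegrand hφ ε).lintegral_prod_right'
  have hDs : Measurable fun v => ∑ i, D i v := Finset.measurable_fun_sum _ fun i _ => hD i
  have hEs : ∀ i, Measurable fun v => ∑ j, E i j v := fun i =>
    Finset.measurable_fun_sum _ fun j _ => hE i j
  have hEss : Measurable fun v => ∑ i, ∑ j, E i j v :=
    Finset.measurable_fun_sum _ fun i _ => hEs i
  have two : ‖(2 : ℝ)‖ₑ = 2 := by rw [Real.enorm_of_nonneg zero_le_two]; simp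
  calc l2 (fun v => wE l v * ‖jetError φ ε G H v‖ₑ)
      ≤ l2 (fun v => wE l v * remIntegral φ ε G H v +
          (∑ i, D i v + ∑ i, ∑ j, E i j v)) := by
        refine l2_mono fun v => ?_
        calc _ ≤ wE l v * (remIntegral φ ε G H v +
              (∑ i, (‖pairInt G H (driftErr φ ε i) 0 (unitIndex i) v‖ₑ +
                ‖pairInt G H (driftErr φ ε i) (unitIndex i) 0 v‖ₑ) +
              ∑ i, ∑ j, (‖pairInt G H (diffErr φ ε i j) 0 (unitIndex i + unitIndex j) v‖ₑ +
                2 * ‖pairInt G H (diffErr φ ε i j) (unitIndex i) (unitIndex j) v‖ₑ +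
                ‖pairInt G H (diffErr φ ε i j) (unitIndex i + unitIndex j) 0 v‖ₑ))) := by
              refine mul_le_mul_right ?_ _
              unfold jetError
              refine (enorm_add_le _ _).trans (add_le_add ?_ ((enorm_add_le _ _).trans
                (add_le_add ?_ ?_)))
              · refine (enorm_integral_le_lintegral_enorm _).trans_eq ?_
                refine lintegral_congr fun p => ?_
                rw [enorm_mul, Real.enorm_of_nonneg (collB_nonneg φ hε _ _)]
              · exact (enorm_sum_le _ _).trans (Finset.sum_le_sum fun i _ => enorm_sub_le)
              · refine (enorm_sum_le _ _).trans (Finset.sum_le_sum fun i _ =>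
                  (enorm_sum_le _ _).trans (Finset.sum_le_sum fun j _ =>
                  (enorm_add_le _ _).trans (add_le_add_left (enorm_sub_le.trans
                    (add_le_add_right ?_ _)) _)))
                rw [enorm_mul, two]
          _ = _ := by
              simp only [D, E, mul_add, Finset.mul_sum, mul_left_comm _ (2 : ℝ≥0∞)]
    _ ≤ l2 (fun v => wE l v * remIntegral φ ε G H v) +
          (∑ i, l2 (D i) + ∑ i, ∑ j, l2 (E i j)) :=
        (l2_add_le mR (hDs.add hEss)).trans (add_le_add_right ((l2_add_le hDs hEss).trans
          (add_le_add (l2_finset_sum_le _ hD) ((l2_finset_sum_le _ hEs).trans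
            (Finset.sum_le_sum fun i _ => l2_finset_sum_le _ (hE i))))) _)
    _ ≤ K * (324 * X) + (∑ _i : Fin 3, K * (26 * X) + ∑ _i : Fin 3, ∑ _j : Fin 3, K * (4 * X)) :=
        add_le_add bR (add_le_add (Finset.sum_le_sum fun i _ => lD i)
          (Finset.sum_le_sum fun i _ => Finset.sum_le_sum fun j _ => lE i j))
    _ = _ := by
        simp only [Finset.sum_const, Finset.card_univ, Fintype.card_fin, nsmul_eq_mul]
        push_cast
        ring

end

/-! ### From functions to jets -/

/-- The change of variables `v_* = v - z`. -/
theorem measurePreserving_collisionPairs (v : Vel) :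
    MeasurePreserving (MeasurableEquiv.prodCongr (MeasurableEquiv.subLeft v)
      (MeasurableEquiv.refl (Metric.sphere (0 : Vel) 1))) collisionPairs (collisionMeasure v) := by
  have h1 : MeasurePreserving (MeasurableEquiv.subLeft v) (volume : Measure Vel) volume :=
    volume.measurePreserving_sub_left v
  have h2 : MeasurePreserving (MeasurableEquiv.refl (Metric.sphere (0 : Vel) 1)) surf surf :=
    MeasurePreserving.id _
  have h3 := (h1.prod h2).restrict_preimage_emb (MeasurableEquiv.prodCongr
    (MeasurableEquiv.subLeft v) (MeasurableEquiv.refl _)).measurableEmbedding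
    {p | 0 ≤ inner ℝ (v - p.1) (p.2 : Vel)}
  have e : Prod.map (MeasurableEquiv.subLeft v) (MeasurableEquiv.refl (Metric.sphere (0 : Vel) 1))
      ⁻¹' {p | 0 ≤ inner ℝ (v - p.1) (p.2 : Vel)} = {p | 0 ≤ inner ℝ p.1 (p.2 : Vel)} := by
    ext p
    simp [MeasurableEquiv.subLeft, Equiv.subLeft]
  rw [e] at h3
  exact h3

theorem integrandQ1_sub (φ : ℝ → ℝ) (ε : ℝ) (g h : Vel → ℝ) (v z : Vel)
    (σ : Metric.sphere (0 : Vel) 1) :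
    integrandQ1 φ ε g h v (v - z, σ) = collB φ ε z σ *
      (g (v - z - transfer z σ) * h (v + transfer z σ) - g (v - z) * h v) := by
  have e1 : postVStar v (v - z) σ = v - z - transfer z σ := by
    unfold postVStar transfer
    rw [sub_sub_cancel]
    module
  have e2 : postV v (v - z) σ = v + transfer z σ := by
    unfold postV transfer
    rw [sub_sub_cancel]
    module
  unfold integrandQ1
  simp only [e1, e2, sub_sub_cancel]
  rfl

/-- A property that holds almost everywhere holds at almost every point of almost every
translate of a given family. -/
theorem ae_ae_translate {Y : Type*} [MeasurableSpace Y] {ν : Measure Y} [SFinite ν]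
    {P : Vel → Prop} (hP : ∀ᵐ x, P x) {f : Y → Vel} (hf : Measurable f) :
    ∀ᵐ v : Vel, ∀ᵐ y ∂ν, P (v + f y) := by
  set N := toMeasurable volume {x | ¬P x} with hN
  have hN0 : volume N = 0 := by rw [hN, measure_toMeasurable]; exact hP
  have hNm : MeasurableSet N := measurableSet_toMeasurable _ _
  have hadd : Measurable fun q : Vel × Y => q.1 + f q.2 :=
    measurable_fst.add (hf.comp measurable_snd)
  have hm : MeasurableSet {q : Vel × Y | q.1 + f q.2 ∉ N} := hadd hNm.compl
  have key : ∀ᵐ v : Vel, ∀ᵐ y ∂ν, v + f y ∉ N := by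
    rw [Measure.ae_ae_comm hm]
    refine Filter.Eventually.of_forall fun y => ?_
    exact (measurePreserving_add_right (volume : Measure Vel) (f y)).quasiMeasurePreserving.ae
      (measure_eq_zero_iff_ae_notMem.1 hN0)
  filter_upwards [key] with v hv
  filter_upwards [hv] with y hy
  by_contra hc
  exact hy (subset_toMeasurable volume _ hc)

section
variable {φ : ℝ → ℝ} {ε θ l : ℝ} {G H : (Fin 3 → ℕ) → Vel → ℝ} {g h : Vel → ℝ}

theorem ae_integrandQ1_eq (φ : ℝ → ℝ) (ε : ℝ) (hg : g =ᵐ[volume] G 0) (hh : h =ᵐ[volume] H 0) :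
    ∀ᵐ v : Vel, (fun p : Vel × Metric.sphere (0 : Vel) 1 =>
      integrandQ1 φ ε g h v (v - p.1, p.2)) =ᵐ[collisionPairs] jetIntegrand φ ε G H v := by
  have hT := measurable_transfer_pair
  have m2 : Measurable fun p : Vel × Metric.sphere (0 : Vel) 1 => -p.1 := measurable_fst.neg
  have m1 : Measurable fun p : Vel × Metric.sphere (0 : Vel) 1 => -p.1 - transfer p.1 p.2 :=
    measurable_fst.neg.sub hT
  filter_upwards [hh, ae_ae_translate (ν := collisionPairs) hg m1,
    ae_ae_translate (ν := collisionPairs) hh hT,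
    ae_ae_translate (ν := collisionPairs) hg m2] with v h0 h1 h2 h3
  filter_upwards [h1, h2, h3] with p p1 p2 p3
  rw [integrandQ1_sub, h0]
  unfold jetIntegrand
  have e1 : v - p.1 - transfer p.1 p.2 = v + (-p.1 - transfer p.1 p.2) := by abel
  have e2 : v - p.1 = v + -p.1 := by abel
  rw [e1, e2, p1, p2, p3]

/-- The operator `Q₁` at almost every point, and its absolute convergence, through representatives. -/
theorem WeightedJets.ae_opQ1 (hJ : WeightedJets l G H) (hφ : Measurable φ) (hε : 0 < ε)
    (h2 : FiniteMomentI φ 2) (h3 : FiniteMomentI φ 3) (hθ : 0 < θ) (hθ1 : θ ≤ 1)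
    (hθ3 : FiniteMomentI φ (3 + θ)) (hg : g =ᵐ[volume] G 0) (hh : h =ᵐ[volume] H 0) :
    ∀ᵐ v : Vel, Integrable (integrandQ1 φ ε g h v) (collisionMeasure v) ∧
      opQ1 φ ε g h v = ∫ p, jetIntegrand φ ε G H v p ∂collisionPairs := by
  filter_upwards [ae_integrandQ1_eq φ ε hg hh, hJ.ae_kernPair_lt_top,
    hJ.ae_remIntegral_lt_top hφ hε hθ hθ1 hθ3] with v hv hk hr
  have hT := measurePreserving_collisionPairs v
  have hint := (hJ.integrable_jetIntegrand hφ hε h2 h3 hk hr).congr hv.symm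
  constructor
  · exact (hT.integrable_comp_emb (MeasurableEquiv.measurableEmbedding _)).1 hint
  · unfold opQ1
    rw [← hT.integral_comp' (integrandQ1 φ ε g h v)]
    exact integral_congr_ae hv

/-- The Landau flux at almost every point, and its absolute convergence, through representatives. -/
theorem WeightedJets.ae_landauFlux (hJ : WeightedJets l G H) (φ : ℝ → ℝ)
    (hg : g =ᵐ[volume] G 0) (hh : h =ᵐ[volume] H 0)
    (hgj : ∀ j, weakGrad g j =ᵐ[volume] G (unitIndex j))
    (hhj : ∀ j, weakGrad h j =ᵐ[volume] H (unitIndex j)) :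
    ∀ᵐ v : Vel, ∀ i, Integrable (landauIntegrand φ g h i v) volume ∧
      landauFlux φ g h i v = jetFlux φ G H i v := by
  have s0 : ∑ k, (0 : Fin 3 → ℕ) k = 0 := by simp
  have s1 := sum_unitIndex
  filter_upwards [hh, ae_all_iff.2 hhj, hJ.ae_kernPair_lt_top] with v h0 h1 hk i
  have hq := (Measure.measurePreserving_sub_left (volume : Measure Vel) v).quasiMeasurePreserving
  have ae : (fun z => landauIntegrand φ g h i v (v - z)) =ᵐ[volume] fun z => ∑ j,
      (landauA φ z i j * (G 0 (v - z) * H (unitIndex j) v) -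
        landauA φ z i j * (G (unitIndex j) (v - z) * H 0 v)) := by
    filter_upwards [hq.ae hg, hq.ae (ae_all_iff.2 hgj)] with z g0 g1
    unfold landauIntegrand
    simp only [sub_sub_cancel, g0, g1, h0, h1, mul_sub]
  have i1 : ∀ j, Integrable (fun z => landauA φ z i j * (G 0 (v - z) * H (unitIndex j) v))
      volume := fun j => hJ.integrable_pair (measurable_landauA φ i j) (abs_landauA_le_kern φ i j)
    (by rw [s0, s1]; omega) hk
  have i2 : ∀ j, Integrable (fun z => landauA φ z i j * (G (unitIndex j) (v - z) * H 0 v))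
      volume := fun j => hJ.integrable_pair (measurable_landauA φ i j) (abs_landauA_le_kern φ i j)
    (by rw [s0, s1]; omega) hk
  have i3 : ∀ j, Integrable (fun z => landauA φ z i j * (G 0 (v - z) * H (unitIndex j) v) -
      landauA φ z i j * (G (unitIndex j) (v - z) * H 0 v)) volume := fun j => (i1 j).sub (i2 j)
  constructor
  · rw [← integrable_comp_sub_left _ v]
    exact (integrable_finsetSum _ fun j _ => i3 j).congr ae.symm
  · unfold landauFlux jetFlux pairInt
    rw [← integral_sub_left_eq_self _ volume v, integral_congr_ae ae,
      integral_finsetSum _ fun j _ => i3 j]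
    exact Finset.sum_congr rfl fun j _ => integral_sub (i1 j) (i2 j)

end

end

/-! ### The grazing collision estimate -/

theorem lemma5p1 (l : ℝ) (hl : 0 ≤ l) :
    ∃ C : ℝ, 0 < C ∧
      ∀ (θ : ℝ), 0 < θ → θ ≤ 1 →
      ∀ (ε : ℝ), 0 < ε → ε ≤ 1 →
      ∀ (phiHat : ℝ → ℝ), Measurable phiHat →
        FiniteMomentI phiHat 0 → FiniteMomentI phiHat 3 → FiniteMomentI phiHat (3 + θ) →
      ∀ (g h : Vel → ℝ), MemH 3 (l + 5) g → MemH 3 (l + 3) h →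
        -- the integral that defines `Q₁(g,h)` converges absolutely at almost every point
        (∀ᵐ v : Vel, Integrable (integrandQ1 phiHat ε g h v) (collisionMeasure v)) ∧
        -- the integral and the divergence that define `Q_L(g,h)` exist
        (∀ᵐ v : Vel, ∀ i, Integrable (landauIntegrand phiHat g h i v) volume) ∧
        IsWeakDiv (landauFlux phiHat g h) (opQL phiHat g h) ∧
        -- the estimate
        normL2 l (fun v => opQ1 phiHat ε g h v - opQL phiHat g h v) ≤
          ENNReal.ofReal (C * ε ^ θ * momentI phiHat (3 + θ)) *
            (normH 3 (l + 5) g * normH 3 0 h + normH 3 2 g * normH 3 (l + 3) h) := by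
  -- The summand `1` below makes the constant positive without a discussion of `A = 0`.
  set A : ℝ≥0∞ := ENNReal.ofReal (16 * Real.pi) * (438 * (kernMass * masterConst l)) with hA
  have hAtop : A ≠ ⊤ := ENNReal.mul_ne_top ENNReal.ofReal_ne_top (ENNReal.mul_ne_top (by simp)
    (ENNReal.mul_ne_top kernMass_ne_top (masterConst_ne_top l)))
  refine ⟨A.toReal + 1, by positivity, fun θ hθ hθ1 ε hε _ φ hφ f0 f3 fθ g h hg hh => ?_⟩
  -- The moment of order one makes the angular integrals of the kernel finite, and that of order two
  -- makes the drift terms absolutely convergent.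
  have f1 : FiniteMomentI φ 1 := f0.between hφ f3 (by norm_num) (by norm_num)
  have f2 : FiniteMomentI φ 2 := f0.between hφ f3 (by norm_num) (by norm_num)
  obtain ⟨G, jG, gG, dG⟩ := hg.exists_jet
  obtain ⟨H, jH, hH, dH⟩ := hh.exists_jet
  have uG : ∀ m, wL2 m (jetSum 3 G) ≤ normH 3 m g := fun m => wL2_jetSum_le_normH jG dG
  have uH : ∀ m, wL2 m (jetSum 3 H) ≤ normH 3 m h := fun m => wL2_jetSum_le_normH jH dH
  have hJ : WeightedJets l G H :=
    ⟨hl, jG, jH, ne_top_of_le_ne_top hg.normH_ne_top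
      ((wL2_mono (by linarith) _).trans (uG (l + 5))), ne_top_of_le_ne_top hh.normH_ne_top (uH _)⟩
  have hmem : ∀ j, unitIndex j ∈ multiIndices 3 := fun j =>
    mem_multiIndices.2 (by rw [sum_unitIndex]; omega)
  have hQ1 := hJ.ae_opQ1 hφ hε f2 f3 hθ hθ1 fθ gG hH
  have hflux := hJ.ae_landauFlux φ gG hH (fun j => dG _ (hmem j)) fun j => dH _ (hmem j)
  have hdiv : IsWeakDiv (landauFlux φ g h) (jetLandau φ G H) :=
    (hJ.isWeakDiv_jetFlux φ).congr_ae fun i => hflux.mono fun v hv => ((hv i).2).symm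
  have hQL : IsWeakDiv (landauFlux φ g h) (opQL φ g h) := isWeakDiv_weakDiv hdiv
  refine ⟨hQ1.mono fun v hv => hv.1, hflux.mono fun v hv i => (hv i).1, hQL, ?_⟩
  set N := normH 3 (l + 5) g * normH 3 0 h + normH 3 2 g * normH 3 (l + 3) h with hN
  have hcross : crossNorm l G H ≤ N := by
    unfold crossNorm
    refine add_le_add (mul_le_mul' ((wL2_mono (by linarith) _).trans (uG (l + 5))) ?_)
      (mul_le_mul' ?_ (uH (l + 3)))
    · rw [← wL2_zero]
      exact uH 0
    · rw [← wL2_zero]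
      exact (wL2_mono (by norm_num) _).trans (uG 2)
  have hI := momentI_nonneg φ (3 + θ)
  have hpi := Real.pi_pos
  calc normL2 l (fun v => opQ1 φ ε g h v - opQL φ g h v)
      ≤ l2 (fun v => wE l v * ‖jetError φ ε G H v‖ₑ) := by
        unfold normL2
        rw [eLpNorm_two_eq_l2]
        refine l2_mono_ae ?_
        filter_upwards [hQ1, isWeakDiv_ae_unique hQL hdiv,
          hJ.ae_integral_jetIntegrand hφ hε f1 f2 f3 hθ hθ1 fθ] with v h1 h2 h3
        rw [h1.2, h2, h3, add_sub_cancel_left, enorm_mul, Real.enorm_of_nonneg (weightW_pos l v).le]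
        rfl
    _ ≤ ENNReal.ofReal (16 * Real.pi * (ε ^ θ * momentI φ (3 + θ))) *
          (438 * (kernMass * (masterConst l * crossNorm l G H))) :=
        hJ.l2_jetError_le hφ hε f1 f3 hθ hθ1 fθ
    _ = A * ENNReal.ofReal (ε ^ θ * momentI φ (3 + θ)) * crossNorm l G H := by
        rw [ENNReal.ofReal_mul (by positivity), hA]
        ring
    _ ≤ ENNReal.ofReal (A.toReal + 1) * ENNReal.ofReal (ε ^ θ * momentI φ (3 + θ)) * N := by
        refine mul_le_mul' (mul_le_mul_left ?_ _) hcross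
        calc A = ENNReal.ofReal A.toReal := (ENNReal.ofReal_toReal hAtop).symm
          _ ≤ _ := ENNReal.ofReal_le_ofReal (by linarith)
    _ = _ := by rw [← ENNReal.ofReal_mul (by positivity), mul_assoc (A.toReal + 1)]
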